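/- **Conventions.** Let $E\to M$ be a holomorphic vector bundle of finite rank on a finite-dimensional complex manifold and let $\mathcal O_{\Lambda E}$ be the sheaf of holomorphic sections of the exterior algebra bundle $\Lambda E$. A *complex supermanifold on $E\to M$* is a sheaf $\mathcal O_{\mathcal M}$ on $M$ of supercommutative $\mathbb Z/2$-graded complex algebras, together with an identification of its associated graded sheaf (for the filtration $\mathcal O_{\mathcal M}^{(k)}$ by the powers of the ideal sheaf of nilpotent elements) with $\mathcal O_{\Lambda E}$, such that $\mathcal O_{\mathcal M}$ is locally isomorphic to $\mathcal O_{\Lambda E}$ by isomorphisms of superalgebra sheaves which induce this identification; such isomorphisms are called *local splittings*. For a family of local splittings $\tau_i:\mathcal O_{\mathcal M}|_{U_i}\to\mathcal O_{\Lambda E}|_{U_i}$ over an open cover $\{U_i\}$ of $M$, the automorphisms $\alpha_{ij}=\tau_i\tau_j^{-1}$ of $\mathcal O_{\Lambda E}|_{U_i\cap U_j}$ form a *cochain representing* $\mathcal M$. The sheaves $Der$ of superderivations and $End$ of $\mathbb C$-linear endomorphisms carry the induced filtrations: a section is in degree $(k)$ if it maps the $j$-th filtration step to the $(j+k)$-th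 for all $j\ge 0$; the index $\bar 0$ denotes even (parity-preserving) sections. Let $\mathcal V^{(2)}_{\mathcal M,\bar 0}=H^0(M,Der^{(2)}_{\bar 0}(\mathcal O_{\mathcal M}))$. For $t\in\mathbb N=\{0,1,\dots\}$, $\mathcal M$ is *strictly $t$-nildominated* if for every open $U\subset M$ $$\bigcap_{X\in\mathcal V^{(2)}_{\mathcal M,\bar 0}}\ker\big([X,\cdot]:Der(\mathcal O_{\mathcal M})(U)\to Der(\mathcal O_{\mathcal M})(U)\big)\subset Der^{(t)}(\mathcal O_{\mathcal M})(U).$$ **Proposition.** Let $\mathcal M'$ and $\mathcal M''$ be a strictly $t'$-nildominated and a strictly $t''$-nildominated complex supermanifold on the bundles $E'\to M'$ and $E''\to M''$. Put $t=\min\{t',t''\}$, $M=M'\times M''$, and let $E=\mathrm{pr}_1^*E'\oplus\mathrm{pr}_2^*E''\to M$. Then: 1. there is a complex supermanifold $\mathcal M$ on $E\to M$ with morphisms $\mathcal M\to\mathcal M'$ and $\mathcal M\to\mathcal M''$ reducing to the projections, i.e. they lie over $\mathrm{pr}_1$ and $\mathrm{pr}_2$, and on the associated graded sheaves they are induced by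 $f\mapsto f\circ\mathrm{pr}_k$ on functions and by $e'\mapsto(e'\circ\mathrm{pr}_1,0)$, resp. $e''\mapsto(0,e''\circ\mathrm{pr}_2)$, on sections of the bundles; 2. every such $\mathcal M$ is strictly $t$-nildominated; 3. $\mathcal M$ is well-defined up to errors in $C^1(M,End^{(t)}_{\bar 0}(\mathcal O_{\Lambda E}))$: if $\mathcal M$ and $\mathcal N$ both are as in 1., and $(\alpha_{ij})$ is a cochain representing $\mathcal M$ with respect to some open cover $\{U_i\}$ of $M$, then there is a cochain $(\gamma_{ij})$ representing $\mathcal N$ with respect to the same cover such that $\alpha_{ij}-\gamma_{ij}\in End^{(t)}_{\bar 0}(\mathcal O_{\Lambda E})(U_i\cap U_j)$ for all $i,j$. -/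

import Mathlib

open scoped Manifold ContDiff Bundle
open Bundle TopologicalSpace Opposite CategoryTheory

universe u

namespace SuperGeometry

noncomputable section

section Presheaves

variable {M : Type u} [TopologicalSpace M]

/-- A presheaf of associative unital complex algebras on `M`, together with the subspaces of even
(`parity U 0`) and odd (`parity U 1`) sections. The laws of a superalgebra are imposed in
`Supermanifold`. -/
structure SuperPresheaf (M : Type u) [TopologicalSpace M] where
  alg : TopCat.Presheaf (AlgCat.{u} ℂ) (TopCat.of M)
  parity : ∀ U : Opens M, ZMod 2 → Submodule ℂ (alg.obj (op U))

namespace SuperPresheaf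

variable (O : SuperPresheaf M)

/-- The algebra of sections over `U`. -/
abbrev Sec (U : Opens M) : Type u := O.alg.obj (op U)

/-- Restriction of sections. -/
def res {V U : Opens M} (h : V ≤ U) : O.Sec U →ₐ[ℂ] O.Sec V :=
  (O.alg.map (homOfLE h).op).hom

/-- The filtration by powers of the nilpotent sections: `f` belongs to the `k`-th step if, locally,
it lies in the ideal generated by the products of `k` nilpotent sections. -/
def filtration (k : ℕ) (U : Opens M) : Set (O.Sec U) :=
  {f | ∀ x ∈ U, ∃ (V : Opens M) (h : V ≤ U), x ∈ V ∧
    O.res h f ∈ Ideal.span {g : O.Sec V |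
      ∃ n : Fin k → O.Sec V, (∀ i, IsNilpotent (n i)) ∧ g = (List.ofFn n).prod}}

/-- Sections over `U` of the sheaf of `ℂ`-linear endomorphisms: families of linear maps on the
sections over all open `V ⊆ U` which commute with restrictions. -/
def sheafEnd (U : Opens M) :
    Subalgebra ℂ (∀ V : {V : Opens M // V ≤ U}, Module.End ℂ (O.Sec V.1)) where
  carrier := {D | ∀ (V W : {V : Opens M // V ≤ U}) (h : W.1 ≤ V.1) (f : O.Sec V.1),
    D W (O.res h f) = O.res h (D V f)}
  mul_mem' := by
    intro a b ha hb V W h f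
    simp only [Pi.mul_apply, Module.End.mul_apply]
    rw [hb V W h f, ha V W h]
  add_mem' := by
    intro a b ha hb V W h f
    simp only [Pi.add_apply, LinearMap.add_apply, map_add]
    rw [hb V W h f, ha V W h]
  algebraMap_mem' := by
    intro r V W h f
    simp [Module.algebraMap_end_apply]

variable {O}

/-- Restriction of a sheaf endomorphism to a smaller open set. -/
def endRestrict {W U : Opens M} (h : W ≤ U) (D : O.sheafEnd U) : O.sheafEnd W :=
  ⟨fun V => D.1 ⟨V.1, V.2.trans h⟩, fun V V' h' f =>
    D.2 ⟨V.1, V.2.trans h⟩ ⟨V'.1, V'.2.trans h⟩ h' f⟩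

/-- `D` is homogeneous of parity `p`. -/
def HasParity {U : Opens M} (p : ZMod 2) (D : O.sheafEnd U) : Prop :=
  ∀ (V : {V : Opens M // V ≤ U}) (q : ZMod 2) (f : O.Sec V.1),
    f ∈ O.parity V.1 q → D.1 V f ∈ O.parity V.1 (p + q)

/-- `D` raises the filtration degree by at least `k`. -/
def RaisesDegree {U : Opens M} (k : ℕ) (D : O.sheafEnd U) : Prop :=
  ∀ (V : {V : Opens M // V ≤ U}) (j : ℕ) (f : O.Sec V.1),
    f ∈ O.filtration j V.1 → D.1 V f ∈ O.filtration (j + k) V.1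

variable (O)

/-- Homogeneous superderivations of parity `p` over `U`:
`D (f g) = D f g + (-1) ^ (p |f|) f D g`. -/
def homDer (p : ZMod 2) (U : Opens M) : Submodule ℂ (O.sheafEnd U) where
  carrier := {D | HasParity p D ∧
    ∀ (V : {V : Opens M // V ≤ U}) (q : ZMod 2) (f g : O.Sec V.1), f ∈ O.parity V.1 q →
      D.1 V (f * g) = D.1 V f * g + (-1 : ℂ) ^ (p.val * q.val) • (f * D.1 V g)}
  add_mem' := by
    rintro a b ⟨ha, ha'⟩ ⟨hb, hb'⟩
    refine ⟨fun V q f hf => add_mem (ha V q f hf) (hb V q f hf), fun V q f g hf => ?_⟩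
    change a.1 V (f * g) + b.1 V (f * g) =
      (a.1 V f + b.1 V f) * g + (-1 : ℂ) ^ (p.val * q.val) • (f * (a.1 V g + b.1 V g))
    rw [ha' V q f g hf, hb' V q f g hf, add_mul, mul_add, smul_add]
    abel
  zero_mem' := by
    refine ⟨fun V q f _ => zero_mem _, fun V q f g _ => ?_⟩
    change (0 : O.Sec V.1) = 0 * g + (-1 : ℂ) ^ (p.val * q.val) • (f * 0)
    simp
  smul_mem' := by
    rintro c a ⟨ha, ha'⟩
    refine ⟨fun V q f hf => Submodule.smul_mem _ c (ha V q f hf), fun V q f g hf => ?_⟩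
    change c • a.1 V (f * g) =
      (c • a.1 V f) * g + (-1 : ℂ) ^ (p.val * q.val) • (f * (c • a.1 V g))
    rw [ha' V q f g hf, smul_add, smul_mul_assoc, mul_smul_comm, smul_comm c]

/-- Superderivations over `U`: sums of an even and an odd one. -/
def superDer (U : Opens M) : Submodule ℂ (O.sheafEnd U) := O.homDer 0 U ⊔ O.homDer 1 U

/-- Global even superderivations which raise the filtration degree by at least two. -/
def nilFields : Set (O.sheafEnd ⊤) := {X | X ∈ O.homDer 0 ⊤ ∧ RaisesDegree 2 X}

/-- Strict `t`-nildominance: over every open set, the superderivations which commute with all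
global even superderivations of degree at least two have degree at least `t`. -/
def StrictlyNildominated (t : ℕ) : Prop :=
  ∀ U : Opens M,
    {Y | Y ∈ O.superDer U ∧ ∀ X ∈ O.nilFields, ⁅endRestrict (le_top : U ≤ ⊤) X, Y⁆ = 0} ⊆
      {Y | Y ∈ O.superDer U ∧ RaisesDegree t Y}

end SuperPresheaf

/-- A morphism of superalgebra sheaves over a continuous map `φ`: pullbacks of sections,
compatible with restrictions and preserving parity. -/
structure SuperMorphism {M' : Type u} [TopologicalSpace M'] (O : SuperPresheaf M)
    (O' : SuperPresheaf M') (φ : C(M, M')) where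
  star : ∀ W : Opens M', O'.Sec W →ₐ[ℂ] O.Sec (Opens.comap φ W)
  star_res : ∀ {V W : Opens M'} (h : V ≤ W) (f : O'.Sec W),
    star V (O'.res h f) = O.res (Opens.comap_mono φ h) (star W f)
  star_parity : ∀ (W : Opens M') (q : ZMod 2) (f : O'.Sec W),
    f ∈ O'.parity W q → star W f ∈ O.parity (Opens.comap φ W) q

end Presheaves

section ExteriorBundle

variable {A : Type u} [NormedAddCommGroup A] [NormedSpace ℂ A]
  {H : Type u} [TopologicalSpace H] (I : ModelWithCorners ℂ A H)
  {M : Type u} [TopologicalSpace M] [ChartedSpace H M]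
  (F : Type u) [NormedAddCommGroup F] [NormedSpace ℂ F]
  (E : M → Type u) [∀ x, AddCommGroup (E x)] [∀ x, Module ℂ (E x)]
  [TopologicalSpace (TotalSpace F E)] [∀ x, TopologicalSpace (E x)] [FiberBundle F E]

/-- Restriction of set-theoretic sections of the exterior algebra bundle. -/
def restrictFun {V U : Opens M} (h : V ≤ U) :
    (∀ x : U, ExteriorAlgebra ℂ (E x)) →ₐ[ℂ] (∀ x : V, ExteriorAlgebra ℂ (E x)) where
  toFun s x := s ⟨x.1, h x.2⟩
  map_one' := rfl
  map_mul' _ _ := rfl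
  map_zero' := rfl
  map_add' _ _ := rfl
  commutes' _ := rfl

/-- The algebra generated over `V` by the holomorphic functions on `V` and the holomorphic
sections of `E` over `V`. -/
def generatedSections (V : Opens M) : Subalgebra ℂ (∀ x : V, ExteriorAlgebra ℂ (E x)) :=
  Algebra.adjoin ℂ
    ({s | ∃ f : M → ℂ, ContMDiffOn I 𝓘(ℂ, ℂ) ω f V ∧
        s = fun x : V => algebraMap ℂ (ExteriorAlgebra ℂ (E x)) (f x)} ∪
     {s | ∃ e : ∀ x, E x,
        ContMDiffOn I (I.prod 𝓘(ℂ, F)) ω (fun x => TotalSpace.mk' F x (e x)) V ∧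
        s = fun x : V => ExteriorAlgebra.ι ℂ (e x)})

variable {I F E} in
theorem generatedSections_res {V W : Opens M} (h : W ≤ V)
    {s : ∀ x : V, ExteriorAlgebra ℂ (E x)} (hs : s ∈ generatedSections I F E V) :
    restrictFun E h s ∈ generatedSections I F E W := by
  have hle : generatedSections I F E V ≤
      (generatedSections I F E W).comap (restrictFun E h) := by
    refine Algebra.adjoin_le ?_
    rintro s (⟨f, hf, rfl⟩ | ⟨e, he, rfl⟩)
    · exact Algebra.subset_adjoin (Or.inl ⟨f, hf.mono h, rfl⟩)
    · exact Algebra.subset_adjoin (Or.inr ⟨e, he.mono h, rfl⟩)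
  exact hle hs

/-- The holomorphic sections over `U` of the exterior algebra bundle of `E`: those which are
locally polynomials in holomorphic functions and holomorphic sections of `E`. -/
def exteriorSections (U : Opens M) : Subalgebra ℂ (∀ x : U, ExteriorAlgebra ℂ (E x)) where
  carrier := {s | ∀ x ∈ U, ∃ (V : Opens M) (h : V ≤ U), x ∈ V ∧
    restrictFun E h s ∈ generatedSections I F E V}
  mul_mem' := by
    intro a b ha hb x hx
    obtain ⟨V, hV, hxV, haV⟩ := ha x hx
    obtain ⟨W, hW, hxW, hbW⟩ := hb x hx
    exact ⟨V ⊓ W, inf_le_left.trans hV, ⟨hxV, hxW⟩,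
      mul_mem (generatedSections_res inf_le_left haV) (generatedSections_res inf_le_right hbW)⟩
  add_mem' := by
    intro a b ha hb x hx
    obtain ⟨V, hV, hxV, haV⟩ := ha x hx
    obtain ⟨W, hW, hxW, hbW⟩ := hb x hx
    exact ⟨V ⊓ W, inf_le_left.trans hV, ⟨hxV, hxW⟩,
      add_mem (generatedSections_res inf_le_left haV) (generatedSections_res inf_le_right hbW)⟩
  algebraMap_mem' := by
    intro r x hx
    exact ⟨U, le_rfl, hx, Subalgebra.algebraMap_mem _ r⟩

/-- Restriction of holomorphic sections. -/
def exteriorRes {V U : Opens M} (h : V ≤ U) :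
    exteriorSections I F E U →ₐ[ℂ] exteriorSections I F E V :=
  ((restrictFun E h).comp (exteriorSections I F E U).val).codRestrict _ (by
    intro s x hx
    obtain ⟨W, hW, hxW, hs⟩ := s.2 x (h hx)
    exact ⟨V ⊓ W, inf_le_left, ⟨hx, hxW⟩, generatedSections_res inf_le_right hs⟩)

/-- The sheaf of holomorphic sections of the exterior algebra bundle of `E`. -/
def exteriorSheaf : SuperPresheaf M where
  alg :=
    { obj := fun U => AlgCat.of ℂ (exteriorSections I F E U.unop)
      map := fun h => AlgCat.ofHom (exteriorRes I F E h.unop.le)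
      map_id := fun _ => rfl
      map_comp := fun _ _ => rfl }
  parity U q :=
    { carrier := {s : exteriorSections I F E U |
        ∀ x : U, s.1 x ∈ CliffordAlgebra.evenOdd (0 : QuadraticForm ℂ (E x)) q}
      add_mem' := fun ha hb x => add_mem (ha x) (hb x)
      zero_mem' := fun _ => zero_mem _
      smul_mem' := fun c _ ha x => Submodule.smul_mem _ c (ha x) }

end ExteriorBundle

section Supermanifolds

variable {A : Type u} [NormedAddCommGroup A] [NormedSpace ℂ A]
  {H : Type u} [TopologicalSpace H] (I : ModelWithCorners ℂ A H)
  {M : Type u} [TopologicalSpace M] [ChartedSpace H M]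
  (F : Type u) [NormedAddCommGroup F] [NormedSpace ℂ F]
  (E : M → Type u) [∀ x, AddCommGroup (E x)] [∀ x, Module ℂ (E x)]
  [TopologicalSpace (TotalSpace F E)] [∀ x, TopologicalSpace (E x)] [FiberBundle F E]

/-- The data of a supermanifold on `E → M`: the superfunctions, and their classes modulo the second
step of the filtration, identified with functions on `M` (`body`, the class modulo nilpotents) and
with sections of `E` (`lin`, the class of the odd part of a superfunction). -/
structure SuperData (E : M → Type u) [∀ x, AddCommGroup (E x)] [∀ x, Module ℂ (E x)]
    extends SuperPresheaf M where
  body : ∀ U : Opens M, toSuperPresheaf.Sec U →ₐ[ℂ] (U → ℂ)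
  lin : ∀ U : Opens M, toSuperPresheaf.Sec U →ₗ[ℂ] (∀ x : U, E x)

variable {E}

/-- A local splitting over `U`: an isomorphism of the restricted superalgebra sheaves, from the
superfunctions to the holomorphic sections of the exterior algebra bundle, which induces the given
identification in degrees zero and one (hence on the associated graded sheaves). -/
structure LocalSplitting (S : SuperData E) (U : Opens M) where
  toEquiv : ∀ V : {V : Opens M // V ≤ U}, S.Sec V.1 ≃ₐ[ℂ] (exteriorSheaf I F E).Sec V.1
  toEquiv_res : ∀ (V W : {V : Opens M // V ≤ U}) (h : W.1 ≤ V.1) (f : S.Sec V.1),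
    toEquiv W (S.res h f) = (exteriorSheaf I F E).res h (toEquiv V f)
  toEquiv_parity : ∀ (V : {V : Opens M // V ≤ U}) (q : ZMod 2) (f : S.Sec V.1),
    toEquiv V f ∈ (exteriorSheaf I F E).parity V.1 q ↔ f ∈ S.parity V.1 q
  body_eq : ∀ (V : {V : Opens M // V ≤ U}) (f : S.Sec V.1) (x : V.1),
    S.body V.1 f x = ExteriorAlgebra.algebraMapInv
      ((show exteriorSections I F E V.1 from toEquiv V f).1 x)
  lin_eq : ∀ (V : {V : Opens M // V ≤ U}) (f : S.Sec V.1) (x : V.1),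
    S.lin V.1 f x = ExteriorAlgebra.ιInv
      ((show exteriorSections I F E V.1 from toEquiv V f).1 x)

variable {I F} in
/-- The transition `τ ∘ σ⁻¹` between two local splittings, over the intersection of their
domains. -/
def LocalSplitting.transition {S : SuperData E} {U U' : Opens M} (τ : LocalSplitting I F S U)
    (σ : LocalSplitting I F S U') : (exteriorSheaf I F E).sheafEnd (U ⊓ U') :=
  ⟨fun V => (τ.toEquiv ⟨V.1, V.2.trans inf_le_left⟩).toLinearMap ∘ₗ
      (σ.toEquiv ⟨V.1, V.2.trans inf_le_right⟩).symm.toLinearMap, by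
    intro V W h f
    obtain ⟨g, rfl⟩ := (σ.toEquiv ⟨V.1, V.2.trans inf_le_right⟩).surjective f
    have h1 := σ.toEquiv_res ⟨V.1, V.2.trans inf_le_right⟩ ⟨W.1, W.2.trans inf_le_right⟩ h g
    have h2 := τ.toEquiv_res ⟨V.1, V.2.trans inf_le_left⟩ ⟨W.1, W.2.trans inf_le_left⟩ h g
    simp only [LinearMap.comp_apply, AlgEquiv.toLinearMap_apply, AlgEquiv.symm_apply_apply]
    rw [← h1, AlgEquiv.symm_apply_apply, h2]⟩

variable (E)

/-- A complex supermanifold on the holomorphic vector bundle `E → M`: a sheaf of supercommutative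
superalgebras, locally isomorphic to the sheaf of holomorphic sections of the exterior algebra
bundle of `E`, with an identification of the associated graded sheaf with the latter. -/
structure Supermanifold [IsManifold I ω M] [VectorBundle ℂ F E] [ContMDiffVectorBundle ω F E I]
    extends SuperData E where
  isSheaf : alg.IsSheaf
  parity_res : ∀ {V U : Opens M} (h : V ≤ U) (q : ZMod 2) (f : toSuperPresheaf.Sec U),
    f ∈ parity U q → toSuperPresheaf.res h f ∈ parity V q
  parity_isInternal : ∀ U : Opens M, DirectSum.IsInternal (parity U)
  parity_graded : ∀ U : Opens M, SetLike.GradedMonoid (parity U)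
  supercomm : ∀ (U : Opens M) (p q : ZMod 2) (f g : toSuperPresheaf.Sec U),
    f ∈ parity U p → g ∈ parity U q → f * g = (-1 : ℂ) ^ (p.val * q.val) • (g * f)
  body_res : ∀ {V U : Opens M} (h : V ≤ U) (f : toSuperPresheaf.Sec U) (x : V),
    body V (toSuperPresheaf.res h f) x = body U f ⟨x.1, h x.2⟩
  lin_res : ∀ {V U : Opens M} (h : V ≤ U) (f : toSuperPresheaf.Sec U) (x : V),
    lin V (toSuperPresheaf.res h f) x = lin U f ⟨x.1, h x.2⟩
  exists_splitting : ∀ x : M, ∃ U : Opens M, x ∈ U ∧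
    Nonempty (LocalSplitting I F toSuperData U)

variable {E I F}

/-- `S` and `N` agree up to even endomorphisms of degree at least `t`: every cochain of transition
maps of `S`, with respect to local splittings over an open cover, differs from some cochain of
transition maps of `N` over the same cover by even endomorphisms of degree at least `t`. -/
def AgreeUpTo [IsManifold I ω M] [VectorBundle ℂ F E] [ContMDiffVectorBundle ω F E I]
    (t : ℕ) (S N : Supermanifold I F E) : Prop :=
  ∀ (J : Type u) (U : J → Opens M), (⨆ i, U i) = ⊤ →
    ∀ τ : ∀ i, LocalSplitting I F S.toSuperData (U i),
      ∃ σ : ∀ i, LocalSplitting I F N.toSuperData (U i), ∀ i j,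
        SuperPresheaf.HasParity 0 ((τ i).transition (τ j) - (σ i).transition (σ j)) ∧
        SuperPresheaf.RaisesDegree t ((τ i).transition (τ j) - (σ i).transition (σ j))

end Supermanifolds

section Products

instance pullbackAddCommGroup {B B' : Type*} (f : B' → B) (E : B → Type*)
    [∀ x, AddCommGroup (E x)] (x : B') : AddCommGroup ((f *ᵖ E) x) :=
  inferInstanceAs (AddCommGroup (E (f x)))

instance prodAddCommGroup {B : Type*} (E₁ E₂ : B → Type*) [∀ x, AddCommGroup (E₁ x)]
    [∀ x, AddCommGroup (E₂ x)] (x : B) : AddCommGroup ((E₁ ×ᵇ E₂) x) :=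
  inferInstanceAs (AddCommGroup (E₁ x × E₂ x))

variable {A₁ A₂ : Type u} [NormedAddCommGroup A₁] [NormedSpace ℂ A₁]
  [NormedAddCommGroup A₂] [NormedSpace ℂ A₂]
  {H₁ H₂ : Type u} [TopologicalSpace H₁] [TopologicalSpace H₂]
  (I₁ : ModelWithCorners ℂ A₁ H₁) (I₂ : ModelWithCorners ℂ A₂ H₂)
  {M₁ M₂ : Type u} [TopologicalSpace M₁] [ChartedSpace H₁ M₁]
  [TopologicalSpace M₂] [ChartedSpace H₂ M₂]
  (E₁ : M₁ → Type u) (E₂ : M₂ → Type u)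

/-- The bundle over `M₁ × M₂` with fibre `E₁ x × E₂ y` at `(x, y)`: the direct sum of the pullbacks
of `E₁` and `E₂` along the projections. -/
abbrev outerSum : M₁ × M₂ → Type u :=
  ((ContMDiffMap.fst : C^ω⟮I₁.prod I₂, M₁ × M₂; I₁, M₁⟯) *ᵖ E₁) ×ᵇ
    ((ContMDiffMap.snd : C^ω⟮I₁.prod I₂, M₁ × M₂; I₂, M₂⟯) *ᵖ E₂)

variable {I₁ I₂ E₁ E₂}
variable [∀ x, AddCommGroup (E₁ x)] [∀ x, Module ℂ (E₁ x)]
  [∀ x, AddCommGroup (E₂ x)] [∀ x, Module ℂ (E₂ x)]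

/-- `S` has morphisms to `S₁` and `S₂` over the projections of `M₁ × M₂` which, on functions and on
sections of the bundles, reduce to the pullbacks `f ↦ f ∘ pr`, `e ↦ (e ∘ pr₁, 0)` and
`e ↦ (0, e ∘ pr₂)` along the projections. -/
def HasProjections (S : SuperData (outerSum I₁ I₂ E₁ E₂)) (S₁ : SuperData E₁)
    (S₂ : SuperData E₂) : Prop :=
  (∃ p : SuperMorphism S.toSuperPresheaf S₁.toSuperPresheaf (ContinuousMap.fst : C(M₁ × M₂, M₁)),
    ∀ (W : Opens M₁) (f : S₁.Sec W) (x : Opens.comap (ContinuousMap.fst : C(M₁ × M₂, M₁)) W),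
      S.body _ (p.star W f) x = S₁.body W f ⟨x.1.1, x.2⟩ ∧
      S.lin _ (p.star W f) x = (S₁.lin W f ⟨x.1.1, x.2⟩, (0 : E₂ x.1.2))) ∧
  (∃ p : SuperMorphism S.toSuperPresheaf S₂.toSuperPresheaf (ContinuousMap.snd : C(M₁ × M₂, M₂)),
    ∀ (W : Opens M₂) (f : S₂.Sec W) (x : Opens.comap (ContinuousMap.snd : C(M₁ × M₂, M₂)) W),
      S.body _ (p.star W f) x = S₂.body W f ⟨x.1.2, x.2⟩ ∧
      S.lin _ (p.star W f) x = ((0 : E₁ x.1.1), S₂.lin W f ⟨x.1.2, x.2⟩))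

end Products

end

end SuperGeometry

/-!
The two bundles enter the proof symmetrically, through a presentation `BundleProduct` of the outer
direct sum. Over a trivialization, the sections of the exterior algebra bundle are functions of even
and odd coordinates, and every argument is reduced to these. By Hadamard's lemma
(`exists_hadamard_sec`, `exists_eq_sum_frameSec_mul`), a section is, modulo an arbitrary power of
the maximal ideal at a point, a polynomial in the coordinates; so homomorphisms and superderivations
are determined by their values at the coordinates (`GermHom.ext_of_coord`, `SecDer.ext_of_coord`),
and raise degrees as soon as they do so on the coordinates (`twistedDer_raises`). Conversely a
Taylor expansion with nilpotent increments (`exists_hom_family`) produces homomorphisms, and over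
the dual numbers even derivations (`SecDer.exists_even`), with prescribed values at the coordinates.

*Existence and uniqueness.* Homomorphisms from the sections over the two factors, which are
compatible with the identifications of the graded sheaves, extend locally to a unique endomorphism
of the sections over the product (`BundleProduct.exists_hom`, `BundleProduct.ext_of_pull`); it is
bijective, because it differs from the identity by an operator which raises degrees
(`HolHom.bijective_sec`). Hence every supermanifold with projections has the universal property of a
product (`BundleProduct.exists_splitting`). Applied to the split product, the universal property
turns local splittings of the factors into a cocycle, from which a product is glued
(`GluingCocycle`, `BundleProduct.exists_supermanifold`). Applied to two products, it gives for every
splitting of the one the splitting of the other with the same restrictions to the factors; the two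
cochains of transition maps are then equal, not only up to errors of degree `t`
(`BundleProduct.agreeUpTo`).

*Nildominance.* An even superderivation of degree two of a factor lifts to the product, annihilating
the superfunctions of the other factor (`BundleProduct.exists_isLift`). Let `Y` commute with all
global even superderivations of degree two; both parity components of `Y` do so as well, and `Y` may
be taken homogeneous. In splittings adapted to the projections, the supercommutators of `Y` with
contractions along the second bundle still commute with the lifts from the first factor
(`BundleProduct.exists_iterated_bracket`). Applied to pullbacks from the first factor and restricted
to a slice through a point, they become superderivations of the first factor
(`BundleProduct.Slices.sliceDer`) which commute with its global even superderivations of degree two,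
so that they have degree `t₁`. On pullbacks the supercommutators are the iterated contractions of
the values of `Y`, and an element of an exterior algebra has degree `k` if all its iterated
contractions have after projection (`mem_extFil_of_ctrList`). Therefore `Y` raises degrees by `t₁`
on the coordinates of the first factor, symmetrically by `t₂` on those of the second one
(`BundleProduct.Adapted.raises_pull₁`), and so by `min t₁ t₂` throughout.
-/

namespace SuperGeometry

noncomputable section

set_option linter.unusedSectionVars false

/-! ### The exterior algebra of a vector space -/

section LinearAlgebra

variable {V W : Type*} [AddCommGroup V] [Module ℂ V] [AddCommGroup W] [Module ℂ W]

variable (V) in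
/-- The elements of the exterior algebra all of whose components have degree at least `k`. -/
def extFil (k : ℕ) : Submodule ℂ (ExteriorAlgebra ℂ V) :=
  LinearMap.range (ExteriorAlgebra.ι ℂ (M := V)) ^ k * ⊤

theorem extFil_zero : extFil V 0 = ⊤ := by
  simp [extFil]

theorem extFil_succ (k : ℕ) :
    extFil V (k + 1) = LinearMap.range (ExteriorAlgebra.ι ℂ (M := V)) * extFil V k := by
  rw [extFil, extFil, pow_succ', mul_assoc]

theorem mem_extFil_zero (u : ExteriorAlgebra ℂ V) : u ∈ extFil V 0 := by
  rw [extFil_zero]; trivial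

theorem top_mul_top_eq : (⊤ : Submodule ℂ (ExteriorAlgebra ℂ V)) * ⊤ = ⊤ := by
  refine le_antisymm le_top fun u _ => ?_
  rw [← one_mul u]
  exact Submodule.mul_mem_mul trivial trivial

theorem extFil_mul_top (k : ℕ) : extFil V k * ⊤ = extFil V k := by
  rw [extFil, mul_assoc, top_mul_top_eq]

theorem ι_mem_extFil_one (v : V) : ExteriorAlgebra.ι ℂ v ∈ extFil V 1 := by
  rw [extFil, pow_one, ← mul_one (ExteriorAlgebra.ι ℂ v)]
  exact Submodule.mul_mem_mul ⟨v, rfl⟩ trivial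

theorem ι_mul_mem_extFil {k : ℕ} (v : V) {u : ExteriorAlgebra ℂ V} (hu : u ∈ extFil V k) :
    ExteriorAlgebra.ι ℂ v * u ∈ extFil V (k + 1) := by
  rw [extFil_succ]
  exact Submodule.mul_mem_mul ⟨v, rfl⟩ hu

theorem sub_algebraMapInv_mem (u : ExteriorAlgebra ℂ V) :
    u - algebraMap ℂ _ (ExteriorAlgebra.algebraMapInv u) ∈ extFil V 1 := by
  induction u using ExteriorAlgebra.induction with
  | algebraMap r => simp
  | ι x => simpa [ExteriorAlgebra.algebraMapInv] using ι_mem_extFil_one x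
  | mul a b ha hb =>
    have : a * b - algebraMap ℂ _ (ExteriorAlgebra.algebraMapInv (a * b)) =
        (a - algebraMap ℂ _ (ExteriorAlgebra.algebraMapInv a)) * b +
        (ExteriorAlgebra.algebraMapInv a) •
          (b - algebraMap ℂ _ (ExteriorAlgebra.algebraMapInv b)) := by
      rw [map_mul, map_mul, Algebra.smul_def]
      noncomm_ring
    rw [this]
    refine add_mem ?_ (Submodule.smul_mem _ _ hb)
    rw [← extFil_mul_top]
    exact Submodule.mul_mem_mul ha trivial
  | add a b ha hb =>
    rw [map_add, map_add, add_sub_add_comm]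
    exact add_mem ha hb

theorem mem_extFil_one {u : ExteriorAlgebra ℂ V} :
    u ∈ extFil V 1 ↔ ExteriorAlgebra.algebraMapInv u = 0 := by
  constructor
  · intro hu
    rw [extFil, pow_one] at hu
    induction hu using Submodule.mul_induction_on' with
    | mem_mul_mem m hm n hn =>
      obtain ⟨v, rfl⟩ := hm
      simp [ExteriorAlgebra.algebraMapInv]
    | add x hx y hy h1 h2 => rw [map_add, h1, h2, add_zero]
  · intro h
    simpa [h] using sub_algebraMapInv_mem u

theorem top_mul_extFil (k : ℕ) : ⊤ * extFil V k = extFil V k := by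
  refine le_antisymm ?_ fun u hu => by
    rw [← one_mul u]; exact Submodule.mul_mem_mul trivial hu
  induction k with
  | zero => rw [extFil_zero, top_mul_top_eq]
  | succ k ih =>
    rw [extFil_succ, ← mul_assoc]
    have h : ⊤ * LinearMap.range (ExteriorAlgebra.ι ℂ (M := V)) ≤
        LinearMap.range (ExteriorAlgebra.ι ℂ (M := V)) * ⊤ := by
      rw [Submodule.mul_le]
      rintro m - _ ⟨v, rfl⟩
      have : m * ExteriorAlgebra.ι ℂ v ∈ extFil V 1 := by
        rw [mem_extFil_one]
        simp [ExteriorAlgebra.algebraMapInv]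
      rwa [extFil, pow_one] at this
    calc _ ≤ LinearMap.range (ExteriorAlgebra.ι ℂ (M := V)) * ⊤ * extFil V k :=
          mul_le_mul_left h _
      _ ≤ _ := by rw [mul_assoc]; exact mul_le_mul_right ih _

theorem extFil_mul_extFil (a b : ℕ) : extFil V a * extFil V b ≤ extFil V (a + b) := by
  conv_lhs => rw [extFil, mul_assoc, top_mul_extFil, extFil, ← mul_assoc, ← pow_add]
  exact le_rfl

theorem mul_mem_extFil {a b : ℕ} {u w : ExteriorAlgebra ℂ V} (hu : u ∈ extFil V a)
    (hw : w ∈ extFil V b) : u * w ∈ extFil V (a + b) :=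
  extFil_mul_extFil a b (Submodule.mul_mem_mul hu hw)

theorem mul_mem_extFil_left {a : ℕ} {u : ExteriorAlgebra ℂ V} (hu : u ∈ extFil V a)
    (w : ExteriorAlgebra ℂ V) : u * w ∈ extFil V a :=
  mul_mem_extFil (b := 0) hu (mem_extFil_zero w)

theorem mul_mem_extFil_right {a : ℕ} {u : ExteriorAlgebra ℂ V} (hu : u ∈ extFil V a)
    (w : ExteriorAlgebra ℂ V) : w * u ∈ extFil V a := by
  simpa using mul_mem_extFil (a := 0) (mem_extFil_zero w) hu

theorem extFil_antitone : Antitone (extFil V) := by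
  refine antitone_nat_of_succ_le fun k u hu => ?_
  rw [extFil, pow_succ, mul_assoc] at hu
  exact (mul_le_mul_right le_top _ : _ ≤ LinearMap.range (ExteriorAlgebra.ι ℂ (M := V)) ^ k * ⊤) hu

theorem extFil_eq_bot [Module.Finite ℂ V] {n : ℕ} (hn : Module.finrank ℂ V < n) :
    extFil V n = ⊥ := by
  have h : (LinearMap.range (ExteriorAlgebra.ι ℂ (M := V)) ^ n) = ⊥ := by
    have h1 : Module.finrank ℂ (⋀[ℂ]^n V) = 0 := by
      rw [exteriorPower.finrank_eq, Nat.choose_eq_zero_of_lt hn]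
    exact Submodule.finrank_eq_zero.1 h1
  rw [extFil, h, Submodule.bot_mul]

theorem eq_zero_of_forall_mem_extFil [Module.Finite ℂ V] {u : ExteriorAlgebra ℂ V}
    (h : ∀ n, u ∈ extFil V n) : u = 0 := by
  have := h (Module.finrank ℂ V + 1)
  rwa [extFil_eq_bot (Nat.lt_succ_self _), Submodule.mem_bot] at this

theorem ιInv_mul (a b : ExteriorAlgebra ℂ V) : ExteriorAlgebra.ιInv (a * b) =
    ExteriorAlgebra.algebraMapInv a • ExteriorAlgebra.ιInv b +
      ExteriorAlgebra.algebraMapInv b • ExteriorAlgebra.ιInv a := by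
  let : Module ℂᵐᵒᵖ V := Module.compHom _ ((RingHom.id ℂ).fromOpposite mul_comm)
  have : IsCentralScalar ℂ V := ⟨fun r m => rfl⟩
  have h : ∀ c : ExteriorAlgebra ℂ V, (ExteriorAlgebra.toTrivSqZeroExt c).fst =
      ExteriorAlgebra.algebraMapInv c := by
    intro c
    have : (TrivSqZeroExt.fstHom ℂ ℂ V).comp ExteriorAlgebra.toTrivSqZeroExt =
        (ExteriorAlgebra.algebraMapInv : ExteriorAlgebra ℂ V →ₐ[ℂ] ℂ) := by
      ext v
      simp [ExteriorAlgebra.algebraMapInv]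
    exact DFunLike.congr_fun this c
  change (ExteriorAlgebra.toTrivSqZeroExt (a * b)).snd = _
  rw [map_mul, TrivSqZeroExt.snd_mul, h, h]
  rfl

theorem ιInv_algebraMap (r : ℂ) :
    ExteriorAlgebra.ιInv (algebraMap ℂ (ExteriorAlgebra ℂ V) r) = 0 := by
  let : Module ℂᵐᵒᵖ V := Module.compHom _ ((RingHom.id ℂ).fromOpposite mul_comm)
  have : IsCentralScalar ℂ V := ⟨fun r m => rfl⟩
  change (ExteriorAlgebra.toTrivSqZeroExt (algebraMap ℂ (ExteriorAlgebra ℂ V) r)).snd = _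
  rw [AlgHom.commutes]
  rfl

theorem sub_ιInv_mem (u : ExteriorAlgebra ℂ V) :
    u - algebraMap ℂ _ (ExteriorAlgebra.algebraMapInv u) -
      ExteriorAlgebra.ι ℂ (ExteriorAlgebra.ιInv u) ∈ extFil V 2 := by
  induction u using ExteriorAlgebra.induction with
  | algebraMap r => simp [ιInv_algebraMap]
  | ι x =>
    have : ExteriorAlgebra.ιInv (ExteriorAlgebra.ι ℂ x) = x := ExteriorAlgebra.ι_leftInverse x
    rw [this]
    simp [ExteriorAlgebra.algebraMapInv]
  | mul a b ha hb =>
    set ea := ExteriorAlgebra.algebraMapInv a with hea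
    set eb := ExteriorAlgebra.algebraMapInv b with heb
    have h1 : (a - algebraMap ℂ _ ea) * (b - algebraMap ℂ _ eb) ∈ extFil V 2 :=
      mul_mem_extFil (a := 1) (b := 1) (sub_algebraMapInv_mem a) (sub_algebraMapInv_mem b)
    have h2 := add_mem h1 (add_mem (Submodule.smul_mem _ ea hb) (Submodule.smul_mem _ eb ha))
    convert h2 using 1
    rw [map_mul, ιInv_mul, ← hea, ← heb]
    simp only [map_add, map_smul, map_mul, Algebra.smul_def, mul_sub, sub_mul]
    rw [← Algebra.commutes eb a, Algebra.commutes eb (algebraMap ℂ (ExteriorAlgebra ℂ V) ea)]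
    abel
  | add a b ha hb =>
    convert add_mem ha hb using 1
    simp only [map_add]
    abel

theorem mem_extFil_two {u : ExteriorAlgebra ℂ V} (h : ExteriorAlgebra.algebraMapInv u = 0)
    (h' : ExteriorAlgebra.ιInv u = 0) : u ∈ extFil V 2 := by
  simpa [h, h'] using sub_ιInv_mem u

theorem map_mem_extFil (f : V →ₗ[ℂ] W) {k : ℕ} {u : ExteriorAlgebra ℂ V} (hu : u ∈ extFil V k) :
    ExteriorAlgebra.map f u ∈ extFil W k := by
  induction k generalizing u with
  | zero => exact mem_extFil_zero _
  | succ k ih =>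
    rw [extFil_succ] at hu
    induction hu using Submodule.mul_induction_on' with
    | mem_mul_mem m hm n hn =>
      obtain ⟨v, rfl⟩ := hm
      rw [map_mul, ExteriorAlgebra.map_apply_ι]
      exact ι_mul_mem_extFil _ (ih hn)
    | add x hx y hy h1 h2 => rw [map_add]; exact add_mem h1 h2

theorem algebraMapInv_map (f : V →ₗ[ℂ] W) (u : ExteriorAlgebra ℂ V) :
    ExteriorAlgebra.algebraMapInv (ExteriorAlgebra.map f u) = ExteriorAlgebra.algebraMapInv u := by
  have : (ExteriorAlgebra.algebraMapInv).comp (ExteriorAlgebra.map f) =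
      (ExteriorAlgebra.algebraMapInv : ExteriorAlgebra ℂ V →ₐ[ℂ] ℂ) := by
    ext v
    simp [ExteriorAlgebra.algebraMapInv]
  exact DFunLike.congr_fun this u

theorem ιInv_map (f : V →ₗ[ℂ] W) (u : ExteriorAlgebra ℂ V) :
    ExteriorAlgebra.ιInv (ExteriorAlgebra.map f u) = f (ExteriorAlgebra.ιInv u) :=
  LinearMap.congr_fun (ExteriorAlgebra.ιInv_comp_map f) u

theorem exists_eq_sum_ι_mul {κ : Type*} [Fintype κ] (b : Module.Basis κ ℂ V) {k : ℕ}
    {u : ExteriorAlgebra ℂ V} (hu : u ∈ extFil V (k + 1)) :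
    ∃ g : κ → ExteriorAlgebra ℂ V, (∀ j, g j ∈ extFil V k) ∧
      u = ∑ j, ExteriorAlgebra.ι ℂ (b j) * g j := by
  rw [extFil_succ] at hu
  induction hu using Submodule.mul_induction_on' with
  | mem_mul_mem m hm n hn =>
    obtain ⟨v, rfl⟩ := hm
    refine ⟨fun j => b.repr v j • n, fun j => Submodule.smul_mem _ _ hn, ?_⟩
    conv_lhs => rw [← b.sum_repr v]
    simp only [map_sum, map_smul, Finset.sum_mul, smul_mul_assoc, mul_smul_comm]
  | add x hx y hy h1 h2 =>
    obtain ⟨g1, hg1, rfl⟩ := h1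
    obtain ⟨g2, hg2, rfl⟩ := h2
    exact ⟨g1 + g2, fun j => add_mem (hg1 j) (hg2 j), by
      simp [mul_add, Finset.sum_add_distrib]⟩

instance [Module.Finite ℂ V] : Module.Finite ℂ (ExteriorAlgebra ℂ V) := by
  let b := Module.finBasis ℂ V
  exact Module.Finite.of_basis (Module.Basis.ExteriorAlgebra b)

/-! ### Parity in the exterior algebra -/

/-- The grade involution. -/
abbrev inv : ExteriorAlgebra ℂ V →ₐ[ℂ] ExteriorAlgebra ℂ V :=
  CliffordAlgebra.involute (Q := (0 : QuadraticForm ℂ V))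

variable (V) in
/-- The even (`0`) and odd (`1`) elements of the exterior algebra. -/
abbrev extParity (q : ZMod 2) : Submodule ℂ (ExteriorAlgebra ℂ V) :=
  CliffordAlgebra.evenOdd (0 : QuadraticForm ℂ V) q

theorem inv_ι (v : V) : inv (ExteriorAlgebra.ι ℂ v) = - ExteriorAlgebra.ι ℂ v :=
  CliffordAlgebra.involute_ι v

theorem inv_inv_apply (u : ExteriorAlgebra ℂ V) : inv (inv u) = u :=
  CliffordAlgebra.involute_involute u

theorem inv_of_mem {q : ZMod 2} {u : ExteriorAlgebra ℂ V} (hu : u ∈ extParity V q) :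
    inv u = (-1 : ℂ) ^ q.val • u := by
  fin_cases q
  · change inv u = (-1 : ℂ) ^ 0 • u
    rw [pow_zero, one_smul]
    exact CliffordAlgebra.involute_eq_of_mem_even hu
  · change inv u = (-1 : ℂ) ^ 1 • u
    rw [pow_one, neg_smul, one_smul]
    exact CliffordAlgebra.involute_eq_of_mem_odd hu

/-- The projections to the even and odd parts, as polynomials in the grade involution. -/
def parityProj (q : ZMod 2) : ExteriorAlgebra ℂ V →ₗ[ℂ] ExteriorAlgebra ℂ V :=
  (2⁻¹ : ℂ) • (LinearMap.id + (-1 : ℂ) ^ q.val • inv.toLinearMap)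

theorem parityProj_apply (q : ZMod 2) (u : ExteriorAlgebra ℂ V) :
    parityProj q u = (2⁻¹ : ℂ) • (u + (-1 : ℂ) ^ q.val • inv u) := rfl

theorem parityProj_of_mem {q : ZMod 2} {u : ExteriorAlgebra ℂ V} (hu : u ∈ extParity V q) :
    parityProj q u = u := by
  rw [parityProj_apply, inv_of_mem hu, smul_smul, ← mul_pow]
  rw [neg_one_mul, neg_neg, one_pow, one_smul, ← two_smul ℂ u, smul_smul]
  norm_num

theorem parityProj_of_mem_ne {p q : ZMod 2} (hpq : p ≠ q) {u : ExteriorAlgebra ℂ V}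
    (hu : u ∈ extParity V q) : parityProj p u = 0 := by
  rw [parityProj_apply, inv_of_mem hu, smul_smul]
  have : (-1 : ℂ) ^ p.val * (-1 : ℂ) ^ q.val = -1 := by
    fin_cases p <;> fin_cases q
    · exact absurd rfl hpq
    · change (-1 : ℂ) ^ 0 * (-1 : ℂ) ^ 1 = -1
      norm_num
    · change (-1 : ℂ) ^ 1 * (-1 : ℂ) ^ 0 = -1
      norm_num
    · exact absurd rfl hpq
  rw [this]
  simp

theorem exists_parity_add (u : ExteriorAlgebra ℂ V) :
    ∃ a ∈ extParity V 0, ∃ b ∈ extParity V 1, u = a + b := by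
  have h := (CliffordAlgebra.evenOdd_isCompl (0 : QuadraticForm ℂ V)).sup_eq_top
  have hu : u ∈ CliffordAlgebra.evenOdd (0 : QuadraticForm ℂ V) 0 ⊔
    CliffordAlgebra.evenOdd (0 : QuadraticForm ℂ V) 1 := by rw [h]; trivial
  obtain ⟨a, ha, b, hb, rfl⟩ := Submodule.mem_sup.1 hu
  exact ⟨a, ha, b, hb, rfl⟩

theorem parityProj_mem (q : ZMod 2) (u : ExteriorAlgebra ℂ V) :
    parityProj q u ∈ extParity V q := by
  obtain ⟨a, ha, b, hb, rfl⟩ := exists_parity_add u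
  rw [map_add]
  fin_cases q
  · have h1 := parityProj_of_mem ha
    have h2 := parityProj_of_mem_ne (p := 0) (by decide) hb
    change parityProj 0 a + parityProj 0 b ∈ extParity V 0
    rw [h1, h2, add_zero]; exact ha
  · have h1 := parityProj_of_mem hb
    have h2 := parityProj_of_mem_ne (p := 1) (by decide) ha
    change parityProj 1 a + parityProj 1 b ∈ extParity V 1
    rw [h1, h2, zero_add]; exact hb

theorem mem_extParity_iff {q : ZMod 2} {u : ExteriorAlgebra ℂ V} :
    u ∈ extParity V q ↔ inv u = (-1 : ℂ) ^ q.val • u := by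
  refine ⟨inv_of_mem, fun h => ?_⟩
  have h1 : parityProj q u = u := by
    rw [parityProj_apply, h, smul_smul, ← mul_pow]
    rw [neg_one_mul, neg_neg, one_pow, one_smul, ← two_smul ℂ u, smul_smul]
    norm_num
  rw [← h1]
  exact parityProj_mem q u

theorem ι_mul_of_mem_parity (v : V) (u : ExteriorAlgebra ℂ V) :
    ExteriorAlgebra.ι ℂ v * u = inv u * ExteriorAlgebra.ι ℂ v := by
  induction u using ExteriorAlgebra.induction with
  | algebraMap r => rw [AlgHom.commutes]; exact (Algebra.commutes r _).symm
  | ι x =>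
    rw [inv_ι, neg_mul, ← add_eq_zero_iff_eq_neg]
    exact ExteriorAlgebra.ι_add_mul_swap v x
  | mul a b ha hb => rw [← mul_assoc, ha, mul_assoc, hb, map_mul, mul_assoc]
  | add a b ha hb => rw [mul_add, ha, hb, map_add, add_mul]

theorem mul_comm_of_mem_even {a : ExteriorAlgebra ℂ V} (ha : a ∈ extParity V 0)
    (c : ExteriorAlgebra ℂ V) : a * c = c * a := by
  induction a, ha using CliffordAlgebra.even_induction with
  | algebraMap r => exact Algebra.commutes r c
  | add x y hx hy h1 h2 => rw [add_mul, mul_add, h1, h2]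
  | ι_mul_ι_mul m₁ m₂ x hx h =>
    have e : ∀ d, CliffordAlgebra.ι (0 : QuadraticForm ℂ V) m₁ *
        (CliffordAlgebra.ι (0 : QuadraticForm ℂ V) m₂ * d) = d *
        (CliffordAlgebra.ι (0 : QuadraticForm ℂ V) m₁ *
          CliffordAlgebra.ι (0 : QuadraticForm ℂ V) m₂) := fun d => by
      have h2 := ι_mul_of_mem_parity m₂ d
      have h1 := ι_mul_of_mem_parity m₁ (inv d)
      rw [inv_inv_apply] at h1
      change ExteriorAlgebra.ι ℂ m₁ * (ExteriorAlgebra.ι ℂ m₂ * d) =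
        d * (ExteriorAlgebra.ι ℂ m₁ * ExteriorAlgebra.ι ℂ m₂)
      rw [h2, ← mul_assoc, h1, mul_assoc]
    rw [mul_assoc, h, mul_assoc, e, mul_assoc, mul_assoc, e]

theorem mul_comm_of_mem_odd {a : ExteriorAlgebra ℂ V} (ha : a ∈ extParity V 1)
    (c : ExteriorAlgebra ℂ V) : a * c = inv c * a := by
  induction a, ha using CliffordAlgebra.odd_induction with
  | ι v => exact ι_mul_of_mem_parity v c
  | add x y hx hy h1 h2 => rw [add_mul, mul_add, h1, h2]
  | ι_mul_ι_mul m₁ m₂ x hx h =>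
    have he := CliffordAlgebra.ι_mul_ι_mem_evenOdd_zero (0 : QuadraticForm ℂ V) m₁ m₂
    rw [mul_assoc, h, ← mul_assoc, mul_comm_of_mem_even he, mul_assoc]

theorem extParity_mul_comm {p q : ZMod 2} {a b : ExteriorAlgebra ℂ V} (ha : a ∈ extParity V p)
    (hb : b ∈ extParity V q) : a * b = (-1 : ℂ) ^ (p.val * q.val) • (b * a) := by
  fin_cases p
  · change a * b = (-1 : ℂ) ^ (0 * q.val) • (b * a)
    rw [zero_mul, pow_zero, one_smul]
    exact mul_comm_of_mem_even ha b
  · change a * b = (-1 : ℂ) ^ (1 * q.val) • (b * a)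
    rw [one_mul, mul_comm_of_mem_odd ha, inv_of_mem hb, smul_mul_assoc]

theorem inv_map (f : V →ₗ[ℂ] W) (u : ExteriorAlgebra ℂ V) :
    inv (ExteriorAlgebra.map f u) = ExteriorAlgebra.map f (inv u) := by
  have : (inv : ExteriorAlgebra ℂ W →ₐ[ℂ] _).comp (ExteriorAlgebra.map f) =
      (ExteriorAlgebra.map f).comp inv := by
    ext v
    simp only [LinearMap.comp_apply, AlgHom.toLinearMap_apply, AlgHom.comp_apply, inv_ι, map_neg,
      ExteriorAlgebra.map_apply_ι]
  exact DFunLike.congr_fun this u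

theorem map_mem_extParity (f : V →ₗ[ℂ] W) {q : ZMod 2} {u : ExteriorAlgebra ℂ V}
    (hu : u ∈ extParity V q) : ExteriorAlgebra.map f u ∈ extParity W q := by
  rw [mem_extParity_iff] at hu ⊢
  rw [inv_map, hu, map_smul]

/-- Contraction of an element of the exterior algebra with a linear form. -/
abbrev ctr (d : Module.Dual ℂ V) : ExteriorAlgebra ℂ V →ₗ[ℂ] ExteriorAlgebra ℂ V :=
  CliffordAlgebra.contractLeft (Q := (0 : QuadraticForm ℂ V)) d

theorem ctr_ι (d : Module.Dual ℂ V) (v : V) :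
    ctr d (ExteriorAlgebra.ι ℂ v) = algebraMap ℂ _ (d v) :=
  CliffordAlgebra.contractLeft_ι _ d v

theorem ctr_ι_mul (d : Module.Dual ℂ V) (v : V) (u : ExteriorAlgebra ℂ V) :
    ctr d (ExteriorAlgebra.ι ℂ v * u) = d v • u - ExteriorAlgebra.ι ℂ v * ctr d u :=
  CliffordAlgebra.contractLeft_ι_mul d v u

theorem ctr_algebraMap (d : Module.Dual ℂ V) (r : ℂ) :
    ctr d (algebraMap ℂ (ExteriorAlgebra ℂ V) r) = 0 :=
  CliffordAlgebra.contractLeft_algebraMap _ d r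

theorem ctr_ctr (d : Module.Dual ℂ V) (u : ExteriorAlgebra ℂ V) : ctr d (ctr d u) = 0 :=
  CliffordAlgebra.contractLeft_contractLeft d u

/-- Contraction is a superderivation of odd parity. -/
theorem ctr_mul (d : Module.Dual ℂ V) (a b : ExteriorAlgebra ℂ V) :
    ctr d (a * b) = ctr d a * b + inv a * ctr d b := by
  induction a using ExteriorAlgebra.induction generalizing b with
  | algebraMap r =>
    rw [AlgHom.commutes, ctr_algebraMap, ← Algebra.smul_def, ← Algebra.smul_def, map_smul,
      zero_mul, zero_add]
  | ι x => rw [ctr_ι_mul, ctr_ι, inv_ι, Algebra.smul_def, neg_mul, sub_eq_add_neg]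
  | mul a c ha hc =>
    rw [mul_assoc, ha, hc, ha, map_mul]
    noncomm_ring
  | add a c ha hc => rw [add_mul, map_add, ha, hc, map_add, map_add]; noncomm_ring

theorem ctr_inv (d : Module.Dual ℂ V) (u : ExteriorAlgebra ℂ V) :
    ctr d (inv u) = - inv (ctr d u) := by
  induction u using ExteriorAlgebra.induction with
  | algebraMap r => rw [AlgHom.commutes, ctr_algebraMap, map_zero, neg_zero]
  | ι x => rw [inv_ι, map_neg, ctr_ι, AlgHom.commutes]
  | mul a b ha hb => rw [map_mul, ctr_mul, ctr_mul, ha, hb, map_add, map_mul, map_mul]; noncomm_ring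
  | add a b ha hb => rw [map_add, map_add, ha, hb, map_add, map_add]; abel

theorem ctr_map (f : V →ₗ[ℂ] W) (d : Module.Dual ℂ W) (u : ExteriorAlgebra ℂ V) :
    ctr d (ExteriorAlgebra.map f u) = ExteriorAlgebra.map f (ctr (d ∘ₗ f) u) := by
  induction u using ExteriorAlgebra.induction with
  | algebraMap r => rw [AlgHom.commutes, ctr_algebraMap, ctr_algebraMap, map_zero]
  | ι x => rw [ExteriorAlgebra.map_apply_ι, ctr_ι, ctr_ι, AlgHom.commutes]; rfl
  | mul a b ha hb =>
    rw [map_mul, ctr_mul, ctr_mul, ha, hb, map_add, map_mul, map_mul, inv_map]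
  | add a b ha hb => rw [map_add, map_add, ha, hb, map_add, map_add]

/-- The decomposition of an element of the exterior algebra into a part without the vector `η` and a
multiple of `η`. -/
theorem eq_map_add_ι_mul_ctr (η : V) (ξ : Module.Dual ℂ V)
    (u : ExteriorAlgebra ℂ V) :
    u = ExteriorAlgebra.map (LinearMap.id - ξ.smulRight η) u +
      ExteriorAlgebra.ι ℂ η * ctr ξ u := by
  have hη : ExteriorAlgebra.ι ℂ η * ExteriorAlgebra.ι ℂ η = 0 := ExteriorAlgebra.ι_sq_zero η
  have step : ∀ (v : V) (w : ExteriorAlgebra ℂ V),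
      w = ExteriorAlgebra.map (LinearMap.id - ξ.smulRight η) w + ExteriorAlgebra.ι ℂ η * ctr ξ w →
      ExteriorAlgebra.ι ℂ v * w =
        ExteriorAlgebra.map (LinearMap.id - ξ.smulRight η) (ExteriorAlgebra.ι ℂ v * w) +
        ExteriorAlgebra.ι ℂ η * ctr ξ (ExteriorAlgebra.ι ℂ v * w) := by
    intro v w hw
    have hv := ExteriorAlgebra.ι_add_mul_swap (R := ℂ) v η
    have hvη : ExteriorAlgebra.ι ℂ η * ExteriorAlgebra.ι ℂ v =
      - (ExteriorAlgebra.ι ℂ v * ExteriorAlgebra.ι ℂ η) := by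
      rw [eq_neg_iff_add_eq_zero, add_comm]; exact hv
    have e1 : ExteriorAlgebra.ι ℂ η *
        ExteriorAlgebra.map (LinearMap.id - ξ.smulRight η) w = ExteriorAlgebra.ι ℂ η * w := by
      conv_rhs => rw [hw, mul_add, ← mul_assoc, hη, zero_mul, add_zero]
    rw [map_mul, ExteriorAlgebra.map_apply_ι, ctr_ι_mul]
    have e2 : ((LinearMap.id : V →ₗ[ℂ] V) - ξ.smulRight η) v = v - ξ v • η := by simp
    rw [e2, map_sub, map_smul, sub_mul, smul_mul_assoc, e1, mul_sub, ← mul_assoc, hvη,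
      mul_smul_comm, neg_mul, sub_neg_eq_add, mul_assoc]
    conv_lhs => rw [hw, mul_add]
    abel
  induction u using CliffordAlgebra.left_induction with
  | algebraMap r =>
    have : ctr ξ (algebraMap ℂ (ExteriorAlgebra ℂ V) r) = 0 := ctr_algebraMap ξ r
    change algebraMap ℂ (ExteriorAlgebra ℂ V) r =
      ExteriorAlgebra.map (LinearMap.id - ξ.smulRight η) (algebraMap ℂ (ExteriorAlgebra ℂ V) r) +
      ExteriorAlgebra.ι ℂ η * ctr ξ (algebraMap ℂ (ExteriorAlgebra ℂ V) r)
    rw [this, AlgHom.commutes, mul_zero, add_zero]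
  | add x y hx hy =>
    rw [map_add, map_add, mul_add, add_add_add_comm, ← hx, ← hy]
  | ι_mul x v hx => exact step v x hx

/-- Iterated contraction along a list of linear forms. -/
def ctrList {κ : Type*} (ξ : κ → Module.Dual ℂ V) (l : List κ) (u : ExteriorAlgebra ℂ V) :
    ExteriorAlgebra ℂ V :=
  l.foldr (fun j w => ctr (ξ j) w) u

/-- Let `η j` be vectors and `ξ j` linear forms with `ξ i (η j) = δ i j`. An element has degree at
least `k` as soon as all its iterated contractions with the `ξ j` have, after projecting to the
complement of the `η j`. -/
theorem mem_extFil_of_ctrList {κ : Type*} [Fintype κ] [DecidableEq κ] {η : κ → V}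
    {ξ : κ → Module.Dual ℂ V} (h : ∀ i j, ξ i (η j) = if i = j then 1 else 0) {k : ℕ}
    {u : ExteriorAlgebra ℂ V}
    (hu : ∀ l : List κ, ExteriorAlgebra.map (LinearMap.id - ∑ j, (ξ j).smulRight (η j))
      (ctrList ξ l u) ∈ extFil V k) : u ∈ extFil V k := by
  -- The pairs `(ξ j, η j)` with `j ∈ s` are removed from the projection one at a time.
  have key : ∀ s : Finset κ, (∀ l : List κ,
      ExteriorAlgebra.map (LinearMap.id - ∑ j ∈ s, (ξ j).smulRight (η j)) (ctrList ξ l u) ∈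
        extFil V k) → ∀ l : List κ, ctrList ξ l u ∈ extFil V k := by
    intro s
    induction s using Finset.induction_on with
    | empty =>
      intro hs l
      have := hs l
      rwa [Finset.sum_empty, sub_zero, ExteriorAlgebra.map_id] at this
    | insert r s hr ih =>
      intro hs
      apply ih
      set P := LinearMap.id - ∑ j ∈ s, (ξ j).smulRight (η j) with hP
      have hPr : (LinearMap.id - (ξ r).smulRight (η r)) ∘ₗ P =
          LinearMap.id - ∑ j ∈ insert r s, (ξ j).smulRight (η j) := by
        ext v
        rw [Finset.sum_insert hr]
        have : ξ r (∑ j ∈ s, ξ j v • η j) = 0 := by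
          rw [map_sum]
          refine Finset.sum_eq_zero fun j hj => ?_
          rw [map_smul, h, if_neg (by rintro rfl; exact hr hj), smul_zero]
        simp [hP, this]
        abel
      have hξP : ξ r ∘ₗ P = ξ r := by
        ext v
        have : ξ r (∑ j ∈ s, ξ j v • η j) = 0 := by
          rw [map_sum]
          refine Finset.sum_eq_zero fun j hj => ?_
          rw [map_smul, h, if_neg (by rintro rfl; exact hr hj), smul_zero]
        simp [hP, this]
      have hdec : ∀ w, ExteriorAlgebra.map P w =
          ExteriorAlgebra.map (LinearMap.id - ∑ j ∈ insert r s, (ξ j).smulRight (η j)) w +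
            ExteriorAlgebra.ι ℂ (η r) * ExteriorAlgebra.map P (ctr (ξ r) w) := by
        intro w
        conv_lhs => rw [eq_map_add_ι_mul_ctr (η r) (ξ r)
          (ExteriorAlgebra.map P w)]
        rw [ctr_map, hξP, ← hPr, ← ExteriorAlgebra.map_comp_map]
        rfl
      intro l
      rw [hdec]
      refine add_mem (hs l) (mul_mem_extFil_right ?_ _)
      rw [hdec, ctr_ctr, map_zero, mul_zero, add_zero]
      exact hs (r :: l)
  exact key Finset.univ hu []

end LinearAlgebra

/-! ### Holomorphic functions in a chart -/

section Functions

/-- Hadamard's lemma: an analytic function is, near a point, its value plus an analytic linear form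
applied to the displacement. -/
theorem _root_.AnalyticAt.exists_eq_add_apply {A : Type*} [NormedAddCommGroup A] [NormedSpace ℂ A]
    {h : A → ℂ} {z₀ : A} (hh : AnalyticAt ℂ h z₀) :
    ∃ L : A → A →L[ℂ] ℂ, AnalyticAt ℂ L z₀ ∧ ∀ᶠ z in nhds z₀, h z = h z₀ + L z (z - z₀) := by
  obtain ⟨p, r, hp⟩ := hh
  have hrad : 0 < p.shift.radius := by
    rw [FormalMultilinearSeries.radius_shift]
    exact hp.r_pos.trans_le hp.r_le
  have hs := p.shift.hasFPowerSeriesOnBall hrad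
  refine ⟨fun z => p.shift.sum (z - z₀), ?_, ?_⟩
  · have h1 : AnalyticAt ℂ p.shift.sum (z₀ - z₀) := by
      rw [sub_self]; exact hs.analyticAt
    exact h1.comp (f := fun z => z - z₀) (analyticAt_id.sub analyticAt_const)
  · filter_upwards [Metric.eball_mem_nhds z₀ hp.r_pos] with z hz
    set y := z - z₀ with hy
    have hy' : y ∈ Metric.eball (0 : A) r := by
      simpa [hy, Metric.mem_eball, edist_eq_enorm_sub] using hz
    have h1 : HasSum (fun n => p n fun _ => y) (h z) := by
      have := hp.hasSum hy'
      rwa [hy, add_sub_cancel] at this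
    have h2 : HasSum (fun n => p.shift n fun _ => y) (p.shift.sum y) := by
      refine p.shift.hasSum ?_
      rw [FormalMultilinearSeries.radius_shift]
      exact Metric.eball_subset_eball hp.r_le hy'
    have h3 : HasSum (fun n => p (n + 1) fun _ => y) (p.shift.sum y y) := by
      have := h2.mapL (ContinuousLinearMap.apply ℂ ℂ y)
      have he : ∀ n, p (n + 1) (fun _ => y) = (p (n + 1)).curryRight (fun _ => y) y := fun n => by
        rw [ContinuousMultilinearMap.curryRight_apply]
        congr 1
        ext i
        refine Fin.lastCases ?_ (fun j => ?_) i <;> simp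
      simp_rw [he]
      exact this
    have h4 := (hasSum_nat_add_iff' 1).2 h1
    have h5 := h3.unique h4
    rw [h5, Finset.sum_range_one, hp.coeff_zero]
    ring

variable {A : Type u} [NormedAddCommGroup A] [NormedSpace ℂ A]
  {H : Type u} [TopologicalSpace H] (I : ModelWithCorners ℂ A H)
  {M : Type u} [TopologicalSpace M] [ChartedSpace H M]

/-- Extension by zero of a function on an open set. -/
def extZero {V : Opens M} (g : V → ℂ) (x : M) : ℂ :=
  open scoped Classical in if h : x ∈ V then g ⟨x, h⟩ else 0

theorem extZero_apply {V : Opens M} (g : V → ℂ) (x : V) : extZero g x = g x := by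
  simp [extZero]

variable (M) in
/-- The algebra of holomorphic functions on an open set. -/
def holFun (V : Opens M) : Subalgebra ℂ (V → ℂ) where
  carrier := {g | ContMDiffOn I 𝓘(ℂ, ℂ) ω (extZero g) V}
  mul_mem' {a b} ha hb := (ContMDiffOn.mul ha hb).congr fun x hx => by
    simp [extZero, show x ∈ V from hx]
  add_mem' {a b} ha hb := (ContMDiffOn.add ha hb).congr fun x hx => by
    simp [extZero, show x ∈ V from hx]
  algebraMap_mem' r := (contMDiffOn_const (c := r)).congr fun x hx => by
    simp [extZero, show x ∈ V from hx]

variable {I}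

theorem mem_holFun_of_contMDiffOn {V : Opens M} {f : M → ℂ}
    (hf : ContMDiffOn I 𝓘(ℂ, ℂ) ω f V) : (fun x : V => f x) ∈ holFun I M V :=
  hf.congr fun x hx => by simp [extZero, show x ∈ V from hx]

theorem mem_holFun_of_locally {V : Opens M} {g : V → ℂ}
    (h : ∀ x ∈ V, ∃ (W : Opens M) (hW : W ≤ V), x ∈ W ∧
      (fun y : W => g ⟨y.1, hW y.2⟩) ∈ holFun I M W) : g ∈ holFun I M V := by
  intro x hx
  obtain ⟨W, hW, hxW, hg⟩ := h x hx
  have h1 : ContMDiffAt I 𝓘(ℂ, ℂ) ω (extZero fun y : W => g ⟨y.1, hW y.2⟩) x :=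
    (hg x hxW).contMDiffAt (W.isOpen.mem_nhds hxW)
  refine (h1.congr_of_eventuallyEq ?_).contMDiffWithinAt
  filter_upwards [W.isOpen.mem_nhds hxW] with y hy
  simp [extZero, show y ∈ W from hy, hW hy]

variable (I) in
/-- Restriction of holomorphic functions. -/
def holRes {W V : Opens M} (h : W ≤ V) : holFun I M V →ₐ[ℂ] holFun I M W where
  toFun g := ⟨fun x => g.1 ⟨x.1, h x.2⟩, by
    refine (ContMDiffOn.mono g.2 h).congr fun x hx => ?_
    simp [extZero, show x ∈ W from hx, h hx]⟩
  map_one' := rfl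
  map_mul' _ _ := rfl
  map_zero' := rfl
  map_add' _ _ := rfl
  commutes' _ := rfl

/-- The domain of the preferred chart at `w`. -/
def chartDom (H : Type u) [TopologicalSpace H] [ChartedSpace H M] (w : M) : Opens M :=
  ⟨(chartAt H w).source, (chartAt H w).open_source⟩

variable (I) in
/-- The coordinate functions of the preferred chart at `w` with respect to a basis. -/
def coordFun (w : M) {ι : Type*} (b : Module.Basis ι ℂ A) (i : ι) (x : M) : ℂ :=
  b.coord i (extChartAt I w x)

section

variable [IsManifold I ω M] {w : M}

theorem contMDiffAt_iff_analyticAt [I.Boundaryless] {f : M → ℂ} {x : M} (hx : x ∈ chartDom H w) :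
    ContMDiffAt I 𝓘(ℂ, ℂ) ω f x ↔
      AnalyticAt ℂ (f ∘ (extChartAt I w).symm) (extChartAt I w x) := by
  rw [contMDiffAt_iff_source_of_mem_source (x := w) hx, ModelWithCorners.range_eq_univ,
    contMDiffWithinAt_univ, contMDiffAt_iff_contDiffAt]
  rw [← contDiffWithinAt_univ, contDiffWithinAt_omega_iff_analyticWithinAt,
    analyticWithinAt_univ]

theorem analyticAt_of_mem_holFun [I.Boundaryless] {V : Opens M} (g : holFun I M V) {x : M}
    (hx : x ∈ chartDom H w) (hxV : x ∈ V) :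
    AnalyticAt ℂ (extZero g.1 ∘ (extChartAt I w).symm) (extChartAt I w x) :=
  (contMDiffAt_iff_analyticAt hx).1 ((g.2 x hxV).contMDiffAt (V.isOpen.mem_nhds hxV))

theorem contMDiffAt_comp_extChartAt {h : A → ℂ} {x : M} (hx : x ∈ chartDom H w)
    (hh : AnalyticAt ℂ h (extChartAt I w x)) :
    ContMDiffAt I 𝓘(ℂ, ℂ) ω (h ∘ extChartAt I w) x := by
  refine ContMDiffAt.comp x (I' := 𝓘(ℂ, A)) ?_ (contMDiffAt_extChartAt' hx)
  rw [contMDiffAt_iff_contDiffAt]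
  exact hh.contDiffAt

theorem contMDiffOn_coordFun [FiniteDimensional ℂ A] {ι : Type*} (b : Module.Basis ι ℂ A) (i : ι)
    {V : Opens M} (hV : V ≤ chartDom H w) : ContMDiffOn I 𝓘(ℂ, ℂ) ω (coordFun I w b i) V := by
  intro x hx
  refine (contMDiffAt_comp_extChartAt (h := b.coord i) (hV hx) ?_).contMDiffWithinAt
  exact (LinearMap.toContinuousLinearMap (b.coord i)).analyticAt _

variable [I.Boundaryless]

/-- The derivative of a holomorphic function in the direction `v`, in the preferred chart
at `w`. -/
def dirDeriv (w : M) (v : A) {V : Opens M} (hV : V ≤ chartDom H w) :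
    holFun I M V →ₗ[ℂ] holFun I M V where
  toFun g := ⟨fun x => fderiv ℂ (extZero g.1 ∘ (extChartAt I w).symm) (extChartAt I w x) v, by
    refine mem_holFun_of_contMDiffOn (f := fun x =>
      fderiv ℂ (extZero g.1 ∘ (extChartAt I w).symm) (extChartAt I w x) v) fun x hx => ?_
    refine (contMDiffAt_comp_extChartAt (h := fun z =>
      fderiv ℂ (extZero g.1 ∘ (extChartAt I w).symm) z v) (hV hx) ?_).contMDiffWithinAt
    exact ((ContinuousLinearMap.apply ℂ ℂ v).analyticAt _).comp
      (analyticAt_of_mem_holFun g (hV hx) hx).fderiv⟩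
  map_add' f g := by
    ext x
    have hf := (analyticAt_of_mem_holFun f (hV x.2) x.2).differentiableAt
    have hg := (analyticAt_of_mem_holFun g (hV x.2) x.2).differentiableAt
    have : extZero (f + g).1 ∘ (extChartAt I w).symm =
        extZero f.1 ∘ (extChartAt I w).symm + extZero g.1 ∘ (extChartAt I w).symm := by
      ext z
      simp only [Function.comp_apply, extZero, Pi.add_apply]
      split_ifs <;> simp
    change fderiv ℂ (extZero (f + g).1 ∘ (extChartAt I w).symm) (extChartAt I w x) v = _
    rw [this, fderiv_add hf hg]
    rfl
  map_smul' c f := by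
    ext x
    have hf := (analyticAt_of_mem_holFun f (hV x.2) x.2).differentiableAt
    have : extZero (c • f).1 ∘ (extChartAt I w).symm =
        c • (extZero f.1 ∘ (extChartAt I w).symm) := by
      ext z
      simp only [Function.comp_apply, extZero, Pi.smul_apply]
      split_ifs <;> simp
    change fderiv ℂ (extZero (c • f).1 ∘ (extChartAt I w).symm) (extChartAt I w x) v = _
    rw [this, fderiv_const_smul hf]
    rfl

theorem dirDeriv_mul (v : A) {V : Opens M} (hV : V ≤ chartDom H w) (f g : holFun I M V) :
    dirDeriv w v hV (f * g) = f * dirDeriv w v hV g + dirDeriv w v hV f * g := by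
  ext x
  have hf := (analyticAt_of_mem_holFun f (hV x.2) x.2).differentiableAt
  have hg := (analyticAt_of_mem_holFun g (hV x.2) x.2).differentiableAt
  have : extZero (f * g).1 ∘ (extChartAt I w).symm =
      (extZero f.1 ∘ (extChartAt I w).symm) * (extZero g.1 ∘ (extChartAt I w).symm) := by
    ext z
    simp only [Function.comp_apply, extZero, Pi.mul_apply]
    split_ifs <;> simp
  change fderiv ℂ (extZero (f * g).1 ∘ (extChartAt I w).symm) (extChartAt I w x) v = _
  rw [this, fderiv_mul hf hg]
  have hx : (extChartAt I w).symm (extChartAt I w x) = x :=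
    (extChartAt I w).left_inv (by rw [extChartAt_source]; exact hV x.2)
  change extZero f.1 ((extChartAt I w).symm (extChartAt I w x)) *
      fderiv ℂ (extZero g.1 ∘ (extChartAt I w).symm) (extChartAt I w x) v +
    extZero g.1 ((extChartAt I w).symm (extChartAt I w x)) *
      fderiv ℂ (extZero f.1 ∘ (extChartAt I w).symm) (extChartAt I w x) v = _
  rw [hx, extZero_apply, extZero_apply, mul_comm (g.1 x)]
  rfl

theorem dirDeriv_res (v : A) {W V : Opens M} (h : W ≤ V) (hV : V ≤ chartDom H w)
    (f : holFun I M V) :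
    dirDeriv w v (h.trans hV) (holRes I h f) = holRes I h (dirDeriv w v hV f) := by
  ext x
  have hx : (extChartAt I w).symm (extChartAt I w x) = x :=
    (extChartAt I w).left_inv (by rw [extChartAt_source]; exact hV (h x.2))
  change fderiv ℂ (extZero (holRes I h f).1 ∘ (extChartAt I w).symm) (extChartAt I w x) v =
    fderiv ℂ (extZero f.1 ∘ (extChartAt I w).symm) (extChartAt I w x) v
  rw [Filter.EventuallyEq.fderiv_eq]
  have hc : ContinuousAt (extChartAt I w).symm (extChartAt I w x) :=
    continuousAt_extChartAt_symm' (by rw [extChartAt_source]; exact hV (h x.2))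
  have := hc.preimage_mem_nhds (by rw [hx]; exact W.isOpen.mem_nhds x.2)
  filter_upwards [this] with z hz
  have hz' : (extChartAt I w).symm z ∈ W := hz
  simp only [Function.comp_apply, extZero, dif_pos hz', dif_pos (h hz')]
  rfl

theorem dirDeriv_coordFun [FiniteDimensional ℂ A] {ι : Type*} (b : Module.Basis ι ℂ A) (i j : ι)
    {V : Opens M} (hV : V ≤ chartDom H w) :
    dirDeriv w (b i) hV ⟨fun x => coordFun I w b j x,
      mem_holFun_of_contMDiffOn (contMDiffOn_coordFun b j hV)⟩ =
      algebraMap ℂ _ (b.repr (b i) j) := by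
  ext x
  have hx' : (x : M) ∈ (extChartAt I w).source := by rw [extChartAt_source]; exact hV x.2
  have hx : (extChartAt I w).symm (extChartAt I w x) = x := (extChartAt I w).left_inv hx'
  change fderiv ℂ (extZero (fun x : V => coordFun I w b j x) ∘ (extChartAt I w).symm)
    (extChartAt I w x) (b i) = b.repr (b i) j
  have hev : (extZero (fun x : V => coordFun I w b j x) ∘ (extChartAt I w).symm) =ᶠ[nhds
      (extChartAt I w x)] LinearMap.toContinuousLinearMap (b.coord j) := by
    have hc : ContinuousAt (extChartAt I w).symm (extChartAt I w x) :=
      continuousAt_extChartAt_symm' hx'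
    have h1 := hc.preimage_mem_nhds (by rw [hx]; exact V.isOpen.mem_nhds x.2)
    have h2 : (extChartAt I w).target ∈ nhds (extChartAt I w x) :=
      extChartAt_target_mem_nhds' ((extChartAt I w).map_source hx')
    filter_upwards [h1, h2] with z hz hzt
    have hz' : (extChartAt I w).symm z ∈ V := hz
    simp only [Function.comp_apply, extZero, dif_pos hz', coordFun,
      (extChartAt I w).right_inv hzt]
    rfl
  rw [hev.fderiv_eq, ContinuousLinearMap.fderiv]
  rfl

/-- Hadamard's lemma for holomorphic functions on a manifold. -/
theorem exists_hadamard [FiniteDimensional ℂ A] {ι : Type*} [Fintype ι] (b : Module.Basis ι ℂ A)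
    {V : Opens M} (hV : V ≤ chartDom H w) (f : holFun I M V) (y : V) :
    ∃ (W : Opens M) (h : W ≤ V) (g : ι → holFun I M W), y.1 ∈ W ∧ ∀ x : W,
      f.1 ⟨x.1, h x.2⟩ = f.1 y +
        ∑ i, (coordFun I w b i x - coordFun I w b i y) * (g i).1 x := by
  obtain ⟨L, hL, hLf⟩ := (analyticAt_of_mem_holFun f (hV y.2) y.2).exists_eq_add_apply
  have hsrc : ∀ x : V, (x : M) ∈ (extChartAt I w).source := fun x => by
    rw [extChartAt_source]; exact hV x.2
  have hinv : ∀ x : V, (extChartAt I w).symm (extChartAt I w x) = x :=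
    fun x => (extChartAt I w).left_inv (hsrc x)
  have hev := hL.eventually_analyticAt.and hLf
  have hev2 : ∀ᶠ x in nhds y.1, (AnalyticAt ℂ L (extChartAt I w x) ∧
      (extZero f.1 ∘ (extChartAt I w).symm) (extChartAt I w x) =
        (extZero f.1 ∘ (extChartAt I w).symm) (extChartAt I w y) +
          L (extChartAt I w x) (extChartAt I w x - extChartAt I w y)) ∧ x ∈ V :=
    ((continuousAt_extChartAt' (hsrc y)).eventually hev).and (V.isOpen.mem_nhds y.2)
  obtain ⟨W, hW, hWo, hyW⟩ := eventually_nhds_iff.1 hev2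
  refine ⟨⟨W, hWo⟩, fun x hx => (hW x hx).2, fun i => ⟨fun x => L (extChartAt I w x) (b i), ?_⟩,
    hyW, fun x => ?_⟩
  · refine mem_holFun_of_contMDiffOn (f := fun x => L (extChartAt I w x) (b i)) fun x hx => ?_
    refine (contMDiffAt_comp_extChartAt (h := fun z => L z (b i)) (hV (hW x hx).2)
      ?_).contMDiffWithinAt
    exact ((ContinuousLinearMap.apply ℂ ℂ (b i)).analyticAt _).comp (hW x hx).1.1
  · have hxV : x.1 ∈ V := (hW x.1 x.2).2
    have h1 := (hW x.1 x.2).1.2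
    simp only [Function.comp_apply] at h1
    rw [hinv ⟨x.1, hxV⟩, hinv y, extZero_apply f.1 ⟨x.1, hxV⟩, extZero_apply] at h1
    rw [h1]
    congr 1
    conv_lhs => rw [← b.sum_repr (extChartAt I w x.1 - extChartAt I w y.1)]
    rw [map_sum]
    refine Finset.sum_congr rfl fun i _ => ?_
    rw [map_smul, map_sub]
    rfl

end

end Functions

/-! ### Taylor homomorphisms -/

section Taylor

theorem iterate_derivation_mul {R : Type*} [CommRing R] [Algebra ℂ R] (D : R →ₗ[ℂ] R)
    (hD : ∀ f g, D (f * g) = f * D g + D f * g) (n : ℕ) (f g : R) :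
    (D ^ n) (f * g) =
      ∑ ij ∈ Finset.HasAntidiagonal.antidiagonal n, n.choose ij.1 • ((D ^ ij.1) f * (D ^ ij.2) g) := by
  induction n with
  | zero => simp
  | succ n ih =>
    rw [Finset.sum_antidiagonal_choose_succ_nsmul (M := R) (fun i j => (D ^ i) f * (D ^ j) g),
      pow_succ', Module.End.mul_apply, ih, map_sum, ← Finset.sum_add_distrib]
    refine Finset.sum_congr rfl fun ij hij => ?_
    rw [map_nsmul, hD, smul_add, pow_succ', pow_succ', Module.End.mul_apply, Module.End.mul_apply,
      Nat.choose_symm_of_eq_add (Finset.HasAntidiagonal.mem_antidiagonal.1 hij).symm]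

theorem sum_range_antidiagonal_eq {B : Type*} [AddCommMonoid B] (N : ℕ) (t : ℕ → ℕ → B)
    (ht : ∀ i j, N ≤ i + j → t i j = 0) :
    ∑ n ∈ Finset.range N, ∑ ij ∈ Finset.HasAntidiagonal.antidiagonal n, t ij.1 ij.2 =
      ∑ i ∈ Finset.range N, ∑ j ∈ Finset.range N, t i j := by
  rw [← Finset.sum_product' (f := t), Finset.sum_sigma']
  refine Finset.sum_of_injOn (fun p => p.2) ?_ ?_ ?_ ?_
  · rintro ⟨n, a⟩ h ⟨m, b⟩ h' hab
    simp only [Finset.coe_sigma, Set.mem_sigma_iff, Finset.mem_coe, Finset.HasAntidiagonal.mem_antidiagonal] at h h'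
    obtain ⟨_, h⟩ := h
    obtain ⟨_, h'⟩ := h'
    dsimp only at hab
    subst hab
    subst h
    subst h'
    rfl
  · rintro ⟨n, a⟩ h
    simp only [Finset.coe_sigma, Set.mem_sigma_iff, Finset.mem_coe, Finset.HasAntidiagonal.mem_antidiagonal,
      Finset.mem_range] at h
    simp only [Finset.coe_product, Set.mem_prod, Finset.mem_coe, Finset.mem_range]
    omega
  · rintro ⟨i, j⟩ _ hn
    apply ht
    by_contra hlt
    exact hn ⟨⟨i + j, (i, j)⟩, by simpa using hlt, rfl⟩
  · intro _ _
    rfl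

/-- The Taylor homomorphism: for a derivation `D` of `R`, a homomorphism `ψ : R → B` with central
image and a central nilpotent `Δ`, the map `f ↦ ∑ ψ (D ^ n f) Δ ^ n / n!` is a homomorphism. -/
def taylorHom {R B : Type*} [CommRing R] [Algebra ℂ R] [Ring B] [Algebra ℂ B] (D : R →ₗ[ℂ] R)
    (hD : ∀ f g, D (f * g) = f * D g + D f * g) (ψ : R →ₐ[ℂ] B)
    (Δ : B) (hΔ : ∀ b, Δ * b = b * Δ) (N : ℕ) (hN : Δ ^ N = 0) (hN0 : 0 < N) : R →ₐ[ℂ] B :=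
  AlgHom.ofLinearMap
    (∑ n ∈ Finset.range N, ((n.factorial : ℂ)⁻¹) •
      (LinearMap.mulRight ℂ (Δ ^ n)) ∘ₗ ψ.toLinearMap ∘ₗ (D ^ n))
    (by
      have h1 : D 1 = 0 := by
        have := hD 1 1
        simpa using this
      rw [LinearMap.sum_apply, Finset.sum_eq_single_of_mem 0 (by simpa using hN0)]
      · simp
      · intro n _ hn
        obtain ⟨m, rfl⟩ := Nat.exists_eq_succ_of_ne_zero hn
        simp [pow_succ, h1])
    (by
      intro f g
      have hpow : ∀ n b, Δ ^ n * b = b * Δ ^ n := fun n b =>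
        ((show Commute Δ b from hΔ b).pow_left n)
      set t : ℕ → ℕ → B := fun i j => (((i.factorial : ℂ)⁻¹) • (ψ ((D ^ i) f) * Δ ^ i)) *
        (((j.factorial : ℂ)⁻¹) • (ψ ((D ^ j) g) * Δ ^ j)) with ht
      have e : ∀ i j, (ψ ((D ^ i) f) * Δ ^ i) * (ψ ((D ^ j) g) * Δ ^ j) =
          ψ ((D ^ i) f * (D ^ j) g) * Δ ^ (i + j) := fun i j => by
        rw [map_mul, pow_add, mul_assoc, ← mul_assoc (Δ ^ i), hpow i (ψ _)]
        simp only [mul_assoc]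
      have h0 : ∀ i j, N ≤ i + j → t i j = 0 := fun i j hij => by
        rw [ht]
        simp only
        rw [smul_mul_smul_comm, e, pow_eq_zero_of_le hij hN, mul_zero, smul_zero]
      have h1 := sum_range_antidiagonal_eq N t h0
      simp only [LinearMap.sum_apply, LinearMap.smul_apply, LinearMap.comp_apply,
        LinearMap.mulRight_apply, AlgHom.toLinearMap_apply]
      rw [Finset.sum_mul_sum, ← h1]
      refine Finset.sum_congr rfl fun n _ => ?_
      rw [iterate_derivation_mul D hD, map_sum, Finset.sum_mul, Finset.smul_sum]
      refine Finset.sum_congr rfl fun ij hij => ?_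
      rw [ht]
      simp only
      rw [smul_mul_smul_comm, e, Finset.HasAntidiagonal.mem_antidiagonal.1 hij, map_nsmul,
        smul_mul_assoc,
        ← Nat.cast_smul_eq_nsmul ℂ, smul_smul]
      congr 1
      have hij' := Finset.HasAntidiagonal.mem_antidiagonal.1 hij
      subst hij'
      have h2 : (((ij.1 + ij.2).choose ij.1 : ℕ) : ℂ) * ij.1.factorial * ij.2.factorial =
          (ij.1 + ij.2).factorial := by
        rw [Nat.choose_symm_add]
        exact_mod_cast Nat.add_choose_mul_factorial_mul_factorial ij.1 ij.2
      have h3 := Nat.cast_ne_zero (R := ℂ).2 (Nat.factorial_ne_zero (ij.1 + ij.2))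
      have h4 := Nat.cast_ne_zero (R := ℂ).2 (Nat.factorial_ne_zero ij.1)
      have h5 := Nat.cast_ne_zero (R := ℂ).2 (Nat.factorial_ne_zero ij.2)
      field_simp
      linear_combination h2)

theorem taylorHom_apply {R B : Type*} [CommRing R] [Algebra ℂ R] [Ring B] [Algebra ℂ B]
    (D : R →ₗ[ℂ] R) (hD : ∀ f g, D (f * g) = f * D g + D f * g) (ψ : R →ₐ[ℂ] B) (Δ : B)
    (hΔ : ∀ b, Δ * b = b * Δ) (N : ℕ) (hN : Δ ^ N = 0) (hN0 : 0 < N) (f : R) :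
    taylorHom D hD ψ Δ hΔ N hN hN0 f =
      ∑ n ∈ Finset.range N, ((n.factorial : ℂ)⁻¹) • (ψ ((D ^ n) f) * Δ ^ n) := by
  change (∑ n ∈ Finset.range N, ((n.factorial : ℂ)⁻¹) •
      (LinearMap.mulRight ℂ (Δ ^ n)) ∘ₗ ψ.toLinearMap ∘ₗ (D ^ n)) f = _
  rw [LinearMap.sum_apply]
  rfl

/-- The value of a Taylor homomorphism at an element whose derivative is a constant. -/
theorem taylorHom_apply_of_const {R B : Type*} [CommRing R] [Algebra ℂ R] [Ring B] [Algebra ℂ B]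
    (D : R →ₗ[ℂ] R) (hD : ∀ f g, D (f * g) = f * D g + D f * g) (ψ : R →ₐ[ℂ] B) (Δ : B)
    (hΔ : ∀ b, Δ * b = b * Δ) (N : ℕ) (hN : Δ ^ N = 0) (hN0 : 0 < N) (f : R) (c : ℂ)
    (hf : D f = algebraMap ℂ R c) :
    taylorHom D hD ψ Δ hΔ N hN hN0 f = ψ f + c • Δ := by
  have h1 : D 1 = 0 := by
    have := hD 1 1
    simpa using this
  have hc : D (algebraMap ℂ R c) = 0 := by
    rw [Algebra.algebraMap_eq_smul_one, map_smul, h1, smul_zero]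
  have hge : ∀ n, (D ^ (n + 2)) f = 0 := fun n => by
    rw [pow_add, pow_two, Module.End.mul_apply, Module.End.mul_apply, hf, hc, map_zero]
  -- The truncation order may be raised, since the additional powers of `Δ` vanish.
  have hraise : ∑ n ∈ Finset.range N, ((n.factorial : ℂ)⁻¹) • (ψ ((D ^ n) f) * Δ ^ n) =
      ∑ n ∈ Finset.range (N + 2), ((n.factorial : ℂ)⁻¹) • (ψ ((D ^ n) f) * Δ ^ n) := by
    refine Finset.sum_subset (Finset.range_mono (by omega)) fun n _ hn => ?_
    rw [pow_eq_zero_of_le (by simpa using hn) hN, mul_zero, smul_zero]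
  rw [taylorHom_apply, hraise, Finset.sum_range_succ', Finset.sum_range_succ',
    Finset.sum_eq_zero fun n _ => by rw [hge, map_zero, zero_mul, smul_zero]]
  simp [hf, Algebra.algebraMap_eq_smul_one, add_comm]

end Taylor

/-! ### Sections of the exterior algebra bundle -/

section Sections

variable {A : Type u} [NormedAddCommGroup A] [NormedSpace ℂ A]
  {H : Type u} [TopologicalSpace H] {I : ModelWithCorners ℂ A H}
  {M : Type u} [TopologicalSpace M] [ChartedSpace H M]
  {F : Type u} [NormedAddCommGroup F] [NormedSpace ℂ F]
  {E : M → Type u} [∀ x, AddCommGroup (E x)] [∀ x, Module ℂ (E x)]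
  [TopologicalSpace (TotalSpace F E)] [∀ x, TopologicalSpace (E x)] [FiberBundle F E]

theorem mem_exteriorSections_of_locally {U : Opens M} {s : ∀ x : U, ExteriorAlgebra ℂ (E x)}
    (hs : ∀ x ∈ U, ∃ (V : Opens M) (h : V ≤ U), x ∈ V ∧
      restrictFun E h s ∈ exteriorSections I F E V) : s ∈ exteriorSections I F E U := by
  intro x hx
  obtain ⟨V, hV, hxV, h⟩ := hs x hx
  obtain ⟨W, hW, hxW, h'⟩ := h x hxV
  exact ⟨W, hW.trans hV, hxW, h'⟩

theorem generatedSections_le (U : Opens M) :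
    generatedSections I F E U ≤ exteriorSections I F E U :=
  fun _ hs _ hx => ⟨U, le_rfl, hx, hs⟩

/-- To show that all holomorphic sections of the exterior algebra bundle lie in a subalgebra which
is defined by a local condition, it suffices to consider functions and sections of `E`. -/
theorem exteriorSections_le {U : Opens M}
    (P : ∀ V : Opens M, Subalgebra ℂ (∀ x : V, ExteriorAlgebra ℂ (E x)))
    (hloc : ∀ s : (∀ x : U, ExteriorAlgebra ℂ (E x)), (∀ x ∈ U, ∃ (V : Opens M) (h : V ≤ U), x ∈ V ∧
      restrictFun E h s ∈ P V) → s ∈ P U)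
    (hf : ∀ (V : Opens M), V ≤ U → ∀ f : M → ℂ, ContMDiffOn I 𝓘(ℂ, ℂ) ω f V →
      (fun x : V => algebraMap ℂ (ExteriorAlgebra ℂ (E x)) (f x)) ∈ P V)
    (he : ∀ (V : Opens M), V ≤ U → ∀ e : ∀ x, E x,
      ContMDiffOn I (I.prod 𝓘(ℂ, F)) ω (fun x => TotalSpace.mk' F x (e x)) V →
      (fun x : V => ExteriorAlgebra.ι ℂ (e x)) ∈ P V) :
    exteriorSections I F E U ≤ P U := by
  intro s hs
  refine hloc s fun x hx => ?_
  obtain ⟨V, hV, hxV, h⟩ := hs x hx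
  have hle : generatedSections I F E V ≤ P V := by
    refine Algebra.adjoin_le ?_
    rintro s (⟨f, hf', rfl⟩ | ⟨e, he', rfl⟩)
    · exact hf V hV f hf'
    · exact he V hV e he'
  exact ⟨V, hV, hxV, hle h⟩

theorem algebraMap_mem_exteriorSections {V : Opens M} {f : M → ℂ}
    (hf : ContMDiffOn I 𝓘(ℂ, ℂ) ω f V) :
    (fun x : V => algebraMap ℂ (ExteriorAlgebra ℂ (E x)) (f x)) ∈ exteriorSections I F E V :=
  generatedSections_le V (Algebra.subset_adjoin (Or.inl ⟨f, hf, rfl⟩))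

theorem ι_mem_exteriorSections {V : Opens M} {e : ∀ x, E x}
    (he : ContMDiffOn I (I.prod 𝓘(ℂ, F)) ω (fun x => TotalSpace.mk' F x (e x)) V) :
    (fun x : V => ExteriorAlgebra.ι ℂ (e x)) ∈ exteriorSections I F E V :=
  generatedSections_le V (Algebra.subset_adjoin (Or.inr ⟨e, he, rfl⟩))

variable (I F E) in
/-- Holomorphic functions as sections of the exterior algebra bundle. -/
def scalarSec (V : Opens M) : holFun I M V →ₐ[ℂ] exteriorSections I F E V where
  toFun g := ⟨fun x => algebraMap ℂ _ (g.1 x), by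
    have := algebraMap_mem_exteriorSections (E := E) (F := F) g.2
    simpa only [extZero_apply] using this⟩
  map_one' := by ext x; exact map_one _
  map_mul' a b := by ext x; exact map_mul _ _ _
  map_zero' := by ext x; exact map_zero _
  map_add' a b := by ext x; exact map_add _ _ _
  commutes' r := rfl

theorem scalarSec_mul_comm {V : Opens M} (g : holFun I M V) (s : exteriorSections I F E V) :
    scalarSec I F E V g * s = s * scalarSec I F E V g := by
  ext x
  exact Algebra.commutes (g.1 x) (s.1 x)

variable [VectorBundle ℂ F E]

variable (F E) in
/-- The domain of the preferred trivialization at `w`. -/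
def trivDom (w : M) : Opens M :=
  ⟨(trivializationAt F E w).baseSet, (trivializationAt F E w).open_baseSet⟩

variable (F E) in
/-- The preferred trivialization at `w`, on the fibre at `x`. -/
def triv (w x : M) : E x →ₗ[ℂ] F := (trivializationAt F E w).linearMapAt ℂ x

variable (F E) in
/-- The inverse of the preferred trivialization at `w`, on the fibre at `x`. -/
def trivSymm (w x : M) : F →ₗ[ℂ] E x := (trivializationAt F E w).symmₗ ℂ x

theorem trivSymm_comp_triv {w x : M} (hx : x ∈ trivDom F E w) :
    trivSymm F E w x ∘ₗ triv F E w x = LinearMap.id := by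
  ext v
  exact (trivializationAt F E w).symmₗ_linearMapAt hx v

theorem triv_comp_trivSymm {w x : M} (hx : x ∈ trivDom F E w) :
    triv F E w x ∘ₗ trivSymm F E w x = LinearMap.id := by
  ext v
  exact (trivializationAt F E w).linearMapAt_symmₗ hx v

theorem map_trivSymm_map_triv {w x : M} (hx : x ∈ trivDom F E w) (s : ExteriorAlgebra ℂ (E x)) :
    ExteriorAlgebra.map (trivSymm F E w x) (ExteriorAlgebra.map (triv F E w x) s) = s := by
  have h := DFunLike.congr_fun
    (ExteriorAlgebra.map_comp_map (triv F E w x) (trivSymm F E w x)) s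
  rw [trivSymm_comp_triv hx, ExteriorAlgebra.map_id] at h
  exact h

variable [ContMDiffVectorBundle ω F E I]

variable (I) in
theorem contMDiffOn_trivSymm (w : M) (v : F) {V : Opens M} (hV : V ≤ trivDom F E w) :
    ContMDiffOn I (I.prod 𝓘(ℂ, F)) ω (fun x => TotalSpace.mk' F x (trivSymm F E w x v)) V := by
  intro x hx
  have hx' := hV hx
  have h : ContMDiffAt I (I.prod 𝓘(ℂ, F)) ω
      (fun x => TotalSpace.mk' F x (trivSymm F E w x v)) x := by
    rw [(trivializationAt F E w).contMDiffAt_section_iff hx']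
    refine contMDiffAt_const (c := v) |>.congr_of_eventuallyEq ?_
    filter_upwards [(trivializationAt F E w).open_baseSet.mem_nhds hx'] with y hy
    have := (trivializationAt F E w).apply_mk_symm hy v
    rw [trivSymm, Trivialization.symmₗ_apply _ hy]
    exact congrArg Prod.snd this
  exact h.contMDiffWithinAt

theorem contMDiffOn_triv {w : M} {V : Opens M} (hV : V ≤ trivDom F E w) {e : ∀ x, E x}
    (he : ContMDiffOn I (I.prod 𝓘(ℂ, F)) ω (fun x => TotalSpace.mk' F x (e x)) V) :
    ContMDiffOn I 𝓘(ℂ, F) ω (fun x => triv F E w x (e x)) V := by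
  intro x hx
  have h := (he x hx).contMDiffAt (V.isOpen.mem_nhds hx)
  rw [(trivializationAt F E w).contMDiffAt_section_iff (hV hx)] at h
  refine (h.congr_of_eventuallyEq ?_).contMDiffWithinAt
  filter_upwards [V.isOpen.mem_nhds hx] with y hy
  rw [triv, Trivialization.linearMapAt_apply,
    if_pos (show y ∈ (trivializationAt F E w).baseSet from hV hy)]

variable (I) in
/-- Sections which are constant in the preferred trivialization at `w`. -/
def constSec (w : M) {V : Opens M} (hV : V ≤ trivDom F E w) :
    ExteriorAlgebra ℂ F →ₐ[ℂ] exteriorSections I F E V :=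
  AlgHom.codRestrict (AlgHom.pi fun x : V => ExteriorAlgebra.map (trivSymm F E w x)) _ (by
    intro u
    induction u using ExteriorAlgebra.induction with
    | algebraMap r =>
      rw [AlgHom.commutes]
      exact Subalgebra.algebraMap_mem _ r
    | ι v =>
      have := ι_mem_exteriorSections (contMDiffOn_trivSymm I w v hV)
      convert this using 1
      ext x
      exact ExteriorAlgebra.map_apply_ι _ _
    | mul a b ha hb => rw [map_mul]; exact mul_mem ha hb
    | add a b ha hb => rw [map_add]; exact add_mem ha hb)

variable [FiniteDimensional ℂ F]

/-- In a trivialization, the coefficients of a section are holomorphic. -/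
theorem functional_mem_holFun {w : M} {V : Opens M} (hV : V ≤ trivDom F E w)
    {s : ∀ x : V, ExteriorAlgebra ℂ (E x)} (hs : s ∈ exteriorSections I F E V)
    (l : ExteriorAlgebra ℂ F →ₗ[ℂ] ℂ) :
    (fun x : V => l (ExteriorAlgebra.map (triv F E w x) (s x))) ∈ holFun I M V := by
  let P : ∀ V : Opens M, Subalgebra ℂ (∀ x : V, ExteriorAlgebra ℂ (E x)) := fun V =>
    { carrier := {s | ∀ l : ExteriorAlgebra ℂ F →ₗ[ℂ] ℂ,
        (fun x : V => l (ExteriorAlgebra.map (triv F E w x) (s x))) ∈ holFun I M V}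
      mul_mem' := by
        intro a b ha hb l
        let u := Module.finBasis ℂ (ExteriorAlgebra ℂ F)
        have h : (fun x : V => l (ExteriorAlgebra.map (triv F E w x) ((a * b) x))) =
            ∑ i, ∑ j, l (u i * u j) •
              ((fun x : V => u.coord i (ExteriorAlgebra.map (triv F E w x) (a x))) *
                (fun x : V => u.coord j (ExteriorAlgebra.map (triv F E w x) (b x)))) := by
          ext x
          rw [Pi.mul_apply, map_mul]
          conv_lhs => rw [← u.sum_repr (ExteriorAlgebra.map (triv F E w x) (a x)),
            ← u.sum_repr (ExteriorAlgebra.map (triv F E w x) (b x)), Finset.sum_mul_sum]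
          simp only [map_sum, smul_mul_smul_comm, map_smul, Finset.sum_apply, Pi.smul_apply,
            Pi.mul_apply, smul_eq_mul, Module.Basis.coord_apply]
          refine Finset.sum_congr rfl fun i _ => Finset.sum_congr rfl fun j _ => ?_
          ring
        rw [h]
        exact sum_mem fun i _ => sum_mem fun j _ => Subalgebra.smul_mem _ (mul_mem (ha _) (hb _)) _
      add_mem' := by
        intro a b ha hb l
        convert add_mem (ha l) (hb l) using 1
        ext x
        simp
      algebraMap_mem' := by
        intro r l
        have : (fun x : V => l (ExteriorAlgebra.map (triv F E w x)
            (algebraMap ℂ (∀ x : V, ExteriorAlgebra ℂ (E x)) r x))) =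
            algebraMap ℂ (V → ℂ) (l (algebraMap ℂ _ r)) := by
          ext x
          exact congrArg l (AlgHom.commutes _ r)
        rw [this]
        exact Subalgebra.algebraMap_mem _ _ }
  refine exteriorSections_le (U := V) P ?_ ?_ ?_ hs l
  · intro s hs l
    refine mem_holFun_of_locally fun x hx => ?_
    obtain ⟨W, hW, hxW, h⟩ := hs x hx
    exact ⟨W, hW, hxW, h l⟩
  · intro W hW f hf l
    have : (fun x : W => l (ExteriorAlgebra.map (triv F E w x) (algebraMap ℂ _ (f x)))) =
        l 1 • (fun x : W => f x) := by
      ext x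
      rw [AlgHom.commutes, Algebra.algebraMap_eq_smul_one, map_smul, Pi.smul_apply, smul_eq_mul,
        smul_eq_mul, mul_comm]
    change _ ∈ holFun I M W
    rw [this]
    exact Subalgebra.smul_mem _ (mem_holFun_of_contMDiffOn hf) _
  · intro W hW e he l
    have h1 := contMDiffOn_triv (hW.trans hV) he
    have h2 : ContMDiffOn I 𝓘(ℂ, ℂ) ω (fun x => (LinearMap.toContinuousLinearMap
        (l ∘ₗ ExteriorAlgebra.ι ℂ)) (triv F E w x (e x))) W :=
      (ContinuousLinearMap.contMDiff _).comp_contMDiffOn h1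
    convert mem_holFun_of_contMDiffOn h2 using 1
    ext x
    rw [ExteriorAlgebra.map_apply_ι]
    rfl

/-- The composite of a section with a linear functional, in the preferred trivialization
at `w`. -/
def coeffSec (w : M) {V : Opens M} (hV : V ≤ trivDom F E w) (l : ExteriorAlgebra ℂ F →ₗ[ℂ] ℂ) :
    exteriorSections I F E V →ₗ[ℂ] holFun I M V where
  toFun s := ⟨_, functional_mem_holFun hV s.2 l⟩
  map_add' a b := by
    ext x
    change l (ExteriorAlgebra.map _ (a.1 x + b.1 x)) = _
    rw [map_add, map_add]
    rfl
  map_smul' c a := by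
    ext x
    change l (ExteriorAlgebra.map _ (c • a.1 x)) = _
    rw [map_smul, map_smul]
    rfl

/-- A section with values in a subspace of the exterior algebra is a combination of constant sections
with values in this subspace, with holomorphic functions as coefficients. -/
theorem eq_sum_scalarSec_mul_constSec {w : M} {V : Opens M} (hV : V ≤ trivDom F E w)
    (K : Submodule ℂ (ExteriorAlgebra ℂ F)) {n : Type*} [Fintype n] (u : Module.Basis n ℂ K)
    (l : n → ExteriorAlgebra ℂ F →ₗ[ℂ] ℂ) (hl : ∀ i (v : K), l i v = u.coord i v)
    (s : exteriorSections I F E V)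
    (hs : ∀ x : V, ExteriorAlgebra.map (triv F E w x) (s.1 x) ∈ K) :
    s = ∑ i, scalarSec I F E V (coeffSec w hV (l i) s) * constSec I w hV (u i) := by
  ext x
  have h1 := congrArg (Subtype.val) (u.sum_repr ⟨_, hs x⟩)
  have h2 := congrArg (ExteriorAlgebra.map (trivSymm F E w x)) h1
  rw [map_trivSymm_map_triv (hV x.2)] at h2
  rw [← h2]
  simp only [AddSubmonoidClass.coe_finsetSum, map_sum, Finset.sum_apply]
  refine Finset.sum_congr rfl fun i _ => ?_
  have h3 := hl i ⟨_, hs x⟩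
  rw [Module.Basis.coord_apply] at h3
  rw [← h3, Submodule.coe_smul, map_smul, Algebra.smul_def]
  rfl

end Sections

/-! ### Local coordinates of the exterior algebra sheaf -/

section LocalCoordinates

variable {A : Type u} [NormedAddCommGroup A] [NormedSpace ℂ A] [FiniteDimensional ℂ A]
  {H : Type u} [TopologicalSpace H] {I : ModelWithCorners ℂ A H} [I.Boundaryless]
  {M : Type u} [TopologicalSpace M] [ChartedSpace H M] [IsManifold I ω M]
  {F : Type u} [NormedAddCommGroup F] [NormedSpace ℂ F] [FiniteDimensional ℂ F]
  {E : M → Type u} [∀ x, AddCommGroup (E x)] [∀ x, Module ℂ (E x)]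
  [TopologicalSpace (TotalSpace F E)] [∀ x, TopologicalSpace (E x)] [FiberBundle F E]
  [VectorBundle ℂ F E] [ContMDiffVectorBundle ω F E I]
  {w : M}

variable (I) in
/-- The coordinate functions of the preferred chart at `w`, as holomorphic functions. -/
def coordHol {ι : Type*} (b : Module.Basis ι ℂ A) {V : Opens M} (hV : V ≤ chartDom H w) (i : ι) :
    holFun I M V :=
  ⟨fun x => coordFun I w b i x, mem_holFun_of_contMDiffOn (contMDiffOn_coordFun b i hV)⟩

variable (H F E) in
/-- The common domain of the preferred chart and the preferred trivialization at `w`. -/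
def bundleDom (w : M) : Opens M := chartDom H w ⊓ trivDom F E w

omit [FiniteDimensional ℂ A] [I.Boundaryless] [IsManifold I ω M] [FiniteDimensional ℂ F]
  [ContMDiffVectorBundle ω F E I] in
theorem bundleDom_le_chartDom : bundleDom H F E w ≤ chartDom H w := inf_le_left

omit [FiniteDimensional ℂ A] [I.Boundaryless] [IsManifold I ω M] [FiniteDimensional ℂ F]
  [ContMDiffVectorBundle ω F E I] in
theorem bundleDom_le_trivDom : bundleDom H F E w ≤ trivDom F E w := inf_le_right

variable (I F E) in
/-- The coordinate functions of the preferred chart at `w`, as even sections. -/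
def coordSec {ι : Type*} (b : Module.Basis ι ℂ A) {V : Opens M} (hV : V ≤ bundleDom H F E w)
    (i : ι) : exteriorSections I F E V :=
  scalarSec I F E V (coordHol I b (hV.trans bundleDom_le_chartDom) i)

variable (I) in
/-- The sections of `E` which are constant in the preferred trivialization at `w`, as odd
sections. -/
def frameSec {V : Opens M} (hV : V ≤ bundleDom H F E w) (v : F) : exteriorSections I F E V :=
  constSec I w (hV.trans bundleDom_le_trivDom) (ExteriorAlgebra.ι ℂ v)

omit [I.Boundaryless] [IsManifold I ω M] [FiniteDimensional ℂ A] in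
theorem eq_sum_scalarSec_mul_constSec_basis {V : Opens M} (hV : V ≤ trivDom F E w)
    {n : Type*} [Fintype n] (u : Module.Basis n ℂ (ExteriorAlgebra ℂ F))
    (s : exteriorSections I F E V) :
    s = ∑ i, scalarSec I F E V (coeffSec w hV (u.coord i) s) * constSec I w hV (u i) :=
  eq_sum_scalarSec_mul_constSec hV ⊤ (u.map Submodule.topEquiv.symm) (fun i => u.coord i)
    (fun _ _ => rfl) s (fun _ => trivial)

omit [I.Boundaryless] [IsManifold I ω M] [FiniteDimensional ℂ A] in
theorem coeffSec_scalarSec_mul_constSec {V : Opens M} (hV : V ≤ trivDom F E w)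
    (l : ExteriorAlgebra ℂ F →ₗ[ℂ] ℂ) (h : holFun I M V) (v : ExteriorAlgebra ℂ F) :
    coeffSec w hV l (scalarSec I F E V h * constSec I w hV v) = l v • h := by
  ext x
  change l (ExteriorAlgebra.map (triv F E w x) (algebraMap ℂ _ (h.1 x) *
    ExteriorAlgebra.map (trivSymm F E w x) v)) = l v * h.1 x
  have h1 := DFunLike.congr_fun
    (ExteriorAlgebra.map_comp_map (trivSymm F E w x) (triv F E w x)) v
  rw [triv_comp_trivSymm (hV x.2), ExteriorAlgebra.map_id] at h1
  have h2 : ExteriorAlgebra.map (triv F E w x) (ExteriorAlgebra.map (trivSymm F E w x) v) = v := h1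
  rw [map_mul, AlgHom.commutes, h2, ← Algebra.smul_def, map_smul, smul_eq_mul, mul_comm]

/-- Hadamard's lemma for sections of the exterior algebra bundle: near a point, a section is a
constant plus a combination of the coordinates which vanish at the point. -/
theorem exists_hadamard_sec {ι κ : Type*} [Fintype ι] [Fintype κ] (b : Module.Basis ι ℂ A)
    (bF : Module.Basis κ ℂ F) {V : Opens M} (hV : V ≤ bundleDom H F E w)
    (f : exteriorSections I F E V) (y : V) :
    ∃ (W : Opens M) (h : W ≤ V) (c : ℂ) (g : ι → exteriorSections I F E W)
      (g' : κ → exteriorSections I F E W), y.1 ∈ W ∧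
      exteriorRes I F E h f = algebraMap ℂ _ c +
        ∑ i, (coordSec I F E b (h.trans hV) i - algebraMap ℂ _ (coordFun I w b i y)) * g i +
        ∑ j, frameSec I (h.trans hV) (bF j) * g' j := by
  have hV' := hV.trans bundleDom_le_trivDom
  let u := Module.finBasis ℂ (ExteriorAlgebra ℂ F)
  rw [eq_sum_scalarSec_mul_constSec_basis hV' u f]
  generalize (Finset.univ : Finset (Fin (Module.finrank ℂ (ExteriorAlgebra ℂ F)))) = s
  induction s using Finset.induction_on with
  | empty => exact ⟨V, le_rfl, 0, 0, 0, y.2, by simp⟩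
  | insert m s hm ih =>
    obtain ⟨W₁, h₁, c₁, g₁, g₁', hy₁, e₁⟩ := ih
    obtain ⟨W₂, h₂, g₂, hy₂, e₂⟩ := exists_hadamard (w := w) b (hV.trans bundleDom_le_chartDom)
      (coeffSec w hV' (u.coord m) f) y
    obtain ⟨a, -, ha⟩ := exists_eq_sum_ι_mul bF (k := 0) (sub_algebraMapInv_mem (u m))
    rw [sub_eq_iff_eq_add'] at ha
    set q : ℂ := ExteriorAlgebra.algebraMapInv (u m)
    set C := coeffSec w hV' (u.coord m) f with hC
    let W := W₁ ⊓ W₂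
    have hW₁ : W ≤ W₁ := inf_le_left
    have hW₂ : W ≤ W₂ := inf_le_right
    have hWV : W ≤ V := hW₁.trans h₁
    refine ⟨W, hWV, C.1 y * q + c₁,
      fun i => scalarSec I F E W (holRes I hW₂ (g₂ i)) * constSec I w (hWV.trans hV') (u m) +
        exteriorRes I F E hW₁ (g₁ i),
      fun j => C.1 y • constSec I w (hWV.trans hV') (a j) + exteriorRes I F E hW₁ (g₁' j),
      ⟨hy₁, hy₂⟩, ?_⟩
    have e₁' := congrArg (exteriorRes I F E hW₁) e₁
    simp only [map_add, map_sum, map_mul, map_sub, AlgHom.commutes] at e₁'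
    rw [Finset.sum_insert hm, map_add]
    have e₃ : exteriorRes I F E hWV (∑ i ∈ s, scalarSec I F E V (coeffSec w hV' (u.coord i) f) *
        constSec I w hV' (u i)) = algebraMap ℂ _ c₁ +
        ∑ i, (coordSec I F E b (hWV.trans hV) i - algebraMap ℂ _ (coordFun I w b i y)) *
          exteriorRes I F E hW₁ (g₁ i) +
        ∑ j, frameSec I (hWV.trans hV) (bF j) * exteriorRes I F E hW₁ (g₁' j) := by
      rw [map_sum]; simp only [map_mul]; exact e₁'
    have e₄ : exteriorRes I F E hWV (scalarSec I F E V C) = algebraMap ℂ _ (C.1 y) +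
        ∑ i, (coordSec I F E b (hWV.trans hV) i - algebraMap ℂ _ (coordFun I w b i y)) *
          scalarSec I F E W (holRes I hW₂ (g₂ i)) := by
      ext x
      have := congrArg (algebraMap ℂ (ExteriorAlgebra ℂ (E x))) (e₂ ⟨x.1, hW₂ x.2⟩)
      simp only [map_add, map_sum, map_mul, map_sub] at this
      refine this.trans ?_
      simp only [AddMemClass.coe_add, AddSubmonoidClass.coe_finsetSum, MulMemClass.coe_mul,
        Pi.add_apply, Finset.sum_apply, Pi.mul_apply]
      rfl
    have e₅ : exteriorRes I F E hWV (constSec I w hV' (u m)) = algebraMap ℂ _ q +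
        ∑ j, frameSec I (hWV.trans hV) (bF j) * constSec I w (hWV.trans hV') (a j) := by
      change constSec I w (hWV.trans hV') (u m) = _
      rw [ha, map_add, AlgHom.commutes, map_sum]
      simp only [map_mul]
      rfl
    have e₆ : exteriorRes I F E hWV (constSec I w hV' (u m)) =
      constSec I w (hWV.trans hV') (u m) := rfl
    rw [e₃, map_mul, e₄, add_mul, Finset.sum_mul, e₆]
    conv_lhs => enter [1, 1]; rw [← e₆, e₅]
    simp only [mul_add, Finset.sum_add_distrib, mul_assoc, Finset.mul_sum, map_add, map_mul,
      mul_smul_comm, ← Algebra.smul_def]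
    abel

/-- A section of degree at least `k + 1` is a combination of frame sections with coefficients of
degree at least `k`. -/
theorem exists_eq_sum_frameSec_mul {κ : Type*} [Fintype κ] (bF : Module.Basis κ ℂ F)
    {V : Opens M} (hV : V ≤ bundleDom H F E w) {k : ℕ} (f : exteriorSections I F E V)
    (hf : ∀ x : V, f.1 x ∈ extFil (E x) (k + 1)) :
    ∃ g : κ → exteriorSections I F E V, (∀ (j : κ) (x : V), (g j).1 x ∈ extFil (E x) k) ∧
      f = ∑ j, frameSec I hV (bF j) * g j := by
  have hV' := hV.trans bundleDom_le_trivDom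
  let u := Module.finBasis ℂ (extFil F (k + 1))
  have hl : ∀ i, ∃ l : ExteriorAlgebra ℂ F →ₗ[ℂ] ℂ, l ∘ₗ (extFil F (k + 1)).subtype = u.coord i :=
    fun i => (u.coord i).exists_extend
  choose l hl using hl
  choose a ha ha' using fun i => exists_eq_sum_ι_mul bF (u i).2
  refine ⟨fun j => ∑ i, scalarSec I F E V (coeffSec w hV' (l i) f) * constSec I w hV' (a i j),
    fun j x => ?_, ?_⟩
  · simp only [AddSubmonoidClass.coe_finsetSum, Finset.sum_apply]
    refine sum_mem fun i _ => ?_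
    exact mul_mem_extFil_right (map_mem_extFil _ (ha i j)) _
  · conv_lhs => rw [eq_sum_scalarSec_mul_constSec hV' (extFil F (k + 1)) u l
      (fun i v => LinearMap.congr_fun (hl i) v) f (fun x => map_mem_extFil _ (hf x))]
    simp only [Finset.mul_sum]
    rw [Finset.sum_comm]
    refine Finset.sum_congr rfl fun i _ => ?_
    rw [ha', map_sum, Finset.mul_sum]
    refine Finset.sum_congr rfl fun j _ => ?_
    rw [map_mul, ← mul_assoc, scalarSec_mul_comm, mul_assoc]
    rfl

/-- Existence of homomorphisms with prescribed values at the coordinates: given a homomorphism `ψ`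
on functions with central image, the even coordinates may be displaced by central nilpotent
elements, and the odd coordinates sent to any elements whose squares vanish. -/
theorem exists_hom_family {ι : Type*} [Fintype ι] [DecidableEq ι] (b : Module.Basis ι ℂ A)
    {W : Opens M} (hW : W ≤ bundleDom H F E w)
    (B : Opens M → Type*) [∀ V, Ring (B V)] [∀ V, Algebra ℂ (B V)]
    (r : ∀ {V' V : Opens M}, V' ≤ V → B V →ₐ[ℂ] B V')
    (ψ : ∀ V : Opens M, V ≤ W → holFun I M V →ₐ[ℂ] B V)
    (hψ : ∀ (V' V : Opens M) (h : V' ≤ V) (hV : V ≤ W) (f : holFun I M V),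
      ψ V' (h.trans hV) (holRes I h f) = r h (ψ V hV f))
    (hψc : ∀ (V : Opens M) (hV : V ≤ W) (f : holFun I M V) (a : B V),
      ψ V hV f * a = a * ψ V hV f)
    (Δ : ∀ V : Opens M, V ≤ W → ι → B V)
    (hΔ : ∀ (V' V : Opens M) (h : V' ≤ V) (hV : V ≤ W) (i : ι), Δ V' (h.trans hV) i =
      r h (Δ V hV i))
    (hΔc : ∀ (V : Opens M) (hV : V ≤ W) (i : ι) (a : B V), Δ V hV i * a = a * Δ V hV i)
    (N : ℕ) (hN : ∀ (V : Opens M) (hV : V ≤ W) (i : ι), Δ V hV i ^ N = 0)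
    (ϑ : ∀ V : Opens M, V ≤ W → F →ₗ[ℂ] B V)
    (hϑ : ∀ (V' V : Opens M) (h : V' ≤ V) (hV : V ≤ W) (v : F), ϑ V' (h.trans hV) v =
      r h (ϑ V hV v))
    (hϑsq : ∀ (V : Opens M) (hV : V ≤ W) (v : F), ϑ V hV v * ϑ V hV v = 0) :
    ∃ Φ : ∀ V : Opens M, V ≤ W → exteriorSections I F E V →ₐ[ℂ] B V,
      (∀ (V' V : Opens M) (h : V' ≤ V) (hV : V ≤ W) (f : exteriorSections I F E V),
        Φ V' (h.trans hV) (exteriorRes I F E h f) = r h (Φ V hV f)) ∧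
      (∀ (V : Opens M) (hV : V ≤ W) (i : ι), Φ V hV (coordSec I F E b (hV.trans hW) i) =
        ψ V hV (coordHol I b ((hV.trans hW).trans bundleDom_le_chartDom) i) + Δ V hV i) ∧
      (∀ (V : Opens M) (hV : V ≤ W) (v : F), Φ V hV (frameSec I (hV.trans hW) v) = ϑ V hV v) := by
  -- The coordinates are displaced one at a time.
  have step : ∀ s : Finset ι, ∃ Ψ : ∀ V : Opens M, V ≤ W → holFun I M V →ₐ[ℂ] B V,
      (∀ (V' V : Opens M) (h : V' ≤ V) (hV : V ≤ W) (f : holFun I M V),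
        Ψ V' (h.trans hV) (holRes I h f) = r h (Ψ V hV f)) ∧
      (∀ (V : Opens M) (hV : V ≤ W) (f : holFun I M V) (a : B V),
        Ψ V hV f * a = a * Ψ V hV f) ∧
      (∀ (V : Opens M) (hV : V ≤ W) (i : ι),
        Ψ V hV (coordHol I b ((hV.trans hW).trans bundleDom_le_chartDom) i) =
        ψ V hV (coordHol I b ((hV.trans hW).trans bundleDom_le_chartDom) i) +
          if i ∈ s then Δ V hV i else 0) := by
    intro s
    induction s using Finset.induction_on with
    | empty => exact ⟨ψ, hψ, hψc, fun V hV i => by simp⟩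
    | insert m s hm ih =>
      obtain ⟨Ψ, h1, h2, h3⟩ := ih
      have hd : ∀ V, V ≤ W → V ≤ chartDom H w := fun V hV =>
          (hV.trans hW).trans bundleDom_le_chartDom
      refine ⟨fun V hV => taylorHom (dirDeriv w (b m) (hd V hV)) (dirDeriv_mul (b m) (hd V hV))
        (Ψ V hV) (Δ V hV m) (hΔc V hV m) (N + 1)
        (by rw [pow_succ, hN, zero_mul]) (Nat.succ_pos _), ?_, ?_, ?_⟩
      · intro V' V h hV f
        rw [taylorHom_apply, taylorHom_apply, map_sum]
        refine Finset.sum_congr rfl fun n hn => ?_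
        clear hn
        have : (dirDeriv w (b m) (hd V' (h.trans hV)) ^ n) (holRes I h f) =
            holRes I h ((dirDeriv w (b m) (hd V hV) ^ n) f) := by
          induction n with
          | zero => rfl
          | succ n ih =>
            rw [pow_succ', Module.End.mul_apply, ih, pow_succ', Module.End.mul_apply]
            exact dirDeriv_res (b m) h (hd V hV) _
        rw [this, h1, hΔ V' V h hV, map_smul, map_mul, map_pow]
      · intro V hV f a
        rw [taylorHom_apply, Finset.sum_mul, Finset.mul_sum]
        refine Finset.sum_congr rfl fun n _ => ?_
        have hp : Δ V hV m ^ n * a = a * Δ V hV m ^ n :=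
          (show Commute (Δ V hV m) a from hΔc V hV m a).pow_left n
        rw [smul_mul_assoc, mul_smul_comm, mul_assoc, hp, ← mul_assoc, h2, mul_assoc]
      · intro V hV i
        refine (taylorHom_apply_of_const _ _ _ _ _ _ _ _ _ _
          (dirDeriv_coordFun b m i (hd V hV))).trans ?_
        change Ψ V hV (coordHol I b (hd V hV) i) + _ = _
        rw [h3, add_assoc]
        congr 1
        rw [Module.Basis.repr_self, Finsupp.single_apply]
        by_cases him : m = i
        · subst him
          simp [hm]
        · rw [if_neg him, zero_smul, add_zero]
          simp [Finset.mem_insert, Ne.symm him]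
  obtain ⟨Ψ, h1, h2, h3⟩ := step Finset.univ
  have ht : ∀ V, V ≤ W → V ≤ trivDom F E w := fun V hV => (hV.trans hW).trans bundleDom_le_trivDom
  let u := Module.finBasis ℂ (ExteriorAlgebra ℂ F)
  let Θ : ∀ V : Opens M, V ≤ W → ExteriorAlgebra ℂ F →ₐ[ℂ] B V := fun V hV =>
    ExteriorAlgebra.lift ℂ ⟨ϑ V hV, hϑsq V hV⟩
  let Φ₀ : ∀ V : Opens M, V ≤ W → exteriorSections I F E V →ₗ[ℂ] B V := fun V hV =>
    ∑ m, (LinearMap.mulRight ℂ (Θ V hV (u m))) ∘ₗ (Ψ V hV).toLinearMap ∘ₗ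
      coeffSec w (ht V hV) (u.coord m)
  have Φ₀_apply : ∀ V hV f, Φ₀ V hV f =
      ∑ m, Ψ V hV (coeffSec w (ht V hV) (u.coord m) f) * Θ V hV (u m) := fun V hV f => by
    simp only [Φ₀, LinearMap.sum_apply]
    rfl
  have key : ∀ V hV h v, Φ₀ V hV (scalarSec I F E V h * constSec I w (ht V hV) v) =
      Ψ V hV h * Θ V hV v := fun V hV h v => by
    rw [Φ₀_apply]
    conv_rhs => rw [← u.sum_repr v, map_sum, Finset.mul_sum]
    refine Finset.sum_congr rfl fun m _ => ?_
    rw [coeffSec_scalarSec_mul_constSec, map_smul, map_smul, smul_mul_assoc, mul_smul_comm]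
    rfl
  have hone : ∀ V hV, Φ₀ V hV 1 = 1 := fun V hV => by
    have := key V hV 1 1
    rwa [map_one, map_one, map_one, map_one, mul_one, mul_one] at this
  have hmul : ∀ V hV f g, Φ₀ V hV (f * g) = Φ₀ V hV f * Φ₀ V hV g := fun V hV f g => by
    have hf := eq_sum_scalarSec_mul_constSec_basis (ht V hV) u f
    have hg := eq_sum_scalarSec_mul_constSec_basis (ht V hV) u g
    conv_lhs => rw [hf, hg, Finset.sum_mul_sum, map_sum]
    rw [Φ₀_apply, Φ₀_apply, Finset.sum_mul_sum]
    refine Finset.sum_congr rfl fun i _ => ?_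
    rw [map_sum]
    refine Finset.sum_congr rfl fun j _ => ?_
    rw [mul_assoc, ← mul_assoc (constSec I w (ht V hV) (u i)), ← scalarSec_mul_comm, mul_assoc,
      ← mul_assoc, ← map_mul, ← map_mul, key, map_mul, map_mul, mul_assoc, mul_assoc,
      ← mul_assoc (Θ V hV (u i)), ← h2, mul_assoc]
  refine ⟨fun V hV => AlgHom.ofLinearMap (Φ₀ V hV) (hone V hV) (hmul V hV), ?_, ?_, ?_⟩
  · intro V' V h hV f
    change Φ₀ V' _ _ = r h (Φ₀ V hV f)
    rw [Φ₀_apply, Φ₀_apply, map_sum]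
    refine Finset.sum_congr rfl fun m _ => ?_
    have hΘ : Θ V' (h.trans hV) = (r h).comp (Θ V hV) := by
      ext v
      simp [Θ, hϑ V' V h hV]
    rw [hΘ, map_mul, ← h1 V' V h hV]
    rfl
  · intro V hV i
    change Φ₀ V hV _ = _
    have := key V hV (coordHol I b ((hV.trans hW).trans bundleDom_le_chartDom) i) 1
    rw [map_one, map_one, mul_one, mul_one] at this
    refine this.trans ?_
    rw [h3, if_pos (Finset.mem_univ _)]
  · intro V hV v
    change Φ₀ V hV _ = _
    have := key V hV 1 (ExteriorAlgebra.ι ℂ v)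
    rw [map_one, map_one, one_mul, one_mul] at this
    refine this.trans ?_
    simp [Θ]

end LocalCoordinates

/-! ### Twisted derivations and uniqueness -/

section Uniqueness

variable {A : Type u} [NormedAddCommGroup A] [NormedSpace ℂ A] [FiniteDimensional ℂ A]
  {H : Type u} [TopologicalSpace H] {I : ModelWithCorners ℂ A H} [I.Boundaryless]
  {M : Type u} [TopologicalSpace M] [ChartedSpace H M] [IsManifold I ω M]
  {F : Type u} [NormedAddCommGroup F] [NormedSpace ℂ F] [FiniteDimensional ℂ F]
  {E : M → Type u} [∀ x, AddCommGroup (E x)] [∀ x, Module ℂ (E x)]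
  [TopologicalSpace (TotalSpace F E)] [∀ x, TopologicalSpace (E x)] [FiberBundle F E]
  [VectorBundle ℂ F E] [ContMDiffVectorBundle ω F E I]
  {w : M}

/-- A twisted derivation from the germs of sections at `m` to an exterior algebra takes values in
degrees at least `t` if it does so on the coordinates. -/
theorem twistedDer_mem_extFil {ι κ : Type*} [Fintype ι] [Fintype κ] (b : Module.Basis ι ℂ A)
    (bF : Module.Basis κ ℂ F) {W : Opens M} (hW : W ≤ bundleDom H F E w) {m : M}
    {X : Type*} [AddCommGroup X] [Module ℂ X]
    (D : ∀ V : Opens M, V ≤ W → m ∈ V → exteriorSections I F E V →ₗ[ℂ] ExteriorAlgebra ℂ X)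
    (hDres : ∀ (V' V : Opens M) (h : V' ≤ V) (hV : V ≤ W) (hm : m ∈ V')
      (f : exteriorSections I F E V),
      D V' (h.trans hV) hm (exteriorRes I F E h f) = D V hV (h hm) f)
    (Φ Φ' : ∀ V : Opens M, V ≤ W → m ∈ V → exteriorSections I F E V → ExteriorAlgebra ℂ X)
    (hD : ∀ (V : Opens M) (hV : V ≤ W) (hm : m ∈ V) (f g : exteriorSections I F E V),
      D V hV hm (f * g) = D V hV hm f * Φ V hV hm g + Φ' V hV hm f * D V hV hm g)
    (hD1 : ∀ (V : Opens M) (hV : V ≤ W) (hm : m ∈ V), D V hV hm 1 = 0) (t : ℕ)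
    (hx : ∀ (V : Opens M) (hV : V ≤ W) (hm : m ∈ V) (i : ι),
      D V hV hm (coordSec I F E b (hV.trans hW) i) ∈ extFil X t)
    (hx' : ∀ (V : Opens M) (hV : V ≤ W) (hm : m ∈ V) (i : ι),
      Φ' V hV hm (coordSec I F E b (hV.trans hW) i - algebraMap ℂ _ (coordFun I w b i m)) ∈
        extFil X 1)
    (hθ : ∀ (V : Opens M) (hV : V ≤ W) (hm : m ∈ V) (j : κ),
      D V hV hm (frameSec I (hV.trans hW) (bF j)) ∈ extFil X t)
    (hθ' : ∀ (V : Opens M) (hV : V ≤ W) (hm : m ∈ V) (j : κ),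
      Φ' V hV hm (frameSec I (hV.trans hW) (bF j)) ∈ extFil X 1)
    (V : Opens M) (hV : V ≤ W) (hm : m ∈ V) (f : exteriorSections I F E V) :
    D V hV hm f ∈ extFil X t := by
  suffices H : ∀ n ≤ t, ∀ (V : Opens M) (hV : V ≤ W) (hm : m ∈ V) (f : exteriorSections I F E V),
      D V hV hm f ∈ extFil X n from H t le_rfl V hV hm f
  intro n
  induction n with
  | zero => intro _ V hV hm f; exact mem_extFil_zero _
  | succ n ih =>
    intro hn V hV hm f
    obtain ⟨W', h, c, g, g', hmW, e⟩ := exists_hadamard_sec b bF (hV.trans hW) f ⟨m, hm⟩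
    have hc : ∀ c : ℂ, D W' (h.trans hV) hmW (algebraMap ℂ _ c) = 0 := fun c => by
      rw [Algebra.algebraMap_eq_smul_one, map_smul, hD1, smul_zero]
    rw [← hDres W' V h hV hmW, e, map_add, map_add, hc, zero_add, map_sum, map_sum]
    refine add_mem (sum_mem fun i _ => ?_) (sum_mem fun j _ => ?_)
    · rw [hD, map_sub, hc, sub_zero]
      refine add_mem (mul_mem_extFil_left (extFil_antitone hn (hx W' (h.trans hV) hmW i)) _) ?_
      rw [add_comm]
      exact mul_mem_extFil (hx' W' (h.trans hV) hmW i) (ih (by omega) _ _ _ _)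
    · rw [hD]
      refine add_mem (mul_mem_extFil_left (extFil_antitone hn (hθ W' (h.trans hV) hmW j)) _) ?_
      rw [add_comm]
      exact mul_mem_extFil (hθ' W' (h.trans hV) hmW j) (ih (by omega) _ _ _ _)

/-- A twisted derivation of the sheaf of sections which raises the degree of the even coordinates by
`t` and that of the odd coordinates by `t` raises all degrees by `t`. -/
theorem twistedDer_raises {ι κ : Type*} [Fintype ι] [Fintype κ] (b : Module.Basis ι ℂ A)
    (bF : Module.Basis κ ℂ F) {W : Opens M} (hW : W ≤ bundleDom H F E w)
    (D : ∀ V : Opens M, V ≤ W → exteriorSections I F E V →ₗ[ℂ] exteriorSections I F E V)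
    (hDres : ∀ (V' V : Opens M) (h : V' ≤ V) (hV : V ≤ W) (f : exteriorSections I F E V),
      D V' (h.trans hV) (exteriorRes I F E h f) = exteriorRes I F E h (D V hV f))
    (Φ' : ∀ V : Opens M, V ≤ W → exteriorSections I F E V → exteriorSections I F E V)
    (hD : ∀ (V : Opens M) (hV : V ≤ W) (f g : exteriorSections I F E V),
      D V hV (f * g) = D V hV f * g + Φ' V hV f * D V hV g)
    (t : ℕ)
    (hx : ∀ (V : Opens M) (hV : V ≤ W) (i : ι) (x : V),
      (D V hV (coordSec I F E b (hV.trans hW) i)).1 x ∈ extFil (E x) t)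
    (hx' : ∀ (V : Opens M) (hV : V ≤ W) (i : ι) (x : V),
      (Φ' V hV (coordSec I F E b (hV.trans hW) i -
        algebraMap ℂ _ (coordFun I w b i x))).1 x ∈ extFil (E x) 1)
    (hθ : ∀ (V : Opens M) (hV : V ≤ W) (j : κ) (x : V),
      (D V hV (frameSec I (hV.trans hW) (bF j))).1 x ∈ extFil (E x) (t + 1))
    (hθ' : ∀ (V : Opens M) (hV : V ≤ W) (j : κ) (x : V),
      (Φ' V hV (frameSec I (hV.trans hW) (bF j))).1 x ∈ extFil (E x) 1)
    (hD1 : ∀ (V : Opens M) (hV : V ≤ W), D V hV 1 = 0)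
    {V : Opens M} (hV : V ≤ W) (k : ℕ) (f : exteriorSections I F E V)
    (hf : ∀ x : V, f.1 x ∈ extFil (E x) k) (x : V) : (D V hV f).1 x ∈ extFil (E x) (k + t) := by
  induction k generalizing f with
  | zero =>
    rw [zero_add]
    exact twistedDer_mem_extFil b bF hW (m := x.1) (X := E x)
      (fun V hV hm => (LinearMap.proj (R := ℂ) (φ := fun x : V => ExteriorAlgebra ℂ (E x))
        ⟨x.1, hm⟩) ∘ₗ (Subalgebra.toSubmodule (exteriorSections I F E V)).subtype ∘ₗ D V hV)
      (fun V' V h hV hm f => congrFun (congrArg Subtype.val (hDres V' V h hV f)) ⟨x.1, hm⟩)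
      (fun V hV hm g => g.1 ⟨x.1, hm⟩) (fun V hV hm g => (Φ' V hV g).1 ⟨x.1, hm⟩)
      (fun V hV hm f g => congrFun (congrArg Subtype.val (hD V hV f g)) ⟨x.1, hm⟩)
      (fun V hV hm => congrFun (congrArg Subtype.val (hD1 V hV)) ⟨x.1, hm⟩) t
      (fun V hV hm i => hx V hV i ⟨x.1, hm⟩)
      (fun V hV hm i => hx' V hV i ⟨x.1, hm⟩)
      (fun V hV hm j => extFil_antitone (Nat.le_succ t) (hθ V hV j ⟨x.1, hm⟩))
      (fun V hV hm j => hθ' V hV j ⟨x.1, hm⟩) V hV x.2 f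
  | succ k ih =>
    obtain ⟨g, hg, rfl⟩ := exists_eq_sum_frameSec_mul bF (hV.trans hW) f hf
    rw [map_sum]
    simp only [AddSubmonoidClass.coe_finsetSum, Finset.sum_apply]
    refine sum_mem fun j _ => ?_
    rw [hD]
    change (D V hV (frameSec I (hV.trans hW) (bF j))).1 x * (g j).1 x +
      (Φ' V hV (frameSec I (hV.trans hW) (bF j))).1 x * (D V hV (g j)).1 x ∈ _
    refine add_mem ?_ ?_
    · have := mul_mem_extFil (hθ V hV j x) (hg j x)
      convert this using 2
      omega
    · have := mul_mem_extFil (hθ' V hV j x) (ih (g j) (hg j))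
      convert this using 2
      omega

end Uniqueness

/-! ### Pullback of sections -/

section Pullback

variable {A : Type u} [NormedAddCommGroup A] [NormedSpace ℂ A]
  {H : Type u} [TopologicalSpace H] {I : ModelWithCorners ℂ A H}
  {M : Type u} [TopologicalSpace M] [ChartedSpace H M]
  {F : Type u} [NormedAddCommGroup F] [NormedSpace ℂ F]
  {E : M → Type u} [∀ x, AddCommGroup (E x)] [∀ x, Module ℂ (E x)]
  [TopologicalSpace (TotalSpace F E)] [∀ x, TopologicalSpace (E x)] [FiberBundle F E]
  {A' : Type u} [NormedAddCommGroup A'] [NormedSpace ℂ A']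
  {H' : Type u} [TopologicalSpace H'] {I' : ModelWithCorners ℂ A' H'}
  {M' : Type u} [TopologicalSpace M'] [ChartedSpace H' M']
  {F' : Type u} [NormedAddCommGroup F'] [NormedSpace ℂ F']
  {E' : M' → Type u} [∀ x, AddCommGroup (E' x)] [∀ x, Module ℂ (E' x)]
  [TopologicalSpace (TotalSpace F' E')] [∀ x, TopologicalSpace (E' x)] [FiberBundle F' E']

variable (I F E I' F' E') in
/-- A map from holomorphic sections of `E → M` to holomorphic sections of `E' → M'` over a
holomorphic map `φ : M' → M`, given by linear maps from the fibres `E (φ y)` to `E' y`. -/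
structure BundlePull (φ : C(M', M)) where
  lin : ∀ y, E (φ y) →ₗ[ℂ] E' y
  contMDiff : ContMDiff I' I ω φ
  contMDiffOn : ∀ (U : Opens M) (e : ∀ x, E x),
    ContMDiffOn I (I.prod 𝓘(ℂ, F)) ω (fun x => TotalSpace.mk' F x (e x)) U →
    ContMDiffOn I' (I'.prod 𝓘(ℂ, F')) ω (fun y => TotalSpace.mk' F' y (lin y (e (φ y))))
      (Opens.comap φ U)

namespace BundlePull

variable {φ : C(M', M)} (P : BundlePull I F E I' F' E' φ)

/-- Pullback of arbitrary sections. -/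
def fn (V : Opens M) (V' : Opens M') (h : V' ≤ Opens.comap φ V) :
    (∀ x : V, ExteriorAlgebra ℂ (E x)) →ₐ[ℂ] (∀ y : V', ExteriorAlgebra ℂ (E' y)) :=
  AlgHom.pi fun y => (ExteriorAlgebra.map (P.lin y)).comp
    (Pi.evalAlgHom ℂ (fun x : V => ExteriorAlgebra ℂ (E x)) ⟨φ y, h y.2⟩)

theorem fn_mem {V : Opens M} {V' : Opens M'} (h : V' ≤ Opens.comap φ V)
    {s : ∀ x : V, ExteriorAlgebra ℂ (E x)} (hs : s ∈ exteriorSections I F E V) :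
    P.fn V V' h s ∈ exteriorSections I' F' E' V' := by
  have key : P.fn V (Opens.comap φ V) le_rfl s ∈ exteriorSections I' F' E' (Opens.comap φ V) := by
    refine exteriorSections_le (U := V) (fun U =>
      (exteriorSections I' F' E' (Opens.comap φ U)).comap (P.fn U (Opens.comap φ U) le_rfl))
      ?_ ?_ ?_ hs
    · intro s hs
      refine mem_exteriorSections_of_locally fun y hy => ?_
      obtain ⟨W, hW, hyW, h⟩ := hs (φ y) hy
      exact ⟨Opens.comap φ W, Opens.comap_mono φ hW, hyW, h⟩
    · intro U _ f hf
      have h1 : ContMDiffOn I' 𝓘(ℂ, ℂ) ω (f ∘ φ) (Opens.comap φ U) :=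
        hf.comp P.contMDiff.contMDiffOn fun y hy => hy
      have h2 := algebraMap_mem_exteriorSections (F := F') (E := E') h1
      refine (Subalgebra.mem_comap _ _ _).2 ?_
      convert h2 using 1
      ext y
      exact AlgHom.commutes (ExteriorAlgebra.map (P.lin y.1)) _
    · intro U _ e he
      have h2 := ι_mem_exteriorSections (P.contMDiffOn U e he)
      refine (Subalgebra.mem_comap _ _ _).2 ?_
      convert h2 using 1
      ext y
      exact ExteriorAlgebra.map_apply_ι _ _
  exact (exteriorRes I' F' E' h ⟨_, key⟩).2

/-- Pullback of holomorphic sections of the exterior algebra bundle. -/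
def sec {V : Opens M} {V' : Opens M'} (h : V' ≤ Opens.comap φ V) :
    exteriorSections I F E V →ₐ[ℂ] exteriorSections I' F' E' V' :=
  ((P.fn V V' h).comp (exteriorSections I F E V).val).codRestrict _ fun s => P.fn_mem h s.2

end BundlePull

end Pullback

section Involution

variable {A : Type u} [NormedAddCommGroup A] [NormedSpace ℂ A]
  {H : Type u} [TopologicalSpace H] {I : ModelWithCorners ℂ A H}
  {M : Type u} [TopologicalSpace M] [ChartedSpace H M]
  {F : Type u} [NormedAddCommGroup F] [NormedSpace ℂ F]
  {E : M → Type u} [∀ x, AddCommGroup (E x)] [∀ x, Module ℂ (E x)]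
  [TopologicalSpace (TotalSpace F E)] [∀ x, TopologicalSpace (E x)] [FiberBundle F E]

theorem inv_mem_exteriorSections {V : Opens M} {s : ∀ x : V, ExteriorAlgebra ℂ (E x)}
    (hs : s ∈ exteriorSections I F E V) :
    (fun x => inv (s x)) ∈ exteriorSections I F E V := by
  let T : ∀ U : Opens M, (∀ x : U, ExteriorAlgebra ℂ (E x)) →ₐ[ℂ]
      (∀ x : U, ExteriorAlgebra ℂ (E x)) := fun U => AlgHom.pi fun x => inv.comp
        (Pi.evalAlgHom ℂ (fun x : U => ExteriorAlgebra ℂ (E x)) x)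
  refine exteriorSections_le (U := V) (fun U => (exteriorSections I F E U).comap (T U)) ?_ ?_ ?_ hs
  · intro s hs
    refine mem_exteriorSections_of_locally fun y hy => ?_
    obtain ⟨W, hW, hyW, h⟩ := hs y hy
    exact ⟨W, hW, hyW, h⟩
  · intro U _ f hf
    refine (Subalgebra.mem_comap _ _ _).2 ?_
    convert algebraMap_mem_exteriorSections (F := F) (E := E) hf using 1
    ext x
    exact AlgHom.commutes inv _
  · intro U _ e he
    refine (Subalgebra.mem_comap _ _ _).2 ?_
    convert neg_mem (ι_mem_exteriorSections he) using 1
    ext x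
    exact inv_ι _

variable (I F E) in
/-- The grade involution of sections. -/
def invSec (V : Opens M) : exteriorSections I F E V →ₐ[ℂ] exteriorSections I F E V :=
  ((AlgHom.pi fun x => inv.comp
    (Pi.evalAlgHom ℂ (fun x : V => ExteriorAlgebra ℂ (E x)) x)).comp
      (exteriorSections I F E V).val).codRestrict _ fun s => inv_mem_exteriorSections s.2

end Involution

section Filtration

variable {A : Type u} [NormedAddCommGroup A] [NormedSpace ℂ A] [FiniteDimensional ℂ A]
  {H : Type u} [TopologicalSpace H] {I : ModelWithCorners ℂ A H} [I.Boundaryless]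
  {M : Type u} [TopologicalSpace M] [ChartedSpace H M] [IsManifold I ω M]
  {F : Type u} [NormedAddCommGroup F] [NormedSpace ℂ F] [FiniteDimensional ℂ F]
  {E : M → Type u} [∀ x, AddCommGroup (E x)] [∀ x, Module ℂ (E x)]
  [TopologicalSpace (TotalSpace F E)] [∀ x, TopologicalSpace (E x)] [FiberBundle F E]
  [VectorBundle ℂ F E] [ContMDiffVectorBundle ω F E I]

variable (F) in
include F in
omit [FiniteDimensional ℂ A] [I.Boundaryless] [IsManifold I ω M]
  [ContMDiffVectorBundle ω F E I] in
theorem finite_fibre (x : M) : Module.Finite ℂ (E x) := by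
  have hx : x ∈ trivDom F E x := mem_baseSet_trivializationAt F E x
  have : Function.Surjective (trivSymm F E x x) := fun v =>
    ⟨triv F E x x v, LinearMap.congr_fun (trivSymm_comp_triv hx) v⟩
  exact Module.Finite.of_surjective _ this

theorem mem_bundleDom (x : M) : x ∈ bundleDom H F E x :=
  ⟨mem_chart_source H x, mem_baseSet_trivializationAt F E x⟩

variable (F) in
omit [FiniteDimensional ℂ A] [I.Boundaryless] [IsManifold I ω M]
  [ContMDiffVectorBundle ω F E I] in
theorem extFil_fibre_eq_bot (x : M) : extFil (E x) (Module.finrank ℂ F + 1) = ⊥ := by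
  have hfin := finite_fibre F (E := E) x
  have hx : x ∈ trivDom F E x := mem_baseSet_trivializationAt F E x
  refine extFil_eq_bot (Nat.lt_succ_of_le
    (LinearMap.finrank_le_finrank_of_injective (f := triv F E x x) ?_))
  exact Function.LeftInverse.injective (g := trivSymm F E x x)
    fun v => LinearMap.congr_fun (trivSymm_comp_triv hx) v

theorem isNilpotent_of_mem_extFil {V : Opens M} (f : exteriorSections I F E V)
    (hf : ∀ x : V, f.1 x ∈ extFil (E x) 1) : f ^ (Module.finrank ℂ F + 1) = 0 := by
  ext x
  have : ∀ n, f.1 x ^ n ∈ extFil (E x) n := fun n => by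
    induction n with
    | zero => exact mem_extFil_zero _
    | succ n ih => rw [pow_succ]; exact mul_mem_extFil ih (hf x)
  have h := this (Module.finrank ℂ F + 1)
  rw [extFil_fibre_eq_bot F, Submodule.mem_bot] at h
  exact h

theorem mem_extFil_one_of_isNilpotent {V : Opens M} {f : exteriorSections I F E V}
    (hf : IsNilpotent f) (x : V) : f.1 x ∈ extFil (E x) 1 := by
  rw [mem_extFil_one]
  obtain ⟨n, hn⟩ := hf
  have h1 : f.1 x ^ n = 0 := congrFun (congrArg Subtype.val hn) x
  have h2 := congrArg ExteriorAlgebra.algebraMapInv h1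
  rw [map_pow, map_zero] at h2
  exact eq_zero_of_pow_eq_zero h2

/-- The filtration of the sheaf of sections of the exterior algebra bundle is the filtration by the
degree. -/
theorem mem_filtration_iff {k : ℕ} {V : Opens M} (f : exteriorSections I F E V) :
    (show (exteriorSheaf I F E).Sec V from f) ∈ (exteriorSheaf I F E).filtration k V ↔
      ∀ x : V, f.1 x ∈ extFil (E x) k := by
  constructor
  · intro hf x
    obtain ⟨W, hW, hxW, h⟩ := hf x.1 x.2
    have key : ∀ g : (exteriorSheaf I F E).Sec W,
        g ∈ Ideal.span {g : (exteriorSheaf I F E).Sec W |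
          ∃ n : Fin k → (exteriorSheaf I F E).Sec W, (∀ i, IsNilpotent (n i)) ∧
            g = (List.ofFn n).prod} →
        (show exteriorSections I F E W from g).1 ⟨x.1, hxW⟩ ∈ extFil (E x) k := by
      intro g hg
      induction hg using Submodule.span_induction with
      | mem g hg =>
        obtain ⟨n, hn, rfl⟩ := hg
        clear h hf
        induction k with
        | zero => exact mem_extFil_zero _
        | succ k ih =>
          rw [List.ofFn_succ, List.prod_cons]
          have h1 := mem_extFil_one_of_isNilpotent (f := (n 0 : exteriorSections I F E W)) (hn 0)
            ⟨x.1, hxW⟩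
          have h2 := mul_mem_extFil h1 (ih (fun i => n i.succ) fun i => hn _)
          rw [add_comm] at h2
          exact h2
      | zero => exact zero_mem _
      | add a b _ _ ha hb => exact add_mem ha hb
      | smul a b _ hb => exact mul_mem_extFil_right hb _
    exact key _ h
  · intro hf x hx
    let W := V ⊓ bundleDom H F E x
    have hW : W ≤ bundleDom H F E x := inf_le_right
    refine ⟨W, inf_le_left, ⟨hx, mem_bundleDom x⟩, ?_⟩
    have key : ∀ (k : ℕ) (g : exteriorSections I F E W), (∀ y : W, g.1 y ∈ extFil (E y) k) →
        (show (exteriorSheaf I F E).Sec W from g) ∈ Ideal.span {g : (exteriorSheaf I F E).Sec W |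
          ∃ n : Fin k → (exteriorSheaf I F E).Sec W, (∀ i, IsNilpotent (n i)) ∧
            g = (List.ofFn n).prod} := by
      intro k
      induction k with
      | zero =>
        intro g _
        have : (Ideal.span {g : (exteriorSheaf I F E).Sec W |
          ∃ n : Fin 0 → (exteriorSheaf I F E).Sec W, (∀ i, IsNilpotent (n i)) ∧
            g = (List.ofFn n).prod}) = ⊤ := by
          rw [Ideal.eq_top_iff_one]
          exact Ideal.subset_span ⟨fun _ => 0, fun i => i.elim0, by simp⟩
        rw [this]
        trivial
      | succ k ih =>
        intro g hg
        obtain ⟨a, ha, rfl⟩ := exists_eq_sum_frameSec_mul (Module.finBasis ℂ F) hW g hg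
        refine sum_mem fun j _ => ?_
        suffices H : ∀ c : (exteriorSheaf I F E).Sec W,
            c ∈ Ideal.span {g : (exteriorSheaf I F E).Sec W |
              ∃ n : Fin k → (exteriorSheaf I F E).Sec W, (∀ i, IsNilpotent (n i)) ∧
                g = (List.ofFn n).prod} →
            (show (exteriorSheaf I F E).Sec W from frameSec I hW (Module.finBasis ℂ F j)) * c ∈
              Ideal.span {g : (exteriorSheaf I F E).Sec W |
              ∃ n : Fin (k + 1) → (exteriorSheaf I F E).Sec W, (∀ i, IsNilpotent (n i)) ∧
                g = (List.ofFn n).prod} from H _ (ih (a j) (ha j))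
        intro c h1
        clear ih ha hg a
        set θ := frameSec I hW (Module.finBasis ℂ F j) with hθ
        have hθf : ∀ y : W, θ.1 y ∈ extFil (E y) 1 := fun y =>
          map_mem_extFil _ (ι_mem_extFil_one _)
        have hcomm : ∀ c : exteriorSections I F E W, θ * c = invSec I F E W c * θ := fun c => by
          ext y
          change ExteriorAlgebra.map (trivSymm F E x y) (ExteriorAlgebra.ι ℂ _) * c.1 y =
            inv (c.1 y) * ExteriorAlgebra.map (trivSymm F E x y) (ExteriorAlgebra.ι ℂ _)
          rw [ExteriorAlgebra.map_apply_ι]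
          exact ι_mul_of_mem_parity _ _
        induction h1 using Submodule.span_induction with
        | mem g hg =>
          obtain ⟨n, hn, rfl⟩ := hg
          refine Ideal.subset_span ⟨Fin.cons (show (exteriorSheaf I F E).Sec W from θ) n,
            fun i => ?_, ?_⟩
          · refine Fin.cases ?_ (fun i => ?_) i
            · exact ⟨_, isNilpotent_of_mem_extFil θ hθf⟩
            · exact hn i
          · rw [List.ofFn_succ, List.prod_cons]
            rfl
        | zero => rw [mul_zero]; exact zero_mem _
        | add a b _ _ ha hb => rw [mul_add]; exact add_mem ha hb
        | smul a b _ hb =>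
          have h2 : θ * (show exteriorSections I F E W from a) =
            invSec I F E W a * θ := hcomm a
          have : (show (exteriorSheaf I F E).Sec W from θ) * (a • b) =
              (show (exteriorSheaf I F E).Sec W from invSec I F E W a) *
                ((show (exteriorSheaf I F E).Sec W from θ) * b) := by
            rw [smul_eq_mul, ← mul_assoc, ← mul_assoc]
            exact congrArg (fun z : (exteriorSheaf I F E).Sec W => z * b) h2
          rw [this]
          exact Ideal.mul_mem_left _ _ hb
    exact key k _ fun y => hf ⟨y.1, y.2.1⟩

end Filtration

/-! ### Sheaf gluing for superalgebras -/

section Gluing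

variable {M : Type u} [TopologicalSpace M]

/-- A presheaf of algebras is a sheaf as soon as compatible families of sections glue uniquely. -/
theorem isSheaf_of_existsUnique_gluing {M : Type u} [TopologicalSpace M]
    (F : TopCat.Presheaf (AlgCat.{u} ℂ) (TopCat.of M))
    (h : ∀ (J : Type u) (U : J → Opens M) (sf : ∀ i, F.obj (op (U i))),
      (∀ i j, F.map (homOfLE (inf_le_left : U i ⊓ U j ≤ U i)).op (sf i) =
        F.map (homOfLE (inf_le_right : U i ⊓ U j ≤ U j)).op (sf j)) →
      ∃! s : F.obj (op (iSup U)), ∀ i, F.map (homOfLE (le_iSup U i)).op s = sf i) :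
    F.IsSheaf := by
  rw [TopCat.Presheaf.isSheaf_iff_isSheaf_comp (forget (AlgCat.{u} ℂ))]
  refine TopCat.Presheaf.isSheaf_of_isSheafUniqueGluing_types _ ?_
  intro J U sf hsf
  obtain ⟨s, hs, hu⟩ := h J U sf fun i j => hsf i j
  exact ⟨s, hs, fun t ht => hu t ht⟩

namespace SuperPresheaf

variable (O : SuperPresheaf M)

theorem res_res {W V U : Opens M} (h : W ≤ V) (h' : V ≤ U) (f : O.Sec U) :
    O.res h (O.res h' f) = O.res (h.trans h') f := by
  have h1 := O.alg.map_comp (homOfLE h').op (homOfLE h).op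
  exact (congrArg (fun z => z.hom f) h1).symm

theorem res_self {U : Opens M} (f : O.Sec U) : O.res le_rfl f = f := by
  have h1 := O.alg.map_id (op U)
  exact congrArg (fun z => z.hom f) h1

variable {O}

theorem eq_of_locally (hO : O.alg.IsSheaf) {U : Opens M} {f g : O.Sec U}
    (h : ∀ x ∈ U, ∃ (V : Opens M) (hV : V ≤ U), x ∈ V ∧ O.res hV f = O.res hV g) : f = g := by
  choose V hV hx e using h
  refine TopCat.Sheaf.eq_of_locally_eq' (C := AlgCat.{u} ℂ) ⟨O.alg, hO⟩
    (fun x : U => V x.1 x.2) U (fun x => homOfLE (hV x.1 x.2)) ?_ f g fun x => e x.1 x.2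
  intro x hxU
  exact Opens.mem_iSup.2 ⟨⟨x, hxU⟩, hx x hxU⟩

theorem exists_gluing (hO : O.alg.IsSheaf) {U : Opens M} (V : U → Opens M) (hV : ∀ x, V x ≤ U)
    (hx : ∀ x : U, x.1 ∈ V x) (f : ∀ x, O.Sec (V x))
    (hf : ∀ x y, O.res (inf_le_left : V x ⊓ V y ≤ V x) (f x) =
      O.res (inf_le_right : V x ⊓ V y ≤ V y) (f y)) :
    ∃ s : O.Sec U, ∀ x, O.res (hV x) s = f x := by
  obtain ⟨s, hs, -⟩ := TopCat.Sheaf.existsUnique_gluing' (C := AlgCat.{u} ℂ) ⟨O.alg, hO⟩ V U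
    (fun x => homOfLE (hV x)) (fun x hxU => Opens.mem_iSup.2 ⟨⟨x, hxU⟩, hx ⟨x, hxU⟩⟩) f
    (fun x y => hf x y)
  exact ⟨s, hs⟩

end SuperPresheaf

end Gluing

section Internal

variable {B : Type*} [AddCommGroup B] [Module ℂ B] {P : ZMod 2 → Submodule ℂ B}

theorem isInternal_iff_isCompl : DirectSum.IsInternal P ↔ IsCompl (P 0) (P 1) :=
  DirectSum.isInternal_submodule_iff_isCompl P (by decide) (by
    have h : ∀ q : ZMod 2, q = 0 ∨ q = 1 := by decide
    ext q
    simpa using h q)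

theorem exists_add_of_isInternal (hP : DirectSum.IsInternal P) (f : B) :
    ∃ a ∈ P 0, ∃ b ∈ P 1, f = a + b := by
  have h := (isInternal_iff_isCompl.1 hP).sup_eq_top
  obtain ⟨a, ha, b, hb, e⟩ := Submodule.mem_sup.1 (h ▸ (Submodule.mem_top : f ∈ ⊤))
  exact ⟨a, ha, b, hb, e.symm⟩

theorem exists_add_of_isInternal' (hP : DirectSum.IsInternal P) (q : ZMod 2) (f : B) :
    ∃ a ∈ P q, ∃ b ∈ P (q + 1), f = a + b := by
  obtain ⟨a, ha, b, hb, e⟩ := exists_add_of_isInternal hP f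
  fin_cases q
  · exact ⟨a, ha, b, hb, e⟩
  · exact ⟨b, hb, a, ha, e.trans (add_comm _ _)⟩

theorem eq_zero_of_isInternal (hP : DirectSum.IsInternal P) {q : ZMod 2} {f : B} (h : f ∈ P q)
    (h' : f ∈ P (q + 1)) : f = 0 := by
  have hd := (isInternal_iff_isCompl.1 hP).disjoint
  rw [Submodule.disjoint_def] at hd
  fin_cases q
  · exact hd f h h'
  · exact hd f h' h

/-- The eigenspaces of an involution of an algebra are the two parts of a grading. -/
theorem isInternal_of_involution (J : B →ₗ[ℂ] B) (hJ : ∀ x, J (J x) = x)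
    (hP : ∀ q x, x ∈ P q ↔ J x = (-1 : ℂ) ^ q.val • x) : DirectSum.IsInternal P := by
  have h0 : ∀ x, x ∈ P 0 ↔ J x = x := fun x => by simp [hP]
  have h1 : ∀ x, x ∈ P 1 ↔ J x = -x := fun x => by simp [hP, ZMod.val_one]
  rw [isInternal_iff_isCompl, isCompl_iff, Submodule.disjoint_def, codisjoint_iff,
    Submodule.eq_top_iff']
  refine ⟨fun x h h' => ?_, fun x => ?_⟩
  · rw [h0] at h
    rw [h1, h] at h'
    have : (2 : ℂ) • x = 0 := by rw [two_smul]; nth_rewrite 1 [h']; simp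
    simpa using this
  · refine Submodule.mem_sup.2 ⟨(2⁻¹ : ℂ) • (x + J x), ?_, (2⁻¹ : ℂ) • (x - J x), ?_, ?_⟩
    · rw [h0, map_smul, map_add, hJ, add_comm]
    · rw [h1, map_smul, map_sub, hJ, ← smul_neg, neg_sub]
    · rw [← smul_add, add_add_sub_cancel, ← two_smul ℂ, smul_smul]
      norm_num

end Internal

/-! ### Homomorphisms on germs -/

section Germs

/-- An algebra homomorphism on the germs at `m` of sections of `O`. -/
@[ext]
structure GermHom {M : Type u} [TopologicalSpace M] (O : SuperPresheaf M) (m : M) (R : Type*)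
    [Ring R] [Algebra ℂ R] where
  app : ∀ V : Opens M, m ∈ V → O.Sec V →ₐ[ℂ] R
  app_res : ∀ {V' V : Opens M} (h : V' ≤ V) (hm : m ∈ V') (f : O.Sec V),
    app V' hm (O.res h f) = app V (h hm) f

variable {M : Type u} [TopologicalSpace M]

namespace GermHom

variable {O : SuperPresheaf M} {m : M} {R : Type*} [Ring R] [Algebra ℂ R]

theorem ext' {h h' : GermHom O m R} (W : Opens M) (hm : m ∈ W)
    (e : ∀ (V : Opens M) (_ : V ≤ W) (hV : m ∈ V) (f : O.Sec V), h.app V hV f = h'.app V hV f) :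
    h = h' := by
  ext V hV f
  have hVW : m ∈ V ⊓ W := ⟨hV, hm⟩
  have := e (V ⊓ W) inf_le_right hVW (O.res inf_le_left f)
  rwa [app_res, app_res] at this

/-- Composition of a homomorphism on germs with a morphism of superalgebra sheaves. -/
def compMorphism {M' : Type u} [TopologicalSpace M'] {O' : SuperPresheaf M'} {φ : C(M, M')}
    (h : GermHom O m R) (p : SuperMorphism O O' φ) : GermHom O' (φ m) R where
  app W hm := (h.app (Opens.comap φ W) hm).comp (p.star W)
  app_res {V' V} hV hm f := by
    have := h.app_res (Opens.comap_mono φ hV) hm (p.star V f)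
    rw [← p.star_res hV] at this
    exact this

end GermHom

variable {E : M → Type u} [∀ x, AddCommGroup (E x)] [∀ x, Module ℂ (E x)]

/-- A homomorphism on germs of superfunctions with values in an exterior algebra is compatible with
a linear map `l` of the fibres if it preserves parity and induces `l` on the associated graded
algebras. -/
structure GermHom.Compat (S : SuperData E) {m : M} {X : Type*} [AddCommGroup X] [Module ℂ X]
    (h : GermHom S.toSuperPresheaf m (ExteriorAlgebra ℂ X)) (l : E m →ₗ[ℂ] X) : Prop where
  parity : ∀ (V : Opens M) (hm : m ∈ V) (q : ZMod 2) (f : S.Sec V), f ∈ S.parity V q →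
    h.app V hm f ∈ extParity X q
  body : ∀ (V : Opens M) (hm : m ∈ V) (f : S.Sec V),
    ExteriorAlgebra.algebraMapInv (h.app V hm f) = S.body V f ⟨m, hm⟩
  lin : ∀ (V : Opens M) (hm : m ∈ V) (f : S.Sec V),
    ExteriorAlgebra.ιInv (h.app V hm f) = l (S.lin V f ⟨m, hm⟩)

/-- A morphism of superalgebra sheaves which induces, on functions, the pullback along the
underlying map and, on sections of the bundles, the linear maps `l` of the fibres. -/
structure SuperMorphism.Compat {M' : Type u} [TopologicalSpace M'] {E' : M' → Type u}
    [∀ x, AddCommGroup (E' x)] [∀ x, Module ℂ (E' x)] (S : SuperData E) (S' : SuperData E')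
    {φ : C(M, M')} (p : SuperMorphism S.toSuperPresheaf S'.toSuperPresheaf φ)
    (l : ∀ x, E' (φ x) →ₗ[ℂ] E x) : Prop where
  body : ∀ (W : Opens M') (f : S'.Sec W) (x : Opens.comap φ W),
    S.body _ (p.star W f) x = S'.body W f ⟨φ x, x.2⟩
  lin : ∀ (W : Opens M') (f : S'.Sec W) (x : Opens.comap φ W),
    S.lin _ (p.star W f) x = l x (S'.lin W f ⟨φ x, x.2⟩)

theorem GermHom.Compat.compMorphism {M' : Type u} [TopologicalSpace M'] {E' : M' → Type u}
    [∀ x, AddCommGroup (E' x)] [∀ x, Module ℂ (E' x)] {S : SuperData E} {S' : SuperData E'}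
    {φ : C(M, M')} {p : SuperMorphism S.toSuperPresheaf S'.toSuperPresheaf φ}
    {l' : ∀ x, E' (φ x) →ₗ[ℂ] E x} (hp : p.Compat S S' l') {m : M} {X : Type*} [AddCommGroup X]
    [Module ℂ X] {h : GermHom S.toSuperPresheaf m (ExteriorAlgebra ℂ X)} {l : E m →ₗ[ℂ] X}
    (hh : h.Compat S l) : (h.compMorphism p).Compat S' (l ∘ₗ l' m) where
  parity V hm q f hf := hh.parity _ _ q _ (p.star_parity V q f hf)
  body V hm f := (hh.body _ _ _).trans (hp.body V f ⟨m, hm⟩)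
  lin V hm f := (hh.lin _ _ _).trans (congrArg l (hp.lin V f ⟨m, hm⟩))

end Germs

section Exterior

variable {A : Type u} [NormedAddCommGroup A] [NormedSpace ℂ A]
  {H : Type u} [TopologicalSpace H] {I : ModelWithCorners ℂ A H}
  {M : Type u} [TopologicalSpace M] [ChartedSpace H M]
  {F : Type u} [NormedAddCommGroup F] [NormedSpace ℂ F]
  {E : M → Type u} [∀ x, AddCommGroup (E x)] [∀ x, Module ℂ (E x)]
  [TopologicalSpace (TotalSpace F E)] [∀ x, TopologicalSpace (E x)] [FiberBundle F E]

variable (I F E) in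
/-- The split superfunctions: the holomorphic sections of the exterior algebra bundle. -/
def exteriorData : SuperData E where
  toSuperPresheaf := exteriorSheaf I F E
  body U := (AlgHom.pi fun x => ExteriorAlgebra.algebraMapInv.comp
    (Pi.evalAlgHom ℂ (fun x : U => ExteriorAlgebra ℂ (E x)) x)).comp (exteriorSections I F E U).val
  lin U := (LinearMap.pi fun x => ExteriorAlgebra.ιInv.comp
    (LinearMap.proj (R := ℂ) (φ := fun x : U => ExteriorAlgebra ℂ (E x)) x)).comp
      (exteriorSections I F E U).val.toLinearMap

theorem exteriorSheaf_res {V U : Opens M} (h : V ≤ U) (f : exteriorSections I F E U) :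
    (exteriorSheaf I F E).res h f = exteriorRes I F E h f := rfl

theorem exteriorSheaf_isSheaf : (exteriorSheaf I F E).alg.IsSheaf := by
  refine isSheaf_of_existsUnique_gluing _ fun J U sf hsf => ?_
  let sf' : ∀ i, exteriorSections I F E (U i) := sf
  have hsf' : ∀ i j (x : M) (hi : x ∈ U i) (hj : x ∈ U j), (sf' i).1 ⟨x, hi⟩ = (sf' j).1 ⟨x, hj⟩ :=
    fun i j x hi hj => congrFun (congrArg Subtype.val (show exteriorRes I F E _ (sf' i) =
      exteriorRes I F E _ (sf' j) from hsf i j)) ⟨x, hi, hj⟩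
  have hx : ∀ x : (iSup U : Opens M), ∃ i, x.1 ∈ U i := fun x => Opens.mem_iSup.1 x.2
  choose k hk using hx
  let s : ∀ x : (iSup U : Opens M), ExteriorAlgebra ℂ (E x) := fun x => (sf' (k x)).1 ⟨x.1, hk x⟩
  have hs : s ∈ exteriorSections I F E (iSup U) := by
    refine mem_exteriorSections_of_locally fun x hx => ?_
    refine ⟨U (k ⟨x, hx⟩), le_iSup U _, hk ⟨x, hx⟩, ?_⟩
    convert (sf' (k ⟨x, hx⟩)).2 using 1
    ext y
    exact hsf' _ _ _ _ _
  refine ⟨(⟨s, hs⟩ : exteriorSections I F E (iSup U)), fun i => ?_, fun t ht => ?_⟩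
  · refine Subtype.ext (funext fun y => ?_)
    exact hsf' _ _ _ _ _
  · refine Subtype.ext (funext fun y => ?_)
    exact congrFun (congrArg Subtype.val (show exteriorRes I F E _ t = sf' _ from ht (k y)))
      ⟨y.1, hk y⟩

theorem mem_exteriorSheaf_parity {U : Opens M} (q : ZMod 2) (f : exteriorSections I F E U) :
    (f : (exteriorSheaf I F E).Sec U) ∈ (exteriorSheaf I F E).parity U q ↔
      ∀ x : U, f.1 x ∈ extParity (E x) q := Iff.rfl

theorem mem_exteriorSheaf_parity_iff {U : Opens M} (q : ZMod 2) (f : exteriorSections I F E U) :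
    (f : (exteriorSheaf I F E).Sec U) ∈ (exteriorSheaf I F E).parity U q ↔
      invSec I F E U f = (-1 : ℂ) ^ q.val • f := by
  rw [mem_exteriorSheaf_parity]
  constructor
  · intro h
    ext x
    exact mem_extParity_iff.1 (h x)
  · intro h x
    exact mem_extParity_iff.2 (congrFun (congrArg Subtype.val h) x)

variable (I F E) in
/-- The split supermanifold on `E`. -/
def exteriorSupermanifold [IsManifold I ω M] [VectorBundle ℂ F E] [ContMDiffVectorBundle ω F E I] :
    Supermanifold I F E where
  toSuperData := exteriorData I F E
  isSheaf := exteriorSheaf_isSheaf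
  parity_res h q f hf x := hf ⟨x.1, h x.2⟩
  parity_isInternal U := isInternal_of_involution (B := exteriorSections I F E U)
    (invSec I F E U).toLinearMap (fun f => Subtype.ext (funext fun x => inv_inv_apply _))
    mem_exteriorSheaf_parity_iff
  parity_graded U :=
    { one_mem := fun _ => SetLike.GradedOne.one_mem
      mul_mem := fun _ _ _ _ ha hb x => SetLike.GradedMul.mul_mem (ha x) (hb x) }
  supercomm U p q f g hf hg :=
    Subtype.ext (funext fun x => extParity_mul_comm (hf x) (hg x))
  body_res _ _ _ := rfl
  lin_res _ _ _ := rfl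
  exists_splitting x := ⟨⊤, trivial, ⟨{
    toEquiv := fun _ => AlgEquiv.refl
    toEquiv_res := fun _ _ _ _ => rfl
    toEquiv_parity := fun _ _ _ => Iff.rfl
    body_eq := fun _ _ _ => rfl
    lin_eq := fun _ _ _ => rfl }⟩⟩

variable (I F) in
/-- Evaluation at a point of sections of the exterior algebra bundle. -/
def evalGerm (x : M) : GermHom (exteriorSheaf I F E) x (ExteriorAlgebra ℂ (E x)) where
  app V hm := (Pi.evalAlgHom ℂ (fun x : V => ExteriorAlgebra ℂ (E x)) ⟨x, hm⟩).comp
    (exteriorSections I F E V).val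
  app_res _ _ _ := rfl

theorem evalGerm_compat (x : M) : (evalGerm I F (E := E) x).Compat (exteriorData I F E)
    LinearMap.id where
  parity _ hm _ _ hf := hf ⟨x, hm⟩
  body _ _ _ := rfl
  lin _ _ _ := rfl

end Exterior

/-! ### Local splittings on germs -/

section Splittings

variable {A : Type u} [NormedAddCommGroup A] [NormedSpace ℂ A]
  {H : Type u} [TopologicalSpace H] {I : ModelWithCorners ℂ A H}
  {M : Type u} [TopologicalSpace M] [ChartedSpace H M]
  {F : Type u} [NormedAddCommGroup F] [NormedSpace ℂ F]
  {E : M → Type u} [∀ x, AddCommGroup (E x)] [∀ x, Module ℂ (E x)]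
  [TopologicalSpace (TotalSpace F E)] [∀ x, TopologicalSpace (E x)] [FiberBundle F E]

namespace LocalSplitting

variable {S : SuperData E} {U : Opens M} (τ : LocalSplitting I F S U)

/-- The splitting over an open subset of its domain. -/
def eqv (V : Opens M) (hV : V ≤ U) : S.Sec V ≃ₐ[ℂ] exteriorSections I F E V :=
  τ.toEquiv ⟨V, hV⟩

theorem eqv_res {V W : Opens M} (h : W ≤ V) (hV : V ≤ U) (f : S.Sec V) :
    τ.eqv W (h.trans hV) (S.res h f) = exteriorRes I F E h (τ.eqv V hV f) :=
  τ.toEquiv_res ⟨V, hV⟩ ⟨W, h.trans hV⟩ h f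

theorem eqv_symm_res {V W : Opens M} (h : W ≤ V) (hV : V ≤ U) (f : exteriorSections I F E V) :
    (τ.eqv W (h.trans hV)).symm (exteriorRes I F E h f) = S.res h ((τ.eqv V hV).symm f) := by
  rw [AlgEquiv.symm_apply_eq, τ.eqv_res h hV, AlgEquiv.apply_symm_apply]

theorem eqv_parity {V : Opens M} (hV : V ≤ U) (q : ZMod 2) (f : S.Sec V) :
    (∀ x : V, (τ.eqv V hV f).1 x ∈ extParity (E x) q) ↔ f ∈ S.parity V q :=
  τ.toEquiv_parity ⟨V, hV⟩ q f

theorem eqv_symm_parity {V : Opens M} (hV : V ≤ U) (q : ZMod 2) (f : exteriorSections I F E V) :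
    (τ.eqv V hV).symm f ∈ S.parity V q ↔ ∀ x : V, f.1 x ∈ extParity (E x) q := by
  rw [← τ.eqv_parity hV, AlgEquiv.apply_symm_apply]

theorem eqv_body {V : Opens M} (hV : V ≤ U) (f : S.Sec V) (x : V) :
    ExteriorAlgebra.algebraMapInv ((τ.eqv V hV f).1 x) = S.body V f x :=
  (τ.body_eq ⟨V, hV⟩ f x).symm

theorem eqv_lin {V : Opens M} (hV : V ≤ U) (f : S.Sec V) (x : V) :
    ExteriorAlgebra.ιInv ((τ.eqv V hV f).1 x) = S.lin V f x :=
  (τ.lin_eq ⟨V, hV⟩ f x).symm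

theorem body_eqv_symm {V : Opens M} (hV : V ≤ U) (f : exteriorSections I F E V) (x : V) :
    S.body V ((τ.eqv V hV).symm f) x = ExteriorAlgebra.algebraMapInv (f.1 x) := by
  rw [← τ.eqv_body hV, AlgEquiv.apply_symm_apply]

theorem lin_eqv_symm {V : Opens M} (hV : V ≤ U) (f : exteriorSections I F E V) (x : V) :
    S.lin V ((τ.eqv V hV).symm f) x = ExteriorAlgebra.ιInv (f.1 x) := by
  rw [← τ.eqv_lin hV, AlgEquiv.apply_symm_apply]

/-- The filtration of the superfunctions corresponds to the degree under a splitting. -/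
theorem eqv_mem_filtration {V : Opens M} (hV : V ≤ U) (k : ℕ) (f : S.Sec V) :
    (show (exteriorSheaf I F E).Sec V from τ.eqv V hV f) ∈ (exteriorSheaf I F E).filtration k V ↔
      f ∈ S.filtration k V := by
  have key : ∀ (W : Opens M) (hW : W ≤ V), ((exteriorSheaf I F E).res hW (τ.eqv V hV f) ∈
      Ideal.span {g : (exteriorSheaf I F E).Sec W |
        ∃ n : Fin k → (exteriorSheaf I F E).Sec W, (∀ i, IsNilpotent (n i)) ∧
          g = (List.ofFn n).prod}) ↔ S.res hW f ∈ Ideal.span {g : S.Sec W |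
        ∃ n : Fin k → S.Sec W, (∀ i, IsNilpotent (n i)) ∧ g = (List.ofFn n).prod} := by
    intro W hW
    let e : S.Sec W ≃+* (exteriorSheaf I F E).Sec W := (τ.eqv W (hW.trans hV)).toRingEquiv
    have h1 : (exteriorSheaf I F E).res hW (τ.eqv V hV f) = e (S.res hW f) :=
      (τ.eqv_res hW hV f).symm
    have h2 : e '' {g : S.Sec W | ∃ n : Fin k → S.Sec W, (∀ i, IsNilpotent (n i)) ∧
        g = (List.ofFn n).prod} = {g : (exteriorSheaf I F E).Sec W |
        ∃ n : Fin k → (exteriorSheaf I F E).Sec W, (∀ i, IsNilpotent (n i)) ∧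
          g = (List.ofFn n).prod} := by
      ext g
      constructor
      · rintro ⟨_, ⟨n, hn, rfl⟩, rfl⟩
        exact ⟨fun i => e (n i), fun i => (hn i).map e, by rw [map_list_prod, List.map_ofFn]; rfl⟩
      · rintro ⟨n, hn, rfl⟩
        refine ⟨_, ⟨fun i => e.symm (n i), fun i => (hn i).map e.symm, rfl⟩, ?_⟩
        rw [map_list_prod, List.map_ofFn]
        congr 2
        ext i
        exact e.apply_symm_apply _
    rw [h1, ← h2, ← Ideal.map_span e, Ideal.mem_map_of_equiv]
    constructor
    · rintro ⟨x, hx, hx'⟩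
      rwa [← e.injective hx']
    · intro h
      exact ⟨_, h, rfl⟩
  constructor
  · intro h x hx
    obtain ⟨W, hW, hxW, h⟩ := h x hx
    exact ⟨W, hW, hxW, (key W hW).1 h⟩
  · intro h x hx
    obtain ⟨W, hW, hxW, h⟩ := h x hx
    exact ⟨W, hW, hxW, (key W hW).2 h⟩

/-- Evaluation at a point after a splitting. -/
def germ (x : M) (hx : x ∈ U) : GermHom S.toSuperPresheaf x (ExteriorAlgebra ℂ (E x)) where
  app V hm := ((evalGerm I F x).app (V ⊓ U) ⟨hm, hx⟩).comp
    ((τ.eqv (V ⊓ U) inf_le_right).toAlgHom.comp (S.res inf_le_left))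
  app_res {V' V} h hm f := by
    have h1 := τ.eqv_res (inf_le_inf_right U h) inf_le_right (S.res inf_le_left f)
    rw [S.res_res] at h1
    change (τ.eqv (V' ⊓ U) inf_le_right (S.res inf_le_left (S.res h f))).1 ⟨x, hm, hx⟩ = _
    rw [S.res_res, h1]
    rfl

theorem germ_app {V W : Opens M} (hW : W ≤ U) (hWV : W ≤ V) (x : W) (hxV : x.1 ∈ V)
    (f : S.Sec V) :
    (τ.germ x.1 (hW x.2)).app V hxV f = (τ.eqv W hW (S.res hWV f)).1 x := by
  have h1 := τ.eqv_res (le_inf hWV hW) inf_le_right (S.res inf_le_left f)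
  rw [S.res_res] at h1
  rw [h1]
  rfl

theorem germ_compat (hb : ∀ {V U : Opens M} (h : V ≤ U) (f : S.Sec U) (x : V),
      S.body V (S.res h f) x = S.body U f ⟨x.1, h x.2⟩)
    (hl : ∀ {V U : Opens M} (h : V ≤ U) (f : S.Sec U) (x : V),
      S.lin V (S.res h f) x = S.lin U f ⟨x.1, h x.2⟩)
    (hp : ∀ {V U : Opens M} (h : V ≤ U) (q : ZMod 2) (f : S.Sec U),
      f ∈ S.parity U q → S.res h f ∈ S.parity V q) (x : M) (hx : x ∈ U) :
    (τ.germ x hx).Compat S LinearMap.id where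
  parity V hm q f hf := (τ.eqv_parity inf_le_right q _).2 (hp _ q f hf) ⟨x, hm, hx⟩
  body V hm f := (τ.eqv_body inf_le_right (S.res inf_le_left f) ⟨x, hm, hx⟩).trans (hb _ _ _)
  lin V hm f := (τ.eqv_lin inf_le_right (S.res inf_le_left f) ⟨x, hm, hx⟩).trans (hl _ _ _)

end LocalSplitting

theorem Supermanifold.germ_compat [IsManifold I ω M] [VectorBundle ℂ F E]
    [ContMDiffVectorBundle ω F E I] (N : Supermanifold I F E) {U : Opens M}
    (τ : LocalSplitting I F N.toSuperData U) (x : M) (hx : x ∈ U) :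
    (τ.germ x hx).Compat N.toSuperData LinearMap.id :=
  τ.germ_compat N.body_res N.lin_res N.parity_res x hx

namespace GermHom

variable {S : SuperData E} {U : Opens M} {R : Type*} [Ring R] [Algebra ℂ R] {m : M}

/-- Composition of a homomorphism on germs of superfunctions with the inverse of a splitting. -/
def compSymm (h : GermHom S.toSuperPresheaf m R) (τ : LocalSplitting I F S U) (hm : m ∈ U) :
    GermHom (exteriorSheaf I F E) m R where
  app V hV := (h.app (V ⊓ U) ⟨hV, hm⟩).comp
    ((τ.eqv (V ⊓ U) inf_le_right).symm.toAlgHom.comp (exteriorRes I F E inf_le_left))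
  app_res {V' V} hV hm' f := by
    have h1 := τ.eqv_symm_res (inf_le_inf_right U hV) inf_le_right (exteriorRes I F E inf_le_left f)
    have hmU : m ∈ V' ⊓ U := ⟨hm', hm⟩
    have h2 := h.app_res (inf_le_inf_right U hV) hmU
      ((τ.eqv (V ⊓ U) inf_le_right).symm (exteriorRes I F E inf_le_left f))
    rw [← h1] at h2
    exact h2

theorem compSymm_app (h : GermHom S.toSuperPresheaf m R) (τ : LocalSplitting I F S U) (hm : m ∈ U)
    {V W : Opens M} (hV : m ∈ V) (hW : m ∈ W) (hWV : W ≤ V) (hWU : W ≤ U)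
    (f : exteriorSections I F E V) :
    (h.compSymm τ hm).app V hV f = h.app W hW ((τ.eqv W hWU).symm (exteriorRes I F E hWV f)) := by
  have h1 := τ.eqv_symm_res (le_inf hWV hWU) inf_le_right (exteriorRes I F E inf_le_left f)
  have h2 := h.app_res (le_inf hWV hWU) hW
    ((τ.eqv (V ⊓ U) inf_le_right).symm (exteriorRes I F E inf_le_left f))
  rw [← h1] at h2
  exact h2.symm

theorem compSymm_germ (τ : LocalSplitting I F S U) (hm : m ∈ U) :
    (τ.germ m hm).compSymm τ hm = evalGerm I F m := by
  refine ext' U hm fun V hVU hV f => ?_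
  rw [compSymm_app (τ.germ m hm) τ hm hV hV le_rfl hVU f]
  refine (τ.germ_app hVU le_rfl ⟨m, hV⟩ hV _).trans ?_
  rw [S.res_self, AlgEquiv.apply_symm_apply]
  rfl

theorem eq_of_compSymm_eq {h h' : GermHom S.toSuperPresheaf m R} (τ : LocalSplitting I F S U)
    (hm : m ∈ U) (e : h.compSymm τ hm = h'.compSymm τ hm) : h = h' := by
  refine ext' U hm fun V hVU hV f => ?_
  have h1 := compSymm_app h τ hm hV hV le_rfl hVU (τ.eqv V hVU f)
  have h2 := compSymm_app h' τ hm hV hV le_rfl hVU (τ.eqv V hVU f)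
  rw [e, h2] at h1
  have h3 : exteriorRes I F E le_rfl (τ.eqv V hVU f) = τ.eqv V hVU f := rfl
  rw [h3, AlgEquiv.symm_apply_apply] at h1
  exact h1.symm

theorem Compat.compSymm {X : Type*} [AddCommGroup X] [Module ℂ X]
    {h : GermHom S.toSuperPresheaf m (ExteriorAlgebra ℂ X)} {l : E m →ₗ[ℂ] X} (hh : h.Compat S l)
    (τ : LocalSplitting I F S U) (hm : m ∈ U) :
    (h.compSymm τ hm).Compat (exteriorData I F E) l where
  parity V hV q f hf := hh.parity _ _ q _ ((τ.eqv_symm_parity inf_le_right q _).2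
    fun x => hf ⟨x.1, x.2.1⟩)
  body V hV f := (hh.body _ _ _).trans (τ.body_eqv_symm inf_le_right _ _)
  lin V hV f := (hh.lin _ _ _).trans (congrArg l (τ.lin_eqv_symm inf_le_right _ _))

end GermHom

/-! ### Holomorphic families of homomorphisms on germs -/

variable {A' : Type u} [NormedAddCommGroup A'] [NormedSpace ℂ A']
  {H' : Type u} [TopologicalSpace H'] {I' : ModelWithCorners ℂ A' H'}
  {M' : Type u} [TopologicalSpace M'] [ChartedSpace H' M']
  {F' : Type u} [NormedAddCommGroup F'] [NormedSpace ℂ F']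
  {E' : M' → Type u} [∀ x, AddCommGroup (E' x)] [∀ x, Module ℂ (E' x)]
  [TopologicalSpace (TotalSpace F' E')] [∀ x, TopologicalSpace (E' x)] [FiberBundle F' E']

variable (I' F' E') in
/-- A homomorphism over `φ` from the sheaf `O` to the restriction to `W'` of the sheaf of sections
of an exterior algebra bundle, encoded by its values at the points of `W'`. -/
structure HolHom {M : Type u} [TopologicalSpace M] (O : SuperPresheaf M) (φ : C(M', M))
    (W' : Opens M') where
  germ : ∀ x ∈ W', GermHom O (φ x) (ExteriorAlgebra ℂ (E' x))
  hol : ∀ (V : Opens M) (V' : Opens M') (hV : V' ≤ Opens.comap φ V) (hW : V' ≤ W') (f : O.Sec V),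
    (fun x : V' => (germ x.1 (hW x.2)).app V (hV x.2) f) ∈ exteriorSections I' F' E' V'

namespace HolHom

variable {O : SuperPresheaf M} {φ : C(M', M)} {W' : Opens M'} (Φ : HolHom I' F' E' O φ W')

/-- The homomorphism on sections. -/
def sec {V : Opens M} {V' : Opens M'} (hV : V' ≤ Opens.comap φ V) (hW : V' ≤ W') :
    O.Sec V →ₐ[ℂ] exteriorSections I' F' E' V' :=
  (AlgHom.pi fun x : V' => (Φ.germ x.1 (hW x.2)).app V (hV x.2)).codRestrict _
    (Φ.hol V V' hV hW)

theorem sec_res {V U : Opens M} {V' U' : Opens M'} (hV : V' ≤ Opens.comap φ V) (hW : U' ≤ W')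
    (hU : U' ≤ Opens.comap φ U) (h : V ≤ U) (h' : V' ≤ U') (f : O.Sec U) :
    Φ.sec hV (h'.trans hW) (O.res h f) = exteriorRes I' F' E' h' (Φ.sec hU hW f) :=
  Subtype.ext (funext fun x => (Φ.germ x.1 (hW (h' x.2))).app_res h (hV x.2) f)

/-- Restriction to a smaller open set. -/
def restrict {U' : Opens M'} (h : U' ≤ W') : HolHom I' F' E' O φ U' where
  germ x hx := Φ.germ x (h hx)
  hol V V' hV hW f := Φ.hol V V' hV (hW.trans h) f

/-- A family of homomorphisms on germs is holomorphic if it is so locally. -/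
def ofLocally (germ : ∀ x ∈ W', GermHom O (φ x) (ExteriorAlgebra ℂ (E' x)))
    (h : ∀ x ∈ W', ∃ (U' : Opens M') (_ : x ∈ U') (hU : U' ≤ W') (Φ : HolHom I' F' E' O φ U'),
      ∀ (y : M') (hy : y ∈ U'), germ y (hU hy) = Φ.germ y hy) : HolHom I' F' E' O φ W' where
  germ := germ
  hol V V' hV hW f := by
    refine mem_exteriorSections_of_locally fun x hx => ?_
    obtain ⟨U', hxU, hU, Φ, hΦ⟩ := h x (hW hx)
    refine ⟨V' ⊓ U', inf_le_left, ⟨hx, hxU⟩, ?_⟩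
    convert Φ.hol V (V' ⊓ U') (inf_le_left.trans hV) inf_le_right f using 1
    ext y
    change (germ y _).app V _ f = (Φ.germ y _).app V _ f
    rw [hΦ y.1 y.2.2]

end HolHom

/-- The composite of a homomorphism on germs at `x` with a holomorphic family. -/
def GermHom.comp {O : SuperPresheaf M} {φ : C(M', M)} {W' : Opens M'} {R : Type*} [Ring R]
    [Algebra ℂ R] {x : M'} (h : GermHom (exteriorSheaf I' F' E') x R)
    (Φ : HolHom I' F' E' O φ W') (hx : x ∈ W') : GermHom O (φ x) R where
  app V hV := (h.app (Opens.comap φ V ⊓ W') ⟨hV, hx⟩).comp (Φ.sec inf_le_left inf_le_right)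
  app_res {V' V} hV hm f := by
    have h1 := Φ.sec_res (V' := Opens.comap φ V' ⊓ W') inf_le_left inf_le_right inf_le_left hV
      (inf_le_inf_right W' (Opens.comap_mono φ hV)) f
    have hm' : x ∈ Opens.comap φ V' ⊓ W' := ⟨hm, hx⟩
    have h2 := h.app_res (inf_le_inf_right W' (Opens.comap_mono φ hV)) hm'
      (Φ.sec inf_le_left inf_le_right f)
    rw [exteriorSheaf_res, ← h1] at h2
    exact h2

theorem GermHom.comp_app {O : SuperPresheaf M} {φ : C(M', M)} {W' : Opens M'} {R : Type*} [Ring R]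
    [Algebra ℂ R] {x : M'} (h : GermHom (exteriorSheaf I' F' E') x R)
    (Φ : HolHom I' F' E' O φ W') (hx : x ∈ W') {V : Opens M} {V' : Opens M'} (hV : φ x ∈ V)
    (hxV : x ∈ V') (hV' : V' ≤ Opens.comap φ V) (hW : V' ≤ W') (f : O.Sec V) :
    (h.comp Φ hx).app V hV f = h.app V' hxV (Φ.sec hV' hW f) := by
  have h1 := Φ.sec_res (V' := V') hV' inf_le_right inf_le_left le_rfl (le_inf hV' hW) f
  have h2 := h.app_res (le_inf hV' hW) hxV (Φ.sec inf_le_left inf_le_right f)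
  rw [exteriorSheaf_res, ← h1, O.res_self] at h2
  exact h2.symm

namespace HolHom

variable {O : SuperPresheaf M}

/-- A splitting, as a holomorphic family. -/
def ofSplitting {S : SuperData E} {U : Opens M} (τ : LocalSplitting I F S U) :
    HolHom I F E S.toSuperPresheaf (ContinuousMap.id M) U where
  germ x hx := τ.germ x hx
  hol V V' hV hW f := by
    convert (τ.eqv V' hW (S.res hV f)).2 using 1
    ext x
    exact τ.germ_app hW hV x (hV x.2) f

/-- The composite of two holomorphic families, the second one over the identity. -/
def comp {φ : C(M', M)} {W' U' : Opens M'}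
    (Ψ : HolHom I' F' E' (exteriorSheaf I' F' E') (ContinuousMap.id M') U')
    (Φ : HolHom I' F' E' O φ W') (h : U' ≤ W') : HolHom I' F' E' O φ U' where
  germ x hx := GermHom.comp (x := x) (Ψ.germ x hx) Φ (h hx)
  hol V V' hV hW f := by
    convert Ψ.hol V' V' le_rfl hW (Φ.sec hV (hW.trans h) f) using 1
    ext x
    exact GermHom.comp_app (x := x.1) (Ψ.germ x.1 (hW x.2)) Φ (h (hW x.2)) (hV x.2) x.2 hV
      (hW.trans h) f

/-- The composite of a holomorphic family over the identity with a morphism of superalgebra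
sheaves. -/
def compMorphism {O' : SuperPresheaf M'} {ψ : C(M, M')} {W : Opens M}
    (Φ : HolHom I F E O (ContinuousMap.id M) W) (p : SuperMorphism O O' ψ) :
    HolHom I F E O' ψ W where
  germ x hx := GermHom.compMorphism (m := x) (Φ.germ x hx) p
  hol V V' hV hW f := Φ.hol (Opens.comap ψ V) V' hV hW (p.star V f)

/-- The composite of a holomorphic family of homomorphisms on superfunctions with the inverse of a
splitting. -/
def compSymm {S : SuperData E} {U : Opens M} {φ : C(M', M)} {W' : Opens M'}
    (Φ : HolHom I' F' E' S.toSuperPresheaf φ W') (τ : LocalSplitting I F S U)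
    (h : W' ≤ Opens.comap φ U) : HolHom I' F' E' (exteriorSheaf I F E) φ W' where
  germ x hx := (Φ.germ x hx).compSymm τ (h hx)
  hol V V' hV hW f := Φ.hol (V ⊓ U) V' (le_inf hV (hW.trans h)) hW
    ((τ.eqv (V ⊓ U) inf_le_right).symm (exteriorRes I F E inf_le_left f))

end HolHom

/-- Pullback of sections, as a holomorphic family. -/
def BundlePull.hol {φ : C(M', M)} (P : BundlePull I F E I' F' E' φ) (W' : Opens M') :
    HolHom I' F' E' (exteriorSheaf I F E) φ W' where
  germ y _ :=
    { app := fun V hV => (ExteriorAlgebra.map (P.lin y)).comp ((evalGerm I F (φ y)).app V hV)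
      app_res := fun _ _ _ => rfl }
  hol V V' hV _ f := (P.sec hV f).2

end Splittings

/-! ### Rigidity of splittings -/

section Rigidity

variable {A : Type u} [NormedAddCommGroup A] [NormedSpace ℂ A] [FiniteDimensional ℂ A]
  {H : Type u} [TopologicalSpace H] {I : ModelWithCorners ℂ A H} [I.Boundaryless]
  {M : Type u} [TopologicalSpace M] [ChartedSpace H M] [IsManifold I ω M]
  {F : Type u} [NormedAddCommGroup F] [NormedSpace ℂ F] [FiniteDimensional ℂ F]
  {E : M → Type u} [∀ x, AddCommGroup (E x)] [∀ x, Module ℂ (E x)]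
  [TopologicalSpace (TotalSpace F E)] [∀ x, TopologicalSpace (E x)] [FiberBundle F E]
  [VectorBundle ℂ F E] [ContMDiffVectorBundle ω F E I]

/-- The value of a compatible homomorphism on a section which vanishes in degree zero at the point
has positive degree. -/
theorem GermHom.app_mem_extFil_one {m : M} {X : Type*} [AddCommGroup X] [Module ℂ X]
    {h : GermHom (exteriorSheaf I F E) m (ExteriorAlgebra ℂ X)}
    (hb : ∀ (V : Opens M) (hm : m ∈ V) (f : exteriorSections I F E V),
      ExteriorAlgebra.algebraMapInv (h.app V hm f) = ExteriorAlgebra.algebraMapInv (f.1 ⟨m, hm⟩))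
    {V : Opens M} (hm : m ∈ V) {f : exteriorSections I F E V}
    (hf : f.1 ⟨m, hm⟩ ∈ extFil (E m) 1) : h.app V hm f ∈ extFil X 1 := by
  rw [mem_extFil_one] at hf ⊢
  rw [hb, hf]

theorem coordSec_sub_mem {ι : Type*} (b : Module.Basis ι ℂ A) {w : M} {V : Opens M}
    (hV : V ≤ bundleDom H F E w) (i : ι) (x : V) :
    (coordSec I F E b hV i - algebraMap ℂ _ (coordFun I w b i x)).1 x ∈ extFil (E x) 1 := by
  change algebraMap ℂ (ExteriorAlgebra ℂ (E x)) (coordFun I w b i x) -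
    algebraMap ℂ (ExteriorAlgebra ℂ (E x)) (coordFun I w b i x) ∈ extFil (E x) 1
  rw [sub_self]
  exact zero_mem _

theorem frameSec_mem {w : M} {V : Opens M} (hV : V ≤ bundleDom H F E w) (v : F) (x : V) :
    (frameSec I hV v).1 x ∈ extFil (E x) 1 :=
  map_mem_extFil _ (ι_mem_extFil_one _)

/-- Homomorphisms on the germs of sections of an exterior algebra bundle agree if they agree on
coordinates. -/
theorem GermHom.ext_of_coord {w m : M} (hm : m ∈ bundleDom H F E w) {X : Type*} [AddCommGroup X]
    [Module ℂ X] [Module.Finite ℂ X] {h h' : GermHom (exteriorSheaf I F E) m (ExteriorAlgebra ℂ X)}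
    (hb : ∀ (V : Opens M) (hm : m ∈ V) (f : exteriorSections I F E V),
      ExteriorAlgebra.algebraMapInv (h'.app V hm f) = ExteriorAlgebra.algebraMapInv (f.1 ⟨m, hm⟩))
    {ι κ : Type*} [Fintype ι] [Fintype κ] (b : Module.Basis ι ℂ A) (bF : Module.Basis κ ℂ F)
    (hx : ∀ i, h.app _ hm (coordSec I F E b le_rfl i) = h'.app _ hm (coordSec I F E b le_rfl i))
    (hθ : ∀ j, h.app _ hm (frameSec I le_rfl (bF j)) = h'.app _ hm (frameSec I le_rfl (bF j))) :
    h = h' := by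
  refine GermHom.ext' _ hm fun V hV hmV f => ?_
  rw [← sub_eq_zero]
  refine eq_zero_of_forall_mem_extFil fun t => ?_
  let D : ∀ V : Opens M, V ≤ bundleDom H F E w → m ∈ V →
      exteriorSections I F E V →ₗ[ℂ] ExteriorAlgebra ℂ X := fun V _ hm =>
    (h.app V hm).toLinearMap - (h'.app V hm).toLinearMap
  refine twistedDer_mem_extFil b bF le_rfl D (fun V' V hVV _ hm f => ?_)
    (fun V _ hm f => h.app V hm f) (fun V _ hm f => h'.app V hm f) (fun V hV hm f g => ?_)
    (fun V hV hm => ?_) t (fun V hV hm' i => ?_) (fun V hV hm i => ?_) (fun V hV hm' j => ?_)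
    (fun V hV hm j => ?_) V hV hmV f
  · exact congrArg₂ (· - ·) (h.app_res hVV hm f) (h'.app_res hVV hm f)
  · change h.app V hm (f * g) - h'.app V hm (f * g) = (h.app V hm f - h'.app V hm f) *
      h.app V hm g + h'.app V hm f * (h.app V hm g - h'.app V hm g)
    have h1 : h.app V hm (f * g) = h.app V hm f * h.app V hm g := map_mul (h.app V hm) _ _
    have h2 : h'.app V hm (f * g) = h'.app V hm f * h'.app V hm g := map_mul (h'.app V hm) _ _
    rw [h1, h2, sub_mul, mul_sub]
    abel
  · have h1 : h.app V hm (1 : exteriorSections I F E V) = 1 := map_one (h.app V hm)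
    have h2 : h'.app V hm (1 : exteriorSections I F E V) = 1 := map_one (h'.app V hm)
    change h.app V hm (1 : exteriorSections I F E V) -
      h'.app V hm (1 : exteriorSections I F E V) ∈ (⊥ : Submodule ℂ _)
    rw [h1, h2, sub_self]
    exact zero_mem _
  · have h1 := h.app_res hV hm' (coordSec I F E b le_rfl i)
    have h2 := h'.app_res hV hm' (coordSec I F E b le_rfl i)
    have h3 : D V hV hm' (coordSec I F E b hV i) = 0 := by
      refine sub_eq_zero.2 ?_
      exact h1.trans ((hx i).trans h2.symm)
    rw [h3]
    exact zero_mem _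
  · exact GermHom.app_mem_extFil_one hb hm (coordSec_sub_mem b hV i ⟨m, hm⟩)
  · have h1 := h.app_res hV hm' (frameSec I le_rfl (bF j))
    have h2 := h'.app_res hV hm' (frameSec I le_rfl (bF j))
    have h3 : D V hV hm' (frameSec I hV (bF j)) = 0 := by
      refine sub_eq_zero.2 ?_
      exact h1.trans ((hθ j).trans h2.symm)
    rw [h3]
    exact zero_mem _
  · exact GermHom.app_mem_extFil_one hb hm (frameSec_mem hV _ ⟨m, hm⟩)

/-- An endomorphism of the sheaf of sections which induces the identity on the associated graded
sheaf is bijective, since its difference from the identity raises degrees. -/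
theorem HolHom.bijective_sec {U : Opens M}
    (Φ : HolHom I F E (exteriorSheaf I F E) (ContinuousMap.id M) U)
    (hΦ : ∀ x hx, GermHom.Compat (m := x) (exteriorData I F E) (Φ.germ x hx) LinearMap.id)
    {V : Opens M} (hV : V ≤ U) :
    Function.Bijective (Φ.sec (V := V) (V' := V) le_rfl hV : exteriorSections I F E V →
      exteriorSections I F E V) := by
  let P : ∀ V : Opens M, V ≤ U → exteriorSections I F E V →ₐ[ℂ] exteriorSections I F E V :=
    fun V hV => Φ.sec (V := V) (V' := V) le_rfl hV
  let D : ∀ V : Opens M, V ≤ U → exteriorSections I F E V →ₗ[ℂ] exteriorSections I F E V :=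
    fun V hV => (P V hV).toLinearMap - LinearMap.id
  have hres : ∀ (V' V : Opens M) (h : V' ≤ V) (hV : V ≤ U) (f : exteriorSections I F E V),
      D V' (h.trans hV) (exteriorRes I F E h f) = exteriorRes I F E h (D V hV f) := by
    intro V' V h hV f
    have h1 : P V' (h.trans hV) (exteriorRes I F E h f) = exteriorRes I F E h (P V hV f) :=
      Φ.sec_res (V := V') (U := V) le_rfl hV le_rfl h h f
    change P V' (h.trans hV) (exteriorRes I F E h f) - exteriorRes I F E h f =
      exteriorRes I F E h (P V hV f - f)
    rw [h1, map_sub]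
  have hbody : ∀ (V : Opens M) (hV : V ≤ U) (f : exteriorSections I F E V) (x : V),
      ExteriorAlgebra.algebraMapInv ((P V hV f).1 x) = ExteriorAlgebra.algebraMapInv (f.1 x) :=
    fun V hV f x => (hΦ x.1 (hV x.2)).body V x.2 f
  have hlin : ∀ (V : Opens M) (hV : V ≤ U) (f : exteriorSections I F E V) (x : V),
      ExteriorAlgebra.ιInv ((P V hV f).1 x) = ExteriorAlgebra.ιInv (f.1 x) :=
    fun V hV f x => (hΦ x.1 (hV x.2)).lin V x.2 f
  have hDb : ∀ (V : Opens M) (hV : V ≤ U) (f : exteriorSections I F E V) (x : V),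
      ExteriorAlgebra.algebraMapInv ((D V hV f).1 x) = 0 := fun V hV f x =>
    (map_sub ExteriorAlgebra.algebraMapInv ((P V hV f).1 x) (f.1 x)).trans
      (sub_eq_zero.2 (hbody V hV f x))
  have hDl : ∀ (V : Opens M) (hV : V ≤ U) (f : exteriorSections I F E V) (x : V),
      ExteriorAlgebra.ιInv ((D V hV f).1 x) = 0 := fun V hV f x =>
    (map_sub ExteriorAlgebra.ιInv ((P V hV f).1 x) (f.1 x)).trans
      (sub_eq_zero.2 (hlin V hV f x))
  have hDmul : ∀ (V : Opens M) (hV : V ≤ U) (f g : exteriorSections I F E V),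
      D V hV (f * g) = D V hV f * g + P V hV f * D V hV g := fun V hV f g => by
    change P V hV (f * g) - f * g = (P V hV f - f) * g + P V hV f * (P V hV g - g)
    rw [map_mul, sub_mul, mul_sub]
    abel
  have hD1 : ∀ (V : Opens M) (hV : V ≤ U), D V hV 1 = 0 := fun V hV => by
    change P V hV 1 - 1 = 0
    rw [map_one, sub_self]
  have raise : ∀ (V : Opens M) (hV : V ≤ U) (k : ℕ) (f : exteriorSections I F E V),
      (∀ x : V, f.1 x ∈ extFil (E x) k) → ∀ x : V, (D V hV f).1 x ∈ extFil (E x) (k + 1) := by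
    intro V hV k f hf x
    let W := V ⊓ bundleDom H F E x.1
    have hWV : W ≤ V := inf_le_left
    have hW : W ≤ bundleDom H F E x.1 := inf_le_right
    have h1 := twistedDer_raises (I := I) (Module.finBasis ℂ A) (Module.finBasis ℂ F) hW
      (fun V' hV' => D V' (hV'.trans (hWV.trans hV)))
      (fun V' V'' h hV'' f => hres V' V'' h _ f)
      (fun V' hV' f => P V' (hV'.trans (hWV.trans hV)) f)
      (fun V' hV' f g => hDmul V' _ f g) 1
      (fun V' hV' i y => mem_extFil_one.2 (hDb V' _ _ y))
      (fun V' hV' i y => by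
        have := coordSec_sub_mem (E := E) (F := F) (I := I) (Module.finBasis ℂ A)
          (hV'.trans hW) i y
        rw [mem_extFil_one] at this ⊢
        rw [hbody, this])
      (fun V' hV' j y => mem_extFil_two (hDb V' _ _ y) (hDl V' _ _ y))
      (fun V' hV' j y => by
        have := frameSec_mem (E := E) (F := F) (I := I) (hV'.trans hW)
          (Module.finBasis ℂ F j) y
        rw [mem_extFil_one] at this ⊢
        rw [hbody, this])
      (fun V' hV' => hD1 V' _)
      (V := W) le_rfl k (exteriorRes I F E hWV f) (fun y => hf ⟨y.1, hWV y.2⟩)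
      ⟨x.1, x.2, mem_bundleDom x.1⟩
    rw [hres W V hWV hV] at h1
    exact h1
  -- Degrees are bounded by the rank, so the difference from the identity is nilpotent.
  have hnil : IsNilpotent (D V hV : Module.End ℂ (exteriorSections I F E V)) := by
    refine ⟨Module.finrank ℂ F + 1, LinearMap.ext fun f => ?_⟩
    have h1 : ∀ (n : ℕ) (x : V), ((D V hV ^ n) f).1 x ∈ extFil (E x) n := by
      intro n
      induction n with
      | zero => exact fun x => mem_extFil_zero _
      | succ n ih => rw [pow_succ']; exact raise V hV n _ ih
    ext x
    have h2 := h1 (Module.finrank ℂ F + 1) x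
    rw [extFil_fibre_eq_bot F, Submodule.mem_bot] at h2
    exact h2
  have hunit : IsUnit ((P V hV).toLinearMap : Module.End ℂ (exteriorSections I F E V)) := by
    have h1 := IsNilpotent.isUnit_one_add (R := Module.End ℂ (exteriorSections I F E V)) hnil
    have h2 : 1 + (D V hV : Module.End ℂ (exteriorSections I F E V)) = (P V hV).toLinearMap := by
      change LinearMap.id + ((P V hV).toLinearMap - LinearMap.id) = _
      abel
    rwa [h2] at h1
  exact (Module.End.isUnit_iff _).1 hunit

theorem Supermanifold.mem_parity_of_res (N : Supermanifold I F E) {U : Opens M} {q : ZMod 2}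
    {f : N.Sec U}
    (h : ∀ x ∈ U, ∃ (V : Opens M) (hV : V ≤ U), x ∈ V ∧ N.res hV f ∈ N.parity V q) :
    f ∈ N.parity U q := by
  obtain ⟨a, ha, b, hb, rfl⟩ := exists_add_of_isInternal' (N.parity_isInternal U) q f
  suffices b = 0 by rwa [this, add_zero]
  refine SuperPresheaf.eq_of_locally N.isSheaf fun x hx => ?_
  obtain ⟨V, hV, hxV, h⟩ := h x hx
  refine ⟨V, hV, hxV, ?_⟩
  rw [map_zero]
  refine eq_zero_of_isInternal (N.parity_isInternal V) (q := q) ?_ (N.parity_res hV _ _ hb)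
  rw [map_add] at h
  exact (Submodule.add_mem_iff_right _ (N.parity_res hV _ _ ha)).1 h

/-- A homomorphism from the superfunctions to the sections of the exterior algebra bundle which is
compatible with the identity is a splitting. -/
theorem Supermanifold.exists_splitting_of_compat (N : Supermanifold I F E) {U : Opens M}
    (Φ : HolHom I F E N.toSuperPresheaf (ContinuousMap.id M) U)
    (hΦ : ∀ x hx, GermHom.Compat (m := x) N.toSuperData (Φ.germ x hx) LinearMap.id) :
    ∃ τ : LocalSplitting I F N.toSuperData U, ∀ x hx, τ.germ x hx = Φ.germ x hx := by
  let P : ∀ V : Opens M, V ≤ U → N.Sec V →ₐ[ℂ] exteriorSections I F E V :=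
    fun V hV => Φ.sec (V := V) (V' := V) le_rfl hV
  have hres : ∀ (V W : Opens M) (h : W ≤ V) (hV : V ≤ U) (f : N.Sec V),
      P W (h.trans hV) (N.res h f) = exteriorRes I F E h (P V hV f) :=
    fun V W h hV f => Φ.sec_res (V := W) (U := V) le_rfl hV le_rfl h h f
  have hloc : ∀ x ∈ U, ∃ W : Opens M, x ∈ W ∧ W ≤ U ∧ ∀ (V : Opens M) (hV : V ≤ U), V ≤ W →
      Function.Bijective (P V hV) := by
    intro x hx
    obtain ⟨W₀, hxW, ⟨τ⟩⟩ := N.exists_splitting x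
    let W := W₀ ⊓ U
    have hW₀ : W ≤ W₀ := inf_le_left
    have hWU : W ≤ U := inf_le_right
    let Ψ : HolHom I F E (exteriorSheaf I F E) (ContinuousMap.id M) W :=
      (Φ.restrict hWU).compSymm τ hW₀
    refine ⟨W, ⟨hxW, hx⟩, hWU, fun V hV hVW => ?_⟩
    have h1 := Ψ.bijective_sec (fun y hy => (hΦ y (hWU hy)).compSymm τ (hW₀ hy)) hVW
    have h2 : ∀ f : N.Sec V, P V hV f = Ψ.sec (V := V) (V' := V) le_rfl hVW
        (τ.eqv V (hVW.trans hW₀) f) := by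
      intro f
      refine Subtype.ext (funext fun y => ?_)
      have h3 := GermHom.compSymm_app (m := y.1) (Φ.germ y.1 (hV y.2)) τ (hW₀ (hVW y.2)) y.2 y.2
        le_rfl (hVW.trans hW₀) (τ.eqv V (hVW.trans hW₀) f)
      have h4 : exteriorRes I F E le_rfl (τ.eqv V (hVW.trans hW₀) f) =
        τ.eqv V (hVW.trans hW₀) f := rfl
      rw [h4, AlgEquiv.symm_apply_apply] at h3
      exact h3.symm
    have h5 : (P V hV : N.Sec V → exteriorSections I F E V) =
        (Ψ.sec (V := V) (V' := V) le_rfl hVW : exteriorSections I F E V → _) ∘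
          τ.eqv V (hVW.trans hW₀) := funext h2
    rw [h5]
    exact h1.comp (τ.eqv V (hVW.trans hW₀)).bijective
  choose W hxW hWU hbij using hloc
  have hinj : ∀ (V : Opens M) (hV : V ≤ U), Function.Injective (P V hV) := by
    intro V hV f g e
    refine SuperPresheaf.eq_of_locally N.isSheaf fun x hx => ?_
    refine ⟨V ⊓ W x (hV hx), inf_le_left, ⟨hx, hxW x (hV hx)⟩, ?_⟩
    refine (hbij x (hV hx) _ (inf_le_left.trans hV) inf_le_right).1 ?_
    rw [hres V _ inf_le_left hV, hres V _ inf_le_left hV, e]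
  have hsurj : ∀ (V : Opens M) (hV : V ≤ U), Function.Surjective (P V hV) := by
    intro V hV g
    let V' : V → Opens M := fun x => V ⊓ W x.1 (hV x.2)
    have hV' : ∀ x, V' x ≤ V := fun x => inf_le_left
    choose f hf using fun x : V => (hbij x.1 (hV x.2) (V' x) ((hV' x).trans hV) inf_le_right).2
      (exteriorRes I F E (hV' x) g)
    obtain ⟨s, hs⟩ := SuperPresheaf.exists_gluing N.isSheaf V' hV'
      (fun x => ⟨x.2, hxW x.1 (hV x.2)⟩) f (fun x y => by
        refine hinj _ ((inf_le_left.trans (hV' x)).trans hV) ?_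
        rw [hres _ _ inf_le_left ((hV' x).trans hV), hres _ _ inf_le_right ((hV' y).trans hV),
          hf, hf]
        rfl)
    refine ⟨s, Subtype.ext (funext fun x => ?_)⟩
    have h1 := hres V (V' x) (hV' x) hV s
    rw [hs, hf] at h1
    exact (congrFun (congrArg Subtype.val h1) ⟨x.1, x.2, hxW x.1 (hV x.2)⟩).symm
  have hpar : ∀ (V : Opens M) (hV : V ≤ U) (q : ZMod 2) (f : N.Sec V), f ∈ N.parity V q →
      ∀ x : V, (P V hV f).1 x ∈ extParity (E x) q :=
    fun V hV q f hf x => (hΦ x.1 (hV x.2)).parity V x.2 q f hf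
  let τ : LocalSplitting I F N.toSuperData U :=
    { toEquiv := fun V => AlgEquiv.ofBijective (P V.1 V.2) ⟨hinj V.1 V.2, hsurj V.1 V.2⟩
      toEquiv_res := fun V W h f => hres V.1 W.1 h V.2 f
      toEquiv_parity := fun V q f => by
        refine ⟨fun h => ?_, fun h => hpar V.1 V.2 q f h⟩
        obtain ⟨a, ha, b, hb, rfl⟩ := exists_add_of_isInternal' (N.parity_isInternal V.1) q f
        suffices b = 0 by rwa [this, add_zero]
        refine hinj V.1 V.2 ?_
        rw [map_zero]
        refine eq_zero_of_isInternal ((exteriorSupermanifold I F E).parity_isInternal V.1) (q := q)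
          (f := P V.1 V.2 b) ?_ (hpar V.1 V.2 _ b hb)
        have h' : ∀ x : V.1, (P V.1 V.2 (a + b)).1 x ∈ extParity (E x) q := h
        intro x
        have h1 := h' x
        rw [map_add] at h1
        exact (Submodule.add_mem_iff_right _ (hpar V.1 V.2 q a ha x)).1 h1
      body_eq := fun V f x => ((hΦ x.1 (V.2 x.2)).body V.1 x.2 f).symm
      lin_eq := fun V f x => ((hΦ x.1 (V.2 x.2)).lin V.1 x.2 f).symm }
  refine ⟨τ, fun x hx => GermHom.ext' U hx fun V hV hxV f => ?_⟩
  refine (τ.germ_app hV le_rfl ⟨x, hxV⟩ hxV f).trans ?_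
  rw [N.res_self]
  rfl

theorem mul_self_of_odd {V : Opens M} {f : exteriorSections I F E V}
    (hf : ∀ x : V, f.1 x ∈ extParity (E x) 1) : f * f = 0 := by
  ext x
  have h := extParity_mul_comm (hf x) (hf x)
  have h1 : f.1 x * f.1 x = -(f.1 x * f.1 x) := by
    rw [ZMod.val_one] at h
    simpa using h
  have h2 : (2 : ℂ) • (f.1 x * f.1 x) = 0 := by
    rw [two_smul]
    nth_rewrite 1 [h1]
    exact neg_add_cancel _
  exact (smul_eq_zero.1 h2).resolve_left two_ne_zero

theorem mul_comm_of_even {V : Opens M} {f : exteriorSections I F E V}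
    (hf : ∀ x : V, f.1 x ∈ extParity (E x) 0) (g : exteriorSections I F E V) : f * g = g * f :=
  Subtype.ext (funext fun x => mul_comm_of_mem_even (hf x) (g.1 x))

variable (I F E) in
/-- The grade involution, as a holomorphic family. -/
def invHol (U : Opens M) : HolHom I F E (exteriorSheaf I F E) (ContinuousMap.id M) U where
  germ x _ :=
    { app := fun V hV => inv.comp ((evalGerm I F (E := E) x).app V hV)
      app_res := fun _ _ _ => rfl }
  hol _ _ hV _ f := inv_mem_exteriorSections (exteriorRes I F E hV f).2

/-- Post-composition of a homomorphism on germs. -/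
def GermHom.map {M : Type u} [TopologicalSpace M] {O : SuperPresheaf M} {m : M} {R R' : Type*}
    [Ring R] [Algebra ℂ R] [Ring R'] [Algebra ℂ R'] (h : GermHom O m R) (k : R →ₐ[ℂ] R') :
    GermHom O m R' where
  app V hm := k.comp (h.app V hm)
  app_res hV hm f := congrArg k (h.app_res hV hm f)

/-- A homomorphism on germs of sections is compatible with a linear map if it is so on
coordinates. -/
theorem GermHom.compat_of_coord {w m : M} (hm : m ∈ bundleDom H F E w) {X : Type*}
    [AddCommGroup X] [Module ℂ X] [Module.Finite ℂ X]
    (h : GermHom (exteriorSheaf I F E) m (ExteriorAlgebra ℂ X)) (l : E m →ₗ[ℂ] X)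
    {ι κ : Type*} [Fintype ι] [Fintype κ] (b : Module.Basis ι ℂ A) (bF : Module.Basis κ ℂ F)
    (hx : ∀ i, h.app _ hm (coordSec I F E b le_rfl i) ∈ extParity X 0)
    (hxb : ∀ i, ExteriorAlgebra.algebraMapInv (h.app _ hm (coordSec I F E b le_rfl i)) =
      coordFun I w b i m)
    (hθ : ∀ j, h.app _ hm (frameSec I le_rfl (bF j)) ∈ extParity X 1)
    (hθl : ∀ j, ExteriorAlgebra.ιInv (h.app _ hm (frameSec I le_rfl (bF j))) =
      l (trivSymm F E w m (bF j))) :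
    h.Compat (exteriorData I F E) l := by
  -- Even elements have no linear part, and odd elements no constant part.
  have ιInv_even : ∀ u ∈ extParity X 0, ExteriorAlgebra.ιInv u = 0 := by
    intro u hu
    have h1 := ιInv_map (-LinearMap.id) u
    have h2 : ExteriorAlgebra.map (-LinearMap.id : X →ₗ[ℂ] X) = inv := by
      ext v
      simp
    rw [h2, inv_of_mem hu] at h1
    simp only [ZMod.val_zero, pow_zero, one_smul, LinearMap.neg_apply, LinearMap.id_apply] at h1
    have h3 : (2 : ℂ) • ExteriorAlgebra.ιInv u = 0 := by
      rw [two_smul]; nth_rewrite 1 [h1]; exact neg_add_cancel _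
    exact (smul_eq_zero.1 h3).resolve_left two_ne_zero
  have const_odd : ∀ u ∈ extParity X 1, ExteriorAlgebra.algebraMapInv u = 0 := by
    intro u hu
    have h1 := algebraMapInv_map (-LinearMap.id) u
    have h2 : ExteriorAlgebra.map (-LinearMap.id : X →ₗ[ℂ] X) = inv := by
      ext v
      simp
    rw [h2, inv_of_mem hu, map_smul, ZMod.val_one, pow_one, neg_smul, one_smul] at h1
    exact self_eq_neg.1 h1.symm
  have halg : ∀ c : ℂ, ExteriorAlgebra.algebraMapInv (algebraMap ℂ (ExteriorAlgebra ℂ X) c) = c :=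
    fun c => AlgHom.commutes _ c
  have hcoord : ∀ i, (coordSec I F E b le_rfl i).1 ⟨m, hm⟩ =
      algebraMap ℂ (ExteriorAlgebra ℂ (E m)) (coordFun I w b i m) := fun i => rfl
  have hframe : ∀ v, (frameSec I le_rfl v).1 ⟨m, hm⟩ =
      ExteriorAlgebra.ι ℂ (trivSymm F E w m v) :=
    fun v => ExteriorAlgebra.map_apply_ι _ _
  let body : ExteriorAlgebra ℂ X →ₐ[ℂ] ExteriorAlgebra ℂ X :=
    (Algebra.ofId ℂ (ExteriorAlgebra ℂ X)).comp ExteriorAlgebra.algebraMapInv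
  have hbody : ∀ (V : Opens M) (hm : m ∈ V) (f : exteriorSections I F E V),
      ExteriorAlgebra.algebraMapInv (h.app V hm f) =
        ExteriorAlgebra.algebraMapInv (f.1 ⟨m, hm⟩) := by
    let k := (evalGerm I F (E := E) m).map
      ((Algebra.ofId ℂ (ExteriorAlgebra ℂ X)).comp ExteriorAlgebra.algebraMapInv)
    have key : h.map body = k := by
      refine GermHom.ext_of_coord hm (fun V hm f => halg _) b bF (fun i => ?_) (fun j => ?_)
      · refine congrArg (algebraMap ℂ _) ((hxb i).trans ?_)
        change _ = ExteriorAlgebra.algebraMapInv ((coordSec I F E b le_rfl i).1 ⟨m, hm⟩)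
        rw [hcoord]
        exact (AlgHom.commutes ExteriorAlgebra.algebraMapInv _).symm
      · refine congrArg (algebraMap ℂ _) ((const_odd _ (hθ j)).trans ?_)
        change _ = ExteriorAlgebra.algebraMapInv ((frameSec I le_rfl (bF j)).1 ⟨m, hm⟩)
        rw [hframe]
        exact (mem_extFil_one.1 (ι_mem_extFil_one _)).symm
    intro V hmV f
    have h1 := congrArg (fun g => ExteriorAlgebra.algebraMapInv (g.app V hmV f)) key
    exact (halg _).symm.trans (h1.trans (halg _))
  refine ⟨fun V hmV q f hf => ?_, fun V hm f => hbody V hm f, fun V hmV f => ?_⟩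
  · have key : (h.comp (invHol I F E ⊤) trivial).map inv = h := by
      refine GermHom.ext_of_coord hm hbody b bF (fun i => ?_) (fun j => ?_)
      · have h1 := h.comp_app (invHol I F E ⊤) trivial (V := bundleDom H F E w) hm hm le_rfl le_top
          (coordSec I F E b le_rfl i)
        have h2 : (invHol I F E ⊤).sec (V := bundleDom H F E w) (V' := bundleDom H F E w) le_rfl
            le_top (coordSec I F E b le_rfl i) = coordSec I F E b le_rfl i :=
          Subtype.ext (funext fun x => AlgHom.commutes inv _)
        rw [h2] at h1
        change inv ((h.comp (invHol I F E ⊤) trivial).app _ hm _) = _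
        refine (congrArg inv h1).trans ?_
        rw [inv_of_mem (hx i), ZMod.val_zero, pow_zero, one_smul]
      · have h1 := h.comp_app (invHol I F E ⊤) trivial (V := bundleDom H F E w) hm hm le_rfl le_top
          (frameSec I le_rfl (bF j))
        have h2 : (invHol I F E ⊤).sec (V := bundleDom H F E w) (V' := bundleDom H F E w) le_rfl
            le_top (frameSec I le_rfl (bF j)) = - frameSec I le_rfl (bF j) := by
          refine Subtype.ext (funext fun x => ?_)
          change inv (ExteriorAlgebra.map (trivSymm F E w x) (ExteriorAlgebra.ι ℂ (bF j))) =
            - ExteriorAlgebra.map (trivSymm F E w x) (ExteriorAlgebra.ι ℂ (bF j))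
          rw [ExteriorAlgebra.map_apply_ι, inv_ι]
        rw [h2] at h1
        change inv ((h.comp (invHol I F E ⊤) trivial).app _ hm _) = _
        refine (congrArg inv (h1.trans (map_neg (h.app _ hm) _))).trans ?_
        rw [map_neg, inv_of_mem (hθ j), ZMod.val_one, pow_one, neg_smul, one_smul, neg_neg]
    have h1 := h.comp_app (invHol I F E ⊤) trivial (V := V) hmV hmV le_rfl le_top f
    have h2 : (invHol I F E ⊤).sec (V := V) (V' := V) le_rfl le_top f =
        (-1 : ℂ) ^ q.val • (f : exteriorSections I F E V) :=
      (mem_exteriorSheaf_parity_iff q f).1 hf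
    rw [h2] at h1
    have h3 : inv ((h.comp (invHol I F E ⊤) trivial).app V hmV f) = h.app V hmV f :=
      congrArg (fun g => g.app V hmV f) key
    have h4 := h1.trans (map_smul (h.app V hmV) _ _)
    refine mem_extParity_iff.2 ((congrArg inv h3.symm).trans ?_)
    exact (inv_inv_apply _).trans h4
  · let D : ∀ V : Opens M, V ≤ bundleDom H F E w → m ∈ V →
        exteriorSections I F E V →ₗ[ℂ] ExteriorAlgebra ℂ X := fun V _ hm =>
      ExteriorAlgebra.ι ℂ ∘ₗ (ExteriorAlgebra.ιInv ∘ₗ (h.app V hm).toLinearMap -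
        l ∘ₗ ExteriorAlgebra.ιInv ∘ₗ ((evalGerm I F (E := E) m).app V hm).toLinearMap)
    have hDa : ∀ (V : Opens M) (hV : V ≤ bundleDom H F E w) (hm : m ∈ V)
        (f : exteriorSections I F E V), D V hV hm f = ExteriorAlgebra.ι ℂ
          (ExteriorAlgebra.ιInv (h.app V hm f) - l (ExteriorAlgebra.ιInv (f.1 ⟨m, hm⟩))) :=
      fun _ _ _ _ => rfl
    let B : ∀ V : Opens M, V ≤ bundleDom H F E w → m ∈ V → exteriorSections I F E V →
        ExteriorAlgebra ℂ X := fun V _ hm f =>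
      algebraMap ℂ _ (ExteriorAlgebra.algebraMapInv (f.1 ⟨m, hm⟩))
    have hDres : ∀ (V' V : Opens M) (hVV : V' ≤ V) (hV : V ≤ bundleDom H F E w) (hm : m ∈ V')
        (f : exteriorSections I F E V), D V' (hVV.trans hV) hm (exteriorRes I F E hVV f) =
          D V hV (hVV hm) f := by
      intro V' V hVV hV hm f
      rw [hDa V' (hVV.trans hV), hDa V hV]
      exact congrArg (fun z => ExteriorAlgebra.ι ℂ (ExteriorAlgebra.ιInv z -
        l (ExteriorAlgebra.ιInv (f.1 ⟨m, hVV hm⟩)))) (h.app_res hVV hm f)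
    have hzero : ∀ t, ∀ (V : Opens M) (hV : V ≤ bundleDom H F E w) (hm : m ∈ V)
        (f : exteriorSections I F E V), D V hV hm f ∈ extFil X t := by
      intro t V hV hmV f
      refine twistedDer_mem_extFil b bF le_rfl D hDres B B (fun V hV hm f g => ?_)
        (fun V hV hm => ?_) t (fun V hV hm' i => ?_) (fun V hV hm i => ?_) (fun V hV hm' j => ?_)
        (fun V hV hm j => ?_) V hV hmV f
      · rw [hDa V hV, hDa V hV, hDa V hV]
        have h1 : h.app V hm (f * g) = h.app V hm f * h.app V hm g := map_mul (h.app V hm) _ _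
        have h2 : (f * g).1 ⟨m, hm⟩ = f.1 ⟨m, hm⟩ * g.1 ⟨m, hm⟩ := rfl
        rw [h1, h2, ιInv_mul, ιInv_mul, hbody V hm f, hbody V hm g, ← Algebra.commutes,
          ← Algebra.smul_def, ← Algebra.smul_def]
        simp only [map_sub, map_add, map_smul]
        module
      · rw [hDa V hV]
        have h1 : h.app V hm (1 : exteriorSections I F E V) = 1 := map_one (h.app V hm)
        have h2 : (1 : exteriorSections I F E V).1 ⟨m, hm⟩ = 1 := rfl
        rw [h1, h2, ← map_one (algebraMap ℂ (ExteriorAlgebra ℂ X)), ιInv_algebraMap,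
          ← map_one (algebraMap ℂ (ExteriorAlgebra ℂ (E m))), ιInv_algebraMap]
        simp
      · have h3 : D V hV hm' (coordSec I F E b hV i) = 0 := by
          have := hDres V _ hV le_rfl hm' (coordSec I F E b le_rfl i)
          refine this.trans ?_
          rw [hDa _ le_rfl, hcoord, ιInv_algebraMap, ιInv_even _ (hx i)]
          simp
        rw [h3]
        exact zero_mem _
      · have := coordSec_sub_mem (E := E) (F := F) (I := I) b hV i ⟨m, hm⟩
        rw [mem_extFil_one] at this ⊢
        change ExteriorAlgebra.algebraMapInv (algebraMap ℂ _ (ExteriorAlgebra.algebraMapInv _)) = 0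
        rw [this]
        simp
      · have h3 : D V hV hm' (frameSec I hV (bF j)) = 0 := by
          have := hDres V _ hV le_rfl hm' (frameSec I le_rfl (bF j))
          refine this.trans ?_
          rw [hDa _ le_rfl, hframe, hθl, ExteriorAlgebra.ι_leftInverse, sub_self, map_zero]
        rw [h3]
        exact zero_mem _
      · have := frameSec_mem (E := E) (F := F) (I := I) hV (bF j) ⟨m, hm⟩
        rw [mem_extFil_one] at this ⊢
        change ExteriorAlgebra.algebraMapInv (algebraMap ℂ _ (ExteriorAlgebra.algebraMapInv _)) = 0
        rw [this]
        simp
    have hVW : V ⊓ bundleDom H F E w ≤ bundleDom H F E w := inf_le_right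
    have hmW : m ∈ V ⊓ bundleDom H F E w := ⟨hmV, hm⟩
    have h1 := eq_zero_of_forall_mem_extFil
      fun t => hzero t _ hVW hmW (exteriorRes I F E inf_le_left f)
    rw [hDa _ hVW, ← map_zero (ExteriorAlgebra.ι ℂ)] at h1
    have h2 := sub_eq_zero.1 (ExteriorAlgebra.ι_leftInverse.injective h1)
    have h3 := h.app_res (inf_le_left : V ⊓ bundleDom H F E w ≤ V) hmW f
    exact (congrArg ExteriorAlgebra.ιInv h3.symm).trans h2

theorem frameSec_odd {w : M} {V : Opens M} (hV : V ≤ bundleDom H F E w) (v : F) (x : V) :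
    (frameSec I hV v : exteriorSections I F E V).1 x ∈ extParity (E x) 1 := by
  have h : ExteriorAlgebra.ι ℂ v ∈ extParity F 1 := CliffordAlgebra.ι_mem_evenOdd_one _ _
  have h' := map_mem_extParity (trivSymm F E w x.1) h
  exact h'

end Rigidity

section CompositionLaws

variable {A : Type u} [NormedAddCommGroup A] [NormedSpace ℂ A]
  {H : Type u} [TopologicalSpace H] {I : ModelWithCorners ℂ A H}
  {M : Type u} [TopologicalSpace M] [ChartedSpace H M]
  {F : Type u} [NormedAddCommGroup F] [NormedSpace ℂ F]
  {E : M → Type u} [∀ x, AddCommGroup (E x)] [∀ x, Module ℂ (E x)]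
  [TopologicalSpace (TotalSpace F E)] [∀ x, TopologicalSpace (E x)] [FiberBundle F E]
  {A' : Type u} [NormedAddCommGroup A'] [NormedSpace ℂ A']
  {H' : Type u} [TopologicalSpace H'] {I' : ModelWithCorners ℂ A' H'}
  {M' : Type u} [TopologicalSpace M'] [ChartedSpace H' M']
  {F' : Type u} [NormedAddCommGroup F'] [NormedSpace ℂ F']
  {E' : M' → Type u} [∀ x, AddCommGroup (E' x)] [∀ x, Module ℂ (E' x)]
  [TopologicalSpace (TotalSpace F' E')] [∀ x, TopologicalSpace (E' x)] [FiberBundle F' E']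
  {R : Type*} [Ring R] [Algebra ℂ R]

theorem GermHom.comp_congr {O : SuperPresheaf M} {φ : C(M', M)} {W W' W'' : Opens M'}
    {Φ : HolHom I' F' E' O φ W'} {Φ' : HolHom I' F' E' O φ W''} (h' : W ≤ W') (h'' : W ≤ W'')
    (e : ∀ y (hy : y ∈ W), Φ.germ y (h' hy) = Φ'.germ y (h'' hy)) {x : M'} (hx : x ∈ W)
    (h : GermHom (exteriorSheaf I' F' E') x R) : h.comp Φ (h' hx) = h.comp Φ' (h'' hx) := by
  ext V hV f
  have hxW : x ∈ Opens.comap φ V ⊓ W := ⟨hV, hx⟩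
  rw [h.comp_app Φ (h' hx) hV hxW inf_le_left (inf_le_right.trans h'),
    h.comp_app Φ' (h'' hx) hV hxW inf_le_left (inf_le_right.trans h'')]
  congr 1
  refine Subtype.ext (funext fun y => ?_)
  exact congrArg (fun g => g.app V y.2.1 f) (e y.1 y.2.2)

/-- Composition of a homomorphism on germs with a holomorphic family over the identity. -/
def GermHom.compId {O : SuperPresheaf M} {W : Opens M} {x : M}
    (h : GermHom (exteriorSheaf I F E) x R) (Φ : HolHom I F E O (ContinuousMap.id M) W)
    (hx : x ∈ W) : GermHom O x R := h.comp Φ hx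

theorem GermHom.Compat.compId {S : SuperData E} {W : Opens M}
    {Φ : HolHom I F E S.toSuperPresheaf (ContinuousMap.id M) W}
    (hΦ : ∀ x hx, GermHom.Compat (m := x) S (Φ.germ x hx) LinearMap.id) {X : Type*}
    [AddCommGroup X] [Module ℂ X] {x : M}
    {h : GermHom (exteriorSheaf I F E) x (ExteriorAlgebra ℂ X)} {l : E x →ₗ[ℂ] X}
    (hh : h.Compat (exteriorData I F E) l) (hx : x ∈ W) : (h.compId Φ hx).Compat S l where
  parity V _ q f hf := hh.parity _ _ q _ fun y => (hΦ y.1 y.2.2).parity _ _ q f hf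
  body V _ f := (hh.body _ _ _).trans ((hΦ x hx).body _ _ f)
  lin V _ f := (hh.lin _ _ _).trans (congrArg l ((hΦ x hx).lin _ _ f))

theorem GermHom.comp_comp {O : SuperPresheaf M} {φ : C(M', M)} {W' U' : Opens M'}
    (Ψ : HolHom I' F' E' (exteriorSheaf I' F' E') (ContinuousMap.id M') U')
    (Φ : HolHom I' F' E' O φ W') (hU : U' ≤ W') {x : M'} (hx : x ∈ U')
    (h : GermHom (exteriorSheaf I' F' E') x R) :
    h.comp (Ψ.comp Φ hU) hx = (h.compId Ψ hx).comp Φ (hU hx) := by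
  ext V hV f
  have hxU : x ∈ Opens.comap φ V ⊓ U' := ⟨hV, hx⟩
  have h1 := (h.compId Ψ hx).comp_app Φ (hU hx) hV hxU inf_le_left (inf_le_right.trans hU) f
  have h2 := h.comp_app Ψ hx (V := Opens.comap φ V ⊓ U') (V' := Opens.comap φ V ⊓ U') hxU hxU le_rfl
    inf_le_right (Φ.sec inf_le_left (inf_le_right.trans hU) f)
  have h3 := h.comp_app (Ψ.comp Φ hU) hx hV hxU inf_le_left inf_le_right f
  refine h3.trans ((congrArg (h.app _ hxU) ?_).trans (h1.trans h2).symm)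
  refine Subtype.ext (funext fun y => ?_)
  exact GermHom.comp_app (x := y.1) (Ψ.germ y.1 y.2.2) Φ (hU y.2.2) y.2.1 y.2 inf_le_left
    (inf_le_right.trans hU) f

theorem GermHom.compId_compMorphism {O : SuperPresheaf M} {O' : SuperPresheaf M'} {ψ : C(M, M')}
    {W : Opens M} (Φ : HolHom I F E O (ContinuousMap.id M) W) (p : SuperMorphism O O' ψ) {x : M}
    (hx : x ∈ W) (h : GermHom (exteriorSheaf I F E) x R) :
    (h.compId Φ hx).compMorphism p = h.comp (Φ.compMorphism p) hx := rfl

theorem GermHom.comp_compSymm {S : SuperData E} {U : Opens M} {φ : C(M', M)} {W' : Opens M'}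
    (Φ : HolHom I' F' E' S.toSuperPresheaf φ W') (τ : LocalSplitting I F S U)
    (hU : W' ≤ Opens.comap φ U) {x : M'} (hx : x ∈ W')
    (h : GermHom (exteriorSheaf I' F' E') x R) :
    (h.comp Φ hx).compSymm τ (hU hx) = h.comp (Φ.compSymm τ hU) hx := by
  refine GermHom.ext' U (hU hx) fun V hVU hV f => ?_
  have hxV : x ∈ Opens.comap φ V ⊓ W' := ⟨hV, hx⟩
  have h1 := GermHom.compSymm_app (h.comp Φ hx) τ (hU hx) hV hV le_rfl hVU f
  have h2 := h.comp_app Φ hx hV hxV inf_le_left inf_le_right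
    ((τ.eqv V hVU).symm (exteriorRes I F E le_rfl f))
  have h3 := h.comp_app (Φ.compSymm τ hU) hx hV hxV inf_le_left inf_le_right f
  refine (h1.trans h2).trans (Eq.trans (congrArg (h.app _ hxV) ?_) h3.symm)
  refine Subtype.ext (funext fun y => ?_)
  exact (GermHom.compSymm_app (Φ.germ y.1 y.2.2) τ (hU y.2.2) y.2.1 y.2.1 le_rfl hVU f).symm

theorem GermHom.compSymm_compId {S : SuperData E} {U : Opens M} (τ : LocalSplitting I F S U) {x : M}
    (hx : x ∈ U) (h : GermHom S.toSuperPresheaf x R) :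
    (h.compSymm τ hx).compId (HolHom.ofSplitting τ) hx = h := by
  refine GermHom.ext' U hx fun V hVU hV f => ?_
  have h1 := (h.compSymm τ hx).comp_app (HolHom.ofSplitting τ) hx (V := V) (V' := V) hV hV le_rfl
    hVU f
  refine h1.trans ?_
  have h2 : (HolHom.ofSplitting τ).sec (V := V) (V' := V) le_rfl hVU f = τ.eqv V hVU f := by
    refine Subtype.ext (funext fun y => ?_)
    refine (τ.germ_app hVU le_rfl y y.2 f).trans ?_
    rw [S.res_self]
  rw [h2]
  refine (h.compSymm_app τ hx hV hV le_rfl hVU _).trans ?_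
  have h4 : exteriorRes I F E le_rfl (τ.eqv V hVU f) = τ.eqv V hVU f := rfl
  rw [h4, AlgEquiv.symm_apply_apply]

theorem GermHom.compId_compSymm {S : SuperData E} {U : Opens M} (τ : LocalSplitting I F S U) {x : M}
    (hx : x ∈ U) (h : GermHom (exteriorSheaf I F E) x R) :
    (h.compId (HolHom.ofSplitting τ) hx).compSymm τ hx = h := by
  refine GermHom.ext' U hx fun V hVU hV f => ?_
  refine (GermHom.compSymm_app _ τ hx hV hV le_rfl hVU f).trans ?_
  refine (h.comp_app (HolHom.ofSplitting τ) hx (V := V) (V' := V) hV hV le_rfl hVU _).trans ?_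
  congr 1
  refine Subtype.ext (funext fun y => ?_)
  refine (τ.germ_app hVU le_rfl y y.2 _).trans ?_
  rw [S.res_self, AlgEquiv.apply_symm_apply]
  rfl

end CompositionLaws

/-! ### Gluing of exterior algebra sheaves -/

section Cocycles

variable {A : Type u} [NormedAddCommGroup A] [NormedSpace ℂ A]
  {H : Type u} [TopologicalSpace H] {I : ModelWithCorners ℂ A H}
  {M : Type u} [TopologicalSpace M] [ChartedSpace H M]
  {F : Type u} [NormedAddCommGroup F] [NormedSpace ℂ F]
  {E : M → Type u} [∀ x, AddCommGroup (E x)] [∀ x, Module ℂ (E x)]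
  [TopologicalSpace (TotalSpace F E)] [∀ x, TopologicalSpace (E x)] [FiberBundle F E]

variable (I F E) in
/-- A cocycle of automorphisms of the sheaf of sections of the exterior algebra bundle which induce
the identity on the associated graded sheaf. The cover is indexed by the points of the base. -/
structure GluingCocycle where
  dom : M → Opens M
  mem_dom : ∀ x, x ∈ dom x
  map : ∀ (i j : M) (V : Opens M), V ≤ dom i → V ≤ dom j →
    exteriorSections I F E V →ₐ[ℂ] exteriorSections I F E V
  map_res : ∀ (i j : M) {W V : Opens M} (h : W ≤ V) (hi : V ≤ dom i) (hj : V ≤ dom j)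
    (f : exteriorSections I F E V),
    map i j W (h.trans hi) (h.trans hj) (exteriorRes I F E h f) =
      exteriorRes I F E h (map i j V hi hj f)
  map_self : ∀ (i : M) (V : Opens M) (hi : V ≤ dom i) (f : exteriorSections I F E V),
    map i i V hi hi f = f
  map_map : ∀ (i j k : M) (V : Opens M) (hi : V ≤ dom i) (hj : V ≤ dom j) (hk : V ≤ dom k)
    (f : exteriorSections I F E V), map i j V hi hj (map j k V hj hk f) = map i k V hi hk f
  map_parity : ∀ (i j : M) (V : Opens M) (hi : V ≤ dom i) (hj : V ≤ dom j) (q : ZMod 2)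
    (f : exteriorSections I F E V), (∀ x : V, f.1 x ∈ extParity (E x) q) →
      ∀ x : V, (map i j V hi hj f).1 x ∈ extParity (E x) q
  map_body : ∀ (i j : M) (V : Opens M) (hi : V ≤ dom i) (hj : V ≤ dom j)
    (f : exteriorSections I F E V) (x : V), ExteriorAlgebra.algebraMapInv
      ((map i j V hi hj f).1 x) = ExteriorAlgebra.algebraMapInv (f.1 x)
  map_lin : ∀ (i j : M) (V : Opens M) (hi : V ≤ dom i) (hj : V ≤ dom j)
    (f : exteriorSections I F E V) (x : V), ExteriorAlgebra.ιInv
      ((map i j V hi hj f).1 x) = ExteriorAlgebra.ιInv (f.1 x)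

namespace GluingCocycle

variable (C : GluingCocycle I F E)

theorem map_invSec (i j : M) (V : Opens M) (hi : V ≤ C.dom i) (hj : V ≤ C.dom j)
    (f : exteriorSections I F E V) :
    C.map i j V hi hj (invSec I F E V f) = invSec I F E V (C.map i j V hi hj f) := by
  have hint : DirectSum.IsInternal ((exteriorSheaf I F E).parity V) :=
    isInternal_of_involution (B := exteriorSections I F E V)
      (invSec I F E V).toLinearMap (fun f => Subtype.ext (funext fun x => inv_inv_apply _))
      mem_exteriorSheaf_parity_iff
  obtain ⟨a, ha, b, hb, e⟩ := exists_add_of_isInternal hint f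
  have key : ∀ (q : ZMod 2) (a : exteriorSections I F E V),
      (a : (exteriorSheaf I F E).Sec V) ∈ (exteriorSheaf I F E).parity V q →
      C.map i j V hi hj (invSec I F E V a) = invSec I F E V (C.map i j V hi hj a) := by
    intro q a ha
    have h1 := (mem_exteriorSheaf_parity_iff q a).1 ha
    have h2 := (mem_exteriorSheaf_parity_iff q _).1 (C.map_parity i j V hi hj q a ha)
    rw [h1, h2, map_smul]
  let a' : exteriorSections I F E V := a
  let b' : exteriorSections I F E V := b
  have e' : f = a' + b' := e
  rw [e', map_add, map_add, map_add, map_add, key 0 a' ha, key 1 b' hb]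

/-- The sections of the glued sheaf: compatible families of sections on the members of the cover. -/
def sections (V : Opens M) : Subalgebra ℂ (∀ i : M, exteriorSections I F E (V ⊓ C.dom i)) where
  carrier := {s | ∀ (i j : M) (W : Opens M) (hV : W ≤ V) (hi : W ≤ C.dom i) (hj : W ≤ C.dom j),
    C.map i j W hi hj (exteriorRes I F E (le_inf hV hj) (s j)) =
      exteriorRes I F E (le_inf hV hi) (s i)}
  mul_mem' ha hb i j W hV hi hj := by
    simp only [Pi.mul_apply, map_mul]
    rw [ha i j W hV hi hj, hb i j W hV hi hj]
  add_mem' ha hb i j W hV hi hj := by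
    simp only [Pi.add_apply, map_add]
    rw [ha i j W hV hi hj, hb i j W hV hi hj]
  algebraMap_mem' r i j W hV hi hj := by
    simp only [Pi.algebraMap_apply, AlgHom.commutes]

/-- Restriction of sections of the glued sheaf. -/
def sectionsRes {W V : Opens M} (h : W ≤ V) : C.sections V →ₐ[ℂ] C.sections W :=
  ((AlgHom.pi fun i => (exteriorRes I F E (inf_le_inf_right (C.dom i) h)).comp
    (Pi.evalAlgHom ℂ (fun i => exteriorSections I F E (V ⊓ C.dom i)) i)).comp
      (C.sections V).val).codRestrict _ fun s i j W' hV hi hj => s.2 i j W' (hV.trans h) hi hj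

/-- The grade involution of the glued sheaf. -/
def sectionsInv (V : Opens M) : C.sections V →ₐ[ℂ] C.sections V :=
  ((AlgHom.pi fun i => (invSec I F E (V ⊓ C.dom i)).comp
    (Pi.evalAlgHom ℂ (fun i => exteriorSections I F E (V ⊓ C.dom i)) i)).comp
      (C.sections V).val).codRestrict _ fun s i j W' hV hi hj => by
    have h1 := C.map_invSec i j W' hi hj (exteriorRes I F E (le_inf hV hj) (s.1 j))
    rw [s.2 i j W' hV hi hj] at h1
    exact h1

/-- The glued presheaf of superalgebras. -/
def presheaf : SuperPresheaf M where
  alg :=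
    { obj := fun U => AlgCat.of ℂ (C.sections U.unop)
      map := fun h => AlgCat.ofHom (C.sectionsRes h.unop.le)
      map_id := fun _ => rfl
      map_comp := fun _ _ => rfl }
  parity U q :=
    { carrier := {s : C.sections U | ∀ (i : M) (x : (U ⊓ C.dom i : Opens M)),
        (s.1 i).1 x ∈ extParity (E x) q}
      add_mem' := fun ha hb i x => add_mem (ha i x) (hb i x)
      zero_mem' := fun _ _ => zero_mem _
      smul_mem' := fun c _ ha i x => Submodule.smul_mem _ c (ha i x) }

theorem presheaf_isSheaf : C.presheaf.alg.IsSheaf := by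
  refine isSheaf_of_existsUnique_gluing _ fun J U sf hsf => ?_
  let sf' : ∀ k, C.sections (U k) := sf
  have hsf' : ∀ k l i (x : M) (hi : x ∈ C.dom i) (hk : x ∈ U k) (hl : x ∈ U l),
      ((sf' k).1 i).1 ⟨x, hk, hi⟩ = ((sf' l).1 i).1 ⟨x, hl, hi⟩ := fun k l i x hi hk hl =>
    congrFun (congrArg Subtype.val (congrFun (congrArg Subtype.val
      (show C.sectionsRes (inf_le_left : U k ⊓ U l ≤ U k) (sf' k) =
        C.sectionsRes inf_le_right (sf' l) from hsf k l)) i)) ⟨x, ⟨hk, hl⟩, hi⟩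
  have hx : ∀ x : (iSup U : Opens M), ∃ k, x.1 ∈ U k := fun x => Opens.mem_iSup.1 x.2
  choose k hk using hx
  let s : ∀ i, exteriorSections I F E (iSup U ⊓ C.dom i) := fun i =>
    ⟨fun x => ((sf' (k ⟨x.1, x.2.1⟩)).1 i).1 ⟨x.1, hk ⟨x.1, x.2.1⟩, x.2.2⟩, by
      refine mem_exteriorSections_of_locally fun x hx => ?_
      refine ⟨U (k ⟨x, hx.1⟩) ⊓ C.dom i, inf_le_inf_right _ (le_iSup U _),
        ⟨hk ⟨x, hx.1⟩, hx.2⟩, ?_⟩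
      convert ((sf' (k ⟨x, hx.1⟩)).1 i).2 using 1
      ext y
      exact hsf' (k ⟨y.1, le_iSup U _ y.2.1⟩) (k ⟨x, hx.1⟩) i y.1 y.2.2
        (hk ⟨y.1, le_iSup U _ y.2.1⟩) y.2.1⟩
  have hs : s ∈ C.sections (iSup U) := by
    intro i j W hV hi hj
    refine Subtype.ext (funext fun x => ?_)
    let l := k ⟨x.1, hV x.2⟩
    have hxl : x.1 ∈ U l := hk ⟨x.1, hV x.2⟩
    let W' := W ⊓ U l
    have hW' : W' ≤ W := inf_le_left
    have h1 := (sf' l).2 i j W' inf_le_right (hW'.trans hi) (hW'.trans hj)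
    have h2 := C.map_res i j hW' hi hj (exteriorRes I F E (le_inf hV hj) (s j))
    have h3 : exteriorRes I F E hW' (exteriorRes I F E (le_inf hV hj) (s j)) =
        exteriorRes I F E (le_inf inf_le_right (hW'.trans hj)) ((sf' l).1 j) :=
      Subtype.ext (funext fun y => hsf' (k ⟨y.1, hV (hW' y.2)⟩) l j y.1 (hj (hW' y.2))
        (hk ⟨y.1, hV (hW' y.2)⟩) y.2.2)
    rw [h3, h1] at h2
    exact (congrFun (congrArg Subtype.val h2) ⟨x.1, x.2, hxl⟩).symm
  refine ⟨(⟨s, hs⟩ : C.sections (iSup U)), fun l => ?_, fun t ht => ?_⟩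
  · refine Subtype.ext (funext fun i => Subtype.ext (funext fun y => ?_))
    exact hsf' (k ⟨y.1, le_iSup U l y.2.1⟩) l i y.1 y.2.2
      (hk ⟨y.1, le_iSup U l y.2.1⟩) y.2.1
  · refine Subtype.ext (funext fun i => Subtype.ext (funext fun y => ?_))
    exact congrFun (congrArg Subtype.val (congrFun (congrArg Subtype.val
      (show C.sectionsRes (le_iSup U _) t = sf' _ from ht (k ⟨y.1, y.2.1⟩))) i))
      ⟨y.1, hk ⟨y.1, y.2.1⟩, y.2.2⟩

theorem mem_presheaf_parity_iff {U : Opens M} (q : ZMod 2) (s : C.sections U) :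
    (s : C.presheaf.Sec U) ∈ C.presheaf.parity U q ↔
      C.sectionsInv U s = (-1 : ℂ) ^ q.val • s := by
  constructor
  · intro h
    exact Subtype.ext (funext fun i => Subtype.ext (funext fun x => mem_extParity_iff.1 (h i x)))
  · intro h i x
    exact mem_extParity_iff.2
      (congrFun (congrArg Subtype.val (congrFun (congrArg Subtype.val h) i)) x)

/-- The glued superfunctions. At a point `x`, the classes modulo the second step of the filtration
are read off in the member of the cover with index `x`. -/
def superData : SuperData E where
  toSuperPresheaf := C.presheaf
  body U := AlgHom.comp (AlgHom.pi fun x : U => ExteriorAlgebra.algebraMapInv.comp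
    (((Pi.evalAlgHom ℂ (fun y : (U ⊓ C.dom x.1 : Opens M) => ExteriorAlgebra ℂ (E y))
      ⟨x.1, x.2, C.mem_dom x.1⟩).comp (exteriorSections I F E (U ⊓ C.dom x.1)).val).comp
      (Pi.evalAlgHom ℂ (fun i => exteriorSections I F E (U ⊓ C.dom i)) x.1))) (C.sections U).val
  lin U :=
    { toFun := fun (s : C.sections U) x =>
        ExteriorAlgebra.ιInv ((s.1 x.1).1 ⟨x.1, x.2, C.mem_dom x.1⟩)
      map_add' := fun _ _ => funext fun _ => map_add ExteriorAlgebra.ιInv _ _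
      map_smul' := fun c _ => funext fun _ => map_smul ExteriorAlgebra.ιInv c _ }

/-- Over a member of the cover, the glued superfunctions are the sections of the exterior algebra
bundle. -/
def splitting (i : M) : LocalSplitting I F C.superData (C.dom i) where
  toEquiv V := AlgEquiv.ofBijective
    ((exteriorRes I F E (le_inf le_rfl V.2)).comp
      ((Pi.evalAlgHom ℂ (fun i => exteriorSections I F E (V.1 ⊓ C.dom i)) i).comp
        (C.sections V.1).val)) (by
    constructor
    · intro s s' e
      have e' : exteriorRes I F E (le_inf le_rfl V.2) (s.1 i) =
        exteriorRes I F E (le_inf le_rfl V.2) (s'.1 i) := e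
      refine Subtype.ext (funext fun j => ?_)
      have h1 := s.2 j i (V.1 ⊓ C.dom j) inf_le_left inf_le_right (inf_le_left.trans V.2)
      have h2 := s'.2 j i (V.1 ⊓ C.dom j) inf_le_left inf_le_right (inf_le_left.trans V.2)
      have e2 := congrArg (exteriorRes I F E (inf_le_left : V.1 ⊓ C.dom j ≤ V.1)) e'
      have e3 : exteriorRes I F E (le_inf inf_le_left (inf_le_left.trans V.2) :
          V.1 ⊓ C.dom j ≤ V.1 ⊓ C.dom i) (s.1 i) =
        exteriorRes I F E (le_inf inf_le_left (inf_le_left.trans V.2)) (s'.1 i) := e2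
      rw [e3, h2] at h1
      exact h1.symm
    · intro f
      refine ⟨⟨fun j => C.map j i (V.1 ⊓ C.dom j) inf_le_right (inf_le_left.trans V.2)
        (exteriorRes I F E inf_le_left f), fun j k W hV hj hk => ?_⟩, ?_⟩
      · rw [← C.map_res k i, C.map_map, ← C.map_res j i]
        rfl
      · change exteriorRes I F E (le_inf le_rfl V.2) (C.map i i _ _ _ _) = f
        rw [C.map_self]
        rfl)
  toEquiv_res _ _ _ _ := rfl
  toEquiv_parity V q s := by
    let s' : C.sections V.1 := s
    constructor
    · intro h j x
      have h1 := s'.2 j i (V.1 ⊓ C.dom j) inf_le_left inf_le_right (inf_le_left.trans V.2)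
      have h2 := C.map_parity j i (V.1 ⊓ C.dom j) inf_le_right (inf_le_left.trans V.2) q
        (exteriorRes I F E (le_inf inf_le_left (inf_le_left.trans V.2)) (s'.1 i))
        (fun x => h ⟨x.1, x.2.1⟩) x
      rw [h1] at h2
      exact h2
    · intro h x
      exact h i ⟨x.1, x.2, V.2 x.2⟩
  body_eq V s x := by
    let s' : C.sections V.1 := s
    have hW : V.1 ⊓ C.dom x.1 ≤ C.dom i := inf_le_left.trans V.2
    have h1 := s'.2 x.1 i (V.1 ⊓ C.dom x.1) inf_le_left inf_le_right hW
    have h2 := C.map_body x.1 i (V.1 ⊓ C.dom x.1) inf_le_right hW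
      (exteriorRes I F E (le_inf inf_le_left hW) (s'.1 i)) ⟨x.1, x.2, C.mem_dom x.1⟩
    rw [h1] at h2
    exact h2
  lin_eq V s x := by
    let s' : C.sections V.1 := s
    have hW : V.1 ⊓ C.dom x.1 ≤ C.dom i := inf_le_left.trans V.2
    have h1 := s'.2 x.1 i (V.1 ⊓ C.dom x.1) inf_le_left inf_le_right hW
    have h2 := C.map_lin x.1 i (V.1 ⊓ C.dom x.1) inf_le_right hW
      (exteriorRes I F E (le_inf inf_le_left hW) (s'.1 i)) ⟨x.1, x.2, C.mem_dom x.1⟩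
    rw [h1] at h2
    exact h2

/-- The supermanifold which is glued from exterior algebra sheaves along a cocycle. -/
def supermanifold [IsManifold I ω M] [VectorBundle ℂ F E] [ContMDiffVectorBundle ω F E I] :
    Supermanifold I F E where
  toSuperData := C.superData
  isSheaf := C.presheaf_isSheaf
  parity_res h _ _ hs i x := hs i ⟨x.1, h x.2.1, x.2.2⟩
  parity_isInternal U := isInternal_of_involution (B := C.sections U)
    (C.sectionsInv U).toLinearMap (fun _ => Subtype.ext (funext fun _ =>
      Subtype.ext (funext fun _ => inv_inv_apply _))) C.mem_presheaf_parity_iff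
  parity_graded _ :=
    { one_mem := fun _ _ => SetLike.GradedOne.one_mem
      mul_mem := fun _ _ _ _ ha hb i x => SetLike.GradedMul.mul_mem (ha i x) (hb i x) }
  supercomm _ _ _ _ _ hf hg := Subtype.ext (funext fun i =>
    Subtype.ext (funext fun x => extParity_mul_comm (hf i x) (hg i x)))
  body_res _ _ _ := rfl
  lin_res _ _ _ := rfl
  exists_splitting x := ⟨C.dom x, C.mem_dom x, ⟨C.splitting x⟩⟩

end GluingCocycle

end Cocycles

/-! ### Morphisms from a glued supermanifold -/

section GluedMorphisms

variable {A : Type u} [NormedAddCommGroup A] [NormedSpace ℂ A]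
  {H : Type u} [TopologicalSpace H] {I : ModelWithCorners ℂ A H}
  {M : Type u} [TopologicalSpace M] [ChartedSpace H M]
  {F : Type u} [NormedAddCommGroup F] [NormedSpace ℂ F]
  {E : M → Type u} [∀ x, AddCommGroup (E x)] [∀ x, Module ℂ (E x)]
  [TopologicalSpace (TotalSpace F E)] [∀ x, TopologicalSpace (E x)] [FiberBundle F E]
  {A' : Type u} [NormedAddCommGroup A'] [NormedSpace ℂ A']
  {H' : Type u} [TopologicalSpace H'] {I' : ModelWithCorners ℂ A' H'}
  {M' : Type u} [TopologicalSpace M'] [ChartedSpace H' M']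
  {F' : Type u} [NormedAddCommGroup F'] [NormedSpace ℂ F']
  {E' : M' → Type u} [∀ x, AddCommGroup (E' x)] [∀ x, Module ℂ (E' x)]
  [TopologicalSpace (TotalSpace F' E')] [∀ x, TopologicalSpace (E' x)] [FiberBundle F' E']

theorem LocalSplitting.eqv_apply {S : SuperData E} {U : Opens M} (τ : LocalSplitting I F S U)
    {V : Opens M} (hV : V ≤ U) (f : S.Sec V) (x : V) :
    (τ.eqv V hV f).1 x = (τ.germ x.1 (hV x.2)).app V x.2 f := by
  refine Eq.symm ((τ.germ_app hV le_rfl x x.2 f).trans ?_)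
  rw [S.res_self]

theorem HolHom.ofSplitting_sec {S : SuperData E} {U : Opens M} (τ : LocalSplitting I F S U)
    {V : Opens M} (hV : V ≤ U) (f : S.Sec V) :
    (HolHom.ofSplitting τ).sec (V := V) (V' := V) le_rfl hV f = τ.eqv V hV f :=
  Subtype.ext (funext fun y => (τ.eqv_apply hV f y).symm)

/-- A morphism to a glued supermanifold, from compatible homomorphisms over the members of the
cover. -/
def GluingCocycle.lift (C : GluingCocycle I F E) {O : SuperPresheaf M'} {φ : C(M, M')}
    (a : ∀ i, HolHom I F E O φ (C.dom i))
    (ha : ∀ (i j : M) (V : Opens M') (V' : Opens M) (hV : V' ≤ Opens.comap φ V)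
      (hi : V' ≤ C.dom i) (hj : V' ≤ C.dom j) (f : O.Sec V),
      C.map i j V' hi hj ((a j).sec hV hj f) = (a i).sec hV hi f)
    (hp : ∀ i x (hx : x ∈ C.dom i) (V : Opens M') (hV : φ x ∈ V) (q : ZMod 2) (f : O.Sec V),
      f ∈ O.parity V q → ((a i).germ x hx).app V hV f ∈ extParity (E x) q) :
    SuperMorphism C.presheaf O φ where
  star W := AlgHom.codRestrict (AlgHom.pi fun i : M =>
      ((a i).sec inf_le_left inf_le_right : O.Sec W →ₐ[ℂ] _)) (C.sections (Opens.comap φ W))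
    fun f i j W' hV hi hj => ha i j W W' hV hi hj f
  star_res {V W} h f := Subtype.ext (funext fun i => Subtype.ext (funext fun x =>
    ((a i).germ x.1 x.2.2).app_res h x.2.1 f))
  star_parity W q f hf i x := hp i x.1 x.2.2 W x.2.1 q f hf

theorem GluingCocycle.lift_compat (C : GluingCocycle I F E) {S' : SuperData E'} {φ : C(M, M')}
    (a : ∀ i, HolHom I F E S'.toSuperPresheaf φ (C.dom i))
    (ha : ∀ (i j : M) (V : Opens M') (V' : Opens M) (hV : V' ≤ Opens.comap φ V)
      (hi : V' ≤ C.dom i) (hj : V' ≤ C.dom j) (f : S'.Sec V),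
      C.map i j V' hi hj ((a j).sec hV hj f) = (a i).sec hV hi f)
    {l : ∀ x, E' (φ x) →ₗ[ℂ] E x} (hl : ∀ i x hx, ((a i).germ x hx).Compat S' (l x)) :
    (C.lift a ha fun i x hx => (hl i x hx).parity).Compat C.superData S' l where
  body W f x := (hl x.1 x.1 (C.mem_dom x.1)).body W x.2 f
  lin W f x := (hl x.1 x.1 (C.mem_dom x.1)).lin W x.2 f

/-- Pullback along a bundle map after a splitting. -/
def BundlePull.holSplitting {φ : C(M, M')} (Q : BundlePull I' F' E' I F E φ) {S : SuperData E'}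
    {U : Opens M'} (τ : LocalSplitting I' F' S U) {W : Opens M} (h : W ≤ Opens.comap φ U) :
    HolHom I F E S.toSuperPresheaf φ W where
  germ y hy := (τ.germ (φ y) (h hy)).map (ExteriorAlgebra.map (Q.lin y))
  hol V V' hV hW f := (Q.sec (V := V ⊓ U) (le_inf hV (hW.trans h))
    (τ.eqv (V ⊓ U) inf_le_right (S.res inf_le_left f))).2

theorem BundlePull.holSplitting_compSymm {φ : C(M, M')} (Q : BundlePull I' F' E' I F E φ)
    {S : SuperData E'} {U : Opens M'} (τ : LocalSplitting I' F' S U) {W : Opens M}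
    (h : W ≤ Opens.comap φ U) (y : M) (hy : y ∈ W) :
    ((Q.holSplitting τ h).germ y hy).compSymm τ (h hy) = (Q.hol ⊤).germ y trivial :=
  congrArg (fun g => g.map (ExteriorAlgebra.map (Q.lin y))) (GermHom.compSymm_germ τ (h hy))

theorem BundlePull.holSplitting_compat [IsManifold I' ω M'] [VectorBundle ℂ F' E']
    [ContMDiffVectorBundle ω F' E' I'] {φ : C(M, M')} (Q : BundlePull I' F' E' I F E φ)
    (N : Supermanifold I' F' E') {U : Opens M'} (τ : LocalSplitting I' F' N.toSuperData U)
    {W : Opens M} (h : W ≤ Opens.comap φ U) (y : M) (hy : y ∈ W) :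
    ((Q.holSplitting τ h).germ y hy).Compat N.toSuperData (Q.lin y) where
  parity V hV q f hf :=
    map_mem_extParity (Q.lin y) ((N.germ_compat τ (φ y) (h hy)).parity V hV q f hf)
  body V hV f := (algebraMapInv_map _ _).trans ((N.germ_compat τ (φ y) (h hy)).body V hV f)
  lin V hV f := (ιInv_map _ _).trans
    (congrArg (Q.lin y) ((N.germ_compat τ (φ y) (h hy)).lin V hV f))

/-- Pullback of sections along a bundle map, as a morphism of superalgebra sheaves. -/
def BundlePull.morphism {φ : C(M, M')} (Q : BundlePull I' F' E' I F E φ) :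
    SuperMorphism (exteriorSheaf I F E) (exteriorSheaf I' F' E') φ where
  star _ := Q.sec le_rfl
  star_res _ _ := rfl
  star_parity _ _ _ hf x := map_mem_extParity (Q.lin x.1) (hf ⟨φ x.1, x.2⟩)

theorem BundlePull.morphism_compat {φ : C(M, M')} (Q : BundlePull I' F' E' I F E φ) :
    Q.morphism.Compat (exteriorData I F E) (exteriorData I' F' E') Q.lin where
  body _ _ _ := algebraMapInv_map _ _
  lin _ _ _ := ιInv_map _ _

theorem BundlePull.compMorphism_morphism {φ : C(M, M')} (Q : BundlePull I' F' E' I F E φ) {x : M}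
    {R : Type*} [Ring R] [Algebra ℂ R] (h : GermHom (exteriorSheaf I F E) x R) :
    h.compMorphism Q.morphism = h.comp (Q.hol ⊤) trivial := by
  ext V hV f
  exact (h.comp_app (Q.hol ⊤) trivial hV (V' := Opens.comap φ V) hV le_rfl le_top f).symm

/-- A homomorphism on germs is determined on pullbacks of sections by its values on the pullbacks
of superfunctions. -/
theorem BundlePull.comp_hol_eq {φ : C(M, M')} (Q : BundlePull I' F' E' I F E φ) {S : SuperData E'}
    {U : Opens M'} (τ : LocalSplitting I' F' S U) {W : Opens M} (h : W ≤ Opens.comap φ U) {x : M}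
    (hx : x ∈ W) {R : Type*} [Ring R] [Algebra ℂ R] (g : GermHom (exteriorSheaf I F E) x R) :
    (g.comp (Q.holSplitting τ h) hx).compSymm τ (h hx) = g.comp (Q.hol ⊤) trivial :=
  (GermHom.comp_compSymm _ τ h hx g).trans (GermHom.comp_congr (W := W) le_rfl le_top
    (fun y hy => Q.holSplitting_compSymm τ h y hy) hx g)

end GluedMorphisms

/-! ### Locality of the filtration and of sheaf endomorphisms -/

section Locality

namespace SuperPresheaf

variable {M : Type u} [TopologicalSpace M] {O : SuperPresheaf M}

theorem res_mem_span {W V : Opens M} (h : W ≤ V) {k : ℕ} {f : O.Sec V}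
    (hf : f ∈ Ideal.span {g : O.Sec V |
      ∃ n : Fin k → O.Sec V, (∀ i, IsNilpotent (n i)) ∧ g = (List.ofFn n).prod}) :
    O.res h f ∈ Ideal.span {g : O.Sec W |
      ∃ n : Fin k → O.Sec W, (∀ i, IsNilpotent (n i)) ∧ g = (List.ofFn n).prod} := by
  have h1 := Ideal.mem_map_of_mem (O.res h) hf
  rw [Ideal.map_span] at h1
  refine Ideal.span_mono ?_ h1
  rintro _ ⟨_, ⟨n, hn, rfl⟩, rfl⟩
  refine ⟨fun i => O.res h (n i), fun i => (hn i).map _, ?_⟩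
  rw [map_list_prod, List.map_ofFn]
  rfl

theorem res_mem_filtration {W V : Opens M} (h : W ≤ V) {k : ℕ} {f : O.Sec V}
    (hf : f ∈ O.filtration k V) : O.res h f ∈ O.filtration k W := by
  intro x hx
  obtain ⟨V', hV', hxV', hf⟩ := hf x (h hx)
  refine ⟨W ⊓ V', inf_le_left, ⟨hx, hxV'⟩, ?_⟩
  have h1 := res_mem_span (inf_le_right : W ⊓ V' ≤ V') hf
  rw [O.res_res] at h1 ⊢
  exact h1

theorem add_mem_filtration {V : Opens M} {k : ℕ} {f g : O.Sec V} (hf : f ∈ O.filtration k V)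
    (hg : g ∈ O.filtration k V) : f + g ∈ O.filtration k V := by
  intro x hx
  obtain ⟨W, h, hxW, hf⟩ := hf x hx
  obtain ⟨W', h', hxW', hg⟩ := hg x hx
  refine ⟨W ⊓ W', inf_le_left.trans h, ⟨hxW, hxW'⟩, ?_⟩
  have h1 := res_mem_span (inf_le_left : W ⊓ W' ≤ W) hf
  have h2 := res_mem_span (inf_le_right : W ⊓ W' ≤ W') hg
  rw [O.res_res] at h1 h2
  rw [map_add]
  exact add_mem h1 h2

theorem mem_filtration_of_locally {V : Opens M} {k : ℕ} {f : O.Sec V}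
    (hf : ∀ x ∈ V, ∃ (W : Opens M) (h : W ≤ V), x ∈ W ∧ O.res h f ∈ O.filtration k W) :
    f ∈ O.filtration k V := by
  intro x hx
  obtain ⟨W, h, hxW, hf⟩ := hf x hx
  obtain ⟨W', h', hxW', hf⟩ := hf x hxW
  rw [O.res_res] at hf
  exact ⟨W', h'.trans h, hxW', hf⟩

theorem raisesDegree_of_locally {U : Opens M} {X : O.sheafEnd U} {t : ℕ}
    (h : ∀ x ∈ U, ∃ (W : Opens M) (hW : W ≤ U), x ∈ W ∧ RaisesDegree t (endRestrict hW X)) :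
    RaisesDegree t X := by
  intro V k f hf
  refine mem_filtration_of_locally fun x hx => ?_
  obtain ⟨W, hW, hxW, h⟩ := h x (V.2 hx)
  refine ⟨V.1 ⊓ W, inf_le_left, ⟨hx, hxW⟩, ?_⟩
  have h1 := h ⟨V.1 ⊓ W, inf_le_right⟩ k _ (res_mem_filtration inf_le_left hf)
  have h2 := X.2 V ⟨V.1 ⊓ W, inf_le_left.trans V.2⟩ inf_le_left f
  rw [← h2]
  exact h1

theorem endRestrict_mem_homDer {W U : Opens M} (h : W ≤ U) {p : ZMod 2} {X : O.sheafEnd U}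
    (hX : X ∈ O.homDer p U) : endRestrict h X ∈ O.homDer p W :=
  ⟨fun V q f hf => hX.1 ⟨V.1, V.2.trans h⟩ q f hf,
    fun V q f g hf => hX.2 ⟨V.1, V.2.trans h⟩ q f g hf⟩

/-- Endomorphisms over the members of an open cover which agree on the overlaps are the
restrictions of a global one. -/
theorem exists_sheafEnd (hO : O.alg.IsSheaf) (W : M → Opens M) (hW : ∀ x, x ∈ W x)
    (D : ∀ x, O.sheafEnd (W x))
    (hD : ∀ (x y : M) (V : Opens M) (h : V ≤ W x) (h' : V ≤ W y),
      (D x).1 ⟨V, h⟩ = (D y).1 ⟨V, h'⟩) :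
    ∃ X : O.sheafEnd ⊤, ∀ x, endRestrict le_top X = D x := by
  have hex : ∀ (V : Opens M) (f : O.Sec V), ∃ s : O.Sec V, ∀ x : V,
      O.res (inf_le_left : V ⊓ W x ≤ V) s =
        (D x.1).1 ⟨V ⊓ W x, inf_le_right⟩ (O.res inf_le_left f) := by
    intro V f
    refine O.exists_gluing hO (fun x : V => V ⊓ W x) (fun x => inf_le_left)
      (fun x => ⟨x.2, hW x.1⟩) (fun x => (D x.1).1 ⟨V ⊓ W x, inf_le_right⟩ (O.res inf_le_left f))
      fun x y => ?_
    have h1 := (D x.1).2 ⟨V ⊓ W x, inf_le_right⟩ ⟨(V ⊓ W x) ⊓ (V ⊓ W y),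
      inf_le_left.trans inf_le_right⟩ inf_le_left (O.res inf_le_left f)
    have h2 := (D y.1).2 ⟨V ⊓ W y, inf_le_right⟩ ⟨(V ⊓ W x) ⊓ (V ⊓ W y),
      inf_le_right.trans inf_le_right⟩ inf_le_right (O.res inf_le_left f)
    rw [O.res_res] at h1 h2
    rw [← h1, ← h2, hD x.1 y.1]
  have huniq : ∀ {V : Opens M} {s s' : O.Sec V}, (∀ x : V,
      O.res (inf_le_left : V ⊓ W x ≤ V) s = O.res (inf_le_left : V ⊓ W x ≤ V) s') → s = s' :=
    fun {V _ _} h => O.eq_of_locally hO fun x hx => ⟨V ⊓ W x, inf_le_left, ⟨hx, hW x⟩, h ⟨x, hx⟩⟩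
  choose s hs using hex
  let X : ∀ V : {V : Opens M // V ≤ ⊤}, Module.End ℂ (O.Sec V.1) := fun V =>
    { toFun := s V.1
      map_add' := fun f g => huniq fun x => by
        rw [map_add, hs, hs, hs, map_add, map_add]
      map_smul' := fun c f => huniq fun x => by
        rw [RingHom.id_apply, map_smul, hs, hs, map_smul, map_smul] }
  have hX : X ∈ O.sheafEnd ⊤ := by
    intro V V' h f
    refine huniq fun x => ?_
    change O.res _ (s V'.1 (O.res h f)) = O.res _ (O.res h (s V.1 f))
    have h1 := hs V.1 f ⟨x.1, h x.2⟩
    have h2 := (D x.1).2 ⟨V.1 ⊓ W x, inf_le_right⟩ ⟨V'.1 ⊓ W x, inf_le_right⟩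
      (inf_le_inf_right _ h) (O.res inf_le_left f)
    have h3 := congrArg (O.res (inf_le_inf_right (W x.1) h)) h1
    rw [hs, O.res_res]
    rw [O.res_res] at h2 h3
    rw [O.res_res]
    exact h2.trans h3.symm
  refine ⟨⟨X, hX⟩, fun x => Subtype.ext (funext fun V => LinearMap.ext fun f => huniq fun y => ?_)⟩
  refine (hs V.1 f y).trans ?_
  rw [hD y.1 x (V.1 ⊓ W y) inf_le_right (inf_le_left.trans V.2)]
  exact (D x).2 V ⟨V.1 ⊓ W y, inf_le_left.trans V.2⟩ inf_le_left f

end SuperPresheaf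

end Locality

/-! ### Dual numbers -/

section DualNumbers

/-- The homomorphism of dual numbers which is induced by a homomorphism of algebras. -/
def dualMap {B B' : Type*} [Ring B] [Algebra ℂ B] [Ring B'] [Algebra ℂ B'] (g : B →ₐ[ℂ] B') :
    DualNumber B →ₐ[ℂ] DualNumber B' where
  toFun x := (g x.fst, g x.snd)
  map_one' := TrivSqZeroExt.ext (map_one g) (map_zero g)
  map_mul' x y := TrivSqZeroExt.ext (map_mul g _ _) (by
    change g (x.fst * y.snd + x.snd * y.fst) = g x.fst * g y.snd + g x.snd * g y.fst
    rw [map_add, map_mul, map_mul])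
  map_zero' := TrivSqZeroExt.ext (map_zero g) (map_zero g)
  map_add' x y := TrivSqZeroExt.ext (map_add g _ _) (map_add g _ _)
  commutes' r := TrivSqZeroExt.ext (AlgHom.commutes g r) (map_zero g)

/-- The linear map to the dual numbers with real part `f` and infinitesimal part `g`. -/
def dualPair {B V : Type*} [Ring B] [Algebra ℂ B] [AddCommGroup V] [Module ℂ V]
    (f g : V →ₗ[ℂ] B) : V →ₗ[ℂ] DualNumber B where
  toFun v := (f v, g v)
  map_add' v w := TrivSqZeroExt.ext (map_add f v w) (map_add g v w)
  map_smul' c v := TrivSqZeroExt.ext (map_smul f c v) (map_smul g c v)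

/-- The infinitesimal part of a homomorphism to the dual numbers. -/
def dualSnd {B C : Type*} [Ring B] [Algebra ℂ B] [Ring C] [Algebra ℂ C]
    (Φ : C →ₐ[ℂ] DualNumber B) : C →ₗ[ℂ] B where
  toFun c := (Φ c).snd
  map_add' c d := congrArg TrivSqZeroExt.snd (map_add Φ c d)
  map_smul' r c := congrArg TrivSqZeroExt.snd (map_smul Φ r c)

/-- The real part of a homomorphism to the dual numbers. -/
def dualFst {B C : Type*} [Ring B] [Algebra ℂ B] [Ring C] [Algebra ℂ C]
    (Φ : C →ₐ[ℂ] DualNumber B) : C →ₐ[ℂ] B :=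
  (TrivSqZeroExt.fstHom ℂ B B).comp Φ

end DualNumbers

/-! ### Supercommutators -/

section Superderivations

variable {B C : Type*} [Ring B] [Algebra ℂ B] [Ring C] [Algebra ℂ C]

theorem neg_one_pow_smul_self {X : Type*} [AddCommGroup X] [Module ℂ X] (n : ℕ) (x : X) :
    (-1 : ℂ) ^ n • (-1 : ℂ) ^ n • x = x := by
  rw [smul_smul, ← mul_pow, neg_one_mul, neg_neg, one_pow, one_smul]

theorem map_pow_of_map {σ : B →ₐ[ℂ] B} {T : B →ₗ[ℂ] B} {a : ℕ}
    (h : ∀ f, T (σ f) = (-1 : ℂ) ^ a • σ (T f)) (n : ℕ) (f : B) :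
    T ((σ ^ n) f) = (-1 : ℂ) ^ (a * n) • (σ ^ n) (T f) := by
  induction n with
  | zero => rw [mul_zero, pow_zero, pow_zero, one_smul, AlgHom.one_apply, AlgHom.one_apply]
  | succ n ih =>
    rw [pow_succ' σ, AlgHom.mul_apply, AlgHom.mul_apply, h, ih, map_smul, smul_smul, ← pow_add]
    congr 2
    ring

theorem supercommutator_map {σ : B →ₐ[ℂ] B} {T T' : B →ₗ[ℂ] B} {a b : ℕ}
    (h : ∀ f, T (σ f) = (-1 : ℂ) ^ a • σ (T f)) (h' : ∀ f, T' (σ f) = (-1 : ℂ) ^ b • σ (T' f))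
    (f : B) : T (T' (σ f)) - (-1 : ℂ) ^ (a * b) • T' (T (σ f)) =
      (-1 : ℂ) ^ (a + b) • σ (T (T' f) - (-1 : ℂ) ^ (a * b) • T' (T f)) := by
  rw [h', map_smul, h, h, map_smul, h', smul_smul, smul_smul, ← pow_add, ← pow_add, add_comm b a,
    map_sub, map_smul, smul_sub, smul_smul _ ((-1 : ℂ) ^ b), smul_smul ((-1 : ℂ) ^ (a + b)),
    ← pow_add, ← pow_add]
  congr 3
  ring

/-- The supercommutator of two superderivations is a superderivation. -/
theorem supercommutator_mul {σ : B →ₐ[ℂ] B} {T T' : B →ₗ[ℂ] B} {a b : ℕ}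
    (hT : ∀ f g, T (f * g) = T f * g + (σ ^ a) f * T g)
    (hT' : ∀ f g, T' (f * g) = T' f * g + (σ ^ b) f * T' g)
    (h : ∀ f, T (σ f) = (-1 : ℂ) ^ a • σ (T f)) (h' : ∀ f, T' (σ f) = (-1 : ℂ) ^ b • σ (T' f))
    (f g : B) : T (T' (f * g)) - (-1 : ℂ) ^ (a * b) • T' (T (f * g)) =
      (T (T' f) - (-1 : ℂ) ^ (a * b) • T' (T f)) * g +
        (σ ^ (a + b)) f * (T (T' g) - (-1 : ℂ) ^ (a * b) • T' (T g)) := by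
  have e : (σ ^ b) ((σ ^ a) f) = (σ ^ a) ((σ ^ b) f) := by
    rw [← AlgHom.mul_apply, ← AlgHom.mul_apply, ← pow_add, ← pow_add, add_comm]
  rw [hT', hT, map_add, map_add, hT, hT, hT', hT', map_pow_of_map h, map_pow_of_map h', e, pow_add,
    AlgHom.mul_apply, mul_comm b a, smul_add, smul_add, smul_add, smul_mul_assoc, smul_mul_assoc,
    neg_one_pow_smul_self, sub_mul, mul_sub, smul_mul_assoc, mul_smul_comm]
  abel

/-- A superderivation, composed with a homomorphism and with a left inverse of it, is a
superderivation. -/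
theorem conj_mul {σ : B →ₐ[ℂ] B} {σ' : C →ₐ[ℂ] C} {T : B →ₗ[ℂ] B} {a : ℕ}
    (hT : ∀ f g, T (f * g) = T f * g + (σ ^ a) f * T g) (p : C →ₐ[ℂ] B) (s : B →ₐ[ℂ] C)
    (hsp : ∀ f, s (p f) = f) (hσ : ∀ f, s ((σ ^ a) (p f)) = (σ' ^ a) f) (f g : C) :
    s (T (p (f * g))) = s (T (p f)) * g + (σ' ^ a) f * s (T (p g)) := by
  rw [map_mul p, hT, map_add, map_mul s, map_mul s, hσ, hsp]

theorem conj_map {σ : B →ₐ[ℂ] B} {σ' : C →ₐ[ℂ] C} {T : B →ₗ[ℂ] B} {a : ℕ}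
    (h : ∀ f, T (σ f) = (-1 : ℂ) ^ a • σ (T f)) (p : C →ₐ[ℂ] B) (s : B →ₐ[ℂ] C)
    (hp : ∀ f, p (σ' f) = σ (p f)) (hs : ∀ f, s (σ f) = σ' (s f)) (f : C) :
    s (T (p (σ' f))) = (-1 : ℂ) ^ a • σ' (s (T (p f))) := by
  rw [hp, h, map_smul, hs]

end Superderivations

/-! ### Derivations of the exterior algebra sheaf -/

section Derivations

variable {A : Type u} [NormedAddCommGroup A] [NormedSpace ℂ A] [FiniteDimensional ℂ A]
  {H : Type u} [TopologicalSpace H] {I : ModelWithCorners ℂ A H} [I.Boundaryless]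
  {M : Type u} [TopologicalSpace M] [ChartedSpace H M] [IsManifold I ω M]
  {F : Type u} [NormedAddCommGroup F] [NormedSpace ℂ F] [FiniteDimensional ℂ F]
  {E : M → Type u} [∀ x, AddCommGroup (E x)] [∀ x, Module ℂ (E x)]
  [TopologicalSpace (TotalSpace F E)] [∀ x, TopologicalSpace (E x)] [FiberBundle F E]
  [VectorBundle ℂ F E] [ContMDiffVectorBundle ω F E I]

theorem Supermanifold.mem_homDer_of_locally (N : Supermanifold I F E) {U : Opens M} {p : ZMod 2}
    {X : N.sheafEnd U} (h : ∀ x ∈ U, ∃ (W : Opens M) (hW : W ≤ U), x ∈ W ∧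
      SuperPresheaf.endRestrict hW X ∈ N.homDer p W) : X ∈ N.homDer p U := by
  refine ⟨fun V q f hf => N.mem_parity_of_res fun x hx => ?_, fun V q f g hf =>
    SuperPresheaf.eq_of_locally N.isSheaf fun x hx => ?_⟩
  · obtain ⟨W, hW, hxW, h⟩ := h x (V.2 hx)
    refine ⟨V.1 ⊓ W, inf_le_left, ⟨hx, hxW⟩, ?_⟩
    have h1 := h.1 ⟨V.1 ⊓ W, inf_le_right⟩ q _ (N.parity_res inf_le_left q f hf)
    rw [← X.2 V ⟨V.1 ⊓ W, inf_le_left.trans V.2⟩ inf_le_left f]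
    exact h1
  · obtain ⟨W, hW, hxW, h⟩ := h x (V.2 hx)
    refine ⟨V.1 ⊓ W, inf_le_left, ⟨hx, hxW⟩, ?_⟩
    have h1 := h.2 ⟨V.1 ⊓ W, inf_le_right⟩ q (N.res inf_le_left f) (N.res inf_le_left g)
      (N.parity_res inf_le_left q f hf)
    have h2 := fun f => X.2 V ⟨V.1 ⊓ W, inf_le_left.trans V.2⟩ inf_le_left f
    rw [← h2, map_mul (N.res inf_le_left), map_add, map_smul, map_mul (N.res inf_le_left),
      map_mul (N.res inf_le_left), ← h2, ← h2]
    exact h1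

/-- A derivation on the germs at `m` of sections of the exterior algebra bundle, with respect to two
homomorphisms on the germs. -/
structure GermDer (W : Opens M) {m : M} {R : Type*} [Ring R] [Algebra ℂ R]
    (Φ Φ' : GermHom (exteriorSheaf I F E) m R) where
  app : ∀ V : Opens M, V ≤ W → m ∈ V → exteriorSections I F E V →ₗ[ℂ] R
  app_res : ∀ {V' V : Opens M} (h : V' ≤ V) (hV : V ≤ W) (hm : m ∈ V')
    (f : exteriorSections I F E V),
    app V' (h.trans hV) hm (exteriorRes I F E h f) = app V hV (h hm) f
  leibniz : ∀ (V : Opens M) (hV : V ≤ W) (hm : m ∈ V) (f g : exteriorSections I F E V),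
    app V hV hm (f * g) = app V hV hm f * Φ.app V hm g + Φ'.app V hm f * app V hV hm g

namespace GermDer

theorem app_one {W : Opens M} {m : M} {R : Type*} [Ring R] [Algebra ℂ R]
    {Φ Φ' : GermHom (exteriorSheaf I F E) m R} (D : GermDer W Φ Φ') (V : Opens M) (hV : V ≤ W)
    (hm : m ∈ V) : D.app V hV hm 1 = 0 := by
  have h := D.leibniz V hV hm 1 1
  have h1 : Φ.app V hm (1 : exteriorSections I F E V) = 1 := map_one (Φ.app V hm)
  have h2 : Φ'.app V hm (1 : exteriorSections I F E V) = 1 := map_one (Φ'.app V hm)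
  rw [h1, h2, mul_one, mul_one, one_mul] at h
  exact left_eq_add.1 h

/-- A derivation on germs vanishes if it vanishes on coordinates. -/
theorem eq_zero_of_coord {W : Opens M} {w m : M} (hW : W ≤ bundleDom H F E w) {X : Type*}
    [AddCommGroup X] [Module ℂ X] [Module.Finite ℂ X]
    {Φ Φ' : GermHom (exteriorSheaf I F E) m (ExteriorAlgebra ℂ X)} (D : GermDer W Φ Φ')
    (hb : ∀ (V : Opens M) (hm : m ∈ V) (f : exteriorSections I F E V),
      ExteriorAlgebra.algebraMapInv (Φ'.app V hm f) = ExteriorAlgebra.algebraMapInv (f.1 ⟨m, hm⟩))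
    {ι κ : Type*} [Fintype ι] [Fintype κ] (b : Module.Basis ι ℂ A) (bF : Module.Basis κ ℂ F)
    (hm : m ∈ W) (hx : ∀ i, D.app W le_rfl hm (coordSec I F E b hW i) = 0)
    (hθ : ∀ j, D.app W le_rfl hm (frameSec I hW (bF j)) = 0) {V : Opens M} (hV : V ≤ W)
    (hmV : m ∈ V) (f : exteriorSections I F E V) : D.app V hV hmV f = 0 := by
  refine eq_zero_of_forall_mem_extFil fun t => ?_
  refine twistedDer_mem_extFil b bF hW D.app (fun V' V h hV hm f => D.app_res h hV hm f)
    (fun V _ hm f => Φ.app V hm f) (fun V _ hm f => Φ'.app V hm f) D.leibniz D.app_one t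
    (fun V hV hm' i => ?_) (fun V hV hm i => ?_) (fun V hV hm' j => ?_)
    (fun V hV hm j => ?_) V hV hmV f
  · have h : D.app V hV hm' (coordSec I F E b (hV.trans hW) i) = 0 :=
      (D.app_res hV le_rfl hm' (coordSec I F E b hW i)).trans (hx i)
    rw [h]
    exact zero_mem _
  · exact GermHom.app_mem_extFil_one hb hm (coordSec_sub_mem b (hV.trans hW) i ⟨m, hm⟩)
  · have h : D.app V hV hm' (frameSec I (hV.trans hW) (bF j)) = 0 :=
      (D.app_res hV le_rfl hm' (frameSec I hW (bF j))).trans (hθ j)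
    rw [h]
    exact zero_mem _
  · exact GermHom.app_mem_extFil_one hb hm (frameSec_mem (hV.trans hW) _ ⟨m, hm⟩)

/-- The difference of two derivations on germs. -/
def sub {W : Opens M} {m : M} {R : Type*} [Ring R] [Algebra ℂ R]
    {Φ Φ' : GermHom (exteriorSheaf I F E) m R} (D D' : GermDer W Φ Φ') : GermDer W Φ Φ' where
  app V hV hm := D.app V hV hm - D'.app V hV hm
  app_res h hV hm f := congrArg₂ (· - ·) (D.app_res h hV hm f) (D'.app_res h hV hm f)
  leibniz V hV hm f g := by
    rw [LinearMap.sub_apply, LinearMap.sub_apply, LinearMap.sub_apply, D.leibniz, D'.leibniz,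
      sub_mul, mul_sub]
    abel

theorem ext_of_coord {W : Opens M} {w m : M} (hW : W ≤ bundleDom H F E w) {X : Type*}
    [AddCommGroup X] [Module ℂ X] [Module.Finite ℂ X]
    {Φ Φ' : GermHom (exteriorSheaf I F E) m (ExteriorAlgebra ℂ X)} (D D' : GermDer W Φ Φ')
    (hb : ∀ (V : Opens M) (hm : m ∈ V) (f : exteriorSections I F E V),
      ExteriorAlgebra.algebraMapInv (Φ'.app V hm f) = ExteriorAlgebra.algebraMapInv (f.1 ⟨m, hm⟩))
    {ι κ : Type*} [Fintype ι] [Fintype κ] (b : Module.Basis ι ℂ A) (bF : Module.Basis κ ℂ F)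
    (hm : m ∈ W) (hx : ∀ i, D.app W le_rfl hm (coordSec I F E b hW i) =
      D'.app W le_rfl hm (coordSec I F E b hW i))
    (hθ : ∀ j, D.app W le_rfl hm (frameSec I hW (bF j)) =
      D'.app W le_rfl hm (frameSec I hW (bF j))) {V : Opens M} (hV : V ≤ W)
    (hmV : m ∈ V) (f : exteriorSections I F E V) : D.app V hV hmV f = D'.app V hV hmV f :=
  sub_eq_zero.1 ((D.sub D').eq_zero_of_coord hW hb b bF hm (fun i => sub_eq_zero.2 (hx i))
    (fun j => sub_eq_zero.2 (hθ j)) hV hmV f)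

end GermDer

variable (I F E) in
/-- A superderivation over `W` of the sheaf of sections of the exterior algebra bundle. Its parity is
the class of `a`. -/
structure SecDer (a : ℕ) (W : Opens M) where
  app : ∀ V : Opens M, V ≤ W → exteriorSections I F E V →ₗ[ℂ] exteriorSections I F E V
  app_res : ∀ {V' V : Opens M} (h : V' ≤ V) (hV : V ≤ W) (f : exteriorSections I F E V),
    app V' (h.trans hV) (exteriorRes I F E h f) = exteriorRes I F E h (app V hV f)
  leibniz : ∀ (V : Opens M) (hV : V ≤ W) (f g : exteriorSections I F E V),
    app V hV (f * g) = app V hV f * g + ((invSec I F E V) ^ a) f * app V hV g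
  app_inv : ∀ (V : Opens M) (hV : V ≤ W) (f : exteriorSections I F E V),
    app V hV (invSec I F E V f) = (-1 : ℂ) ^ a • invSec I F E V (app V hV f)

theorem algebraMapInv_inv {V : Type*} [AddCommGroup V] [Module ℂ V] (u : ExteriorAlgebra ℂ V) :
    ExteriorAlgebra.algebraMapInv (inv u) = ExteriorAlgebra.algebraMapInv u := by
  have h : (ExteriorAlgebra.algebraMapInv : ExteriorAlgebra ℂ V →ₐ[ℂ] ℂ).comp inv =
      ExteriorAlgebra.algebraMapInv := by
    refine ExteriorAlgebra.hom_ext (LinearMap.ext fun v => ?_)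
    simp [ExteriorAlgebra.algebraMapInv]
  exact AlgHom.congr_fun h u

theorem algebraMapInv_invSec_pow (a : ℕ) {V : Opens M} (f : exteriorSections I F E V) (x : V) :
    ExteriorAlgebra.algebraMapInv ((((invSec I F E V) ^ a) f).1 x) =
      ExteriorAlgebra.algebraMapInv (f.1 x) := by
  induction a with
  | zero => rfl
  | succ a ih =>
    rw [pow_succ']
    exact (algebraMapInv_inv _).trans ih

theorem invSec_pow_res (a : ℕ) {W V : Opens M} (h : W ≤ V) (f : exteriorSections I F E V) :
    ((invSec I F E W) ^ a) (exteriorRes I F E h f) =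
      exteriorRes I F E h (((invSec I F E V) ^ a) f) := by
  induction a with
  | zero => rfl
  | succ a ih =>
    rw [pow_succ', pow_succ', AlgHom.mul_apply, AlgHom.mul_apply, ih]
    rfl

theorem invSec_pow_of_mem (a : ℕ) {V : Opens M} {q : ZMod 2} {f : exteriorSections I F E V}
    (hf : ∀ x : V, f.1 x ∈ extParity (E x) q) :
    ((invSec I F E V) ^ a) f = (-1 : ℂ) ^ (a * q.val) • f := by
  have h1 := (mem_exteriorSheaf_parity_iff q f).1 hf
  induction a with
  | zero => simp
  | succ a ih =>
    rw [pow_succ', AlgHom.mul_apply, ih, map_smul, h1, smul_smul, ← pow_add]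
    congr 2
    ring

theorem exists_parity_add_sec {V : Opens M} (f : exteriorSections I F E V) :
    ∃ f₀ f₁ : exteriorSections I F E V, (∀ x : V, f₀.1 x ∈ extParity (E x) 0) ∧
      (∀ x : V, f₁.1 x ∈ extParity (E x) 1) ∧ f = f₀ + f₁ := by
  obtain ⟨f₀, h₀, f₁, h₁, e⟩ := exists_add_of_isInternal
    ((exteriorSupermanifold I F E).parity_isInternal V) f
  exact ⟨f₀, f₁, h₀, h₁, e⟩

namespace SecDer

variable {a : ℕ} {W : Opens M}

/-- The germ of a superderivation at a point. -/
def germ (D : SecDer I F E a W) (m : M) : GermDer W (evalGerm I F m)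
    ({ app := fun V hm => ((evalGerm I F m).app V hm).comp ((invSec I F E V) ^ a)
       app_res := fun {V' V} h hm f => congrFun (congrArg Subtype.val (invSec_pow_res a h f))
        ⟨m, hm⟩ } : GermHom (exteriorSheaf I F E) m (ExteriorAlgebra ℂ (E m))) where
  app V hV hm := (LinearMap.proj (R := ℂ) (φ := fun x : V => ExteriorAlgebra ℂ (E x)) ⟨m, hm⟩) ∘ₗ
    (Subalgebra.toSubmodule (exteriorSections I F E V)).subtype ∘ₗ D.app V hV
  app_res h hV hm f := congrFun (congrArg Subtype.val (D.app_res h hV f)) ⟨m, hm⟩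
  leibniz V hV hm f g := congrFun (congrArg Subtype.val (D.leibniz V hV f g)) ⟨m, hm⟩

theorem ext_of_coord {w : M} (hW : W ≤ bundleDom H F E w) {D D' : SecDer I F E a W}
    {ι κ : Type*} [Fintype ι] [Fintype κ] (b : Module.Basis ι ℂ A) (bF : Module.Basis κ ℂ F)
    (hx : ∀ i, D.app W le_rfl (coordSec I F E b hW i) = D'.app W le_rfl (coordSec I F E b hW i))
    (hθ : ∀ j, D.app W le_rfl (frameSec I hW (bF j)) = D'.app W le_rfl (frameSec I hW (bF j)))
    {V : Opens M} (hV : V ≤ W) (f : exteriorSections I F E V) : D.app V hV f = D'.app V hV f := by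
  refine Subtype.ext (funext fun m => ?_)
  have hfin := finite_fibre F (E := E) m.1
  exact GermDer.ext_of_coord hW (D.germ m.1) (D'.germ m.1)
    (fun V hm f => algebraMapInv_invSec_pow a f ⟨m.1, hm⟩) b bF (hV m.2)
    (fun i => congrFun (congrArg Subtype.val (hx i)) ⟨m.1, hV m.2⟩)
    (fun j => congrFun (congrArg Subtype.val (hθ j)) ⟨m.1, hV m.2⟩) hV m.2 f

theorem app_one (D : SecDer I F E a W) (V : Opens M) (hV : V ≤ W) : D.app V hV 1 = 0 := by
  have h := D.leibniz V hV 1 1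
  rw [map_one ((invSec I F E V) ^ a), mul_one, mul_one, one_mul] at h
  exact left_eq_add.1 h

theorem app_mem_parity (D : SecDer I F E a W) {V : Opens M} (hV : V ≤ W) {q : ZMod 2}
    {f : exteriorSections I F E V} (hf : ∀ x : V, f.1 x ∈ extParity (E x) q) (x : V) :
    (D.app V hV f).1 x ∈ extParity (E x) (a + q) := by
  refine (mem_exteriorSheaf_parity_iff ((a : ZMod 2) + q) (D.app V hV f)).2 ?_ x
  have h1 := D.app_inv V hV f
  rw [(mem_exteriorSheaf_parity_iff q f).1 hf, map_smul] at h1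
  have h2 : invSec I F E V (D.app V hV f) =
      (-1 : ℂ) ^ a • (-1 : ℂ) ^ q.val • D.app V hV f := by
    rw [h1, smul_smul, ← mul_pow, neg_one_mul, neg_neg, one_pow, one_smul]
  rw [h2, smul_smul, ← pow_add]
  congr 1
  rw [neg_one_pow_eq_pow_mod_two, neg_one_pow_eq_pow_mod_two (n := (((a : ZMod 2) + q)).val)]
  congr 1
  have : (((a : ZMod 2) + q)).val = (a + q.val) % 2 := by
    rw [← ZMod.val_natCast 2 (a + q.val), Nat.cast_add, ZMod.natCast_zmod_val]
  rw [this, Nat.mod_mod]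

/-- Restriction to a smaller open set. -/
def restrict (D : SecDer I F E a W) {W' : Opens M} (h : W' ≤ W) : SecDer I F E a W' where
  app V hV := D.app V (hV.trans h)
  app_res h' hV f := D.app_res h' (hV.trans h) f
  leibniz V hV f g := D.leibniz V (hV.trans h) f g
  app_inv V hV f := D.app_inv V (hV.trans h) f

/-- A superderivation raises degrees as soon as it does so on coordinates. -/
theorem raises {w : M} (hW : W ≤ bundleDom H F E w) (D : SecDer I F E a W)
    {ι κ : Type*} [Fintype ι] [Fintype κ] (b : Module.Basis ι ℂ A) (bF : Module.Basis κ ℂ F)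
    (t : ℕ) (hx : ∀ (i : ι) (x : W), (D.app W le_rfl (coordSec I F E b hW i)).1 x ∈ extFil (E x) t)
    (hθ : ∀ (j : κ) (x : W), (D.app W le_rfl (frameSec I hW (bF j))).1 x ∈ extFil (E x) (t + 1))
    {V : Opens M} (hV : V ≤ W) (k : ℕ) (f : exteriorSections I F E V)
    (hf : ∀ x : V, f.1 x ∈ extFil (E x) k) (x : V) : (D.app V hV f).1 x ∈ extFil (E x) (k + t) := by
  refine twistedDer_raises b bF hW D.app (fun V' V h hV f => D.app_res h hV f)
    (fun V _ f => ((invSec I F E V) ^ a) f) D.leibniz t (fun V hV i x => ?_)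
    (fun V hV i x => ?_) (fun V hV j x => ?_) (fun V hV j x => ?_) D.app_one hV k f hf x
  · have h := congrFun (congrArg Subtype.val (D.app_res hV le_rfl (coordSec I F E b hW i))) x
    have h' : (D.app V hV (coordSec I F E b (hV.trans hW) i)).1 x =
      (D.app W le_rfl (coordSec I F E b hW i)).1 ⟨x.1, hV x.2⟩ := h
    rw [h']
    exact hx i ⟨x.1, hV x.2⟩
  · rw [mem_extFil_one, algebraMapInv_invSec_pow, ← mem_extFil_one]
    exact coordSec_sub_mem b (hV.trans hW) i x
  · have h := congrFun (congrArg Subtype.val (D.app_res hV le_rfl (frameSec I hW (bF j)))) x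
    have h' : (D.app V hV (frameSec I (hV.trans hW) (bF j))).1 x =
      (D.app W le_rfl (frameSec I hW (bF j))).1 ⟨x.1, hV x.2⟩ := h
    rw [h']
    exact hθ j ⟨x.1, hV x.2⟩
  · rw [mem_extFil_one, algebraMapInv_invSec_pow, ← mem_extFil_one]
    exact frameSec_mem (hV.trans hW) _ x

variable {S : Supermanifold I F E} {U : Opens M} (τ : LocalSplitting I F S.toSuperData U)

/-- The endomorphism of superfunctions which corresponds to a superderivation under a splitting. -/
def toEnd (hW : W ≤ U) (D : SecDer I F E a W) : S.sheafEnd W :=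
  ⟨fun V => (τ.eqv V.1 (V.2.trans hW)).symm.toLinearMap ∘ₗ D.app V.1 V.2 ∘ₗ
    (τ.eqv V.1 (V.2.trans hW)).toLinearMap, fun V V' h f => by
    change (τ.eqv V'.1 _).symm (D.app V'.1 _ (τ.eqv V'.1 _ (S.res h f))) =
      S.res h ((τ.eqv V.1 _).symm (D.app V.1 _ (τ.eqv V.1 _ f)))
    rw [τ.eqv_res h (V.2.trans hW), D.app_res h V.2, τ.eqv_symm_res h (V.2.trans hW)]⟩

theorem toEnd_apply (hW : W ≤ U) (D : SecDer I F E a W) {V : Opens M} (hV : V ≤ W) (f : S.Sec V) :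
    (D.toEnd τ hW).1 ⟨V, hV⟩ f =
      (τ.eqv V (hV.trans hW)).symm (D.app V hV (τ.eqv V (hV.trans hW) f)) := rfl

theorem toEnd_mem_homDer (hW : W ≤ U) (D : SecDer I F E a W) :
    D.toEnd τ hW ∈ S.homDer (a : ZMod 2) W := by
  refine ⟨fun V q f hf => ?_, fun V q f g hf => ?_⟩
  · rw [← τ.eqv_parity (V.2.trans hW)] at hf
    exact (τ.eqv_symm_parity (V.2.trans hW) _ _).2 (D.app_mem_parity V.2 hf)
  · rw [← τ.eqv_parity (V.2.trans hW)] at hf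
    rw [toEnd_apply, toEnd_apply, toEnd_apply, AlgEquiv.symm_apply_eq, map_add, map_smul,
      map_mul (τ.eqv V.1 (V.2.trans hW)), map_mul (τ.eqv V.1 (V.2.trans hW)),
      map_mul (τ.eqv V.1 (V.2.trans hW)), AlgEquiv.apply_symm_apply, AlgEquiv.apply_symm_apply,
      D.leibniz,
      invSec_pow_of_mem a hf, smul_mul_assoc]
    congr 2
    rw [neg_one_pow_eq_pow_mod_two, neg_one_pow_eq_pow_mod_two (n := (a : ZMod 2).val * q.val)]
    rw [ZMod.val_natCast, Nat.mod_mul_mod]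

theorem raisesDegree_toEnd_iff (hW : W ≤ U) (D : SecDer I F E a W) (t : ℕ) :
    SuperPresheaf.RaisesDegree t (D.toEnd τ hW) ↔
      ∀ (V : Opens M) (hV : V ≤ W) (k : ℕ) (f : exteriorSections I F E V),
        (∀ x : V, f.1 x ∈ extFil (E x) k) → ∀ x : V, (D.app V hV f).1 x ∈ extFil (E x) (k + t) := by
  constructor
  · intro h V hV k f hf
    have h1 := (τ.eqv_mem_filtration (hV.trans hW) k ((τ.eqv V (hV.trans hW)).symm f)).1 (by
      rw [AlgEquiv.apply_symm_apply]
      exact (mem_filtration_iff f).2 hf)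
    have h2 := (τ.eqv_mem_filtration (hV.trans hW) (k + t) _).2 (h ⟨V, hV⟩ k _ h1)
    rw [toEnd_apply, AlgEquiv.apply_symm_apply, AlgEquiv.apply_symm_apply] at h2
    exact (mem_filtration_iff _).1 h2
  · intro h V k f hf
    have h1 := (mem_filtration_iff _).1 ((τ.eqv_mem_filtration (V.2.trans hW) k f).2 hf)
    refine (τ.eqv_mem_filtration (V.2.trans hW) (k + t) _).1 ?_
    have h2 := (mem_filtration_iff _).2 (h V.1 V.2 k _ h1)
    rw [toEnd_apply, AlgEquiv.apply_symm_apply]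
    exact h2

end SecDer

/-- The superderivation of sections which corresponds to a superderivation of superfunctions under a
splitting. -/
def LocalSplitting.secDer {S : Supermanifold I F E} {U W : Opens M}
    (τ : LocalSplitting I F S.toSuperData U) (hW : W ≤ U) {p : ZMod 2} {X : S.sheafEnd W}
    (hX : X ∈ S.homDer p W) : SecDer I F E p.val W where
  app V hV := (τ.eqv V (hV.trans hW)).toLinearMap ∘ₗ X.1 ⟨V, hV⟩ ∘ₗ
    (τ.eqv V (hV.trans hW)).symm.toLinearMap
  app_res {V' V} h hV f := by
    change τ.eqv V' _ (X.1 ⟨V', _⟩ ((τ.eqv V' _).symm (exteriorRes I F E h f))) =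
      exteriorRes I F E h (τ.eqv V _ (X.1 ⟨V, hV⟩ ((τ.eqv V _).symm f)))
    rw [τ.eqv_symm_res h (hV.trans hW), X.2 ⟨V, hV⟩ ⟨V', h.trans hV⟩ h,
      τ.eqv_res h (hV.trans hW)]
  leibniz V hV f g := by
    let e := τ.eqv V (hV.trans hW)
    let T : exteriorSections I F E V →ₗ[ℂ] exteriorSections I F E V :=
      e.toLinearMap ∘ₗ X.1 ⟨V, hV⟩ ∘ₗ e.symm.toLinearMap
    have key : ∀ (q : ZMod 2) (f : exteriorSections I F E V),
        (∀ x : V, f.1 x ∈ extParity (E x) q) →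
        T (f * g) = T f * g + ((invSec I F E V) ^ p.val) f * T g := by
      intro q f hf
      have h1 := hX.2 ⟨V, hV⟩ q (e.symm f) (e.symm g) ((τ.eqv_symm_parity (hV.trans hW) q f).2 hf)
      have h2 := congrArg e h1
      rw [map_add, map_mul e, map_smul, map_mul e, AlgEquiv.apply_symm_apply,
        AlgEquiv.apply_symm_apply, ← map_mul e.symm] at h2
      rw [invSec_pow_of_mem _ hf, smul_mul_assoc]
      exact h2
    obtain ⟨f₀, f₁, h₀, h₁, rfl⟩ := exists_parity_add_sec f
    change T ((f₀ + f₁) * g) = T (f₀ + f₁) * g + ((invSec I F E V) ^ p.val) (f₀ + f₁) * T g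
    rw [add_mul, map_add, map_add, map_add, add_mul, add_mul, key 0 f₀ h₀, key 1 f₁ h₁]
    abel
  app_inv V hV f := by
    let e := τ.eqv V (hV.trans hW)
    let T : exteriorSections I F E V →ₗ[ℂ] exteriorSections I F E V :=
      e.toLinearMap ∘ₗ X.1 ⟨V, hV⟩ ∘ₗ e.symm.toLinearMap
    have key : ∀ (q : ZMod 2) (f : exteriorSections I F E V),
        (∀ x : V, f.1 x ∈ extParity (E x) q) →
        T (invSec I F E V f) = (-1 : ℂ) ^ p.val • invSec I F E V (T f) := by
      intro q f hf
      have h1 : e (X.1 ⟨V, hV⟩ (e.symm f)) = T f := rfl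
      have h2 := hX.1 ⟨V, hV⟩ q _ ((τ.eqv_symm_parity (hV.trans hW) q f).2 hf)
      have h3 := (mem_exteriorSheaf_parity_iff (p + q) _).1
        ((τ.eqv_parity (hV.trans hW) (p + q) _).2 h2)
      have h4 : invSec I F E V (T f) = (-1 : ℂ) ^ (p + q).val • T f := h3
      rw [(mem_exteriorSheaf_parity_iff q f).1 hf, h4, map_smul, smul_smul, ← pow_add]
      congr 1
      rw [neg_one_pow_eq_pow_mod_two, neg_one_pow_eq_pow_mod_two (n := p.val + _), ZMod.val_add]
      congr 1
      omega
    obtain ⟨f₀, f₁, h₀, h₁, rfl⟩ := exists_parity_add_sec f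
    change T (invSec I F E V (f₀ + f₁)) = (-1 : ℂ) ^ p.val • invSec I F E V (T (f₀ + f₁))
    rw [map_add, map_add, key 0 f₀ h₀, key 1 f₁ h₁, map_add, map_add, smul_add]

/-! ### Even derivations with prescribed values at the coordinates -/

/-- A homomorphism with prescribed values at the coordinates has derivations along it with
prescribed central even values at the coordinates: together they form a homomorphism to the dual
numbers. -/
theorem exists_hom_derivation {w : M} {W : Opens M} (hW : W ≤ bundleDom H F E w) {ι : Type*}
    [Fintype ι] [DecidableEq ι] (b : Module.Basis ι ℂ A)
    (B : Opens M → Type*) [∀ V, Ring (B V)] [∀ V, Algebra ℂ (B V)]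
    (r : ∀ {V' V : Opens M}, V' ≤ V → B V →ₐ[ℂ] B V')
    (ψ : ∀ V : Opens M, V ≤ W → holFun I M V →ₐ[ℂ] B V)
    (hψ : ∀ (V' V : Opens M) (h : V' ≤ V) (hV : V ≤ W) (f : holFun I M V),
      ψ V' (h.trans hV) (holRes I h f) = r h (ψ V hV f))
    (hψc : ∀ (V : Opens M) (hV : V ≤ W) (f : holFun I M V) (a : B V),
      ψ V hV f * a = a * ψ V hV f)
    (Δ : ∀ V : Opens M, V ≤ W → ι → B V)
    (hΔ : ∀ (V' V : Opens M) (h : V' ≤ V) (hV : V ≤ W) (i : ι), Δ V' (h.trans hV) i =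
      r h (Δ V hV i))
    (hΔc : ∀ (V : Opens M) (hV : V ≤ W) (i : ι) (a : B V), Δ V hV i * a = a * Δ V hV i)
    (ϑ ζ : ∀ V : Opens M, V ≤ W → F →ₗ[ℂ] B V)
    (hϑ : ∀ (V' V : Opens M) (h : V' ≤ V) (hV : V ≤ W) (v : F), ϑ V' (h.trans hV) v =
      r h (ϑ V hV v))
    (hζ : ∀ (V' V : Opens M) (h : V' ≤ V) (hV : V ≤ W) (v : F), ζ V' (h.trans hV) v =
      r h (ζ V hV v))
    (hϑsq : ∀ (V : Opens M) (hV : V ≤ W) (v : F), ϑ V hV v * ϑ V hV v = 0)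
    (hϑζ : ∀ (V : Opens M) (hV : V ≤ W) (v : F), ϑ V hV v * ζ V hV v + ζ V hV v * ϑ V hV v = 0) :
    ∃ (Φ : ∀ V : Opens M, V ≤ W → exteriorSections I F E V →ₐ[ℂ] B V)
      (T : ∀ V : Opens M, V ≤ W → exteriorSections I F E V →ₗ[ℂ] B V),
      (∀ (V' V : Opens M) (h : V' ≤ V) (hV : V ≤ W) (f : exteriorSections I F E V),
        Φ V' (h.trans hV) (exteriorRes I F E h f) = r h (Φ V hV f)) ∧
      (∀ (V' V : Opens M) (h : V' ≤ V) (hV : V ≤ W) (f : exteriorSections I F E V),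
        T V' (h.trans hV) (exteriorRes I F E h f) = r h (T V hV f)) ∧
      (∀ (V : Opens M) (hV : V ≤ W) (f g : exteriorSections I F E V),
        T V hV (f * g) = T V hV f * Φ V hV g + Φ V hV f * T V hV g) ∧
      (∀ (V : Opens M) (hV : V ≤ W) (i : ι), Φ V hV (coordSec I F E b (hV.trans hW) i) =
        ψ V hV (coordHol I b ((hV.trans hW).trans bundleDom_le_chartDom) i)) ∧
      (∀ (V : Opens M) (hV : V ≤ W) (i : ι), T V hV (coordSec I F E b (hV.trans hW) i) =
        Δ V hV i) ∧
      (∀ (V : Opens M) (hV : V ≤ W) (v : F), Φ V hV (frameSec I (hV.trans hW) v) = ϑ V hV v) ∧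
      ∀ (V : Opens M) (hV : V ≤ W) (v : F), T V hV (frameSec I (hV.trans hW) v) = ζ V hV v := by
  obtain ⟨Φ, Φ_res, Φ_x, Φ_θ⟩ := exists_hom_family (I := I) (F := F) (E := E) b hW
    (fun V => DualNumber (B V)) (fun h => dualMap (r h))
    (fun V hV => (TrivSqZeroExt.inlAlgHom ℂ (B V) (B V)).comp (ψ V hV))
    (fun V' V h hV f => TrivSqZeroExt.ext (hψ V' V h hV f) (map_zero (r h)).symm)
    (fun V hV f a => TrivSqZeroExt.ext (hψc V hV f _) (by
      change ψ V hV f * a.snd + 0 * a.fst = a.fst * 0 + a.snd * ψ V hV f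
      rw [zero_mul, mul_zero, add_zero, zero_add, hψc]))
    (fun V hV i => TrivSqZeroExt.inr (Δ V hV i))
    (fun V' V h hV i => TrivSqZeroExt.ext (map_zero (r h)).symm (hΔ V' V h hV i))
    (fun V hV i a => TrivSqZeroExt.ext (by
      change 0 * a.fst = a.fst * 0
      rw [zero_mul, mul_zero]) (by
      change 0 * a.snd + Δ V hV i * a.fst = a.fst * Δ V hV i + a.snd * 0
      rw [zero_mul, mul_zero, add_zero, zero_add, hΔc]))
    2 (fun V hV i => by rw [pow_two, TrivSqZeroExt.inr_mul_inr])
    (fun V hV => dualPair (ϑ V hV) (ζ V hV))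
    (fun V' V h hV v => TrivSqZeroExt.ext (hϑ V' V h hV v) (hζ V' V h hV v))
    (fun V hV v => TrivSqZeroExt.ext (hϑsq V hV v) (hϑζ V hV v))
  refine ⟨fun V hV => dualFst (Φ V hV), fun V hV => dualSnd (Φ V hV),
    fun V' V h hV f => congrArg TrivSqZeroExt.fst (Φ_res V' V h hV f),
    fun V' V h hV f => congrArg TrivSqZeroExt.snd (Φ_res V' V h hV f), fun V hV f g => ?_,
    fun V hV i => (congrArg TrivSqZeroExt.fst (Φ_x V hV i)).trans (add_zero _),
    fun V hV i => (congrArg TrivSqZeroExt.snd (Φ_x V hV i)).trans (zero_add _),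
    fun V hV v => congrArg TrivSqZeroExt.fst (Φ_θ V hV v),
    fun V hV v => congrArg TrivSqZeroExt.snd (Φ_θ V hV v)⟩
  change (Φ V hV (f * g)).snd = (Φ V hV f).snd * (Φ V hV g).fst + (Φ V hV f).fst * (Φ V hV g).snd
  rw [map_mul]
  change (Φ V hV f).fst * (Φ V hV g).snd + (Φ V hV f).snd * (Φ V hV g).fst =
    (Φ V hV f).snd * (Φ V hV g).fst + (Φ V hV f).fst * (Φ V hV g).snd
  exact add_comm _ _

/-- Even derivations with prescribed values at the coordinates exist. -/
theorem exists_derivation {w : M} {W : Opens M} (hW : W ≤ bundleDom H F E w) {ι : Type*}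
    [Fintype ι] [DecidableEq ι] (b : Module.Basis ι ℂ A) (δ : ι → exteriorSections I F E W)
    (hδ : ∀ i (x : W), (δ i).1 x ∈ extParity (E x) 0) (η : F →ₗ[ℂ] exteriorSections I F E W)
    (hη : ∀ v (x : W), (η v).1 x ∈ extParity (E x) 1) :
    ∃ T : ∀ V : Opens M, V ≤ W → exteriorSections I F E V →ₗ[ℂ] exteriorSections I F E V,
      (∀ (V' V : Opens M) (h : V' ≤ V) (hV : V ≤ W) (f : exteriorSections I F E V),
        T V' (h.trans hV) (exteriorRes I F E h f) = exteriorRes I F E h (T V hV f)) ∧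
      (∀ (V : Opens M) (hV : V ≤ W) (f g : exteriorSections I F E V),
        T V hV (f * g) = T V hV f * g + f * T V hV g) ∧
      (∀ i, T W le_rfl (coordSec I F E b hW i) = δ i) ∧
      ∀ v, T W le_rfl (frameSec I hW v) = η v := by
  have hθodd : ∀ {V : Opens M} (hV : V ≤ W) v (x : V),
      (frameSec I (hV.trans hW) v : exteriorSections I F E V).1 x ∈ extParity (E x) 1 :=
    fun hV v x => frameSec_odd (hV.trans hW) v x
  obtain ⟨Φ, T, Φ_res, T_res, T_mul, Φ_x, T_x, Φ_θ, T_θ⟩ := exists_hom_derivation hW b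
    (fun V => exteriorSections I F E V) (fun h => exteriorRes I F E h)
    (fun V _ => scalarSec I F E V) (fun V' V h hV f => rfl)
    (fun V hV f a => scalarSec_mul_comm f a) (fun V hV i => exteriorRes I F E hV (δ i))
    (fun V' V h hV i => rfl)
    (fun V hV i a => mul_comm_of_even (fun x => hδ i ⟨x.1, hV x.2⟩) a)
    (fun V hV => (constSec I w ((hV.trans hW).trans bundleDom_le_trivDom)).toLinearMap ∘ₗ
      ExteriorAlgebra.ι ℂ)
    (fun V hV => (exteriorRes I F E hV).toLinearMap ∘ₗ η)
    (fun V' V h hV v => rfl) (fun V' V h hV v => rfl) (fun V hV v => mul_self_of_odd (hθodd hV v))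
    (fun V hV v => by
      let θ : exteriorSections I F E V := frameSec I (hV.trans hW) v
      let ζ : exteriorSections I F E V := exteriorRes I F E hV (η v)
      have h1 : θ * θ = 0 := mul_self_of_odd (hθodd hV v)
      have h2 : ζ * ζ = 0 := mul_self_of_odd fun x => hη v ⟨x.1, hV x.2⟩
      have h3 : (θ + ζ) * (θ + ζ) = 0 :=
        mul_self_of_odd fun x => add_mem (hθodd hV v x) (hη v ⟨x.1, hV x.2⟩)
      rw [add_mul, mul_add, mul_add, h1, h2, zero_add, add_zero] at h3
      exact h3)
  -- The homomorphism fixes the coordinates, hence is the identity.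
  have hΦ : ∀ (V : Opens M) (hV : V ≤ W) (f : exteriorSections I F E V), Φ V hV f = f := by
    intro V hV f
    refine Subtype.ext (funext fun m => ?_)
    have hfin := finite_fibre F (E := E) m.1
    let h : GermHom (exteriorSheaf I F E) m.1 (ExteriorAlgebra ℂ (E m.1)) :=
      { app := fun V' hm => ((evalGerm I F m.1).app (V' ⊓ W) ⟨hm, hV m.2⟩).comp
          ((Φ (V' ⊓ W) inf_le_right).comp (exteriorRes I F E inf_le_left))
        app_res := fun {V' V''} h hm f => congrArg
          ((evalGerm I F m.1).app (V' ⊓ W) ⟨hm, hV m.2⟩) (Φ_res (V' ⊓ W) (V'' ⊓ W)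
            (inf_le_inf_right W h) inf_le_right (exteriorRes I F E inf_le_left f)) }
    have key : h = evalGerm I F m.1 := GermHom.ext_of_coord (hW (hV m.2)) (fun V hm f => rfl) b
      (Module.finBasis ℂ F)
      (fun i => congrArg ((evalGerm I F m.1).app (bundleDom H F E w ⊓ W)
        ⟨hW (hV m.2), hV m.2⟩)
        (Φ_x (bundleDom H F E w ⊓ W) inf_le_right i))
      (fun j => congrArg ((evalGerm I F m.1).app (bundleDom H F E w ⊓ W)
        ⟨hW (hV m.2), hV m.2⟩)
        (Φ_θ (bundleDom H F E w ⊓ W) inf_le_right (Module.finBasis ℂ F j)))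
    have e1 := congrFun (congrArg Subtype.val (Φ_res (V ⊓ W) V inf_le_left hV f)) ⟨m.1, m.2, hV m.2⟩
    exact e1.symm.trans (congrArg (fun h : GermHom (exteriorSheaf I F E) m.1
      (ExteriorAlgebra ℂ (E m.1)) => h.app V m.2 f) key)
  refine ⟨T, T_res, fun V hV f g => (T_mul V hV f g).trans ?_, fun i => T_x W le_rfl i,
    fun v => T_θ W le_rfl v⟩
  exact congrArg₂ (fun x y => T V hV f * x + y * T V hV g) (hΦ V hV g) (hΦ V hV f)

/-- There are even derivations with prescribed values at the coordinates: they are the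
infinitesimal parts of homomorphisms to the dual numbers. -/
theorem SecDer.exists_even {w : M} {W : Opens M} (hW : W ≤ bundleDom H F E w) {ι : Type*}
    [Fintype ι] [DecidableEq ι] (b : Module.Basis ι ℂ A) (δ : ι → exteriorSections I F E W)
    (hδ : ∀ i (x : W), (δ i).1 x ∈ extParity (E x) 0) (η : F →ₗ[ℂ] exteriorSections I F E W)
    (hη : ∀ v (x : W), (η v).1 x ∈ extParity (E x) 1) :
    ∃ D : SecDer I F E 0 W, (∀ i, D.app W le_rfl (coordSec I F E b hW i) = δ i) ∧
      ∀ v, D.app W le_rfl (frameSec I hW v) = η v := by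
  obtain ⟨T, T_res, T_mul, T_x, T_θ⟩ := exists_derivation hW b δ hδ η hη
  have T_inv : ∀ (V : Opens M) (hV : V ≤ W) (f : exteriorSections I F E V),
      T V hV (invSec I F E V f) = invSec I F E V (T V hV f) := by
    intro V hV f
    refine Subtype.ext (funext fun m => ?_)
    have hfin := finite_fibre F (E := E) m.1
    let Ψ : GermHom (exteriorSheaf I F E) m.1 (ExteriorAlgebra ℂ (E m.1)) :=
      (evalGerm I F m.1).map inv
    let ev : ∀ V : Opens M, m.1 ∈ V → exteriorSections I F E V →ₗ[ℂ] ExteriorAlgebra ℂ (E m.1) :=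
      fun V hm => (LinearMap.proj (R := ℂ) (φ := fun x : V => ExteriorAlgebra ℂ (E x)) ⟨m.1, hm⟩) ∘ₗ
        (Subalgebra.toSubmodule (exteriorSections I F E V)).subtype
    obtain ⟨D₁, h₁⟩ : ∃ D : GermDer W Ψ Ψ, ∀ (V : Opens M) (hV : V ≤ W) (hm : m.1 ∈ V)
        (f : exteriorSections I F E V), D.app V hV hm f = ev V hm (T V hV (invSec I F E V f)) := ⟨
      { app := fun V hV hm => ev V hm ∘ₗ T V hV ∘ₗ (invSec I F E V).toLinearMap
        app_res := fun {V' V} h hV hm f =>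
          congrArg (ev V' hm) (T_res _ _ h hV (invSec I F E V f))
        leibniz := fun V hV hm f g =>
          (congrArg (fun z => ev V hm (T V hV z)) (map_mul (invSec I F E V) f g)).trans
            (congrArg (ev V hm) (T_mul V hV (invSec I F E V f) (invSec I F E V g))) },
      fun _ _ _ _ => rfl⟩
    obtain ⟨D₂, h₂⟩ : ∃ D : GermDer W Ψ Ψ, ∀ (V : Opens M) (hV : V ≤ W) (hm : m.1 ∈ V)
        (f : exteriorSections I F E V), D.app V hV hm f = ev V hm (invSec I F E V (T V hV f)) := ⟨
      { app := fun V hV hm => ev V hm ∘ₗ (invSec I F E V).toLinearMap ∘ₗ T V hV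
        app_res := fun {V' V} h hV hm f =>
          congrArg (fun z => ev V' hm (invSec I F E V' z)) (T_res _ _ h hV f)
        leibniz := fun V hV hm f g => by
          have h1 := congrArg (invSec I F E V) (T_mul V hV f g)
          rw [map_add, map_mul (invSec I F E V), map_mul (invSec I F E V)] at h1
          exact congrArg (ev V hm) h1 },
      fun _ _ _ _ => rfl⟩
    have hb : ∀ (V : Opens M) (hm : m.1 ∈ V) (f : exteriorSections I F E V),
        ExteriorAlgebra.algebraMapInv (Ψ.app V hm f) =
          ExteriorAlgebra.algebraMapInv (f.1 ⟨m.1, hm⟩) := fun V hm f => algebraMapInv_inv _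
    have hx : ∀ i, D₁.app W le_rfl (hV m.2) (coordSec I F E b hW i) =
        D₂.app W le_rfl (hV m.2) (coordSec I F E b hW i) := by
      intro i
      have e1 : invSec I F E W (coordSec I F E b hW i) = coordSec I F E b hW i :=
        Subtype.ext (funext fun x => AlgHom.commutes inv _)
      have e2 : invSec I F E W (δ i) = δ i := by
        have := (mem_exteriorSheaf_parity_iff 0 (δ i)).1 (hδ i)
        rwa [ZMod.val_zero, pow_zero, one_smul] at this
      rw [h₁, h₂, e1, T_x i, e2]
    have hθ : ∀ j, D₁.app W le_rfl (hV m.2) (frameSec I hW (Module.finBasis ℂ F j)) =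
        D₂.app W le_rfl (hV m.2) (frameSec I hW (Module.finBasis ℂ F j)) := by
      intro j
      have e1 := (mem_exteriorSheaf_parity_iff 1 (frameSec I hW (Module.finBasis ℂ F j))).1
        fun x => map_mem_extParity _ (CliffordAlgebra.ι_mem_evenOdd_one _ _)
      have e2 := (mem_exteriorSheaf_parity_iff 1 _).1 (hη (Module.finBasis ℂ F j))
      rw [h₁, h₂, e1, map_smul, T_θ, e2]
    have key := GermDer.ext_of_coord hW D₁ D₂ hb b (Module.finBasis ℂ F) (hV m.2) hx hθ hV m.2 f
    exact (h₁ V hV m.2 f).symm.trans (key.trans (h₂ V hV m.2 f))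
  exact ⟨
    { app := T
      app_res := fun h hV f => T_res _ _ h hV f
      leibniz := fun V hV f g => by
        rw [pow_zero, AlgHom.one_apply]
        exact T_mul V hV f g
      app_inv := fun V hV f => by
        rw [pow_zero, one_smul]
        exact T_inv V hV f }, T_x, T_θ⟩

/-! ### Brackets and contractions -/

namespace SecDer

/-- The supercommutator of two superderivations. -/
def bracket {a b : ℕ} {W : Opens M} (D : SecDer I F E a W) (D' : SecDer I F E b W) :
    SecDer I F E (a + b) W where
  app V hV := D.app V hV ∘ₗ D'.app V hV - (-1 : ℂ) ^ (a * b) • (D'.app V hV ∘ₗ D.app V hV)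
  app_res {V' V} h hV f := by
    change D.app V' _ (D'.app V' _ (exteriorRes I F E h f)) -
      (-1 : ℂ) ^ (a * b) • D'.app V' _ (D.app V' _ (exteriorRes I F E h f)) =
      exteriorRes I F E h (D.app V hV (D'.app V hV f) -
        (-1 : ℂ) ^ (a * b) • D'.app V hV (D.app V hV f))
    rw [D.app_res h hV, D'.app_res h hV, D'.app_res h hV, D.app_res h hV, map_sub, map_smul]
  leibniz V hV f g := by
    change D.app V hV (D'.app V hV (f * g)) -
      (-1 : ℂ) ^ (a * b) • D'.app V hV (D.app V hV (f * g)) =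
      (D.app V hV (D'.app V hV f) - (-1 : ℂ) ^ (a * b) • D'.app V hV (D.app V hV f)) * g +
      ((invSec I F E V) ^ (a + b)) f *
        (D.app V hV (D'.app V hV g) - (-1 : ℂ) ^ (a * b) • D'.app V hV (D.app V hV g))
    exact supercommutator_mul (D.leibniz V hV) (D'.leibniz V hV) (D.app_inv V hV)
      (D'.app_inv V hV) f g
  app_inv V hV f := by
    change D.app V hV (D'.app V hV (invSec I F E V f)) -
      (-1 : ℂ) ^ (a * b) • D'.app V hV (D.app V hV (invSec I F E V f)) =
      (-1 : ℂ) ^ (a + b) • invSec I F E V (D.app V hV (D'.app V hV f) -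
        (-1 : ℂ) ^ (a * b) • D'.app V hV (D.app V hV f))
    exact supercommutator_map (D.app_inv V hV) (D'.app_inv V hV) f

theorem bracket_app {a b : ℕ} {W : Opens M} (D : SecDer I F E a W) (D' : SecDer I F E b W)
    {V : Opens M} (hV : V ≤ W) (f : exteriorSections I F E V) :
    (D.bracket D').app V hV f = D.app V hV (D'.app V hV f) -
      (-1 : ℂ) ^ (a * b) • D'.app V hV (D.app V hV f) := rfl

theorem app_algebraMap {a : ℕ} {W : Opens M} (D : SecDer I F E a W) {V : Opens M} (hV : V ≤ W)
    (r : ℂ) : D.app V hV (algebraMap ℂ _ r) = 0 := by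
  rw [Algebra.algebraMap_eq_smul_one, map_smul, D.app_one, smul_zero]

end SecDer

/-- Contraction of sections with a linear form which is constant in a trivialization. -/
def ctrSec {w : M} (ξ : Module.Dual ℂ F) {V : Opens M} (hV : V ≤ trivDom F E w) :
    exteriorSections I F E V →ₗ[ℂ] exteriorSections I F E V where
  toFun f := ⟨fun x => ctr (ξ ∘ₗ triv F E w x) (f.1 x), by
    have hfin := finite_fibre F (E := E) w
    let u := Module.finBasis ℂ (ExteriorAlgebra ℂ F)
    have e : (fun x : V => ctr (ξ ∘ₗ triv F E w x) (f.1 x)) =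
        (∑ i, scalarSec I F E V (coeffSec w hV (u.coord i) f) * constSec I w hV (ctr ξ (u i)) :
          exteriorSections I F E V).1 := by
      funext x
      have h1 : f.1 x = ∑ i, ((scalarSec I F E V (coeffSec w hV (u.coord i) f) *
          constSec I w hV (u i) : exteriorSections I F E V)).1 x := by
        conv_lhs => rw [eq_sum_scalarSec_mul_constSec_basis hV u f]
        simp
      have h2 : (∑ i, scalarSec I F E V (coeffSec w hV (u.coord i) f) *
          constSec I w hV (ctr ξ (u i)) : exteriorSections I F E V).1 x =
          ∑ i, ((scalarSec I F E V (coeffSec w hV (u.coord i) f) *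
            constSec I w hV (ctr ξ (u i)) : exteriorSections I F E V)).1 x := by
        simp
      rw [h1, h2, map_sum]
      refine Finset.sum_congr rfl fun i _ => ?_
      change ctr (ξ ∘ₗ triv F E w x) (algebraMap ℂ _ _ * ExteriorAlgebra.map (trivSymm F E w x) (u i))
        = algebraMap ℂ _ _ * ExteriorAlgebra.map (trivSymm F E w x) (ctr ξ (u i))
      rw [← Algebra.smul_def, map_smul, ctr_map, LinearMap.comp_assoc, triv_comp_trivSymm (hV x.2),
        LinearMap.comp_id, Algebra.smul_def]
    rw [e]
    exact Subtype.prop _⟩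
  map_add' f g := Subtype.ext (funext fun x => map_add (ctr (ξ ∘ₗ triv F E w x)) _ _)
  map_smul' c f := Subtype.ext (funext fun x => map_smul (ctr (ξ ∘ₗ triv F E w x)) c _)

/-- Contraction with a linear form which is constant in a trivialization is an odd derivation. -/
def ctrDer {w : M} {W : Opens M} (hW : W ≤ trivDom F E w) (ξ : Module.Dual ℂ F) :
    SecDer I F E 1 W where
  app V hV := ctrSec ξ (hV.trans hW)
  app_res _ _ _ := rfl
  leibniz V hV f g := Subtype.ext (funext fun x => ctr_mul (ξ ∘ₗ triv F E w x) _ _)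
  app_inv V hV f := by
    rw [pow_one, neg_one_smul]
    exact Subtype.ext (funext fun x => ctr_inv (ξ ∘ₗ triv F E w x) _)

theorem ctrDer_coordSec {w : M} {W : Opens M} (hW : W ≤ bundleDom H F E w)
    (ξ : Module.Dual ℂ F) {ι : Type*} (b : Module.Basis ι ℂ A) (i : ι) :
    (ctrDer (hW.trans bundleDom_le_trivDom) ξ).app W le_rfl (coordSec I F E b hW i) = 0 :=
  Subtype.ext (funext fun x => ctr_algebraMap _ _)

theorem ctrDer_frameSec {w : M} {W : Opens M} (hW : W ≤ bundleDom H F E w)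
    (ξ : Module.Dual ℂ F) (v : F) :
    (ctrDer (hW.trans bundleDom_le_trivDom) ξ).app W le_rfl (frameSec I hW v) =
      algebraMap ℂ (exteriorSections I F E W) (ξ v) := by
  refine Subtype.ext (funext fun x => ?_)
  change ctr (ξ ∘ₗ triv F E w x) (ExteriorAlgebra.map (trivSymm F E w x) (ExteriorAlgebra.ι ℂ v)) =
    algebraMap ℂ _ (ξ v)
  rw [ctr_map, LinearMap.comp_assoc, triv_comp_trivSymm (bundleDom_le_trivDom (hW x.2)),
    LinearMap.comp_id, ctr_ι, AlgHom.commutes]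

end Derivations

/-! ### Products of bundles -/

section Product

variable {A : Type u} [NormedAddCommGroup A] [NormedSpace ℂ A] [FiniteDimensional ℂ A]
  {H : Type u} [TopologicalSpace H] {I : ModelWithCorners ℂ A H} [I.Boundaryless]
  {M : Type u} [TopologicalSpace M] [ChartedSpace H M] [IsManifold I ω M]
  {F : Type u} [NormedAddCommGroup F] [NormedSpace ℂ F] [FiniteDimensional ℂ F]
  {E : M → Type u} [∀ x, AddCommGroup (E x)] [∀ x, Module ℂ (E x)]
  [TopologicalSpace (TotalSpace F E)] [∀ x, TopologicalSpace (E x)] [FiberBundle F E]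
  [VectorBundle ℂ F E] [ContMDiffVectorBundle ω F E I]
  {A₁ : Type u} [NormedAddCommGroup A₁] [NormedSpace ℂ A₁] [FiniteDimensional ℂ A₁]
  {H₁ : Type u} [TopologicalSpace H₁] {I₁ : ModelWithCorners ℂ A₁ H₁} [I₁.Boundaryless]
  {M₁ : Type u} [TopologicalSpace M₁] [ChartedSpace H₁ M₁] [IsManifold I₁ ω M₁]
  {F₁ : Type u} [NormedAddCommGroup F₁] [NormedSpace ℂ F₁] [FiniteDimensional ℂ F₁]
  {E₁ : M₁ → Type u} [∀ x, AddCommGroup (E₁ x)] [∀ x, Module ℂ (E₁ x)]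
  [TopologicalSpace (TotalSpace F₁ E₁)] [∀ x, TopologicalSpace (E₁ x)] [FiberBundle F₁ E₁]
  [VectorBundle ℂ F₁ E₁] [ContMDiffVectorBundle ω F₁ E₁ I₁]
  {A₂ : Type u} [NormedAddCommGroup A₂] [NormedSpace ℂ A₂] [FiniteDimensional ℂ A₂]
  {H₂ : Type u} [TopologicalSpace H₂] {I₂ : ModelWithCorners ℂ A₂ H₂} [I₂.Boundaryless]
  {M₂ : Type u} [TopologicalSpace M₂] [ChartedSpace H₂ M₂] [IsManifold I₂ ω M₂]
  {F₂ : Type u} [NormedAddCommGroup F₂] [NormedSpace ℂ F₂] [FiniteDimensional ℂ F₂]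
  {E₂ : M₂ → Type u} [∀ x, AddCommGroup (E₂ x)] [∀ x, Module ℂ (E₂ x)]
  [TopologicalSpace (TotalSpace F₂ E₂)] [∀ x, TopologicalSpace (E₂ x)] [FiberBundle F₂ E₂]
  [VectorBundle ℂ F₂ E₂] [ContMDiffVectorBundle ω F₂ E₂ I₂]

variable (I F E I₁ F₁ E₁ I₂ F₂ E₂) in
/-- A presentation of `E → M` as the outer direct sum of `E₁ → M₁` and `E₂ → M₂`, in terms which are
symmetric in the two factors: pullbacks of sections along `φ₁` and `φ₂`, compatibly with the
preferred charts and trivializations. -/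
structure BundleProduct (φ₁ : C(M, M₁)) (φ₂ : C(M, M₂)) where
  pull₁ : BundlePull I₁ F₁ E₁ I F E φ₁
  pull₂ : BundlePull I₂ F₂ E₂ I F E φ₂
  baseEquiv : A ≃ₗ[ℂ] A₁ × A₂
  fibreEquiv : F ≃ₗ[ℂ] F₁ × F₂
  extChartAt_eq : ∀ w x, baseEquiv (extChartAt I w x) =
    (extChartAt I₁ (φ₁ w) (φ₁ x), extChartAt I₂ (φ₂ w) (φ₂ x))
  dom_le₁ : ∀ w, bundleDom H F E w ≤ Opens.comap φ₁ (bundleDom H₁ F₁ E₁ (φ₁ w))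
  dom_le₂ : ∀ w, bundleDom H F E w ≤ Opens.comap φ₂ (bundleDom H₂ F₂ E₂ (φ₂ w))
  trivSymm_eq : ∀ w, ∀ x ∈ bundleDom H F E w, ∀ v, trivSymm F E w x v =
    pull₁.lin x (trivSymm F₁ E₁ (φ₁ w) (φ₁ x) (fibreEquiv v).1) +
      pull₂.lin x (trivSymm F₂ E₂ (φ₂ w) (φ₂ x) (fibreEquiv v).2)
  exists_box : ∀ (W : Opens M), ∀ m ∈ W, ∃ (W₁ : Opens M₁) (W₂ : Opens M₂), φ₁ m ∈ W₁ ∧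
    φ₂ m ∈ W₂ ∧ Opens.comap φ₁ W₁ ⊓ Opens.comap φ₂ W₂ ≤ W

namespace BundleProduct

variable {φ₁ : C(M, M₁)} {φ₂ : C(M, M₂)}
  (P : BundleProduct I F E I₁ F₁ E₁ I₂ F₂ E₂ φ₁ φ₂)

/-- The same product with the factors exchanged. -/
def swap : BundleProduct I F E I₂ F₂ E₂ I₁ F₁ E₁ φ₂ φ₁ where
  pull₁ := P.pull₂
  pull₂ := P.pull₁
  baseEquiv := P.baseEquiv.trans (LinearEquiv.prodComm ℂ A₁ A₂)
  fibreEquiv := P.fibreEquiv.trans (LinearEquiv.prodComm ℂ F₁ F₂)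
  extChartAt_eq w x := congrArg Prod.swap (P.extChartAt_eq w x)
  dom_le₁ := P.dom_le₂
  dom_le₂ := P.dom_le₁
  trivSymm_eq w x hx v := (P.trivSymm_eq w x hx v).trans (add_comm _ _)
  exists_box W m hm := by
    obtain ⟨W₁, W₂, h₁, h₂, h⟩ := P.exists_box W m hm
    exact ⟨W₂, W₁, h₂, h₁, inf_comm (Opens.comap φ₁ W₁) _ ▸ h⟩

/-- The basis of the model space of the base which is adapted to the factors. -/
def basis : Module.Basis (Fin (Module.finrank ℂ A₁) ⊕ Fin (Module.finrank ℂ A₂)) ℂ A :=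
  ((Module.finBasis ℂ A₁).prod (Module.finBasis ℂ A₂)).map P.baseEquiv.symm

/-- The basis of the model fibre which is adapted to the factors. -/
def basisF : Module.Basis (Fin (Module.finrank ℂ F₁) ⊕ Fin (Module.finrank ℂ F₂)) ℂ F :=
  ((Module.finBasis ℂ F₁).prod (Module.finBasis ℂ F₂)).map P.fibreEquiv.symm

theorem coordFun_inl (w x : M) (i : Fin (Module.finrank ℂ A₁)) :
    coordFun I w P.basis (Sum.inl i) x =
      coordFun I₁ (φ₁ w) (Module.finBasis ℂ A₁) i (φ₁ x) := by
  simp only [coordFun, basis, Module.Basis.coord_apply, Module.Basis.map_repr,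
    LinearEquiv.trans_apply, LinearEquiv.symm_symm, P.extChartAt_eq, Module.Basis.prod_repr_inl]

theorem coordFun_inr (w x : M) (i : Fin (Module.finrank ℂ A₂)) :
    coordFun I w P.basis (Sum.inr i) x =
      coordFun I₂ (φ₂ w) (Module.finBasis ℂ A₂) i (φ₂ x) := by
  simp only [coordFun, basis, Module.Basis.coord_apply, Module.Basis.map_repr,
    LinearEquiv.trans_apply, LinearEquiv.symm_symm, P.extChartAt_eq, Module.Basis.prod_repr_inr]

/-- The coordinates of the product are the pullbacks of the coordinates of the factors. -/
theorem coordSec_inl {w : M} {V : Opens M} (hV : V ≤ bundleDom H F E w)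
    (i : Fin (Module.finrank ℂ A₁)) : coordSec I F E P.basis hV (Sum.inl i) =
      P.pull₁.sec (hV.trans (P.dom_le₁ w)) (coordSec I₁ F₁ E₁ (Module.finBasis ℂ A₁) le_rfl i) := by
  refine Subtype.ext (funext fun x => ?_)
  refine (congrArg (algebraMap ℂ _) (P.coordFun_inl w x i)).trans ?_
  exact (AlgHom.commutes (ExteriorAlgebra.map (P.pull₁.lin x.1)) _).symm

theorem coordSec_inr {w : M} {V : Opens M} (hV : V ≤ bundleDom H F E w)
    (i : Fin (Module.finrank ℂ A₂)) : coordSec I F E P.basis hV (Sum.inr i) =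
      P.pull₂.sec (hV.trans (P.dom_le₂ w)) (coordSec I₂ F₂ E₂ (Module.finBasis ℂ A₂) le_rfl i) := by
  refine Subtype.ext (funext fun x => ?_)
  refine (congrArg (algebraMap ℂ _) (P.coordFun_inr w x i)).trans ?_
  exact (AlgHom.commutes (ExteriorAlgebra.map (P.pull₂.lin x.1)) _).symm

theorem frameSec_eq {w : M} {V : Opens M} (hV : V ≤ bundleDom H F E w) (v : F) :
    frameSec I hV v = P.pull₁.sec (hV.trans (P.dom_le₁ w)) (frameSec I₁ le_rfl (P.fibreEquiv v).1) +
      P.pull₂.sec (hV.trans (P.dom_le₂ w)) (frameSec I₂ le_rfl (P.fibreEquiv v).2) := by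
  refine Subtype.ext (funext fun x => ?_)
  change ExteriorAlgebra.map (trivSymm F E w x) (ExteriorAlgebra.ι ℂ v) =
    ExteriorAlgebra.map (P.pull₁.lin x) (ExteriorAlgebra.map (trivSymm F₁ E₁ (φ₁ w) (φ₁ x))
      (ExteriorAlgebra.ι ℂ (P.fibreEquiv v).1)) +
    ExteriorAlgebra.map (P.pull₂.lin x) (ExteriorAlgebra.map (trivSymm F₂ E₂ (φ₂ w) (φ₂ x))
      (ExteriorAlgebra.ι ℂ (P.fibreEquiv v).2))
  simp only [ExteriorAlgebra.map_apply_ι]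
  rw [P.trivSymm_eq w x (hV x.2), map_add]

theorem frameSec_zero {w : M} {V : Opens M} (hV : V ≤ bundleDom H F E w) :
    frameSec I (F := F) (E := E) hV (0 : F) = 0 := by
  rw [frameSec, map_zero, map_zero]

theorem frameSec_inl {w : M} {V : Opens M} (hV : V ≤ bundleDom H F E w)
    (j : Fin (Module.finrank ℂ F₁)) : frameSec I hV (P.basisF (Sum.inl j)) =
      P.pull₁.sec (hV.trans (P.dom_le₁ w)) (frameSec I₁ le_rfl (Module.finBasis ℂ F₁ j)) := by
  rw [P.frameSec_eq hV]
  simp [basisF, frameSec_zero]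

theorem frameSec_inr {w : M} {V : Opens M} (hV : V ≤ bundleDom H F E w)
    (j : Fin (Module.finrank ℂ F₂)) : frameSec I hV (P.basisF (Sum.inr j)) =
      P.pull₂.sec (hV.trans (P.dom_le₂ w)) (frameSec I₂ le_rfl (Module.finBasis ℂ F₂ j)) := by
  rw [P.frameSec_eq hV]
  simp [basisF, frameSec_zero]

/-- Homomorphisms on germs of sections over a product agree if they agree on the sections which are
pulled back from the factors. -/
theorem ext_of_pull {m : M} {X : Type*} [AddCommGroup X] [Module ℂ X] [Module.Finite ℂ X]
    {h h' : GermHom (exteriorSheaf I F E) m (ExteriorAlgebra ℂ X)} {l : E m →ₗ[ℂ] X}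
    (hh' : h'.Compat (exteriorData I F E) l)
    (e₁ : h.comp (P.pull₁.hol ⊤) trivial = h'.comp (P.pull₁.hol ⊤) trivial)
    (e₂ : h.comp (P.pull₂.hol ⊤) trivial = h'.comp (P.pull₂.hol ⊤) trivial) : h = h' := by
  have hm := mem_bundleDom (H := H) (F := F) (E := E) m
  have k₁ : ∀ f : exteriorSections I₁ F₁ E₁ (bundleDom H₁ F₁ E₁ (φ₁ m)),
      h.app _ hm (P.pull₁.sec (P.dom_le₁ m) f) = h'.app _ hm (P.pull₁.sec (P.dom_le₁ m) f) := by
    intro f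
    have h1 := h.comp_app (P.pull₁.hol ⊤) trivial (P.dom_le₁ m hm) hm (P.dom_le₁ m) le_top f
    have h2 := h'.comp_app (P.pull₁.hol ⊤) trivial (P.dom_le₁ m hm) hm (P.dom_le₁ m) le_top f
    rw [e₁] at h1
    exact h1.symm.trans h2
  have k₂ : ∀ f : exteriorSections I₂ F₂ E₂ (bundleDom H₂ F₂ E₂ (φ₂ m)),
      h.app _ hm (P.pull₂.sec (P.dom_le₂ m) f) = h'.app _ hm (P.pull₂.sec (P.dom_le₂ m) f) := by
    intro f
    have h1 := h.comp_app (P.pull₂.hol ⊤) trivial (P.dom_le₂ m hm) hm (P.dom_le₂ m) le_top f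
    have h2 := h'.comp_app (P.pull₂.hol ⊤) trivial (P.dom_le₂ m hm) hm (P.dom_le₂ m) le_top f
    rw [e₂] at h1
    exact h1.symm.trans h2
  refine GermHom.ext_of_coord hm hh'.body P.basis P.basisF ?_ ?_
  · rintro (i | i)
    · rw [P.coordSec_inl]; exact k₁ _
    · rw [P.coordSec_inr]; exact k₂ _
  · rintro (j | j)
    · rw [P.frameSec_inl]; exact k₁ _
    · rw [P.frameSec_inr]; exact k₂ _

end BundleProduct

variable {φ₁ : C(M, M₁)} {φ₂ : C(M, M₂)}

/-! ### The universal property of split products -/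

section ProductMaps

variable (P : BundleProduct I F E I₁ F₁ E₁ I₂ F₂ E₂ φ₁ φ₂)

namespace BundleProduct

set_option maxHeartbeats 1600000 in
/-- Compatible homomorphisms on the sections over the two factors extend, locally, to an
endomorphism of the sections over the product. -/
theorem exists_hom {W : Opens M} {w : M} (hW : W ≤ bundleDom H F E w)
    (a : HolHom I F E (exteriorSheaf I₁ F₁ E₁) φ₁ W)
    (ha : ∀ x hx, (a.germ x hx).Compat (exteriorData I₁ F₁ E₁) (P.pull₁.lin x))
    (b : HolHom I F E (exteriorSheaf I₂ F₂ E₂) φ₂ W)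
    (hb : ∀ x hx, (b.germ x hx).Compat (exteriorData I₂ F₂ E₂) (P.pull₂.lin x)) :
    ∃ Φ : HolHom I F E (exteriorSheaf I F E) (ContinuousMap.id M) W,
      (∀ x hx, GermHom.Compat (m := x) (exteriorData I F E) (Φ.germ x hx) LinearMap.id) ∧
      (∀ x hx, GermHom.comp (x := x) (Φ.germ x hx) (P.pull₁.hol ⊤) trivial = a.germ x hx) ∧
      (∀ x hx, GermHom.comp (x := x) (Φ.germ x hx) (P.pull₂.hol ⊤) trivial = b.germ x hx) := by
  let D₁ := bundleDom H₁ F₁ E₁ (φ₁ w)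
  let D₂ := bundleDom H₂ F₂ E₂ (φ₂ w)
  have h₁ : ∀ V : Opens M, V ≤ W → V ≤ Opens.comap φ₁ D₁ := fun V hV =>
    (hV.trans hW).trans (P.dom_le₁ w)
  have h₂ : ∀ V : Opens M, V ≤ W → V ≤ Opens.comap φ₂ D₂ := fun V hV =>
    (hV.trans hW).trans (P.dom_le₂ w)
  -- The values of `a` and `b` on the sections over the coordinate domains of the factors.
  let sa : ∀ V : Opens M, V ≤ W → exteriorSections I₁ F₁ E₁ D₁ →ₐ[ℂ] exteriorSections I F E V :=
    fun V hV => a.sec (h₁ V hV) hV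
  let sb : ∀ V : Opens M, V ≤ W → exteriorSections I₂ F₂ E₂ D₂ →ₐ[ℂ] exteriorSections I F E V :=
    fun V hV => b.sec (h₂ V hV) hV
  let x₁ := fun i => coordSec I₁ F₁ E₁ (Module.finBasis ℂ A₁) (le_refl D₁) i
  let x₂ := fun i => coordSec I₂ F₂ E₂ (Module.finBasis ℂ A₂) (le_refl D₂) i
  let ϑ₁ : F₁ → exteriorSections I₁ F₁ E₁ D₁ := fun v => frameSec I₁ (le_refl D₁) v
  let ϑ₂ : F₂ → exteriorSections I₂ F₂ E₂ D₂ := fun v => frameSec I₂ (le_refl D₂) v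
  have x₁_even : ∀ i (x : D₁), (x₁ i).1 x ∈ extParity (E₁ x) 0 := fun i x =>
    SetLike.algebraMap_mem_graded _ _
  have x₂_even : ∀ i (x : D₂), (x₂ i).1 x ∈ extParity (E₂ x) 0 := fun i x =>
    SetLike.algebraMap_mem_graded _ _
  have ϑ₁_odd : ∀ v (x : D₁), (ϑ₁ v).1 x ∈ extParity (E₁ x) 1 :=
    frameSec_odd le_rfl
  have ϑ₂_odd : ∀ v (x : D₂), (ϑ₂ v).1 x ∈ extParity (E₂ x) 1 :=
    frameSec_odd le_rfl
  have sa_par : ∀ (V : Opens M) (hV : V ≤ W) (q : ZMod 2) (f : exteriorSections I₁ F₁ E₁ D₁),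
      (∀ x : D₁, f.1 x ∈ extParity (E₁ x) q) → ∀ x : V, (sa V hV f).1 x ∈ extParity (E x) q :=
    fun V hV q f hf x => (ha x.1 (hV x.2)).parity D₁ _ q f hf
  have sb_par : ∀ (V : Opens M) (hV : V ≤ W) (q : ZMod 2) (f : exteriorSections I₂ F₂ E₂ D₂),
      (∀ x : D₂, f.1 x ∈ extParity (E₂ x) q) → ∀ x : V, (sb V hV f).1 x ∈ extParity (E x) q :=
    fun V hV q f hf x => (hb x.1 (hV x.2)).parity D₂ _ q f hf
  have pa_par : ∀ (V : Opens M) (hV : V ≤ W) (q : ZMod 2) (f : exteriorSections I₁ F₁ E₁ D₁),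
      (∀ x : D₁, f.1 x ∈ extParity (E₁ x) q) →
        ∀ x : V, (P.pull₁.sec (h₁ V hV) f).1 x ∈ extParity (E x) q :=
    fun V hV q f hf x => map_mem_extParity _ (hf ⟨_, h₁ V hV x.2⟩)
  have pb_par : ∀ (V : Opens M) (hV : V ≤ W) (q : ZMod 2) (f : exteriorSections I₂ F₂ E₂ D₂),
      (∀ x : D₂, f.1 x ∈ extParity (E₂ x) q) →
        ∀ x : V, (P.pull₂.sec (h₂ V hV) f).1 x ∈ extParity (E x) q :=
    fun V hV q f hf x => map_mem_extParity _ (hf ⟨_, h₂ V hV x.2⟩)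
  -- The increments of the even coordinates are even and nilpotent, since `a` and `b` induce the
  -- pullbacks of functions on the bodies.
  let Δ : ∀ V : Opens M, V ≤ W → (Fin (Module.finrank ℂ A₁) ⊕ Fin (Module.finrank ℂ A₂)) →
      exteriorSections I F E V := fun V hV => Sum.elim
    (fun i => sa V hV (x₁ i) - P.pull₁.sec (h₁ V hV) (x₁ i))
    (fun i => sb V hV (x₂ i) - P.pull₂.sec (h₂ V hV) (x₂ i))
  have Δ_even : ∀ (V : Opens M) (hV : V ≤ W) i (x : V), (Δ V hV i).1 x ∈ extParity (E x) 0 := by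
    rintro V hV (i | i) x
    · exact sub_mem (sa_par V hV 0 _ (x₁_even i) x) (pa_par V hV 0 _ (x₁_even i) x)
    · exact sub_mem (sb_par V hV 0 _ (x₂_even i) x) (pb_par V hV 0 _ (x₂_even i) x)
  have Δ_mem : ∀ (V : Opens M) (hV : V ≤ W) i (x : V), (Δ V hV i).1 x ∈ extFil (E x) 1 := by
    rintro V hV (i | i) x
    · rw [mem_extFil_one]
      refine (map_sub ExteriorAlgebra.algebraMapInv ((sa V hV (x₁ i)).1 x)
        ((P.pull₁.sec (h₁ V hV) (x₁ i)).1 x)).trans (sub_eq_zero.2 ?_)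
      have e : ExteriorAlgebra.algebraMapInv ((sa V hV (x₁ i)).1 x) =
          ExteriorAlgebra.algebraMapInv ((x₁ i).1 ⟨φ₁ x.1, h₁ V hV x.2⟩) :=
        (ha x.1 (hV x.2)).body D₁ (h₁ V hV x.2) (x₁ i)
      refine e.trans ?_
      exact (algebraMapInv_map (P.pull₁.lin x.1) ((x₁ i).1 ⟨_, h₁ V hV x.2⟩)).symm
    · rw [mem_extFil_one]
      refine (map_sub ExteriorAlgebra.algebraMapInv ((sb V hV (x₂ i)).1 x)
        ((P.pull₂.sec (h₂ V hV) (x₂ i)).1 x)).trans (sub_eq_zero.2 ?_)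
      have e : ExteriorAlgebra.algebraMapInv ((sb V hV (x₂ i)).1 x) =
          ExteriorAlgebra.algebraMapInv ((x₂ i).1 ⟨φ₂ x.1, h₂ V hV x.2⟩) :=
        (hb x.1 (hV x.2)).body D₂ (h₂ V hV x.2) (x₂ i)
      refine e.trans ?_
      exact (algebraMapInv_map (P.pull₂.lin x.1) ((x₂ i).1 ⟨_, h₂ V hV x.2⟩)).symm
  let ϑ : ∀ V : Opens M, V ≤ W → F →ₗ[ℂ] exteriorSections I F E V := fun V hV =>
    ((sa V hV).toLinearMap ∘ₗ (constSec I₁ (φ₁ w) (bundleDom_le_trivDom (H := H₁))).toLinearMap ∘ₗ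
      ExteriorAlgebra.ι ℂ ∘ₗ LinearMap.fst ℂ F₁ F₂ +
    (sb V hV).toLinearMap ∘ₗ (constSec I₂ (φ₂ w) (bundleDom_le_trivDom (H := H₂))).toLinearMap ∘ₗ
      ExteriorAlgebra.ι ℂ ∘ₗ LinearMap.snd ℂ F₁ F₂) ∘ₗ P.fibreEquiv.toLinearMap
  have ϑ_apply : ∀ V hV v, ϑ V hV v = sa V hV (ϑ₁ (P.fibreEquiv v).1) +
    sb V hV (ϑ₂ (P.fibreEquiv v).2) := fun _ _ _ => rfl
  have ϑ_odd : ∀ (V : Opens M) (hV : V ≤ W) v (x : V), (ϑ V hV v).1 x ∈ extParity (E x) 1 :=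
    fun V hV v x => add_mem (sa_par V hV 1 _ (ϑ₁_odd _) x) (sb_par V hV 1 _ (ϑ₂_odd _) x)
  obtain ⟨Ψ, Ψ_res, Ψ_x, Ψ_θ⟩ := exists_hom_family (I := I) (F := F) (E := E) P.basis hW
    (fun V => exteriorSections I F E V) (fun h => exteriorRes I F E h)
    (fun V _ => scalarSec I F E V) (fun _ _ _ _ _ => rfl)
    (fun V _ f a => scalarSec_mul_comm f a) Δ
    (fun V' V h hV i => by cases i <;> rfl) (fun V hV i a => mul_comm_of_even (Δ_even V hV i) a)
    (Module.finrank ℂ F + 1) (fun V hV i => isNilpotent_of_mem_extFil _ (Δ_mem V hV i)) ϑ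
    (fun _ _ _ _ _ => rfl) (fun V hV v => mul_self_of_odd (ϑ_odd V hV v))
  -- On the coordinates of the factors, `Ψ` has the values of `a` and `b`.
  have Ψ₁ : ∀ (V : Opens M) (hV : V ≤ W) i, Ψ V hV (P.pull₁.sec (h₁ V hV) (x₁ i)) =
      sa V hV (x₁ i) := by
    intro V hV i
    have e1 := P.coordSec_inl (hV.trans hW) i
    have e2 := Ψ_x V hV (Sum.inl i)
    have e3 : scalarSec I F E V (coordHol I P.basis ((hV.trans hW).trans bundleDom_le_chartDom)
      (Sum.inl i)) = P.pull₁.sec (h₁ V hV) (x₁ i) := e1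
    rw [e3, e1] at e2
    exact e2.trans (add_sub_cancel _ _)
  have Ψ₂ : ∀ (V : Opens M) (hV : V ≤ W) i, Ψ V hV (P.pull₂.sec (h₂ V hV) (x₂ i)) =
      sb V hV (x₂ i) := by
    intro V hV i
    have e1 := P.coordSec_inr (hV.trans hW) i
    have e2 := Ψ_x V hV (Sum.inr i)
    have e3 : scalarSec I F E V (coordHol I P.basis ((hV.trans hW).trans bundleDom_le_chartDom)
      (Sum.inr i)) = P.pull₂.sec (h₂ V hV) (x₂ i) := e1
    rw [e3, e1] at e2
    exact e2.trans (add_sub_cancel _ _)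
  have zero₁ : ϑ₁ 0 = 0 := by simp only [ϑ₁, frameSec, map_zero]
  have zero₂ : ϑ₂ 0 = 0 := by simp only [ϑ₂, frameSec, map_zero]
  have Ψ₃ : ∀ (V : Opens M) (hV : V ≤ W) v, Ψ V hV (P.pull₁.sec (h₁ V hV) (ϑ₁ v)) =
      sa V hV (ϑ₁ v) := by
    intro V hV v
    have e1 := P.frameSec_eq (hV.trans hW) (P.fibreEquiv.symm (v, 0))
    have e2 := Ψ_θ V hV (P.fibreEquiv.symm (v, 0))
    rw [e1, ϑ_apply, LinearEquiv.apply_symm_apply] at e2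
    change Ψ V hV (P.pull₁.sec (h₁ V hV) (ϑ₁ v) + P.pull₂.sec (h₂ V hV) (ϑ₂ 0)) =
      sa V hV (ϑ₁ v) + sb V hV (ϑ₂ 0) at e2
    rwa [zero₂, map_zero, map_zero, add_zero, add_zero] at e2
  have Ψ₄ : ∀ (V : Opens M) (hV : V ≤ W) v, Ψ V hV (P.pull₂.sec (h₂ V hV) (ϑ₂ v)) =
      sb V hV (ϑ₂ v) := by
    intro V hV v
    have e1 := P.frameSec_eq (hV.trans hW) (P.fibreEquiv.symm (0, v))
    have e2 := Ψ_θ V hV (P.fibreEquiv.symm (0, v))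
    rw [e1, ϑ_apply, LinearEquiv.apply_symm_apply] at e2
    change Ψ V hV (P.pull₁.sec (h₁ V hV) (ϑ₁ 0) + P.pull₂.sec (h₂ V hV) (ϑ₂ v)) =
      sa V hV (ϑ₁ 0) + sb V hV (ϑ₂ v) at e2
    rwa [zero₁, map_zero, map_zero, zero_add, zero_add] at e2
  let Φ : HolHom I F E (exteriorSheaf I F E) (ContinuousMap.id M) W :=
    { germ := fun x hx =>
        { app := fun V hV => ((evalGerm I F x).app (V ⊓ W) ⟨hV, hx⟩).comp
            ((Ψ (V ⊓ W) inf_le_right).comp (exteriorRes I F E inf_le_left))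
          app_res := fun {V' V} h hV f => by
            have := Ψ_res (V' ⊓ W) (V ⊓ W) (inf_le_inf_right W h) inf_le_right
              (exteriorRes I F E inf_le_left f)
            exact congrArg (fun g : exteriorSections I F E (V' ⊓ W) => g.1 ⟨x, hV, hx⟩) this }
      hol := fun V V' hV hW' f => by
        convert (Ψ V' hW' (exteriorRes I F E hV f)).2 using 1
        ext x
        have := Ψ_res V' (V ⊓ W) (le_inf hV hW') inf_le_right (exteriorRes I F E inf_le_left f)
        exact (congrArg (fun g : exteriorSections I F E V' => g.1 x) this).symm }
  have Φ_app : ∀ (x : M) (hx : x ∈ W) (V : Opens M) (hV : x ∈ V) (V' : Opens M) (hV' : V' ≤ W)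
      (hVV : V' ≤ V) (hxV : x ∈ V') (f : exteriorSections I F E V),
      (Φ.germ x hx).app V hV f = (Ψ V' hV' (exteriorRes I F E hVV f)).1 ⟨x, hxV⟩ := by
    intro x hx V hV V' hV' hVV hxV f
    have := Ψ_res V' (V ⊓ W) (le_inf hVV hV') inf_le_right (exteriorRes I F E inf_le_left f)
    exact (congrArg (fun g : exteriorSections I F E V' => g.1 ⟨x, hxV⟩) this).symm
  have hfin := fun x => finite_fibre F (E := E) x
  -- Compatibility, and the equality with `a` and `b` on pullbacks, are checked on coordinates.
  refine ⟨Φ, fun x hx => ?_, fun x hx => ?_, fun x hx => ?_⟩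
  · refine GermHom.compat_of_coord (w := w) (hW hx) (Φ.germ x hx) LinearMap.id P.basis P.basisF
      (fun i => ?_) (fun i => ?_) (fun j => ?_) (fun j => ?_)
    · rw [Φ_app x hx _ (hW hx) W le_rfl hW hx]
      cases i with
      | inl i =>
        rw [P.coordSec_inl]
        have e := Ψ₁ W le_rfl i
        exact (congrArg (fun g : exteriorSections I F E W => g.1 ⟨x, hx⟩) e) ▸
          sa_par W le_rfl 0 _ (x₁_even i) ⟨x, hx⟩
      | inr i =>
        rw [P.coordSec_inr]
        have e := Ψ₂ W le_rfl i
        exact (congrArg (fun g : exteriorSections I F E W => g.1 ⟨x, hx⟩) e) ▸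
          sb_par W le_rfl 0 _ (x₂_even i) ⟨x, hx⟩
    · rw [Φ_app x hx _ (hW hx) W le_rfl hW hx]
      cases i with
      | inl i =>
        rw [P.coordSec_inl, P.coordFun_inl]
        have e := Ψ₁ W le_rfl i
        refine (congrArg (fun g : exteriorSections I F E W =>
          ExteriorAlgebra.algebraMapInv (g.1 ⟨x, hx⟩)) e).trans ?_
        exact ((ha x hx).body D₁ _ (x₁ i)).trans (AlgHom.commutes _ _)
      | inr i =>
        rw [P.coordSec_inr, P.coordFun_inr]
        have e := Ψ₂ W le_rfl i
        refine (congrArg (fun g : exteriorSections I F E W =>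
          ExteriorAlgebra.algebraMapInv (g.1 ⟨x, hx⟩)) e).trans ?_
        exact ((hb x hx).body D₂ _ (x₂ i)).trans (AlgHom.commutes _ _)
    · rw [Φ_app x hx _ (hW hx) W le_rfl hW hx]
      have e := Ψ_θ W le_rfl (P.basisF j)
      exact (congrArg (fun g : exteriorSections I F E W => g.1 ⟨x, hx⟩) e) ▸
        ϑ_odd W le_rfl _ ⟨x, hx⟩
    · rw [Φ_app x hx _ (hW hx) W le_rfl hW hx]
      have e := Ψ_θ W le_rfl (P.basisF j)
      refine (congrArg (fun g : exteriorSections I F E W =>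
          ExteriorAlgebra.ιInv (g.1 ⟨x, hx⟩)) e).trans ?_
      change ExteriorAlgebra.ιInv ((a.germ x hx).app D₁ _ (ϑ₁ (P.fibreEquiv (P.basisF j)).1) +
        (b.germ x hx).app D₂ _ (ϑ₂ (P.fibreEquiv (P.basisF j)).2)) = _
      rw [map_add, P.trivSymm_eq w x (hW hx)]
      have l₁ : ∀ v, ExteriorAlgebra.ιInv ((ϑ₁ v).1 ⟨φ₁ x, h₁ W le_rfl hx⟩) =
          trivSymm F₁ E₁ (φ₁ w) (φ₁ x) v := fun v => by
        refine (ιInv_map (trivSymm F₁ E₁ (φ₁ w) (φ₁ x)) (ExteriorAlgebra.ι ℂ v)).trans ?_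
        rw [ExteriorAlgebra.ι_leftInverse]
      have l₂ : ∀ v, ExteriorAlgebra.ιInv ((ϑ₂ v).1 ⟨φ₂ x, h₂ W le_rfl hx⟩) =
          trivSymm F₂ E₂ (φ₂ w) (φ₂ x) v := fun v => by
        refine (ιInv_map (trivSymm F₂ E₂ (φ₂ w) (φ₂ x)) (ExteriorAlgebra.ι ℂ v)).trans ?_
        rw [ExteriorAlgebra.ι_leftInverse]
      refine congrArg₂ (· + ·) ?_ ?_
      · refine ((ha x hx).lin D₁ _ _).trans (congrArg (P.pull₁.lin x) (l₁ _))
      · refine ((hb x hx).lin D₂ _ _).trans (congrArg (P.pull₂.lin x) (l₂ _))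
  · have hx₁ : φ₁ x ∈ D₁ := h₁ W le_rfl hx
    have key : ∀ f : exteriorSections I₁ F₁ E₁ D₁, Ψ W le_rfl (P.pull₁.sec (h₁ W le_rfl) f) =
        sa W le_rfl f → (GermHom.comp (x := x) (Φ.germ x hx) (P.pull₁.hol ⊤) trivial).app D₁ hx₁ f =
          (a.germ x hx).app D₁ hx₁ f := by
      intro f hf
      refine (GermHom.comp_app (x := x) (Φ.germ x hx) (P.pull₁.hol ⊤) trivial hx₁ hx (h₁ W le_rfl)
        le_top f).trans ?_
      refine (Φ_app x hx W hx W le_rfl le_rfl hx _).trans ?_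
      exact congrArg (fun g : exteriorSections I F E W => g.1 ⟨x, hx⟩) hf
    exact GermHom.ext_of_coord hx₁ (ha x hx).body (Module.finBasis ℂ A₁) (Module.finBasis ℂ F₁)
      (fun i => key _ (Ψ₁ W le_rfl i)) (fun j => key _ (Ψ₃ W le_rfl _))
  · have hx₂ : φ₂ x ∈ D₂ := h₂ W le_rfl hx
    have key : ∀ f : exteriorSections I₂ F₂ E₂ D₂, Ψ W le_rfl (P.pull₂.sec (h₂ W le_rfl) f) =
        sb W le_rfl f → (GermHom.comp (x := x) (Φ.germ x hx) (P.pull₂.hol ⊤) trivial).app D₂ hx₂ f =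
          (b.germ x hx).app D₂ hx₂ f := by
      intro f hf
      refine (GermHom.comp_app (x := x) (Φ.germ x hx) (P.pull₂.hol ⊤) trivial hx₂ hx (h₂ W le_rfl)
        le_top f).trans ?_
      refine (Φ_app x hx W hx W le_rfl le_rfl hx _).trans ?_
      exact congrArg (fun g : exteriorSections I F E W => g.1 ⟨x, hx⟩) hf
    exact GermHom.ext_of_coord hx₂ (hb x hx).body (Module.finBasis ℂ A₂) (Module.finBasis ℂ F₂)
      (fun i => key _ (Ψ₂ W le_rfl i)) (fun j => key _ (Ψ₄ W le_rfl _))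

end BundleProduct

end ProductMaps

/-! ### Adapted splittings and the universal property of products -/

section UniversalProperty

variable (P : BundleProduct I F E I₁ F₁ E₁ I₂ F₂ E₂ φ₁ φ₂)
  {S₁ : Supermanifold I₁ F₁ E₁} {S₂ : Supermanifold I₂ F₂ E₂} {N : Supermanifold I F E}
  {q₁ : SuperMorphism N.toSuperPresheaf S₁.toSuperPresheaf φ₁}
  {q₂ : SuperMorphism N.toSuperPresheaf S₂.toSuperPresheaf φ₂}

theorem GermHom.Compat.of_eq {S : SuperData E} {m : M} {X : Type*} [AddCommGroup X] [Module ℂ X]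
    {h : GermHom S.toSuperPresheaf m (ExteriorAlgebra ℂ X)} {l l' : E m →ₗ[ℂ] X}
    (hh : h.Compat S l) (e : l = l') : h.Compat S l' := e ▸ hh

namespace BundleProduct

/-- A splitting of a product supermanifold is adapted to splittings of the factors if it turns the
projections into the pullbacks of sections. -/
structure Adapted {W : Opens M} {U₁ : Opens M₁} {U₂ : Opens M₂}
    (q₁ : SuperMorphism N.toSuperPresheaf S₁.toSuperPresheaf φ₁)
    (q₂ : SuperMorphism N.toSuperPresheaf S₂.toSuperPresheaf φ₂)
    (ρ : LocalSplitting I F N.toSuperData W)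
    (τ₁ : LocalSplitting I₁ F₁ S₁.toSuperData U₁) (τ₂ : LocalSplitting I₂ F₂ S₂.toSuperData U₂) :
    Prop where
  le₁ : W ≤ Opens.comap φ₁ U₁
  le₂ : W ≤ Opens.comap φ₂ U₂
  eq₁ : ∀ y (hy : y ∈ W), ((ρ.germ y hy).compMorphism q₁).compSymm τ₁ (le₁ hy) =
    (P.pull₁.hol ⊤).germ y trivial
  eq₂ : ∀ y (hy : y ∈ W), ((ρ.germ y hy).compMorphism q₂).compSymm τ₂ (le₂ hy) =
    (P.pull₂.hol ⊤).germ y trivial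

/-- Locally, every splittings of the factors induce a splitting of the product. -/
theorem exists_adapted (hq₁ : q₁.Compat N.toSuperData S₁.toSuperData P.pull₁.lin)
    (hq₂ : q₂.Compat N.toSuperData S₂.toSuperData P.pull₂.lin)
    {U₁ : Opens M₁} {U₂ : Opens M₂}
    (τ₁ : LocalSplitting I₁ F₁ S₁.toSuperData U₁) (τ₂ : LocalSplitting I₂ F₂ S₂.toSuperData U₂)
    (x : M) (hx₁ : φ₁ x ∈ U₁) (hx₂ : φ₂ x ∈ U₂) :
    ∃ (W : Opens M) (ρ : LocalSplitting I F N.toSuperData W), x ∈ W ∧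
      P.Adapted q₁ q₂ ρ τ₁ τ₂ := by
  obtain ⟨W₀, hx₀, ⟨ρ₀⟩⟩ := N.exists_splitting x
  let W : Opens M := W₀ ⊓ (Opens.comap φ₁ U₁ ⊓ Opens.comap φ₂ U₂) ⊓ bundleDom H F E x
  have hxW : x ∈ W := ⟨⟨hx₀, hx₁, hx₂⟩, mem_bundleDom x⟩
  have hW₀ : W ≤ W₀ := inf_le_left.trans inf_le_left
  have hW₁ : W ≤ Opens.comap φ₁ U₁ := (inf_le_left.trans inf_le_right).trans inf_le_left
  have hW₂ : W ≤ Opens.comap φ₂ U₂ := (inf_le_left.trans inf_le_right).trans inf_le_right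
  let R₀ : HolHom I F E N.toSuperPresheaf (ContinuousMap.id M) W :=
    (HolHom.ofSplitting ρ₀).restrict hW₀
  have hR₀ : ∀ y hy, GermHom.Compat (m := y) N.toSuperData (R₀.germ y hy) LinearMap.id :=
    fun y hy => N.germ_compat ρ₀ y (hW₀ hy)
  -- In an arbitrary splitting `ρ₀`, the projections differ from the pullbacks of sections by an
  -- automorphism `Φ`; composing `ρ₀` with its inverse `Ψ` makes the splitting adapted.
  let a := (R₀.compMorphism q₁).compSymm τ₁ hW₁
  let b := (R₀.compMorphism q₂).compSymm τ₂ hW₂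
  have ha : ∀ y hy, (a.germ y hy).Compat (exteriorData I₁ F₁ E₁) (P.pull₁.lin y) := fun y hy =>
    (GermHom.Compat.compSymm (GermHom.Compat.compMorphism hq₁ (hR₀ y hy)) τ₁ (hW₁ hy)).of_eq
      (LinearMap.id_comp _)
  have hb : ∀ y hy, (b.germ y hy).Compat (exteriorData I₂ F₂ E₂) (P.pull₂.lin y) := fun y hy =>
    (GermHom.Compat.compSymm (GermHom.Compat.compMorphism hq₂ (hR₀ y hy)) τ₂ (hW₂ hy)).of_eq
      (LinearMap.id_comp _)
  obtain ⟨Φ, hΦ, hΦ₁, hΦ₂⟩ := P.exists_hom inf_le_right a ha b hb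
  obtain ⟨T, hT⟩ := (exteriorSupermanifold I F E).exists_splitting_of_compat Φ hΦ
  let Ψ : HolHom I F E (exteriorSheaf I F E) (ContinuousMap.id M) W :=
    { germ := fun y hy => GermHom.compSymm (S := exteriorData I F E) (evalGerm I F y) T hy
      hol := fun V V' hV hW' f => by
        let g : exteriorSections I F E (V ⊓ W) :=
          (T.eqv (V ⊓ W) inf_le_right).symm (exteriorRes I F E inf_le_left f)
        exact (exteriorRes I F E (le_inf hV hW') g).2 }
  have hΨ : ∀ y hy, GermHom.Compat (m := y) (exteriorData I F E) (Ψ.germ y hy) LinearMap.id :=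
    fun y hy => GermHom.Compat.compSymm (S := exteriorData I F E) (evalGerm_compat y) T hy
  obtain ⟨ρ, hρ⟩ := N.exists_splitting_of_compat (Ψ.comp R₀ le_rfl) fun y hy =>
    GermHom.Compat.compId hR₀ (hΨ y hy) hy
  -- Both factors are treated alike: on the image of a pullback, the splitting `ρ` is the inverse
  -- of `Φ` after `Φ`.
  refine ⟨W, ρ, hxW, hW₁, hW₂, fun y hy => ?_, fun y hy => ?_⟩
  · let ψ : GermHom (exteriorSheaf I F E) y (ExteriorAlgebra ℂ (E y)) := Ψ.germ y hy
    have e1 : (GermHom.compMorphism (m := y) ((Ψ.comp R₀ le_rfl).germ y hy) q₁).compSymm τ₁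
        (hW₁ hy) = ψ.comp a hy :=
      GermHom.comp_compSymm (R₀.compMorphism q₁) τ₁ hW₁ hy ψ
    rw [hρ y hy]
    refine e1.trans ?_
    have e2 : ψ.comp a hy =
        ψ.comp (Φ.comp (P.pull₁.hol ⊤) le_top) hy :=
      GermHom.comp_congr le_rfl le_rfl (fun z hz => (hΦ₁ z hz).symm) hy _
    refine e2.trans ((GermHom.comp_comp Φ (P.pull₁.hol ⊤) le_top hy ψ).trans ?_)
    have e3 : ψ.compId Φ hy = ψ.compId
        (HolHom.ofSplitting T) hy :=
      GermHom.comp_congr le_rfl le_rfl (fun z hz => (hT z hz).symm) hy _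
    have e4 : ψ.compId (HolHom.ofSplitting T) hy = evalGerm I F y :=
      GermHom.compSymm_compId (S := exteriorData I F E) T hy (evalGerm I F y)
    rw [e3, e4]
    rfl
  · let ψ : GermHom (exteriorSheaf I F E) y (ExteriorAlgebra ℂ (E y)) := Ψ.germ y hy
    have e1 : (GermHom.compMorphism (m := y) ((Ψ.comp R₀ le_rfl).germ y hy) q₂).compSymm τ₂
        (hW₂ hy) = ψ.comp b hy :=
      GermHom.comp_compSymm (R₀.compMorphism q₂) τ₂ hW₂ hy ψ
    rw [hρ y hy]
    refine e1.trans ?_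
    have e2 : ψ.comp b hy =
        ψ.comp (Φ.comp (P.pull₂.hol ⊤) le_top) hy :=
      GermHom.comp_congr le_rfl le_rfl (fun z hz => (hΦ₂ z hz).symm) hy _
    refine e2.trans ((GermHom.comp_comp Φ (P.pull₂.hol ⊤) le_top hy ψ).trans ?_)
    have e3 : ψ.compId Φ hy = ψ.compId
        (HolHom.ofSplitting T) hy :=
      GermHom.comp_congr le_rfl le_rfl (fun z hz => (hT z hz).symm) hy _
    have e4 : ψ.compId (HolHom.ofSplitting T) hy = evalGerm I F y :=
      GermHom.compSymm_compId (S := exteriorData I F E) T hy (evalGerm I F y)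
    rw [e3, e4]
    rfl

variable {P}

/-- In an adapted splitting, the pullback of sections becomes the projection, read in the splitting
of the factor. -/
theorem Adapted.compSymm_comp_pull₁ {W : Opens M} {U₁ : Opens M₁} {U₂ : Opens M₂}
    {ρ : LocalSplitting I F N.toSuperData W} {τ₁ : LocalSplitting I₁ F₁ S₁.toSuperData U₁}
    {τ₂ : LocalSplitting I₂ F₂ S₂.toSuperData U₂} (hρ : P.Adapted q₁ q₂ ρ τ₁ τ₂)
    {R : Type*} [Ring R] [Algebra ℂ R] {x : M} (hx : x ∈ W) (h : GermHom N.toSuperPresheaf x R) :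
    (h.compSymm ρ hx).comp (P.pull₁.hol ⊤) trivial =
      (h.compMorphism q₁).compSymm τ₁ (hρ.le₁ hx) := by
  have e1 : (h.compSymm ρ hx).comp (P.pull₁.hol ⊤) trivial = (h.compSymm ρ hx).comp
      (((HolHom.ofSplitting ρ).compMorphism q₁).compSymm τ₁ hρ.le₁) hx :=
    GermHom.comp_congr le_top le_rfl (fun y hy => (hρ.eq₁ y hy).symm) hx _
  refine e1.trans ?_
  rw [← GermHom.comp_compSymm, ← GermHom.compId_compMorphism, GermHom.compSymm_compId]

theorem Adapted.compSymm_comp_pull₂ {W : Opens M} {U₁ : Opens M₁} {U₂ : Opens M₂}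
    {ρ : LocalSplitting I F N.toSuperData W} {τ₁ : LocalSplitting I₁ F₁ S₁.toSuperData U₁}
    {τ₂ : LocalSplitting I₂ F₂ S₂.toSuperData U₂} (hρ : P.Adapted q₁ q₂ ρ τ₁ τ₂)
    {R : Type*} [Ring R] [Algebra ℂ R] {x : M} (hx : x ∈ W) (h : GermHom N.toSuperPresheaf x R) :
    (h.compSymm ρ hx).comp (P.pull₂.hol ⊤) trivial =
      (h.compMorphism q₂).compSymm τ₂ (hρ.le₂ hx) := by
  have e1 : (h.compSymm ρ hx).comp (P.pull₂.hol ⊤) trivial = (h.compSymm ρ hx).comp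
      (((HolHom.ofSplitting ρ).compMorphism q₂).compSymm τ₂ hρ.le₂) hx :=
    GermHom.comp_congr le_top le_rfl (fun y hy => (hρ.eq₂ y hy).symm) hx _
  refine e1.trans ?_
  rw [← GermHom.comp_compSymm, ← GermHom.compId_compMorphism, GermHom.compSymm_compId]

variable (P)

/-- Homomorphisms on germs of superfunctions on a product agree if they agree on the
superfunctions which are pulled back from the factors. -/
theorem ext_of_morphisms (hq₁ : q₁.Compat N.toSuperData S₁.toSuperData P.pull₁.lin)
    (hq₂ : q₂.Compat N.toSuperData S₂.toSuperData P.pull₂.lin)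
    {x : M} {X : Type*} [AddCommGroup X] [Module ℂ X] [Module.Finite ℂ X]
    {h h' : GermHom N.toSuperPresheaf x (ExteriorAlgebra ℂ X)} {l : E x →ₗ[ℂ] X}
    (hh' : h'.Compat N.toSuperData l)
    (e₁ : h.compMorphism q₁ = h'.compMorphism q₁) (e₂ : h.compMorphism q₂ = h'.compMorphism q₂) :
    h = h' := by
  obtain ⟨U₁, hx₁, ⟨τ₁⟩⟩ := S₁.exists_splitting (φ₁ x)
  obtain ⟨U₂, hx₂, ⟨τ₂⟩⟩ := S₂.exists_splitting (φ₂ x)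
  obtain ⟨W, ρ, hx, hρ⟩ := P.exists_adapted hq₁ hq₂ τ₁ τ₂ x hx₁ hx₂
  refine GermHom.eq_of_compSymm_eq ρ hx (P.ext_of_pull (hh'.compSymm ρ hx) ?_ ?_)
  · rw [hρ.compSymm_comp_pull₁ hx, hρ.compSymm_comp_pull₁ hx, e₁]
  · rw [hρ.compSymm_comp_pull₂ hx, hρ.compSymm_comp_pull₂ hx, e₂]

/-- The universal property of a product supermanifold: compatible homomorphisms on the
superfunctions of the factors come from a splitting of the product. -/
theorem exists_splitting (hq₁ : q₁.Compat N.toSuperData S₁.toSuperData P.pull₁.lin)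
    (hq₂ : q₂.Compat N.toSuperData S₂.toSuperData P.pull₂.lin) {W : Opens M}
    (a : HolHom I F E S₁.toSuperPresheaf φ₁ W)
    (ha : ∀ x hx, (a.germ x hx).Compat S₁.toSuperData (P.pull₁.lin x))
    (b : HolHom I F E S₂.toSuperPresheaf φ₂ W)
    (hb : ∀ x hx, (b.germ x hx).Compat S₂.toSuperData (P.pull₂.lin x)) :
    ∃ ρ : LocalSplitting I F N.toSuperData W,
      (∀ x hx, (ρ.germ x hx).compMorphism q₁ = a.germ x hx) ∧
      (∀ x hx, (ρ.germ x hx).compMorphism q₂ = b.germ x hx) := by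
  have hloc : ∀ x ∈ W, ∃ (W' : Opens M) (_ : x ∈ W') (hW' : W' ≤ W)
      (Φ : HolHom I F E N.toSuperPresheaf (ContinuousMap.id M) W'),
      (∀ y hy, GermHom.Compat (m := y) N.toSuperData (Φ.germ y hy) LinearMap.id) ∧
      (∀ y hy, GermHom.compMorphism (m := y) (Φ.germ y hy) q₁ = a.germ y (hW' hy)) ∧
      (∀ y hy, GermHom.compMorphism (m := y) (Φ.germ y hy) q₂ = b.germ y (hW' hy)) := by
    intro x hxW
    obtain ⟨U₁, hx₁, ⟨τ₁⟩⟩ := S₁.exists_splitting (φ₁ x)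
    obtain ⟨U₂, hx₂, ⟨τ₂⟩⟩ := S₂.exists_splitting (φ₂ x)
    obtain ⟨W₀, ρ, hx, hρ⟩ := P.exists_adapted hq₁ hq₂ τ₁ τ₂ x hx₁ hx₂
    let W' : Opens M := (W₀ ⊓ W) ⊓ bundleDom H F E x
    have hW₀ : W' ≤ W₀ := inf_le_left.trans inf_le_left
    have hWW : W' ≤ W := inf_le_left.trans inf_le_right
    obtain ⟨Ψ, hΨ, hΨ₁, hΨ₂⟩ := P.exists_hom (W := W') inf_le_right
      ((a.restrict hWW).compSymm τ₁ (hW₀.trans hρ.le₁))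
      (fun y hy => (ha y (hWW hy)).compSymm τ₁ (hρ.le₁ (hW₀ hy)))
      ((b.restrict hWW).compSymm τ₂ (hW₀.trans hρ.le₂))
      (fun y hy => (hb y (hWW hy)).compSymm τ₂ (hρ.le₂ (hW₀ hy)))
    refine ⟨W', ⟨⟨hx, hxW⟩, mem_bundleDom x⟩, hWW, Ψ.comp (HolHom.ofSplitting ρ) hW₀,
      fun y hy => ?_, fun y hy => ?_, fun y hy => ?_⟩
    · exact GermHom.Compat.compId (N.germ_compat ρ) (hΨ y hy) (hW₀ hy)
    · refine GermHom.eq_of_compSymm_eq τ₁ (hρ.le₁ (hW₀ hy)) (Eq.trans ?_ (hΨ₁ y hy))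
      let ψ : GermHom (exteriorSheaf I F E) y (ExteriorAlgebra ℂ (E y)) := Ψ.germ y hy
      have e1 := hρ.compSymm_comp_pull₁ (hW₀ hy) (ψ.compId (HolHom.ofSplitting ρ) (hW₀ hy))
      rw [GermHom.compId_compSymm] at e1
      exact e1.symm
    · refine GermHom.eq_of_compSymm_eq τ₂ (hρ.le₂ (hW₀ hy)) (Eq.trans ?_ (hΨ₂ y hy))
      let ψ : GermHom (exteriorSheaf I F E) y (ExteriorAlgebra ℂ (E y)) := Ψ.germ y hy
      have e1 := hρ.compSymm_comp_pull₂ (hW₀ hy) (ψ.compId (HolHom.ofSplitting ρ) (hW₀ hy))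
      rw [GermHom.compId_compSymm] at e1
      exact e1.symm
  choose W' hxW' hW' Φ hΦ hΦ₁ hΦ₂ using hloc
  have hfin := fun x => finite_fibre F (E := E) x
  -- The local solutions are unique, so they agree on germs.
  let Θ : HolHom I F E N.toSuperPresheaf (ContinuousMap.id M) W :=
    HolHom.ofLocally (fun y hy => (Φ y hy).germ y (hxW' y hy)) fun x hx => by
      refine ⟨W' x hx, hxW' x hx, hW' x hx, Φ x hx, fun y hy => ?_⟩
      refine P.ext_of_morphisms hq₁ hq₂ (x := y) (hΦ x hx y hy) ?_ ?_
      · exact (hΦ₁ y _ y _).trans (hΦ₁ x hx y hy).symm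
      · exact (hΦ₂ y _ y _).trans (hΦ₂ x hx y hy).symm
  obtain ⟨ρ, hρ⟩ := N.exists_splitting_of_compat Θ fun y hy => hΦ y hy y (hxW' y hy)
  refine ⟨ρ, fun x hx => ?_, fun x hx => ?_⟩
  · rw [hρ x hx]; exact hΦ₁ x hx x _
  · rw [hρ x hx]; exact hΦ₂ x hx x _

end BundleProduct

end UniversalProperty

section Agreement

variable (P : BundleProduct I F E I₁ F₁ E₁ I₂ F₂ E₂ φ₁ φ₂)
  {S₁ : Supermanifold I₁ F₁ E₁} {S₂ : Supermanifold I₂ F₂ E₂} {S N : Supermanifold I F E}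
  {p₁ : SuperMorphism S.toSuperPresheaf S₁.toSuperPresheaf φ₁}
  {p₂ : SuperMorphism S.toSuperPresheaf S₂.toSuperPresheaf φ₂}
  {q₁ : SuperMorphism N.toSuperPresheaf S₁.toSuperPresheaf φ₁}
  {q₂ : SuperMorphism N.toSuperPresheaf S₂.toSuperPresheaf φ₂}

/-- Two product supermanifolds have the same cochains of transition maps, because the splittings of
one determine splittings of the other with the same restrictions to the factors. -/
theorem BundleProduct.agreeUpTo (hp₁ : p₁.Compat S.toSuperData S₁.toSuperData P.pull₁.lin)
    (hp₂ : p₂.Compat S.toSuperData S₂.toSuperData P.pull₂.lin)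
    (hq₁ : q₁.Compat N.toSuperData S₁.toSuperData P.pull₁.lin)
    (hq₂ : q₂.Compat N.toSuperData S₂.toSuperData P.pull₂.lin) (t : ℕ) : AgreeUpTo t S N := by
  intro J U _ τ
  -- `σ i` is the splitting of `N` which restricts to the factors as `τ i` does.
  have hσ := fun i => P.exists_splitting hq₁ hq₂ ((HolHom.ofSplitting (τ i)).compMorphism p₁)
    (fun x hx => (GermHom.Compat.compMorphism hp₁ (S.germ_compat (τ i) x hx)).of_eq
      (LinearMap.id_comp _))
    ((HolHom.ofSplitting (τ i)).compMorphism p₂)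
    (fun x hx => (GermHom.Compat.compMorphism hp₂ (S.germ_compat (τ i) x hx)).of_eq
      (LinearMap.id_comp _))
  choose σ hσ₁ hσ₂ using hσ
  refine ⟨σ, fun i j => ?_⟩
  have hfin := fun x => finite_fibre F (E := E) x
  have hgerm : ∀ x (hi : x ∈ U i) (hj : x ∈ U j),
      ((τ i).germ x hi).compSymm (τ j) hj = ((σ i).germ x hi).compSymm (σ j) hj := by
    intro x hi hj
    have h1 : (((τ i).germ x hi).compSymm (τ j) hj).compId (HolHom.ofSplitting (σ j)) hj =
        (σ i).germ x hi := by
      refine P.ext_of_morphisms hq₁ hq₂ (N.germ_compat (σ i) x hi) ?_ ?_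
      · have e := GermHom.comp_congr (Φ := (HolHom.ofSplitting (σ j)).compMorphism q₁)
          (Φ' := (HolHom.ofSplitting (τ j)).compMorphism p₁) le_rfl le_rfl (hσ₁ j) hj
          (((τ i).germ x hi).compSymm (τ j) hj)
        rw [← GermHom.compId_compMorphism, ← GermHom.compId_compMorphism,
          GermHom.compSymm_compId] at e
        exact e.trans (hσ₁ i x hi).symm
      · have e := GermHom.comp_congr (Φ := (HolHom.ofSplitting (σ j)).compMorphism q₂)
          (Φ' := (HolHom.ofSplitting (τ j)).compMorphism p₂) le_rfl le_rfl (hσ₂ j) hj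
          (((τ i).germ x hi).compSymm (τ j) hj)
        rw [← GermHom.compId_compMorphism, ← GermHom.compId_compMorphism,
          GermHom.compSymm_compId] at e
        exact e.trans (hσ₂ i x hi).symm
    rw [← h1, GermHom.compId_compSymm]
  -- The transition maps are equal, so the difference has arbitrarily high degree.
  have hD : (τ i).transition (τ j) - (σ i).transition (σ j) = 0 := by
    refine Subtype.ext (funext fun V => LinearMap.ext fun f => ?_)
    have hVi : V.1 ≤ U i := V.2.trans inf_le_left
    have hVj : V.1 ≤ U j := V.2.trans inf_le_right
    change (τ i).eqv V.1 hVi (((τ j).eqv V.1 hVj).symm f) -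
      (σ i).eqv V.1 hVi (((σ j).eqv V.1 hVj).symm f) = 0
    refine sub_eq_zero.2 ?_
    refine Subtype.ext (funext fun x => ?_)
    have e := congrArg (fun h => h.app V.1 x.2 f) (hgerm x.1 (hVi x.2) (hVj x.2))
    change (((τ i).germ x.1 (hVi x.2)).compSymm (τ j) (hVj x.2)).app V.1 x.2 f =
      (((σ i).germ x.1 (hVi x.2)).compSymm (σ j) (hVj x.2)).app V.1 x.2 f at e
    have e1 := GermHom.compSymm_app ((τ i).germ x.1 (hVi x.2)) (τ j) (hVj x.2) x.2 x.2 le_rfl hVj f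
    have e2 := GermHom.compSymm_app ((σ i).germ x.1 (hVi x.2)) (σ j) (hVj x.2) x.2 x.2 le_rfl hVj f
    have e3 := (τ i).germ_app hVi le_rfl x x.2
      (((τ j).eqv V.1 hVj).symm (exteriorRes I F E le_rfl f))
    have e4 := (σ i).germ_app hVi le_rfl x x.2
      (((σ j).eqv V.1 hVj).symm (exteriorRes I F E le_rfl f))
    rw [S.res_self] at e3
    rw [N.res_self] at e4
    exact (e1.trans e3).symm.trans (e.trans (e2.trans e4))
  rw [hD]
  refine ⟨fun V q f _ => zero_mem _, fun V k f _ x hx => ⟨V.1, le_rfl, hx, ?_⟩⟩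
  have h0 : (0 : (exteriorSheaf I F E).sheafEnd (U i ⊓ U j)).1 V f = 0 := rfl
  rw [h0, map_zero]
  exact zero_mem _

end Agreement

/-! ### Existence of product supermanifolds -/

section Existence

variable (P : BundleProduct I F E I₁ F₁ E₁ I₂ F₂ E₂ φ₁ φ₂)

namespace BundleProduct

/-- Every two supermanifolds have a product: the splittings of the factors at the points of a
product of bundles determine, by the universal property of the split product, a cocycle, and the
projections are glued from the pullbacks of sections. -/
theorem exists_supermanifold (S₁ : Supermanifold I₁ F₁ E₁) (S₂ : Supermanifold I₂ F₂ E₂) :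
    ∃ (N : Supermanifold I F E) (q₁ : SuperMorphism N.toSuperPresheaf S₁.toSuperPresheaf φ₁)
      (q₂ : SuperMorphism N.toSuperPresheaf S₂.toSuperPresheaf φ₂),
      q₁.Compat N.toSuperData S₁.toSuperData P.pull₁.lin ∧
      q₂.Compat N.toSuperData S₂.toSuperData P.pull₂.lin := by
  have hfin := fun x => finite_fibre F (E := E) x
  choose U₁ hU₁ τ using fun x => S₁.exists_splitting (φ₁ x)
  choose U₂ hU₂ σ using fun x => S₂.exists_splitting (φ₂ x)
  replace τ := fun x => (τ x).some
  replace σ := fun x => (σ x).some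
  let dom : M → Opens M := fun x => Opens.comap φ₁ (U₁ x) ⊓ Opens.comap φ₂ (U₂ x)
  let a : ∀ i, HolHom I F E S₁.toSuperPresheaf φ₁ (dom i) := fun i =>
    P.pull₁.holSplitting (τ i) inf_le_left
  let b : ∀ i, HolHom I F E S₂.toSuperPresheaf φ₂ (dom i) := fun i =>
    P.pull₂.holSplitting (σ i) inf_le_right
  have ha : ∀ i x hx, ((a i).germ x hx).Compat S₁.toSuperData (P.pull₁.lin x) := fun i x hx =>
    P.pull₁.holSplitting_compat S₁ (τ i) inf_le_left x hx
  have hb : ∀ i x hx, ((b i).germ x hx).Compat S₂.toSuperData (P.pull₂.lin x) := fun i x hx =>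
    P.pull₂.holSplitting_compat S₂ (σ i) inf_le_right x hx
  -- Transition maps: the universal property of the split product.
  have hT : ∀ i j, ∃ T : LocalSplitting I F (exteriorData I F E) (dom i ⊓ dom j),
      (∀ x (hx : x ∈ dom i ⊓ dom j), (T.germ x hx).comp (a j) hx.2 = (a i).germ x hx.1) ∧
      (∀ x (hx : x ∈ dom i ⊓ dom j), (T.germ x hx).comp (b j) hx.2 = (b i).germ x hx.1) := by
    intro i j
    obtain ⟨T, hT₁, hT₂⟩ := P.exists_splitting (S₁ := exteriorSupermanifold I₁ F₁ E₁)
      (S₂ := exteriorSupermanifold I₂ F₂ E₂) (N := exteriorSupermanifold I F E)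
      (q₁ := P.pull₁.morphism) (q₂ := P.pull₂.morphism) P.pull₁.morphism_compat
      P.pull₂.morphism_compat (W := dom i ⊓ dom j)
      (((a i).restrict inf_le_left).compSymm (τ j) (inf_le_right.trans inf_le_left))
      (fun x hx => (ha i x hx.1).compSymm (τ j) hx.2.1)
      (((b i).restrict inf_le_left).compSymm (σ j) (inf_le_right.trans inf_le_right))
      (fun x hx => (hb i x hx.1).compSymm (σ j) hx.2.2)
    refine ⟨T, fun x hx => ?_, fun x hx => ?_⟩
    · refine GermHom.eq_of_compSymm_eq (τ j) hx.2.1 ?_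
      refine (P.pull₁.comp_hol_eq (τ j) inf_le_left hx.2 (T.germ x hx)).trans ?_
      exact (P.pull₁.compMorphism_morphism (T.germ x hx)).symm.trans (hT₁ x hx)
    · refine GermHom.eq_of_compSymm_eq (σ j) hx.2.2 ?_
      refine (P.pull₂.comp_hol_eq (σ j) inf_le_right hx.2 (T.germ x hx)).trans ?_
      exact (P.pull₂.compMorphism_morphism (T.germ x hx)).symm.trans (hT₂ x hx)
  choose T hTa hTb using hT
  have hTc : ∀ i j x hx, ((T i j).germ x hx).Compat (exteriorData I F E) LinearMap.id :=
    fun i j x hx => (exteriorSupermanifold I F E).germ_compat (T i j) x hx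
  have hext : ∀ (i x : M) (hx : x ∈ dom i)
      (g g' : GermHom (exteriorSheaf I F E) x (ExteriorAlgebra ℂ (E x))),
      g'.Compat (exteriorData I F E) LinearMap.id → g.comp (a i) hx = g'.comp (a i) hx →
      g.comp (b i) hx = g'.comp (b i) hx → g = g' := by
    intro i x hx g g' hg e₁ e₂
    refine P.ext_of_pull hg ?_ ?_
    · rw [← P.pull₁.comp_hol_eq (τ i) inf_le_left hx, ← P.pull₁.comp_hol_eq (τ i) inf_le_left hx]
      exact congrArg (fun h => h.compSymm (τ i) hx.1) e₁
    · rw [← P.pull₂.comp_hol_eq (σ i) inf_le_right hx, ← P.pull₂.comp_hol_eq (σ i) inf_le_right hx]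
      exact congrArg (fun h => h.compSymm (σ i) hx.2) e₂
  -- The cocycle conditions hold because both sides agree on pullbacks from the factors.
  have hself : ∀ i x (hx : x ∈ dom i), (T i i).germ x ⟨hx, hx⟩ = evalGerm I F x := fun i x hx =>
    hext i x hx _ _ (evalGerm_compat x) (hTa i i x ⟨hx, hx⟩) (hTb i i x ⟨hx, hx⟩)
  have hcomp : ∀ i j k x (hi : x ∈ dom i) (hj : x ∈ dom j) (hk : x ∈ dom k),
      ((T i j).germ x ⟨hi, hj⟩).compId (HolHom.ofSplitting (T j k)) ⟨hj, hk⟩ =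
        (T i k).germ x ⟨hi, hk⟩ := by
    intro i j k x hi hj hk
    let g : GermHom (exteriorSheaf I F E) x (ExteriorAlgebra ℂ (E x)) := (T i j).germ x ⟨hi, hj⟩
    have hx : x ∈ dom j ⊓ dom k := ⟨hj, hk⟩
    refine hext k x hk _ _ (hTc i k x ⟨hi, hk⟩) ?_ ?_
    · refine ((GermHom.comp_comp (HolHom.ofSplitting (T j k)) (a k) inf_le_right hx g).symm.trans
        ?_).trans (hTa i k x ⟨hi, hk⟩).symm
      refine (GermHom.comp_congr (Φ' := a j) (W := dom j ⊓ dom k) le_rfl inf_le_left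
        (fun y hy => hTa j k y hy) hx g).trans (hTa i j x ⟨hi, hj⟩)
    · refine ((GermHom.comp_comp (HolHom.ofSplitting (T j k)) (b k) inf_le_right hx g).symm.trans
        ?_).trans (hTb i k x ⟨hi, hk⟩).symm
      refine (GermHom.comp_congr (Φ' := b j) (W := dom j ⊓ dom k) le_rfl inf_le_left
        (fun y hy => hTb j k y hy) hx g).trans (hTb i j x ⟨hi, hj⟩)
  let C : GluingCocycle I F E :=
    { dom := dom
      mem_dom := fun x => ⟨hU₁ x, hU₂ x⟩
      map := fun i j V hi hj => ((T i j).eqv V (le_inf hi hj)).toAlgHom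
      map_res := fun i j W V h hi hj f => (T i j).eqv_res h (le_inf hi hj) f
      map_self := fun i V hi f => Subtype.ext (funext fun x =>
        ((T i i).eqv_apply (le_inf hi hi) f x).trans
          (congrArg (fun g => g.app V x.2 f) (hself i x.1 (hi x.2))))
      map_map := fun i j k V hi hj hk f => Subtype.ext (funext fun x => by
        refine ((T i j).eqv_apply (le_inf hi hj) ((T j k).eqv V (le_inf hj hk) f) x).trans ?_
        refine Eq.trans ?_ ((T i k).eqv_apply (le_inf hi hk) f x).symm
        have h1 := ((T i j).germ x.1 ⟨hi x.2, hj x.2⟩).comp_app (HolHom.ofSplitting (T j k))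
          ⟨hj x.2, hk x.2⟩ (V := V) (V' := V) x.2 x.2 le_rfl (le_inf hj hk) f
        have h2 := HolHom.ofSplitting_sec (T j k) (le_inf hj hk) f
        refine (congrArg (((T i j).germ x.1 ⟨hi x.2, hj x.2⟩).app V x.2) h2).symm.trans ?_
        exact h1.symm.trans (congrArg (fun g => g.app V x.2 f)
          (hcomp i j k x.1 (hi x.2) (hj x.2) (hk x.2))))
      map_parity := fun i j V hi hj q f hf => ((T i j).eqv_parity (le_inf hi hj) q f).2 hf
      map_body := fun i j V hi hj f x => (T i j).eqv_body (le_inf hi hj) f x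
      map_lin := fun i j V hi hj f x => (T i j).eqv_lin (le_inf hi hj) f x }
  -- The pullbacks from the factors are compatible with the transition maps.
  have haC : ∀ (i j : M) (V : Opens M₁) (V' : Opens M) (hV : V' ≤ Opens.comap φ₁ V)
      (hi : V' ≤ C.dom i) (hj : V' ≤ C.dom j) (f : S₁.Sec V),
      C.map i j V' hi hj ((a j).sec hV hj f) = (a i).sec hV hi f := by
    intro i j V V' hV hi hj f
    refine Subtype.ext (funext fun x => ?_)
    refine ((T i j).eqv_apply (le_inf hi hj) ((a j).sec hV hj f) x).trans ?_
    exact (((T i j).germ x.1 ⟨hi x.2, hj x.2⟩).comp_app (a j) (hj x.2) (hV x.2) x.2 hV hj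
      f).symm.trans (congrArg (fun g => g.app V (hV x.2) f) (hTa i j x.1 ⟨hi x.2, hj x.2⟩))
  have hbC : ∀ (i j : M) (V : Opens M₂) (V' : Opens M) (hV : V' ≤ Opens.comap φ₂ V)
      (hi : V' ≤ C.dom i) (hj : V' ≤ C.dom j) (f : S₂.Sec V),
      C.map i j V' hi hj ((b j).sec hV hj f) = (b i).sec hV hi f := by
    intro i j V V' hV hi hj f
    refine Subtype.ext (funext fun x => ?_)
    refine ((T i j).eqv_apply (le_inf hi hj) ((b j).sec hV hj f) x).trans ?_
    exact (((T i j).germ x.1 ⟨hi x.2, hj x.2⟩).comp_app (b j) (hj x.2) (hV x.2) x.2 hV hj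
      f).symm.trans (congrArg (fun g => g.app V (hV x.2) f) (hTb i j x.1 ⟨hi x.2, hj x.2⟩))
  exact ⟨C.supermanifold, C.lift a haC fun i x hx => (ha i x hx).parity,
    C.lift b hbC fun i x hx => (hb i x hx).parity, C.lift_compat a haC ha, C.lift_compat b hbC hb⟩

end BundleProduct

end Existence

/-! ### Slices of a product -/

section Slices

theorem map_zero_eq_algebraMap {V W : Type*} [AddCommGroup V] [Module ℂ V] [AddCommGroup W]
    [Module ℂ W]
    (u : ExteriorAlgebra ℂ V) : ExteriorAlgebra.map (0 : V →ₗ[ℂ] W) u =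
      algebraMap ℂ _ (ExteriorAlgebra.algebraMapInv u) := by
  have h : ExteriorAlgebra.map (0 : V →ₗ[ℂ] W) =
      (Algebra.ofId ℂ (ExteriorAlgebra ℂ W)).comp ExteriorAlgebra.algebraMapInv := by
    refine ExteriorAlgebra.hom_ext (LinearMap.ext fun v => ?_)
    simp [ExteriorAlgebra.algebraMapInv]
  exact AlgHom.congr_fun h u

/-- The embeddings of the first factor of a product as the slices through the points of the product,
together with the retractions of the bundle on the product onto the bundle on the first factor. -/
structure BundleProduct.Slices (P : BundleProduct I F E I₁ F₁ E₁ I₂ F₂ E₂ φ₁ φ₂) where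
  slice : M → C(M₁, M)
  pull : ∀ m, BundlePull I F E I₁ F₁ E₁ (slice m)
  proj : ∀ m, E m →ₗ[ℂ] E₁ (φ₁ m)
  fst_slice : ∀ m x, φ₁ (slice m x) = x
  snd_slice : ∀ m x, φ₂ (slice m x) = φ₂ m
  proj_pull₁ : ∀ m v, proj m (P.pull₁.lin m v) = v
  proj_pull₂ : ∀ m v, proj m (P.pull₂.lin m v) = 0
  sec_pull₁ : ∀ (m : M) {V V' : Opens M₁} {U : Opens M} (h : V' ≤ Opens.comap (slice m) U)
    (h' : U ≤ Opens.comap φ₁ V) (hV : V' ≤ V) (f : exteriorSections I₁ F₁ E₁ V),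
    (pull m).sec h (P.pull₁.sec h' f) = exteriorRes I₁ F₁ E₁ hV f
  sec_pull₂ : ∀ (m : M) {V : Opens M₂} {V' : Opens M₁} {U : Opens M}
    (h : V' ≤ Opens.comap (slice m) U) (h' : U ≤ Opens.comap φ₂ V) (hm : φ₂ m ∈ V)
    (f : exteriorSections I₂ F₂ E₂ V), (pull m).sec h (P.pull₂.sec h' f) =
      algebraMap ℂ _ (ExteriorAlgebra.algebraMapInv (f.1 ⟨φ₂ m, hm⟩))
  sec_self : ∀ (m : M) {U : Opens M} {V' : Opens M₁} (h : V' ≤ Opens.comap (slice m) U)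
    (hm : m ∈ U) (hm' : φ₁ m ∈ V') (f : exteriorSections I F E U),
    ((pull m).sec h f).1 ⟨φ₁ m, hm'⟩ = ExteriorAlgebra.map (proj m) (f.1 ⟨m, hm⟩)

end Slices

/-! ### Lifts of derivations to a product of bundles -/

section Lifts

/-- The zero derivation. -/
instance {a : ℕ} {W : Opens M} : Zero (SecDer I F E a W) where
  zero :=
    { app := fun _ _ => 0
      app_res := fun _ _ _ => (map_zero _).symm
      leibniz := fun _ _ f g => by
        rw [LinearMap.zero_apply, LinearMap.zero_apply, LinearMap.zero_apply, zero_mul, mul_zero,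
          add_zero]
      app_inv := fun _ _ _ => by
        rw [LinearMap.zero_apply, LinearMap.zero_apply, map_zero, smul_zero] }

/-- An even derivation which is related to an even derivation over the base of a pullback at the
coordinates, is related to it everywhere. -/
theorem SecDer.app_pull {φ : C(M, M₁)} (Q : BundlePull I₁ F₁ E₁ I F E φ) {W : Opens M} {w₁ : M₁}
    {W₁ U₁ : Opens M₁} (hd : W₁ ≤ bundleDom H₁ F₁ E₁ w₁) (D : SecDer I F E 0 W)
    (D₁ : SecDer I₁ F₁ E₁ 0 U₁) (hU : W₁ ≤ U₁) (h₁ : W ≤ Opens.comap φ W₁) {ι κ : Type*}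
    [Fintype ι] [Fintype κ] (b : Module.Basis ι ℂ A₁) (bF : Module.Basis κ ℂ F₁)
    (hx : ∀ i, D.app W le_rfl (Q.sec h₁ (coordSec I₁ F₁ E₁ b hd i)) =
      Q.sec h₁ (D₁.app W₁ hU (coordSec I₁ F₁ E₁ b hd i)))
    (hθ : ∀ j, D.app W le_rfl (Q.sec h₁ (frameSec I₁ hd (bF j))) =
      Q.sec h₁ (D₁.app W₁ hU (frameSec I₁ hd (bF j))))
    {V₁ : Opens M₁} (hV₁ : V₁ ≤ U₁) {V : Opens M} (hV : V ≤ W) (h : V ≤ Opens.comap φ V₁)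
    (f : exteriorSections I₁ F₁ E₁ V₁) :
    D.app V hV (Q.sec h f) = Q.sec h (D₁.app V₁ hV₁ f) := by
  have D_mul : ∀ (V : Opens M) (hV : V ≤ W) (f g : exteriorSections I F E V),
      D.app V hV (f * g) = D.app V hV f * g + f * D.app V hV g := fun V hV f g => by
    rw [D.leibniz, pow_zero, AlgHom.one_apply]
  have D₁_mul : ∀ (V : Opens M₁) (hV : V ≤ U₁) (f g : exteriorSections I₁ F₁ E₁ V),
      D₁.app V hV (f * g) = D₁.app V hV f * g + f * D₁.app V hV g := fun V hV f g => by
    rw [D₁.leibniz, pow_zero, AlgHom.one_apply]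
  refine Subtype.ext (funext fun m => ?_)
  have hfin := finite_fibre F (E := E) m.1
  let Ψ : GermHom (exteriorSheaf I₁ F₁ E₁) (φ m.1) (ExteriorAlgebra ℂ (E m.1)) :=
    (Q.hol ⊤).germ m.1 trivial
  let ev : ∀ (V : Opens M), m.1 ∈ V → exteriorSections I F E V →ₗ[ℂ]
      ExteriorAlgebra ℂ (E m.1) := fun V hm =>
    (LinearMap.proj (R := ℂ) (φ := fun x : V => ExteriorAlgebra ℂ (E x)) ⟨m.1, hm⟩) ∘ₗ
      (Subalgebra.toSubmodule (exteriorSections I F E V)).subtype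
  obtain ⟨K, hK⟩ : ∃ K : GermDer W₁ Ψ Ψ, ∀ (V' : Opens M₁) (hV' : V' ≤ W₁) (hm : φ m.1 ∈ V')
      (f : exteriorSections I₁ F₁ E₁ V'), K.app V' hV' hm f =
        ev (Opens.comap φ V' ⊓ W) ⟨hm, hV m.2⟩ (D.app (Opens.comap φ V' ⊓ W) inf_le_right
          (Q.sec inf_le_left f)) := ⟨
    { app := fun V' hV' hm => ev (Opens.comap φ V' ⊓ W) ⟨hm, hV m.2⟩ ∘ₗ
        D.app (Opens.comap φ V' ⊓ W) inf_le_right ∘ₗ (Q.sec inf_le_left).toLinearMap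
      app_res := fun {V' V''} h hV' hm f => congrArg (ev (Opens.comap φ V' ⊓ W)
        ⟨hm, hV m.2⟩) (D.app_res (inf_le_inf_right W (Opens.comap_mono φ h)) inf_le_right
          (Q.sec inf_le_left f))
      leibniz := fun V' hV' hm f g => by
        have h1 := D_mul (Opens.comap φ V' ⊓ W) inf_le_right (Q.sec inf_le_left f)
          (Q.sec inf_le_left g)
        rw [← map_mul (Q.sec inf_le_left)] at h1
        exact congrArg (ev (Opens.comap φ V' ⊓ W) ⟨hm, hV m.2⟩) h1 }, fun _ _ _ _ => rfl⟩
  obtain ⟨K', hK'⟩ : ∃ K : GermDer W₁ Ψ Ψ, ∀ (V' : Opens M₁) (hV' : V' ≤ W₁) (hm : φ m.1 ∈ V')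
      (f : exteriorSections I₁ F₁ E₁ V'), K.app V' hV' hm f =
        ev (Opens.comap φ V' ⊓ W) ⟨hm, hV m.2⟩ (Q.sec inf_le_left
          (D₁.app V' (hV'.trans hU) f)) := ⟨
    { app := fun V' hV' hm => ev (Opens.comap φ V' ⊓ W) ⟨hm, hV m.2⟩ ∘ₗ
        (Q.sec inf_le_left).toLinearMap ∘ₗ D₁.app V' (hV'.trans hU)
      app_res := fun {V' V''} h hV' hm f => congrArg (fun z => ev (Opens.comap φ V' ⊓ W)
        ⟨hm, hV m.2⟩ (Q.sec inf_le_left z)) (D₁.app_res h (hV'.trans hU) f)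
      leibniz := fun V' hV' hm f g => by
        have h1 := congrArg (Q.sec (inf_le_left : Opens.comap φ V' ⊓ W ≤ _))
          (D₁_mul V' (hV'.trans hU) f g)
        rw [map_add, map_mul (Q.sec inf_le_left), map_mul (Q.sec inf_le_left)] at h1
        exact congrArg (ev (Opens.comap φ V' ⊓ W) ⟨hm, hV m.2⟩) h1 }, fun _ _ _ _ => rfl⟩
  have hb : ∀ (V' : Opens M₁) (hm : φ m.1 ∈ V') (f : exteriorSections I₁ F₁ E₁ V'),
      ExteriorAlgebra.algebraMapInv (Ψ.app V' hm f) =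
        ExteriorAlgebra.algebraMapInv (f.1 ⟨φ m.1, hm⟩) := fun V' hm f => algebraMapInv_map _ _
  have hmW : φ m.1 ∈ W₁ := h₁ (hV m.2)
  have hKx : ∀ i, K.app W₁ le_rfl hmW (coordSec I₁ F₁ E₁ b hd i) =
      K'.app W₁ le_rfl hmW (coordSec I₁ F₁ E₁ b hd i) := fun i => by
    have e1 := D.app_res (inf_le_right : Opens.comap φ W₁ ⊓ W ≤ W) le_rfl
      (Q.sec h₁ (coordSec I₁ F₁ E₁ b hd i))
    rw [hx i] at e1
    rw [hK, hK']
    exact congrArg (ev (Opens.comap φ W₁ ⊓ W) ⟨hmW, hV m.2⟩) e1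
  have hKθ : ∀ j, K.app W₁ le_rfl hmW (frameSec I₁ hd (bF j)) =
      K'.app W₁ le_rfl hmW (frameSec I₁ hd (bF j)) := fun j => by
    have e1 := D.app_res (inf_le_right : Opens.comap φ W₁ ⊓ W ≤ W) le_rfl
      (Q.sec h₁ (frameSec I₁ hd (bF j)))
    rw [hθ j] at e1
    rw [hK, hK']
    exact congrArg (ev (Opens.comap φ W₁ ⊓ W) ⟨hmW, hV m.2⟩) e1
  have hm₁ : φ m.1 ∈ V₁ ⊓ W₁ := ⟨h m.2, hmW⟩
  have key := GermDer.ext_of_coord hd K K' hb b bF hmW hKx hKθ inf_le_right hm₁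
    (exteriorRes I₁ F₁ E₁ inf_le_left f)
  rw [hK, hK', D₁.app_res inf_le_left hV₁ f] at key
  have e1 := D.app_res (V' := V ⊓ (Opens.comap φ (V₁ ⊓ W₁) ⊓ W)) inf_le_left hV (Q.sec h f)
  have e2 := D.app_res (V' := V ⊓ (Opens.comap φ (V₁ ⊓ W₁) ⊓ W)) inf_le_right inf_le_right
    (Q.sec inf_le_left (exteriorRes I₁ F₁ E₁ (inf_le_left : V₁ ⊓ W₁ ≤ V₁) f))
  have e3 := congrFun (congrArg Subtype.val (e1.symm.trans e2)) ⟨m.1, m.2, hm₁, hV m.2⟩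
  exact e3.trans key

variable (P : BundleProduct I F E I₁ F₁ E₁ I₂ F₂ E₂ φ₁ φ₂)

/-- `D` lifts the derivation `D₁` over the first factor: it is related to `D₁` by the pullback of
sections, and annihilates the pullbacks from the second factor. -/
structure BundleProduct.IsSecLift {W : Opens M} {U₁ : Opens M₁} (D₁ : SecDer I₁ F₁ E₁ 0 U₁)
    (D : SecDer I F E 0 W) : Prop where
  le : W ≤ Opens.comap φ₁ U₁
  app_pull₁ : ∀ (V₁ : Opens M₁) (hV₁ : V₁ ≤ U₁) (V : Opens M) (hV : V ≤ W)
    (h : V ≤ Opens.comap φ₁ V₁) (f : exteriorSections I₁ F₁ E₁ V₁),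
    D.app V hV (P.pull₁.sec h f) = P.pull₁.sec h (D₁.app V₁ hV₁ f)
  app_pull₂ : ∀ (V₂ : Opens M₂) (V : Opens M) (hV : V ≤ W) (h : V ≤ Opens.comap φ₂ V₂)
    (f : exteriorSections I₂ F₂ E₂ V₂), D.app V hV (P.pull₂.sec h f) = 0

/-- An even derivation over the first factor of a product lifts to a derivation over the product
which annihilates the pullbacks from the second factor. -/
theorem BundleProduct.exists_lift {w : M} {W : Opens M} (hW : W ≤ bundleDom H F E w)
    {U₁ : Opens M₁} (hU : W ≤ Opens.comap φ₁ U₁) (D₁ : SecDer I₁ F₁ E₁ 0 U₁) :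
    ∃ D : SecDer I F E 0 W, P.IsSecLift D₁ D := by
  let W₁ : Opens M₁ := U₁ ⊓ bundleDom H₁ F₁ E₁ (φ₁ w)
  let W₂ : Opens M₂ := bundleDom H₂ F₂ E₂ (φ₂ w)
  have hW₁ : W ≤ Opens.comap φ₁ W₁ := le_inf hU (hW.trans (P.dom_le₁ w))
  have hW₂ : W ≤ Opens.comap φ₂ W₂ := hW.trans (P.dom_le₂ w)
  have hd₁ : W₁ ≤ bundleDom H₁ F₁ E₁ (φ₁ w) := inf_le_right
  have hpar : ∀ (q : ZMod 2) (f : exteriorSections I₁ F₁ E₁ W₁),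
      (∀ x : W₁, f.1 x ∈ extParity (E₁ x) q) → ∀ x : W,
      (P.pull₁.sec hW₁ (D₁.app W₁ inf_le_left f)).1 x ∈ extParity (E x) q := by
    intro q f hf x
    have h := D₁.app_mem_parity (inf_le_left : W₁ ≤ U₁) hf ⟨φ₁ x, hW₁ x.2⟩
    rw [Nat.cast_zero, zero_add] at h
    exact map_mem_extParity _ h
  obtain ⟨D, D_x, D_θ⟩ := SecDer.exists_even hW P.basis
    (Sum.elim (fun i => P.pull₁.sec hW₁ (D₁.app W₁ inf_le_left
      (coordSec I₁ F₁ E₁ (Module.finBasis ℂ A₁) hd₁ i))) 0)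
    (by
      rintro (i | i) x
      · exact hpar 0 _ (fun x => SetLike.algebraMap_mem_graded _ _) x
      · exact zero_mem _)
    ((P.pull₁.sec hW₁).toLinearMap ∘ₗ D₁.app W₁ inf_le_left ∘ₗ
      (constSec I₁ (φ₁ w) (hd₁.trans bundleDom_le_trivDom)).toLinearMap ∘ₗ
        ExteriorAlgebra.ι ℂ ∘ₗ LinearMap.fst ℂ F₁ F₂ ∘ₗ P.fibreEquiv.toLinearMap)
    (fun v x => hpar 1 _ (fun x => map_mem_extParity _ (CliffordAlgebra.ι_mem_evenOdd_one _ _)) x)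
  have D_x₁ : ∀ i, D.app W le_rfl (P.pull₁.sec hW₁ (coordSec I₁ F₁ E₁ (Module.finBasis ℂ A₁)
      hd₁ i)) = P.pull₁.sec hW₁ (D₁.app W₁ inf_le_left
        (coordSec I₁ F₁ E₁ (Module.finBasis ℂ A₁) hd₁ i)) := fun i =>
    (congrArg (D.app W le_rfl) (P.coordSec_inl hW i)).symm.trans (D_x (Sum.inl i))
  have D_x₂ : ∀ i, D.app W le_rfl (P.pull₂.sec hW₂ (coordSec I₂ F₂ E₂ (Module.finBasis ℂ A₂)
      le_rfl i)) = 0 := fun i =>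
    (congrArg (D.app W le_rfl) (P.coordSec_inr hW i)).symm.trans (D_x (Sum.inr i))
  have D_θ₁ : ∀ j, D.app W le_rfl (P.pull₁.sec hW₁ (frameSec I₁ hd₁ (Module.finBasis ℂ F₁ j))) =
      P.pull₁.sec hW₁ (D₁.app W₁ inf_le_left (frameSec I₁ hd₁ (Module.finBasis ℂ F₁ j))) := by
    intro j
    refine (congrArg (D.app W le_rfl) (P.frameSec_inl hW j)).symm.trans ((D_θ _).trans ?_)
    have h : (P.fibreEquiv (P.basisF (Sum.inl j))).1 = Module.finBasis ℂ F₁ j := by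
      simp [BundleProduct.basisF]
    change P.pull₁.sec hW₁ (D₁.app W₁ inf_le_left
      (frameSec I₁ hd₁ (P.fibreEquiv (P.basisF (Sum.inl j))).1)) = _
    rw [h]
  have D_θ₂ : ∀ j, D.app W le_rfl (P.pull₂.sec hW₂ (frameSec I₂ le_rfl
      (Module.finBasis ℂ F₂ j))) = 0 := by
    intro j
    refine (congrArg (D.app W le_rfl) (P.frameSec_inr hW j)).symm.trans ((D_θ _).trans ?_)
    have h : (P.fibreEquiv (P.basisF (Sum.inr j))).1 = 0 := by
      simp [BundleProduct.basisF]
    change P.pull₁.sec hW₁ (D₁.app W₁ inf_le_left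
      (frameSec I₁ hd₁ (P.fibreEquiv (P.basisF (Sum.inr j))).1)) = _
    rw [h, BundleProduct.frameSec_zero, map_zero, map_zero]
  exact ⟨D, hU, fun V₁ hV₁ V hV h f => D.app_pull P.pull₁ hd₁ D₁ inf_le_left hW₁
      (Module.finBasis ℂ A₁) (Module.finBasis ℂ F₁) D_x₁ D_θ₁ hV₁ hV h f,
    fun V₂ V hV h f => (D.app_pull (U₁ := ⊤) P.pull₂ le_rfl 0 le_top hW₂
      (Module.finBasis ℂ A₂) (Module.finBasis ℂ F₂) (fun i => (D_x₂ i).trans (map_zero _).symm)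
      (fun j => (D_θ₂ j).trans (map_zero _).symm) le_top hV h f).trans (map_zero _)⟩

end Lifts

/-! ### Lifts of superderivations to a product supermanifold -/

section GlobalLifts

variable (P : BundleProduct I F E I₁ F₁ E₁ I₂ F₂ E₂ φ₁ φ₂)
  {S₁ : Supermanifold I₁ F₁ E₁} {S₂ : Supermanifold I₂ F₂ E₂} {N : Supermanifold I F E}
  {q₁ : SuperMorphism N.toSuperPresheaf S₁.toSuperPresheaf φ₁}
  {q₂ : SuperMorphism N.toSuperPresheaf S₂.toSuperPresheaf φ₂}

/-- `X` lifts the endomorphism `X₁` of the first factor: it is related to `X₁` by the first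
projection, and annihilates the pullbacks from the second factor. -/
structure IsLift (q₁ : SuperMorphism N.toSuperPresheaf S₁.toSuperPresheaf φ₁)
    (q₂ : SuperMorphism N.toSuperPresheaf S₂.toSuperPresheaf φ₂) {W : Opens M}
    (X₁ : S₁.sheafEnd ⊤) (X : N.sheafEnd W) : Prop where
  app₁ : ∀ (V₁ : Opens M₁) (V : Opens M) (hV : V ≤ W) (h : V ≤ Opens.comap φ₁ V₁)
    (f : S₁.Sec V₁), X.1 ⟨V, hV⟩ (N.res h (q₁.star V₁ f)) =
      N.res h (q₁.star V₁ (X₁.1 ⟨V₁, le_top⟩ f))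
  app₂ : ∀ (V₂ : Opens M₂) (V : Opens M) (hV : V ≤ W) (h : V ≤ Opens.comap φ₂ V₂)
    (f : S₂.Sec V₂), X.1 ⟨V, hV⟩ (N.res h (q₂.star V₂ f)) = 0

theorem LocalSplitting.raises_secDer {S : Supermanifold I F E} {U W : Opens M}
    (τ : LocalSplitting I F S.toSuperData U) (hW : W ≤ U) {p : ZMod 2} {X : S.sheafEnd W}
    (hX : X ∈ S.homDer p W) {t : ℕ} (ht : SuperPresheaf.RaisesDegree t X) {V : Opens M}
    (hV : V ≤ W) (k : ℕ) (f : exteriorSections I F E V) (hf : ∀ x : V, f.1 x ∈ extFil (E x) k)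
    (x : V) : ((τ.secDer hW hX).app V hV f).1 x ∈ extFil (E x) (k + t) := by
  have h1 := (τ.eqv_mem_filtration (hV.trans hW) k ((τ.eqv V (hV.trans hW)).symm f)).1 (by
    rw [AlgEquiv.apply_symm_apply]
    exact (mem_filtration_iff f).2 hf)
  have h2 := (τ.eqv_mem_filtration (hV.trans hW) (k + t) _).2 (ht ⟨V, hV⟩ k _ h1)
  exact (mem_filtration_iff _).1 h2 x

namespace BundleProduct

variable {P}

theorem Adapted.eqv_star₁ {W : Opens M} {U₁ : Opens M₁} {U₂ : Opens M₂}
    {ρ : LocalSplitting I F N.toSuperData W} {τ₁ : LocalSplitting I₁ F₁ S₁.toSuperData U₁}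
    {τ₂ : LocalSplitting I₂ F₂ S₂.toSuperData U₂} (hρ : P.Adapted q₁ q₂ ρ τ₁ τ₂)
    {V₁ : Opens M₁} (hV₁ : V₁ ≤ U₁) {V : Opens M} (hV : V ≤ W) (h : V ≤ Opens.comap φ₁ V₁)
    (f : S₁.Sec V₁) :
    ρ.eqv V hV (N.res h (q₁.star V₁ f)) = P.pull₁.sec h (τ₁.eqv V₁ hV₁ f) := by
  refine Subtype.ext (funext fun y => ?_)
  have e1 := congrArg (fun g : GermHom (exteriorSheaf I₁ F₁ E₁) (φ₁ y.1)
    (ExteriorAlgebra ℂ (E y.1)) => g.app V₁ (h y.2) (τ₁.eqv V₁ hV₁ f)) (hρ.eq₁ y.1 (hV y.2))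
  have e2 := GermHom.compSymm_app ((ρ.germ y.1 (hV y.2)).compMorphism q₁) τ₁ (hρ.le₁ (hV y.2))
    (h y.2) (h y.2) le_rfl hV₁ (τ₁.eqv V₁ hV₁ f)
  have e3 : (τ₁.eqv V₁ hV₁).symm (exteriorRes I₁ F₁ E₁ le_rfl (τ₁.eqv V₁ hV₁ f)) = f :=
    (τ₁.eqv V₁ hV₁).symm_apply_apply f
  rw [e3] at e2
  have e4 := (ρ.germ y.1 (hV y.2)).app_res h y.2 (q₁.star V₁ f)
  exact (ρ.eqv_apply hV _ y).trans (e4.trans (e2.symm.trans e1))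

theorem Adapted.swap {W : Opens M} {U₁ : Opens M₁} {U₂ : Opens M₂}
    {ρ : LocalSplitting I F N.toSuperData W} {τ₁ : LocalSplitting I₁ F₁ S₁.toSuperData U₁}
    {τ₂ : LocalSplitting I₂ F₂ S₂.toSuperData U₂} (hρ : P.Adapted q₁ q₂ ρ τ₁ τ₂) :
    P.swap.Adapted q₂ q₁ ρ τ₂ τ₁ :=
  ⟨hρ.le₂, hρ.le₁, hρ.eq₂, hρ.eq₁⟩

theorem Adapted.eqv_star₂ {W : Opens M} {U₁ : Opens M₁} {U₂ : Opens M₂}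
    {ρ : LocalSplitting I F N.toSuperData W} {τ₁ : LocalSplitting I₁ F₁ S₁.toSuperData U₁}
    {τ₂ : LocalSplitting I₂ F₂ S₂.toSuperData U₂} (hρ : P.Adapted q₁ q₂ ρ τ₁ τ₂)
    {V₂ : Opens M₂} (hV₂ : V₂ ≤ U₂) {V : Opens M} (hV : V ≤ W) (h : V ≤ Opens.comap φ₂ V₂)
    (f : S₂.Sec V₂) :
    ρ.eqv V hV (N.res h (q₂.star V₂ f)) = P.pull₂.sec h (τ₂.eqv V₂ hV₂ f) :=
  hρ.swap.eqv_star₁ hV₂ hV h f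

variable (P)

/-- Superderivations on a product are determined by their values on the superfunctions which are
pulled back from the factors. -/
theorem ext_of_star (hq₁ : q₁.Compat N.toSuperData S₁.toSuperData P.pull₁.lin)
    (hq₂ : q₂.Compat N.toSuperData S₂.toSuperData P.pull₂.lin) {p : ZMod 2} {U : Opens M}
    {X X' : N.sheafEnd U} (hX : X ∈ N.homDer p U) (hX' : X' ∈ N.homDer p U)
    (h₁ : ∀ (V₁ : Opens M₁) (V : Opens M) (hV : V ≤ U) (h : V ≤ Opens.comap φ₁ V₁)
      (f : S₁.Sec V₁), X.1 ⟨V, hV⟩ (N.res h (q₁.star V₁ f)) =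
        X'.1 ⟨V, hV⟩ (N.res h (q₁.star V₁ f)))
    (h₂ : ∀ (V₂ : Opens M₂) (V : Opens M) (hV : V ≤ U) (h : V ≤ Opens.comap φ₂ V₂)
      (f : S₂.Sec V₂), X.1 ⟨V, hV⟩ (N.res h (q₂.star V₂ f)) =
        X'.1 ⟨V, hV⟩ (N.res h (q₂.star V₂ f))) : X = X' := by
  refine Subtype.ext (funext fun V => LinearMap.ext fun f =>
    N.toSuperPresheaf.eq_of_locally N.isSheaf fun x hx => ?_)
  obtain ⟨U₁, hx₁, ⟨τ₁⟩⟩ := S₁.exists_splitting (φ₁ x)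
  obtain ⟨U₂, hx₂, ⟨τ₂⟩⟩ := S₂.exists_splitting (φ₂ x)
  obtain ⟨W, ρ, hxW, hρ⟩ := P.exists_adapted hq₁ hq₂ τ₁ τ₂ x hx₁ hx₂
  let W' : Opens M := (W ⊓ V.1) ⊓ bundleDom H F E x
  have hW : W' ≤ W := inf_le_left.trans inf_le_left
  have hWV : W' ≤ V.1 := inf_le_left.trans inf_le_right
  have hd : W' ≤ bundleDom H F E x := inf_le_right
  let W₁ : Opens M₁ := U₁ ⊓ bundleDom H₁ F₁ E₁ (φ₁ x)
  let W₂ : Opens M₂ := U₂ ⊓ bundleDom H₂ F₂ E₂ (φ₂ x)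
  have hW₁ : W' ≤ Opens.comap φ₁ W₁ := le_inf (hW.trans hρ.le₁) (hd.trans (P.dom_le₁ x))
  have hW₂ : W' ≤ Opens.comap φ₂ W₂ := le_inf (hW.trans hρ.le₂) (hd.trans (P.dom_le₂ x))
  have hU : W' ≤ U := hWV.trans V.2
  let D := ρ.secDer hW (SuperPresheaf.endRestrict_mem_homDer hU hX)
  let D' := ρ.secDer hW (SuperPresheaf.endRestrict_mem_homDer hU hX')
  have e₁ : ∀ g : exteriorSections I₁ F₁ E₁ W₁, D.app W' le_rfl (P.pull₁.sec hW₁ g) =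
      D'.app W' le_rfl (P.pull₁.sec hW₁ g) := by
    intro g
    have e1 := hρ.eqv_star₁ (inf_le_left : W₁ ≤ U₁) hW hW₁ ((τ₁.eqv W₁ inf_le_left).symm g)
    rw [AlgEquiv.apply_symm_apply] at e1
    rw [← e1]
    change ρ.eqv W' hW (X.1 ⟨W', hU⟩ ((ρ.eqv W' hW).symm (ρ.eqv W' hW _))) =
      ρ.eqv W' hW (X'.1 ⟨W', hU⟩ ((ρ.eqv W' hW).symm (ρ.eqv W' hW _)))
    rw [AlgEquiv.symm_apply_apply, h₁]
  have e₂ : ∀ g : exteriorSections I₂ F₂ E₂ W₂, D.app W' le_rfl (P.pull₂.sec hW₂ g) =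
      D'.app W' le_rfl (P.pull₂.sec hW₂ g) := by
    intro g
    have e1 := hρ.eqv_star₂ (inf_le_left : W₂ ≤ U₂) hW hW₂ ((τ₂.eqv W₂ inf_le_left).symm g)
    rw [AlgEquiv.apply_symm_apply] at e1
    rw [← e1]
    change ρ.eqv W' hW (X.1 ⟨W', hU⟩ ((ρ.eqv W' hW).symm (ρ.eqv W' hW _))) =
      ρ.eqv W' hW (X'.1 ⟨W', hU⟩ ((ρ.eqv W' hW).symm (ρ.eqv W' hW _)))
    rw [AlgEquiv.symm_apply_apply, h₂]
  have hx' : ∀ i, D.app W' le_rfl (coordSec I F E P.basis hd i) =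
      D'.app W' le_rfl (coordSec I F E P.basis hd i) := by
    rintro (i | i)
    · rw [P.coordSec_inl hd i]
      exact e₁ (coordSec I₁ F₁ E₁ (Module.finBasis ℂ A₁) inf_le_right i)
    · rw [P.coordSec_inr hd i]
      exact e₂ (coordSec I₂ F₂ E₂ (Module.finBasis ℂ A₂) inf_le_right i)
  have hθ : ∀ j, D.app W' le_rfl (frameSec I hd (P.basisF j)) =
      D'.app W' le_rfl (frameSec I hd (P.basisF j)) := by
    rintro (j | j)
    · rw [P.frameSec_inl hd j]
      exact e₁ (frameSec I₁ inf_le_right (Module.finBasis ℂ F₁ j))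
    · rw [P.frameSec_inr hd j]
      exact e₂ (frameSec I₂ inf_le_right (Module.finBasis ℂ F₂ j))
  have key := SecDer.ext_of_coord hd P.basis P.basisF hx' hθ le_rfl (ρ.eqv W' hW (N.res hWV f))
  have key' : X.1 ⟨W', hU⟩ ((ρ.eqv W' hW).symm (ρ.eqv W' hW (N.res hWV f))) =
      X'.1 ⟨W', hU⟩ ((ρ.eqv W' hW).symm (ρ.eqv W' hW (N.res hWV f))) :=
    (ρ.eqv W' hW).injective key
  refine ⟨W', hWV, ⟨⟨hxW, hx⟩, mem_bundleDom x⟩, ?_⟩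
  rw [AlgEquiv.symm_apply_apply] at key'
  have e3 := X.2 V ⟨W', hU⟩ hWV f
  have e4 := X'.2 V ⟨W', hU⟩ hWV f
  exact e3.symm.trans (key'.trans e4)

/-- Locally, even superderivations of degree two of the first factor have lifts. -/
theorem exists_isLift_local (hq₁ : q₁.Compat N.toSuperData S₁.toSuperData P.pull₁.lin)
    (hq₂ : q₂.Compat N.toSuperData S₂.toSuperData P.pull₂.lin) {X₁ : S₁.sheafEnd ⊤}
    (hX₁ : X₁ ∈ S₁.nilFields) (x : M) : ∃ (W : Opens M) (X : N.sheafEnd W), x ∈ W ∧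
      IsLift q₁ q₂ X₁ X ∧ X ∈ N.homDer 0 W ∧ SuperPresheaf.RaisesDegree 2 X := by
  obtain ⟨U₁, hx₁, ⟨τ₁⟩⟩ := S₁.exists_splitting (φ₁ x)
  obtain ⟨U₂, hx₂, ⟨τ₂⟩⟩ := S₂.exists_splitting (φ₂ x)
  obtain ⟨W, ρ, hxW, hρ⟩ := P.exists_adapted hq₁ hq₂ τ₁ τ₂ x hx₁ hx₂
  let W' : Opens M := W ⊓ bundleDom H F E x
  have hW : W' ≤ W := inf_le_left
  have hd : W' ≤ bundleDom H F E x := inf_le_right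
  have hU₁ : W' ≤ Opens.comap φ₁ U₁ := hW.trans hρ.le₁
  have hU₂ : W' ≤ Opens.comap φ₂ U₂ := hW.trans hρ.le₂
  have hX₁' := SuperPresheaf.endRestrict_mem_homDer (le_top : U₁ ≤ ⊤) hX₁.1
  let D₁ : SecDer I₁ F₁ E₁ 0 U₁ := τ₁.secDer le_rfl hX₁'
  have D₁_raises : ∀ (V : Opens M₁) (hV : V ≤ U₁) (k : ℕ) (f : exteriorSections I₁ F₁ E₁ V),
      (∀ x : V, f.1 x ∈ extFil (E₁ x) k) → ∀ x : V, (D₁.app V hV f).1 x ∈ extFil (E₁ x) (k + 2) :=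
    fun V hV k f hf x => τ₁.raises_secDer le_rfl hX₁' (fun V => hX₁.2 ⟨V.1, le_top⟩) hV k f hf x
  obtain ⟨D, -, hD₁, hD₂⟩ := P.exists_lift hd hU₁ D₁
  refine ⟨W', D.toEnd ρ hW, ⟨hxW, mem_bundleDom x⟩, ⟨fun V₁ V hV h f => ?_,
    fun V₂ V hV h f => ?_⟩, D.toEnd_mem_homDer ρ hW, ?_⟩
  · have hVU : V ≤ Opens.comap φ₁ (V₁ ⊓ U₁) := le_inf h (hV.trans hU₁)
    have red : ∀ g : S₁.Sec V₁, N.res h (q₁.star V₁ g) =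
        N.res hVU (q₁.star (V₁ ⊓ U₁) (S₁.res inf_le_left g)) := fun g => by
      rw [q₁.star_res, N.res_res]
    rw [red, red, SecDer.toEnd_apply, AlgEquiv.symm_apply_eq,
      hρ.eqv_star₁ inf_le_right (hV.trans hW) hVU, hρ.eqv_star₁ inf_le_right (hV.trans hW) hVU,
      hD₁ _ inf_le_right]
    refine congrArg (P.pull₁.sec hVU) ?_
    change τ₁.eqv (V₁ ⊓ U₁) _ (X₁.1 ⟨V₁ ⊓ U₁, _⟩ ((τ₁.eqv (V₁ ⊓ U₁) _).symm
      (τ₁.eqv (V₁ ⊓ U₁) _ (S₁.res inf_le_left f)))) = _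
    rw [AlgEquiv.symm_apply_apply]
    exact congrArg (τ₁.eqv (V₁ ⊓ U₁) inf_le_right)
      (X₁.2 ⟨V₁, le_top⟩ ⟨V₁ ⊓ U₁, le_top⟩ inf_le_left f)
  · have hVU : V ≤ Opens.comap φ₂ (V₂ ⊓ U₂) := le_inf h (hV.trans hU₂)
    have red : N.res h (q₂.star V₂ f) =
        N.res hVU (q₂.star (V₂ ⊓ U₂) (S₂.res inf_le_left f)) := by
      rw [q₂.star_res, N.res_res]
    rw [red, SecDer.toEnd_apply, hρ.eqv_star₂ inf_le_right (hV.trans hW) hVU, hD₂, map_zero]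
  · rw [SecDer.raisesDegree_toEnd_iff]
    let W₁ : Opens M₁ := U₁ ⊓ bundleDom H₁ F₁ E₁ (φ₁ x)
    have hW₁ : W' ≤ Opens.comap φ₁ W₁ := le_inf hU₁ (hd.trans (P.dom_le₁ x))
    have hpull : ∀ (k : ℕ) (g : exteriorSections I₁ F₁ E₁ W₁),
        (∀ y : W₁, g.1 y ∈ extFil (E₁ y) k) → ∀ y : W',
          (D.app W' le_rfl (P.pull₁.sec hW₁ g)).1 y ∈ extFil (E y) (k + 2) := by
      intro k g hg y
      have e := congrFun (congrArg Subtype.val (hD₁ W₁ inf_le_left W' le_rfl hW₁ g)) y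
      have h := map_mem_extFil (P.pull₁.lin y.1)
        (D₁_raises W₁ inf_le_left k g hg ⟨φ₁ y, hW₁ y.2⟩)
      exact (congrArg (· ∈ extFil (E y) (k + 2)) e).mpr h
    intro V hV k f hf y
    refine D.raises hd P.basis P.basisF 2 ?_ ?_ hV k f hf y
    · rintro (i | i) y
      · rw [P.coordSec_inl hd i]
        have h := hpull 0 (coordSec I₁ F₁ E₁ (Module.finBasis ℂ A₁) inf_le_right i)
          (fun y => mem_extFil_zero _) y
        rw [zero_add] at h
        exact h
      · rw [P.coordSec_inr hd i, hD₂]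
        exact zero_mem _
    · rintro (j | j) y
      · rw [P.frameSec_inl hd j]
        exact hpull 1 (frameSec I₁ inf_le_right (Module.finBasis ℂ F₁ j))
          (frameSec_mem inf_le_right _) y
      · rw [P.frameSec_inr hd j, hD₂]
        exact zero_mem _

/-- Global even superderivations of degree two of the first factor lift to the product. -/
theorem exists_isLift (hq₁ : q₁.Compat N.toSuperData S₁.toSuperData P.pull₁.lin)
    (hq₂ : q₂.Compat N.toSuperData S₂.toSuperData P.pull₂.lin) {X₁ : S₁.sheafEnd ⊤}
    (hX₁ : X₁ ∈ S₁.nilFields) : ∃ X ∈ N.nilFields, IsLift q₁ q₂ X₁ X := by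
  choose W X hxW hX hder hdeg using P.exists_isLift_local hq₁ hq₂ hX₁
  obtain ⟨Y, hY⟩ := N.toSuperPresheaf.exists_sheafEnd N.isSheaf W hxW X (by
    intro x y V h h'
    have e := P.ext_of_star hq₁ hq₂ (SuperPresheaf.endRestrict_mem_homDer h (hder x))
      (SuperPresheaf.endRestrict_mem_homDer h' (hder y))
      (fun V₁ V' hV' h₁ f => ((hX x).app₁ V₁ V' (hV'.trans h) h₁ f).trans
        ((hX y).app₁ V₁ V' (hV'.trans h') h₁ f).symm)
      (fun V₂ V' hV' h₂ f => ((hX x).app₂ V₂ V' (hV'.trans h) h₂ f).trans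
        ((hX y).app₂ V₂ V' (hV'.trans h') h₂ f).symm)
    exact congrArg (fun Z : N.sheafEnd V => Z.1 ⟨V, le_rfl⟩) e)
  refine ⟨Y, ⟨?_, ?_⟩, ⟨fun V₁ V hV h f => ?_, fun V₂ V hV h f => ?_⟩⟩
  · refine N.mem_homDer_of_locally fun x _ => ⟨W x, le_top, hxW x, ?_⟩
    rw [hY]
    exact hder x
  · refine SuperPresheaf.raisesDegree_of_locally fun x _ => ⟨W x, le_top, hxW x, ?_⟩
    rw [hY]
    exact hdeg x
  · refine N.toSuperPresheaf.eq_of_locally N.isSheaf fun x hx =>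
      ⟨V ⊓ W x, inf_le_left, ⟨hx, hxW x⟩, ?_⟩
    have e1 := Y.2 ⟨V, hV⟩ ⟨V ⊓ W x, le_top⟩ inf_le_left (N.res h (q₁.star V₁ f))
    have e2 := congrArg (fun Z : N.sheafEnd (W x) => Z.1 ⟨V ⊓ W x, inf_le_right⟩
      (N.res (inf_le_left.trans h) (q₁.star V₁ f))) (hY x)
    rw [N.res_res] at e1 ⊢
    exact e1.symm.trans (e2.trans ((hX x).app₁ V₁ _ inf_le_right _ f))
  · refine N.toSuperPresheaf.eq_of_locally N.isSheaf fun x hx =>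
      ⟨V ⊓ W x, inf_le_left, ⟨hx, hxW x⟩, ?_⟩
    have e1 := Y.2 ⟨V, hV⟩ ⟨V ⊓ W x, le_top⟩ inf_le_left (N.res h (q₂.star V₂ f))
    have e2 := congrArg (fun Z : N.sheafEnd (W x) => Z.1 ⟨V ⊓ W x, inf_le_right⟩
      (N.res (inf_le_left.trans h) (q₂.star V₂ f))) (hY x)
    rw [N.res_res] at e1
    rw [map_zero]
    exact e1.symm.trans (e2.trans ((hX x).app₂ V₂ _ inf_le_right _ f))

end BundleProduct

end GlobalLifts

variable {P : BundleProduct I F E I₁ F₁ E₁ I₂ F₂ E₂ φ₁ φ₂}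

/-! ### Restriction of superderivations to slices -/

section SliceDerivations

theorem BundlePull.sec_invSec_pow {φ : C(M, M₁)} (Q : BundlePull I₁ F₁ E₁ I F E φ) {V₁ : Opens M₁}
    {V : Opens M} (h : V ≤ Opens.comap φ V₁) (n : ℕ) (f : exteriorSections I₁ F₁ E₁ V₁) :
    Q.sec h (((invSec I₁ F₁ E₁ V₁) ^ n) f) = ((invSec I F E V) ^ n) (Q.sec h f) := by
  induction n with
  | zero => rfl
  | succ n ih =>
    rw [pow_succ', pow_succ', AlgHom.mul_apply, AlgHom.mul_apply, ← ih]
    exact Subtype.ext (funext fun x => (inv_map (Q.lin x.1) _).symm)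

namespace BundleProduct.Slices

variable (sl : P.Slices)

/-- The superderivation over the first factor which is the restriction to a slice of a
superderivation over the product. -/
def sliceDer {a : ℕ} {W : Opens M} (B : SecDer I F E a W) (m : M) {W₁ : Opens M₁}
    (hW₁ : W₁ ≤ Opens.comap (sl.slice m) W) : SecDer I₁ F₁ E₁ a W₁ := by
  have hle : ∀ {V₁ : Opens M₁}, V₁ ≤ W₁ →
      V₁ ≤ Opens.comap (sl.slice m) (Opens.comap φ₁ V₁ ⊓ W) := fun {V₁} h x hx => by
    have h1 : φ₁ (sl.slice m x) ∈ V₁ := (sl.fst_slice m x).symm ▸ hx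
    exact ⟨h1, hW₁ (h hx)⟩
  have hpull : ∀ {V₁ : Opens M₁} (h : V₁ ≤ W₁) (f : exteriorSections I₁ F₁ E₁ V₁),
      (sl.pull m).sec (hle h) (P.pull₁.sec inf_le_left f) = f := fun {V₁} h f =>
    sl.sec_pull₁ m (hle h) inf_le_left le_rfl f
  exact
    { app := fun V₁ h => ((sl.pull m).sec (hle h)).toLinearMap ∘ₗ
        B.app (Opens.comap φ₁ V₁ ⊓ W) inf_le_right ∘ₗ (P.pull₁.sec inf_le_left).toLinearMap
      app_res := fun {V' V₁} h hV f => congrArg ((sl.pull m).sec (hle (h.trans hV)))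
        (B.app_res (inf_le_inf_right W (Opens.comap_mono φ₁ h)) inf_le_right
          (P.pull₁.sec inf_le_left f))
      leibniz := fun V₁ hV f g => by
        refine conj_mul (B.leibniz (Opens.comap φ₁ V₁ ⊓ W) inf_le_right)
          (P.pull₁.sec inf_le_left) ((sl.pull m).sec (hle hV)) (hpull hV) (fun f => ?_) f g
        rw [(sl.pull m).sec_invSec_pow, hpull hV f]
      app_inv := fun V₁ hV f =>
        conj_map (B.app_inv (Opens.comap φ₁ V₁ ⊓ W) inf_le_right) (P.pull₁.sec inf_le_left)
          ((sl.pull m).sec (hle hV)) (P.pull₁.sec_invSec_pow inf_le_left 1)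
          ((sl.pull m).sec_invSec_pow (hle hV) 1) f }

theorem sliceDer_app {a : ℕ} {W : Opens M} (B : SecDer I F E a W) (m : M) {W₁ : Opens M₁}
    (hW₁ : W₁ ≤ Opens.comap (sl.slice m) W) {V₁ : Opens M₁} (hV₁ : V₁ ≤ W₁) {V : Opens M}
    (hV : V ≤ W) (h : V₁ ≤ Opens.comap (sl.slice m) V) (h' : V ≤ Opens.comap φ₁ V₁)
    (f : exteriorSections I₁ F₁ E₁ V₁) : (sl.sliceDer B m hW₁).app V₁ hV₁ f =
      (sl.pull m).sec h (B.app V hV (P.pull₁.sec h' f)) := by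
  have e := B.app_res (le_inf h' hV) inf_le_right (P.pull₁.sec inf_le_left f)
  have e' := congrArg ((sl.pull m).sec h) e
  exact e'.symm

/-- A slice intertwines a derivation over the first factor with its lift to the product. -/
theorem app_sec_of_lift {w : M} {W : Opens M} (hW : W ≤ bundleDom H F E w)
    {U₁ : Opens M₁} {D₁ : SecDer I₁ F₁ E₁ 0 U₁} {D : SecDer I F E 0 W} (hD : P.IsSecLift D₁ D)
    {m : M} (hm : m ∈ W) {W₁ : Opens M₁} (hU : W₁ ≤ U₁) (hW₁ : W₁ ≤ Opens.comap (sl.slice m) W)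
    {V : Opens M} (hV : V ≤ W) {V₁ : Opens M₁} (hV₁ : V₁ ≤ W₁)
    (h : V₁ ≤ Opens.comap (sl.slice m) V) (f : exteriorSections I F E V) :
    D₁.app V₁ (hV₁.trans hU) ((sl.pull m).sec h f) = (sl.pull m).sec h (D.app V hV f) := by
  let G₁ : Opens M₁ := U₁ ⊓ bundleDom H₁ F₁ E₁ (φ₁ w)
  have hG₁ : W ≤ Opens.comap φ₁ G₁ := le_inf hD.le (hW.trans (P.dom_le₁ w))
  have hWG : W₁ ≤ G₁ := fun x hx => by
    have h1 : φ₁ (sl.slice m x) ∈ G₁ := hG₁ (hW₁ hx)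
    rwa [sl.fst_slice] at h1
  have e₁ : ∀ g : exteriorSections I₁ F₁ E₁ G₁, (D₁.restrict hU).app W₁ le_rfl
      ((sl.pull m).sec hW₁ (P.pull₁.sec hG₁ g)) =
      (sl.pull m).sec hW₁ (D.app W le_rfl (P.pull₁.sec hG₁ g)) := by
    intro g
    rw [hD.app_pull₁ G₁ inf_le_left W le_rfl hG₁, sl.sec_pull₁ m hW₁ hG₁ hWG,
      sl.sec_pull₁ m hW₁ hG₁ hWG]
    exact D₁.app_res hWG inf_le_left g
  have e₂ : ∀ g : exteriorSections I₂ F₂ E₂ (bundleDom H₂ F₂ E₂ (φ₂ w)),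
      (D₁.restrict hU).app W₁ le_rfl
      ((sl.pull m).sec hW₁ (P.pull₂.sec (hW.trans (P.dom_le₂ w)) g)) =
      (sl.pull m).sec hW₁ (D.app W le_rfl (P.pull₂.sec (hW.trans (P.dom_le₂ w)) g)) := by
    intro g
    rw [hD.app_pull₂, sl.sec_pull₂ m hW₁ (hW.trans (P.dom_le₂ w)) (P.dom_le₂ w (hW hm)),
      map_zero]
    exact SecDer.app_algebraMap _ _ _
  refine SecDer.app_pull (sl.pull m) hW (D₁.restrict hU) D le_rfl hW₁ P.basis P.basisF ?_ ?_
    hV hV₁ h f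
  · rintro (i | i)
    · rw [P.coordSec_inl hW i]
      exact e₁ (coordSec I₁ F₁ E₁ (Module.finBasis ℂ A₁) inf_le_right i)
    · rw [P.coordSec_inr hW i]
      exact e₂ _
  · rintro (j | j)
    · rw [P.frameSec_inl hW j]
      exact e₁ (frameSec I₁ inf_le_right (Module.finBasis ℂ F₁ j))
    · rw [P.frameSec_inr hW j]
      exact e₂ _

end BundleProduct.Slices

end SliceDerivations

/-! ### Contractions along the second factor -/

section Contractions

namespace BundleProduct

variable (P) in
/-- The linear forms on the model fibre which are the coordinates of the second factor. -/
def coord₂ (j : Fin (Module.finrank ℂ F₂)) : Module.Dual ℂ F := P.basisF.coord (Sum.inr j)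

theorem coord₂_inl (j : Fin (Module.finrank ℂ F₂)) (i : Fin (Module.finrank ℂ F₁)) :
    P.coord₂ j (P.basisF (Sum.inl i)) = 0 := by
  simp [coord₂]

theorem coord₂_inr (i j : Fin (Module.finrank ℂ F₂)) :
    P.coord₂ i (P.basisF (Sum.inr j)) = if i = j then 1 else 0 := by
  simp [coord₂, Finsupp.single_apply, eq_comm]

theorem trivSymm_basisF_inl {w x : M} (hx : x ∈ bundleDom H F E w)
    (i : Fin (Module.finrank ℂ F₁)) : trivSymm F E w x (P.basisF (Sum.inl i)) =
      P.pull₁.lin x (trivSymm F₁ E₁ (φ₁ w) (φ₁ x) (Module.finBasis ℂ F₁ i)) := by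
  rw [P.trivSymm_eq w x hx]
  simp [basisF]

theorem trivSymm_basisF_inr {w x : M} (hx : x ∈ bundleDom H F E w)
    (j : Fin (Module.finrank ℂ F₂)) : trivSymm F E w x (P.basisF (Sum.inr j)) =
      P.pull₂.lin x (trivSymm F₂ E₂ (φ₂ w) (φ₂ x) (Module.finBasis ℂ F₂ j)) := by
  rw [P.trivSymm_eq w x hx]
  simp [basisF]

/-- The coordinates of the second factor vanish on the first factor. -/
theorem coord₂_comp_pull₁ {w x : M} (hx : x ∈ bundleDom H F E w)
    (j : Fin (Module.finrank ℂ F₂)) :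
    (P.coord₂ j ∘ₗ triv F E w x) ∘ₗ P.pull₁.lin x = 0 := by
  have hx₁ : φ₁ x ∈ trivDom F₁ E₁ (φ₁ w) := bundleDom_le_trivDom (P.dom_le₁ w hx)
  refine LinearMap.ext fun v => ?_
  have hv : P.pull₁.lin x v =
      trivSymm F E w x (P.fibreEquiv.symm (triv F₁ E₁ (φ₁ w) (φ₁ x) v, 0)) := by
    rw [P.trivSymm_eq w x hx, LinearEquiv.apply_symm_apply, map_zero, map_zero, add_zero]
    exact congrArg _ (LinearMap.congr_fun (trivSymm_comp_triv hx₁) v).symm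
  have h := LinearMap.congr_fun (triv_comp_trivSymm (bundleDom_le_trivDom hx))
    (P.fibreEquiv.symm (triv F₁ E₁ (φ₁ w) (φ₁ x) v, 0))
  change P.coord₂ j (triv F E w x (P.pull₁.lin x v)) = 0
  rw [hv]
  refine (congrArg (P.coord₂ j) h).trans ?_
  simp [coord₂, basisF]

/-- The projection along the coordinates of the second factor is the projection to the fibre of the
first one. -/
theorem sub_sum_eq (sl : P.Slices) {w x : M} (hx : x ∈ bundleDom H F E w) :
    LinearMap.id - ∑ j, (P.coord₂ j ∘ₗ triv F E w x).smulRight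
      (trivSymm F E w x (P.basisF (Sum.inr j))) = P.pull₁.lin x ∘ₗ sl.proj x := by
  refine LinearMap.ext fun v => ?_
  obtain ⟨u, rfl⟩ : ∃ u, trivSymm F E w x u = v :=
    ⟨triv F E w x v, LinearMap.congr_fun (trivSymm_comp_triv (bundleDom_le_trivDom hx)) v⟩
  have hu : triv F E w x (trivSymm F E w x u) = u :=
    LinearMap.congr_fun (triv_comp_trivSymm (bundleDom_le_trivDom hx)) u
  have e : ∀ z : F, (LinearMap.id - ∑ j, (P.coord₂ j ∘ₗ triv F E w x).smulRight
      (trivSymm F E w x (P.basisF (Sum.inr j))) : E x →ₗ[ℂ] E x) (trivSymm F E w x z) =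
      trivSymm F E w x z - ∑ j, P.coord₂ j z • trivSymm F E w x (P.basisF (Sum.inr j)) := by
    intro z
    have hz : triv F E w x (trivSymm F E w x z) = z :=
      LinearMap.congr_fun (triv_comp_trivSymm (bundleDom_le_trivDom hx)) z
    simp [hz]
  clear hu
  have key : (LinearMap.id - ∑ j, (P.coord₂ j ∘ₗ triv F E w x).smulRight
      (trivSymm F E w x (P.basisF (Sum.inr j)))) ∘ₗ trivSymm F E w x =
      (P.pull₁.lin x ∘ₗ sl.proj x) ∘ₗ trivSymm F E w x := by
    refine P.basisF.ext ?_
    rintro (i | i)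
    · refine (e _).trans ?_
      change _ = P.pull₁.lin x (sl.proj x (trivSymm F E w x (P.basisF (Sum.inl i))))
      rw [trivSymm_basisF_inl hx, sl.proj_pull₁]
      simp [coord₂_inl]
    · refine (e _).trans ?_
      change _ = P.pull₁.lin x (sl.proj x (trivSymm F E w x (P.basisF (Sum.inr i))))
      simp only [coord₂_inr]
      rw [trivSymm_basisF_inr hx, sl.proj_pull₂]
      simp [trivSymm_basisF_inr hx]
  exact LinearMap.congr_fun key u

variable (P) in
/-- Contraction with a coordinate of the second factor. -/
def ctr₂ {w : M} {W : Opens M} (hW : W ≤ bundleDom H F E w) (j : Fin (Module.finrank ℂ F₂)) :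
    SecDer I F E 1 W :=
  ctrDer (hW.trans bundleDom_le_trivDom) (P.coord₂ j)

theorem ctr₂_pull₁ {w : M} {W : Opens M} (hW : W ≤ bundleDom H F E w)
    (j : Fin (Module.finrank ℂ F₂)) {V : Opens M} (hV : V ≤ W) {V₁ : Opens M₁}
    (h : V ≤ Opens.comap φ₁ V₁) (f : exteriorSections I₁ F₁ E₁ V₁) :
    (P.ctr₂ hW j).app V hV (P.pull₁.sec h f) = 0 := by
  refine Subtype.ext (funext fun x => ?_)
  change ctr (P.coord₂ j ∘ₗ triv F E w x) (ExteriorAlgebra.map (P.pull₁.lin x) _) = 0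
  rw [ctr_map, coord₂_comp_pull₁ (hW (hV x.2)), ctr, map_zero, LinearMap.zero_apply, map_zero]

/-- Lifts from the first factor commute with the contractions along the second factor. -/
theorem IsSecLift.comm_ctr₂ {w : M} {W : Opens M} (hW : W ≤ bundleDom H F E w) {U₁ : Opens M₁}
    {D₁ : SecDer I₁ F₁ E₁ 0 U₁} {D : SecDer I F E 0 W} (hD : P.IsSecLift D₁ D)
    (j : Fin (Module.finrank ℂ F₂)) {V : Opens M} (hV : V ≤ W) (f : exteriorSections I F E V) :
    D.app V hV ((P.ctr₂ hW j).app V hV f) = (P.ctr₂ hW j).app V hV (D.app V hV f) := by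
  have hW₁ : W ≤ Opens.comap φ₁ (U₁ ⊓ bundleDom H₁ F₁ E₁ (φ₁ w)) :=
    le_inf hD.le (hW.trans (P.dom_le₁ w))
  have e₁ : ∀ g : exteriorSections I₁ F₁ E₁ (U₁ ⊓ bundleDom H₁ F₁ E₁ (φ₁ w)),
      (P.ctr₂ hW j).app W le_rfl (D.app W le_rfl (P.pull₁.sec hW₁ g)) = 0 := fun g => by
    rw [hD.app_pull₁ _ inf_le_left, ctr₂_pull₁]
  have key : ∀ g : exteriorSections I F E W, (∃ r : ℂ, (P.ctr₂ hW j).app W le_rfl g =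
      algebraMap ℂ _ r) → (P.ctr₂ hW j).app W le_rfl (D.app W le_rfl g) = 0 →
      (D.bracket (P.ctr₂ hW j)).app W le_rfl g = (0 : SecDer I F E (0 + 1) W).app W le_rfl g := by
    rintro g ⟨r, hr⟩ hg
    rw [SecDer.bracket_app, hr, hg, SecDer.app_algebraMap, smul_zero, sub_zero]
    rfl
  -- The bracket is a superderivation which vanishes on the coordinates.
  have h := SecDer.ext_of_coord hW (D := D.bracket (P.ctr₂ hW j)) (D' := 0) P.basis P.basisF
    (fun i => key _ ⟨0, (ctrDer_coordSec hW _ _ i).trans (map_zero _).symm⟩ (by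
      rcases i with i | i
      · rw [P.coordSec_inl hW i]
        exact e₁ (coordSec I₁ F₁ E₁ (Module.finBasis ℂ A₁) inf_le_right i)
      · rw [P.coordSec_inr hW i, hD.app_pull₂, map_zero]))
    (fun i => key _ ⟨_, ctrDer_frameSec hW _ _⟩ (by
      rcases i with i | i
      · rw [P.frameSec_inl hW i]
        exact e₁ (frameSec I₁ inf_le_right (Module.finBasis ℂ F₁ i))
      · rw [P.frameSec_inr hW i, hD.app_pull₂, map_zero])) hV f
  rw [SecDer.bracket_app, zero_mul, pow_zero, one_smul] at h
  exact sub_eq_zero.1 h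

/-- The iterated supercommutators of a superderivation with the contractions along the second factor
are superderivations; on the pullbacks from the first factor they coincide with the composites. -/
theorem exists_iterated_bracket {w : M} {W : Opens M} (hW : W ≤ bundleDom H F E w) {a : ℕ}
    (Y : SecDer I F E a W) (l : List (Fin (Module.finrank ℂ F₂))) :
    ∃ (n : ℕ) (B : SecDer I F E n W),
      (∀ D : SecDer I F E 0 W,
        (∀ (V : Opens M) (hV : V ≤ W) (f : exteriorSections I F E V),
          D.app V hV (Y.app V hV f) = Y.app V hV (D.app V hV f)) →
        (∀ j (V : Opens M) (hV : V ≤ W) (f : exteriorSections I F E V),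
          D.app V hV ((P.ctr₂ hW j).app V hV f) = (P.ctr₂ hW j).app V hV (D.app V hV f)) →
        ∀ (V : Opens M) (hV : V ≤ W) (f : exteriorSections I F E V),
          D.app V hV (B.app V hV f) = B.app V hV (D.app V hV f)) ∧
      ∀ (V₁ : Opens M₁) (V : Opens M) (hV : V ≤ W) (h : V ≤ Opens.comap φ₁ V₁)
        (f : exteriorSections I₁ F₁ E₁ V₁) (x : V), (B.app V hV (P.pull₁.sec h f)).1 x =
          ctrList (fun j => P.coord₂ j ∘ₗ triv F E w x) l ((Y.app V hV (P.pull₁.sec h f)).1 x) := by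
  induction l with
  | nil => exact ⟨a, Y, fun D h _ => h, fun V₁ V hV h f x => rfl⟩
  | cons j l ih =>
    obtain ⟨n, B, hB, hB'⟩ := ih
    refine ⟨1 + n, (P.ctr₂ hW j).bracket B, fun D hY hc V hV f => ?_, fun V₁ V hV h f x => ?_⟩
    · rw [SecDer.bracket_app, SecDer.bracket_app, map_sub, map_smul, hc, hB D hY hc, hB D hY hc, hc]
    · rw [SecDer.bracket_app, ctr₂_pull₁, map_zero, smul_zero, sub_zero]
      exact congrArg (ctr (P.coord₂ j ∘ₗ triv F E w x)) (hB' V₁ V hV h f x)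

end BundleProduct

end Contractions

/-! ### Nildominance of products -/

section Nildominance

/-- Strict nildominance read in a local splitting: a superderivation of sections which commutes with
the global even superderivations of degree two raises degrees by `t`. -/
theorem LocalSplitting.raises_of_commutes {S : Supermanifold I F E} {t : ℕ}
    (hS : S.StrictlyNildominated t) {U W : Opens M} (τ : LocalSplitting I F S.toSuperData U)
    (hW : W ≤ U) {a : ℕ} (Z : SecDer I F E a W)
    (hZ : ∀ (X : S.sheafEnd ⊤) (hX : X ∈ S.nilFields) (V : Opens M) (hV : V ≤ W)
      (f : exteriorSections I F E V),
      (τ.secDer le_rfl (SuperPresheaf.endRestrict_mem_homDer (le_top : U ≤ ⊤) hX.1)).app V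
        (hV.trans hW) (Z.app V hV f) = Z.app V hV ((τ.secDer le_rfl
          (SuperPresheaf.endRestrict_mem_homDer (le_top : U ≤ ⊤) hX.1)).app V (hV.trans hW) f))
    {V : Opens M} (hV : V ≤ W) (k : ℕ) (f : exteriorSections I F E V)
    (hf : ∀ x : V, f.1 x ∈ extFil (E x) k) (x : V) : (Z.app V hV f).1 x ∈ extFil (E x) (k + t) := by
  have hle : ∀ p : ZMod 2, S.homDer p W ≤ S.superDer W := by
    intro p
    fin_cases p
    · exact le_sup_left
    · exact le_sup_right
  refine (Z.raisesDegree_toEnd_iff τ hW t).1 (hS W ⟨hle _ (Z.toEnd_mem_homDer τ hW),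
    fun X hX => ?_⟩).2 V hV k f hf x
  refine Subtype.ext (funext fun V => LinearMap.ext fun g => ?_)
  have h := congrArg (τ.eqv V.1 (V.2.trans hW)).symm (hZ X hX V.1 V.2 (τ.eqv V.1 (V.2.trans hW) g))
  change (τ.eqv V.1 (V.2.trans hW)).symm (τ.eqv V.1 (V.2.trans hW) (X.1 ⟨V.1, le_top⟩
    ((τ.eqv V.1 (V.2.trans hW)).symm _))) = (τ.eqv V.1 (V.2.trans hW)).symm (Z.app V.1 V.2
      (τ.eqv V.1 (V.2.trans hW) (X.1 ⟨V.1, le_top⟩ ((τ.eqv V.1 (V.2.trans hW)).symm _)))) at h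
  rw [AlgEquiv.symm_apply_apply, AlgEquiv.symm_apply_apply] at h
  exact sub_eq_zero.2 h

theorem HasParity.eq_zero_of_add_eq_zero (S : Supermanifold I F E) {U : Opens M}
    {Z₀ Z₁ : S.sheafEnd U} (h₀ : SuperPresheaf.HasParity 0 Z₀)
    (h₁ : SuperPresheaf.HasParity 1 Z₁) (h : Z₀ + Z₁ = 0) : Z₀ = 0 ∧ Z₁ = 0 := by
  have hadd : ∀ V (f : S.Sec V.1), Z₁.1 V f = -Z₀.1 V f := fun V f =>
    eq_neg_of_add_eq_zero_right (congrArg (fun Z : S.sheafEnd U => Z.1 V f) h :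
      Z₀.1 V f + Z₁.1 V f = 0)
  have key : ∀ V (q : ZMod 2) (f : S.Sec V.1), f ∈ S.parity V.1 q → Z₀.1 V f = 0 := by
    intro V q f hf
    have hp := h₀ V q f hf
    have hp' := h₁ V q f hf
    rw [zero_add] at hp
    rw [hadd, neg_mem_iff, add_comm] at hp'
    exact eq_zero_of_isInternal (S.parity_isInternal V.1) hp hp'
  have hz : ∀ V (f : S.Sec V.1), Z₀.1 V f = 0 := by
    intro V f
    obtain ⟨a, ha, b, hb, rfl⟩ := exists_add_of_isInternal (S.parity_isInternal V.1) f
    rw [map_add, key V 0 a ha, key V 1 b hb, add_zero]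
  refine ⟨Subtype.ext (funext fun V => LinearMap.ext (hz V)),
    Subtype.ext (funext fun V => LinearMap.ext fun f => ?_)⟩
  rw [hadd, hz, neg_zero]
  rfl

/-- The homogeneous parts of an endomorphism commute with every even endomorphism which commutes
with the sum. -/
theorem HasParity.lie_eq_zero_of_lie_add (S : Supermanifold I F E) {U : Opens M}
    {X Y₀ Y₁ : S.sheafEnd U} (hX : SuperPresheaf.HasParity 0 X)
    (h₀ : SuperPresheaf.HasParity 0 Y₀) (h₁ : SuperPresheaf.HasParity 1 Y₁)
    (h : ⁅X, Y₀ + Y₁⁆ = 0) : ⁅X, Y₀⁆ = 0 ∧ ⁅X, Y₁⁆ = 0 := by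
  have key : ∀ (p : ZMod 2) (Y : S.sheafEnd U), SuperPresheaf.HasParity p Y →
      SuperPresheaf.HasParity p ⁅X, Y⁆ := by
    intro p Y hY V q f hf
    have h1 := hX V _ _ (hY V q f hf)
    have h2 := hY V _ _ (hX V q f hf)
    rw [zero_add] at h1 h2
    exact sub_mem h1 h2
  refine HasParity.eq_zero_of_add_eq_zero S (key 0 Y₀ h₀) (key 1 Y₁ h₁) (Subtype.ext
    (funext fun V => LinearMap.ext fun f => ?_))
  have e : X.1 V (Y₀.1 V f + Y₁.1 V f) - (Y₀.1 V (X.1 V f) + Y₁.1 V (X.1 V f)) = 0 :=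
    congrArg (fun Z : S.sheafEnd U => Z.1 V f) h
  rw [map_add, add_sub_add_comm] at e
  exact e

theorem LocalSplitting.raisesDegree_of_secDer {S : Supermanifold I F E} {U W : Opens M}
    (τ : LocalSplitting I F S.toSuperData U) (hW : W ≤ U) {p : ZMod 2} {X : S.sheafEnd W}
    (hX : X ∈ S.homDer p W) {t : ℕ} (h : ∀ (V : Opens M) (hV : V ≤ W) (k : ℕ)
      (f : exteriorSections I F E V), (∀ x : V, f.1 x ∈ extFil (E x) k) →
      ∀ x : V, ((τ.secDer hW hX).app V hV f).1 x ∈ extFil (E x) (k + t)) :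
    SuperPresheaf.RaisesDegree t X := by
  intro V k f hf
  have h1 := h V.1 V.2 k (τ.eqv V.1 (V.2.trans hW) f)
    ((mem_filtration_iff _).1 ((τ.eqv_mem_filtration (V.2.trans hW) k f).2 hf))
  have h2 := (τ.eqv_mem_filtration (V.2.trans hW) (k + t) (X.1 V f)).1
  refine h2 ((mem_filtration_iff _).2 fun x => ?_)
  have e : (τ.secDer hW hX).app V.1 V.2 (τ.eqv V.1 (V.2.trans hW) f) =
      τ.eqv V.1 (V.2.trans hW) (X.1 V f) :=
    congrArg (fun g => τ.eqv V.1 (V.2.trans hW) (X.1 V g)) (AlgEquiv.symm_apply_apply _ f)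
  rw [← e]
  exact h1 x

variable
  {S₁ : Supermanifold I₁ F₁ E₁} {S₂ : Supermanifold I₂ F₂ E₂} {N : Supermanifold I F E}
  {q₁ : SuperMorphism N.toSuperPresheaf S₁.toSuperPresheaf φ₁}
  {q₂ : SuperMorphism N.toSuperPresheaf S₂.toSuperPresheaf φ₂}

namespace BundleProduct

/-- In adapted splittings, the lift of a superderivation of superfunctions becomes a lift of a
derivation of sections. -/
theorem Adapted.isSecLift {W : Opens M} {U₁ : Opens M₁} {U₂ : Opens M₂}
    {ρ : LocalSplitting I F N.toSuperData W} {τ₁ : LocalSplitting I₁ F₁ S₁.toSuperData U₁}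
    {τ₂ : LocalSplitting I₂ F₂ S₂.toSuperData U₂} (hρ : P.Adapted q₁ q₂ ρ τ₁ τ₂) {W' : Opens M}
    (hW : W' ≤ W) {X₁ : S₁.sheafEnd ⊤} (hX₁ : X₁ ∈ S₁.nilFields) {X : N.sheafEnd ⊤}
    (hX : X ∈ N.nilFields) (hlift : IsLift q₁ q₂ X₁ X) :
    P.IsSecLift (τ₁.secDer le_rfl (SuperPresheaf.endRestrict_mem_homDer (le_top : U₁ ≤ ⊤) hX₁.1))
      (ρ.secDer hW (SuperPresheaf.endRestrict_mem_homDer (le_top : W' ≤ ⊤) hX.1)) := by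
  refine ⟨hW.trans hρ.le₁, fun V₁ hV₁ V hV h f => ?_, fun V₂ V hV h f => ?_⟩
  · have e := hρ.eqv_star₁ hV₁ (hV.trans hW) h ((τ₁.eqv V₁ hV₁).symm f)
    rw [AlgEquiv.apply_symm_apply] at e
    rw [← e]
    change ρ.eqv V (hV.trans hW) (X.1 ⟨V, le_top⟩ ((ρ.eqv V (hV.trans hW)).symm
      (ρ.eqv V (hV.trans hW) _))) = P.pull₁.sec h (τ₁.eqv V₁ hV₁ (X₁.1 ⟨V₁, le_top⟩ _))
    rw [AlgEquiv.symm_apply_apply, hlift.app₁ V₁ V le_top h, hρ.eqv_star₁ hV₁ (hV.trans hW) h]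
    rfl
  · have hVU : V ≤ Opens.comap φ₂ (V₂ ⊓ U₂) := le_inf h ((hV.trans hW).trans hρ.le₂)
    have red : P.pull₂.sec h f = P.pull₂.sec hVU (exteriorRes I₂ F₂ E₂ inf_le_left f) := rfl
    have e := hρ.eqv_star₂ inf_le_right (hV.trans hW) hVU
      ((τ₂.eqv (V₂ ⊓ U₂) inf_le_right).symm (exteriorRes I₂ F₂ E₂ inf_le_left f))
    rw [AlgEquiv.apply_symm_apply] at e
    rw [red, ← e]
    change ρ.eqv V (hV.trans hW) (X.1 ⟨V, le_top⟩ ((ρ.eqv V (hV.trans hW)).symm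
      (ρ.eqv V (hV.trans hW) _))) = 0
    rw [AlgEquiv.symm_apply_apply, hlift.app₂ _ V le_top hVU, map_zero]

/-- A homogeneous superderivation of the product which commutes with the global even
superderivations of degree two has the degree of nildominance of the first factor on the
superfunctions which are pulled back from it. -/
theorem Adapted.raises_pull₁ (sl : P.Slices)
    (hq₁ : q₁.Compat N.toSuperData S₁.toSuperData P.pull₁.lin)
    (hq₂ : q₂.Compat N.toSuperData S₂.toSuperData P.pull₂.lin) {t₁ : ℕ}
    (h₁ : S₁.StrictlyNildominated t₁) {W : Opens M} {U₁ : Opens M₁} {U₂ : Opens M₂}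
    {ρ : LocalSplitting I F N.toSuperData W} {τ₁ : LocalSplitting I₁ F₁ S₁.toSuperData U₁}
    {τ₂ : LocalSplitting I₂ F₂ S₂.toSuperData U₂} (hρ : P.Adapted q₁ q₂ ρ τ₁ τ₂) {W' : Opens M}
    (hW : W' ≤ W) {w : M} (hd : W' ≤ bundleDom H F E w) {p : ZMod 2} {Y : N.sheafEnd W'}
    (hY : Y ∈ N.homDer p W')
    (hc : ∀ X ∈ N.nilFields, ⁅SuperPresheaf.endRestrict (le_top : W' ≤ ⊤) X, Y⁆ = 0)
    {V₁ : Opens M₁} (h : W' ≤ Opens.comap φ₁ V₁) (k : ℕ) (f : exteriorSections I₁ F₁ E₁ V₁)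
    (hf : ∀ x : V₁, f.1 x ∈ extFil (E₁ x) k) (y : W') :
    ((ρ.secDer hW hY).app W' le_rfl (P.pull₁.sec h f)).1 y ∈ extFil (E y) (k + t₁) := by
  have hδ : ∀ i j, (P.coord₂ i ∘ₗ triv F E w y) (trivSymm F E w y (P.basisF (Sum.inr j))) =
      if i = j then 1 else 0 := fun i j => by
    rw [← coord₂_inr (P := P) i j]
    exact congrArg (P.coord₂ i)
      (LinearMap.congr_fun (triv_comp_trivSymm (bundleDom_le_trivDom (hd y.2))) _)
  -- It suffices to bound the iterated contractions along the second factor,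
  -- projected to the first.
  refine mem_extFil_of_ctrList hδ fun l => ?_
  rw [sub_sum_eq sl (hd y.2), ← ExteriorAlgebra.map_comp_map, AlgHom.comp_apply]
  refine map_mem_extFil _ ?_
  obtain ⟨n, B, hB, hB'⟩ := exists_iterated_bracket (P := P) hd (ρ.secDer hW hY) l
  -- The slice through `y` stays in `W'` over a neighbourhood of the image of `y`.
  obtain ⟨G₁, G₂, hyG₁, hyG₂, hG⟩ := P.exists_box W' y.1 y.2
  let W₁ : Opens M₁ := G₁ ⊓ (U₁ ⊓ V₁)
  have hyW₁ : φ₁ y ∈ W₁ := ⟨hyG₁, hρ.le₁ (hW y.2), h y.2⟩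
  have hWU : W₁ ≤ U₁ := inf_le_right.trans inf_le_left
  have hWV : W₁ ≤ V₁ := inf_le_right.trans inf_le_right
  have hs : W₁ ≤ Opens.comap (sl.slice y) W' := fun x hx => by
    refine hG ⟨?_, ?_⟩
    · change φ₁ (sl.slice y x) ∈ G₁
      rw [sl.fst_slice]
      exact hx.1
    · change φ₂ (sl.slice y x) ∈ G₂
      rw [sl.snd_slice]
      exact hyG₂
  -- The restriction of `B` to the slice commutes with the superderivations `X₁` of the first
  -- factor, because `B` commutes with their lifts.
  have key := τ₁.raises_of_commutes h₁ hWU (sl.sliceDer B y hs) (fun X₁ hX₁ V hV g => by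
    obtain ⟨X, hX, hlift⟩ := P.exists_isLift hq₁ hq₂ hX₁
    have hsec := hρ.isSecLift hW hX₁ hX hlift
    set D₁ : SecDer I₁ F₁ E₁ 0 U₁ :=
      τ₁.secDer le_rfl (SuperPresheaf.endRestrict_mem_homDer (le_top : U₁ ≤ ⊤) hX₁.1)
    set D : SecDer I F E 0 W' :=
      ρ.secDer hW (SuperPresheaf.endRestrict_mem_homDer (le_top : W' ≤ ⊤) hX.1) with hDdef
    have hDY : ∀ (V : Opens M) (hV : V ≤ W') (f : exteriorSections I F E V),
        D.app V hV ((ρ.secDer hW hY).app V hV f) = (ρ.secDer hW hY).app V hV (D.app V hV f) := by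
      intro V hV f
      have e := congrArg (fun Z : N.sheafEnd W' => Z.1 ⟨V, hV⟩ ((ρ.eqv V (hV.trans hW)).symm f))
        (hc X hX)
      have e' : X.1 ⟨V, le_top⟩ (Y.1 ⟨V, hV⟩ ((ρ.eqv V (hV.trans hW)).symm f)) =
          Y.1 ⟨V, hV⟩ (X.1 ⟨V, le_top⟩ ((ρ.eqv V (hV.trans hW)).symm f)) := sub_eq_zero.1 e
      change ρ.eqv V (hV.trans hW) (X.1 ⟨V, le_top⟩ ((ρ.eqv V (hV.trans hW)).symm
        (ρ.eqv V (hV.trans hW) (Y.1 ⟨V, hV⟩ ((ρ.eqv V (hV.trans hW)).symm f))))) =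
        ρ.eqv V (hV.trans hW) (Y.1 ⟨V, hV⟩ ((ρ.eqv V (hV.trans hW)).symm
        (ρ.eqv V (hV.trans hW) (X.1 ⟨V, le_top⟩ ((ρ.eqv V (hV.trans hW)).symm f)))))
      rw [AlgEquiv.symm_apply_apply, AlgEquiv.symm_apply_apply, e']
    have hDB := hB D hDY (fun j V hV f => hsec.comm_ctr₂ hd j hV f)
    have hle : V ≤ Opens.comap (sl.slice y) (Opens.comap φ₁ V ⊓ W') := fun x hx => by
      have h1 : φ₁ (sl.slice y x) ∈ V := (sl.fst_slice y x).symm ▸ hx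
      exact ⟨h1, hs (hV hx)⟩
    rw [sl.sliceDer_app B y hs hV inf_le_right hle inf_le_left,
      sl.sliceDer_app B y hs hV inf_le_right hle inf_le_left,
      sl.app_sec_of_lift hd hsec y.2 hWU hs inf_le_right hV hle, hDB,
      hsec.app_pull₁ V (hV.trans hWU)]) le_rfl k (exteriorRes I₁ F₁ E₁ hWV f)
    (fun x => hf ⟨x.1, hWV x.2⟩) ⟨φ₁ y, hyW₁⟩
  have hle : W₁ ≤ Opens.comap (sl.slice y) (Opens.comap φ₁ W₁ ⊓ W') := fun x hx => by
    have h1 : φ₁ (sl.slice y x) ∈ W₁ := (sl.fst_slice y x).symm ▸ hx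
    exact ⟨h1, hs hx⟩
  have hyI : y.1 ∈ Opens.comap φ₁ W₁ ⊓ W' := ⟨hyW₁, y.2⟩
  rw [sl.sliceDer_app B y hs le_rfl inf_le_right hle inf_le_left,
    sl.sec_self y.1 hle hyI hyW₁] at key
  have e := B.app_res (inf_le_right : Opens.comap φ₁ W₁ ⊓ W' ≤ W') le_rfl (P.pull₁.sec h f)
  have e1 := congrFun (congrArg Subtype.val e) ⟨y.1, hyI⟩
  have e2 := hB' V₁ W' le_rfl h f y
  exact (congrArg (fun z => ExteriorAlgebra.map (sl.proj y) z ∈ extFil (E₁ (φ₁ y)) (k + t₁))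
    (e1.trans e2)).mp key

/-- A homogeneous superderivation of the product which commutes with the global even
superderivations of degree two has the smaller one of the degrees of nildominance of the factors. -/
theorem raisesDegree_of_commutes (sl₁ : P.Slices) (sl₂ : P.swap.Slices)
    (hq₁ : q₁.Compat N.toSuperData S₁.toSuperData P.pull₁.lin)
    (hq₂ : q₂.Compat N.toSuperData S₂.toSuperData P.pull₂.lin) {t₁ t₂ : ℕ}
    (h₁ : S₁.StrictlyNildominated t₁) (h₂ : S₂.StrictlyNildominated t₂) {U : Opens M}
    {p : ZMod 2} {Y : N.sheafEnd U} (hY : Y ∈ N.homDer p U)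
    (hc : ∀ X ∈ N.nilFields, ⁅SuperPresheaf.endRestrict (le_top : U ≤ ⊤) X, Y⁆ = 0) :
    SuperPresheaf.RaisesDegree (min t₁ t₂) Y := by
  refine SuperPresheaf.raisesDegree_of_locally fun x hx => ?_
  obtain ⟨U₁, hx₁, ⟨τ₁⟩⟩ := S₁.exists_splitting (φ₁ x)
  obtain ⟨U₂, hx₂, ⟨τ₂⟩⟩ := S₂.exists_splitting (φ₂ x)
  obtain ⟨W, ρ, hxW, hρ⟩ := P.exists_adapted hq₁ hq₂ τ₁ τ₂ x hx₁ hx₂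
  let W' : Opens M := (W ⊓ U) ⊓ bundleDom H F E x
  have hU : W' ≤ U := inf_le_left.trans inf_le_right
  have hW : W' ≤ W := inf_le_left.trans inf_le_left
  have hd : W' ≤ bundleDom H F E x := inf_le_right
  have hY' := SuperPresheaf.endRestrict_mem_homDer hU hY
  have hc' : ∀ X ∈ N.nilFields, ⁅SuperPresheaf.endRestrict (le_top : W' ≤ ⊤) X,
      SuperPresheaf.endRestrict hU Y⁆ = 0 :=
    fun X hX => congrArg (SuperPresheaf.endRestrict hU) (hc X hX)
  refine ⟨W', hU, ⟨⟨hxW, hx⟩, mem_bundleDom x⟩, ρ.raisesDegree_of_secDer hW hY'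
    fun V hV k f hf y => ?_⟩
  have r₁ := fun (V₁ : Opens M₁) (h : W' ≤ Opens.comap φ₁ V₁) =>
    hρ.raises_pull₁ sl₁ hq₁ hq₂ h₁ hW hd hY' hc' h
  have r₂ := fun (V₂ : Opens M₂) (h : W' ≤ Opens.comap φ₂ V₂) =>
    hρ.swap.raises_pull₁ sl₂ hq₂ hq₁ h₂ hW hd hY' hc' h
  refine SecDer.raises hd _ P.basis P.basisF (min t₁ t₂) ?_ ?_ hV k f hf y
  · rintro (i | i) y
    · have h := extFil_antitone (add_le_add le_rfl (min_le_left t₁ t₂))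
        (r₁ _ (hd.trans (P.dom_le₁ x)) 0
          (coordSec I₁ F₁ E₁ (Module.finBasis ℂ A₁) le_rfl i) (fun y => mem_extFil_zero _) y)
      rw [zero_add] at h
      rw [P.coordSec_inl hd i]
      exact h
    · have h := extFil_antitone (add_le_add le_rfl (min_le_right t₁ t₂))
        (r₂ _ (hd.trans (P.dom_le₂ x)) 0
          (coordSec I₂ F₂ E₂ (Module.finBasis ℂ A₂) le_rfl i) (fun y => mem_extFil_zero _) y)
      rw [zero_add] at h
      rw [P.coordSec_inr hd i]
      exact h
  · rintro (j | j) y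
    · have h := extFil_antitone (add_le_add le_rfl (min_le_left t₁ t₂))
        (r₁ _ (hd.trans (P.dom_le₁ x)) 1 (frameSec I₁ le_rfl (Module.finBasis ℂ F₁ j))
          (frameSec_mem le_rfl _) y)
      rw [add_comm 1] at h
      rw [P.frameSec_inl hd j]
      exact h
    · have h := extFil_antitone (add_le_add le_rfl (min_le_right t₁ t₂))
        (r₂ _ (hd.trans (P.dom_le₂ x)) 1 (frameSec I₂ le_rfl (Module.finBasis ℂ F₂ j))
          (frameSec_mem le_rfl _) y)
      rw [add_comm 1] at h
      rw [P.frameSec_inr hd j]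
      exact h

/-- A product of supermanifolds is strictly nildominated of the smaller one of the two degrees. -/
theorem strictlyNildominated (sl₁ : P.Slices) (sl₂ : P.swap.Slices)
    (hq₁ : q₁.Compat N.toSuperData S₁.toSuperData P.pull₁.lin)
    (hq₂ : q₂.Compat N.toSuperData S₂.toSuperData P.pull₂.lin) {t₁ t₂ : ℕ}
    (h₁ : S₁.StrictlyNildominated t₁) (h₂ : S₂.StrictlyNildominated t₂) :
    N.StrictlyNildominated (min t₁ t₂) := by
  rintro U Y ⟨hY, hc⟩
  refine ⟨hY, ?_⟩
  obtain ⟨Y₀, h₀, Y₁, h₁', rfl⟩ := Submodule.mem_sup.1 hY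
  have hc' := fun X (hX : X ∈ N.nilFields) => HasParity.lie_eq_zero_of_lie_add N
    (SuperPresheaf.endRestrict_mem_homDer (le_top : U ≤ ⊤) hX.1).1 h₀.1 h₁'.1 (hc X hX)
  intro V k f hf
  exact SuperPresheaf.add_mem_filtration
    (raisesDegree_of_commutes sl₁ sl₂ hq₁ hq₂ h₁ h₂ h₀ (fun X hX => (hc' X hX).1) V k f hf)
    (raisesDegree_of_commutes sl₁ sl₂ hq₁ hq₂ h₁ h₂ h₁' (fun X hX => (hc' X hX).2) V k f hf)

end BundleProduct

end Nildominance

end Product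

/-! ### Outer direct sums -/

section OuterSum

variable {A₁ : Type u} [NormedAddCommGroup A₁] [NormedSpace ℂ A₁] [FiniteDimensional ℂ A₁]
  {H₁ : Type u} [TopologicalSpace H₁] (I₁ : ModelWithCorners ℂ A₁ H₁) [I₁.Boundaryless]
  {M₁ : Type u} [TopologicalSpace M₁] [ChartedSpace H₁ M₁] [IsManifold I₁ ω M₁]
  (F₁ : Type u) [NormedAddCommGroup F₁] [NormedSpace ℂ F₁] [FiniteDimensional ℂ F₁]
  (E₁ : M₁ → Type u) [∀ x, AddCommGroup (E₁ x)] [∀ x, Module ℂ (E₁ x)]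
  [TopologicalSpace (TotalSpace F₁ E₁)] [∀ x, TopologicalSpace (E₁ x)] [FiberBundle F₁ E₁]
  [VectorBundle ℂ F₁ E₁] [ContMDiffVectorBundle ω F₁ E₁ I₁]
  {A₂ : Type u} [NormedAddCommGroup A₂] [NormedSpace ℂ A₂] [FiniteDimensional ℂ A₂]
  {H₂ : Type u} [TopologicalSpace H₂] (I₂ : ModelWithCorners ℂ A₂ H₂) [I₂.Boundaryless]
  {M₂ : Type u} [TopologicalSpace M₂] [ChartedSpace H₂ M₂] [IsManifold I₂ ω M₂]
  (F₂ : Type u) [NormedAddCommGroup F₂] [NormedSpace ℂ F₂] [FiniteDimensional ℂ F₂]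
  (E₂ : M₂ → Type u) [∀ x, AddCommGroup (E₂ x)] [∀ x, Module ℂ (E₂ x)]
  [TopologicalSpace (TotalSpace F₂ E₂)] [∀ x, TopologicalSpace (E₂ x)] [FiberBundle F₂ E₂]
  [VectorBundle ℂ F₂ E₂] [ContMDiffVectorBundle ω F₂ E₂ I₂]

omit [FiniteDimensional ℂ A₁] [I₁.Boundaryless] [FiniteDimensional ℂ F₁] [FiniteDimensional ℂ A₂]
  [I₂.Boundaryless] [FiniteDimensional ℂ F₂] in
/-- A section of an outer direct sum is holomorphic if and only if its components are. -/
theorem contMDiffOn_outerSum_iff (U : Set (M₁ × M₂)) (e : ∀ y, outerSum I₁ I₂ E₁ E₂ y) :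
    ContMDiffOn (I₁.prod I₂) ((I₁.prod I₂).prod 𝓘(ℂ, F₁ × F₂)) ω
      (fun y => TotalSpace.mk' (F₁ × F₂) y (e y)) U ↔
    ContMDiffOn (I₁.prod I₂) (I₁.prod 𝓘(ℂ, F₁)) ω
        (fun y : M₁ × M₂ => TotalSpace.mk' F₁ (E := E₁) y.1 (e y).1) U ∧
      ContMDiffOn (I₁.prod I₂) (I₂.prod 𝓘(ℂ, F₂)) ω
        (fun y : M₁ × M₂ => TotalSpace.mk' F₂ (E := E₂) y.2 (e y).2) U := by
  have key : ∀ y ∈ U, (ContMDiffWithinAt (I₁.prod I₂) ((I₁.prod I₂).prod 𝓘(ℂ, F₁ × F₂)) ω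
      (fun y => TotalSpace.mk' (F₁ × F₂) y (e y)) U y ↔
      ContMDiffWithinAt (I₁.prod I₂) 𝓘(ℂ, F₁) ω
        (fun z : M₁ × M₂ => (trivializationAt F₁ E₁ y.1 ⟨z.1, (e z).1⟩).2) U y ∧
      ContMDiffWithinAt (I₁.prod I₂) 𝓘(ℂ, F₂) ω
        (fun z : M₁ × M₂ => (trivializationAt F₂ E₂ y.2 ⟨z.2, (e z).2⟩).2) U y) := by
    intro y hy
    rw [contMDiffWithinAt_section]
    change ContMDiffWithinAt (I₁.prod I₂) 𝓘(ℂ, F₁ × F₂) ω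
      (fun z : M₁ × M₂ => ((trivializationAt F₁ E₁ y.1 ⟨z.1, (e z).1⟩).2,
        (trivializationAt F₂ E₂ y.2 ⟨z.2, (e z).2⟩).2)) U y ↔ _
    constructor
    · intro h
      exact ⟨(ContinuousLinearMap.fst ℂ F₁ F₂).contMDiff.contMDiffAt.comp_contMDiffWithinAt y h,
        (ContinuousLinearMap.snd ℂ F₁ F₂).contMDiff.contMDiffAt.comp_contMDiffWithinAt y h⟩
    · rintro ⟨h₁, h₂⟩
      exact h₁.prodMk_space h₂
  constructor
  · intro h
    refine ⟨fun y hy => ?_, fun y hy => ?_⟩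
    · exact contMDiffWithinAt_totalSpace.2 ⟨contMDiffWithinAt_fst, ((key y hy).1 (h y hy)).1⟩
    · exact contMDiffWithinAt_totalSpace.2 ⟨contMDiffWithinAt_snd, ((key y hy).1 (h y hy)).2⟩
  · rintro ⟨h₁, h₂⟩ y hy
    exact (key y hy).2 ⟨(contMDiffWithinAt_totalSpace.1 (h₁ y hy)).2,
      (contMDiffWithinAt_totalSpace.1 (h₂ y hy)).2⟩

/-- The pullback of sections along the first projection. -/
def outerSumPull₁ : BundlePull I₁ F₁ E₁ (I₁.prod I₂) (F₁ × F₂) (outerSum I₁ I₂ E₁ E₂)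
    (ContinuousMap.fst : C(M₁ × M₂, M₁)) where
  lin y := LinearMap.inl ℂ (E₁ y.1) (E₂ y.2)
  contMDiff := contMDiff_fst
  contMDiffOn U e he := (contMDiffOn_outerSum_iff I₁ F₁ E₁ I₂ F₂ E₂ _ _).2
    ⟨he.comp contMDiffOn_fst fun _ hy => hy,
      ((contMDiff_zeroSection ℂ E₂ (IB := I₂) (F := F₂)).comp contMDiff_snd).contMDiffOn⟩

/-- The pullback of sections along the second projection. -/
def outerSumPull₂ : BundlePull I₂ F₂ E₂ (I₁.prod I₂) (F₁ × F₂) (outerSum I₁ I₂ E₁ E₂)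
    (ContinuousMap.snd : C(M₁ × M₂, M₂)) where
  lin y := LinearMap.inr ℂ (E₁ y.1) (E₂ y.2)
  contMDiff := contMDiff_snd
  contMDiffOn U e he := (contMDiffOn_outerSum_iff I₁ F₁ E₁ I₂ F₂ E₂ _ _).2
    ⟨((contMDiff_zeroSection ℂ E₁ (IB := I₁) (F := F₁)).comp contMDiff_fst).contMDiffOn,
      he.comp contMDiffOn_snd fun _ hy => hy⟩

/-- The outer direct sum, as a product of bundles. -/
def outerSumProduct : BundleProduct (I₁.prod I₂) (F₁ × F₂) (outerSum I₁ I₂ E₁ E₂) I₁ F₁ E₁ I₂ F₂ E₂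
    (ContinuousMap.fst : C(M₁ × M₂, M₁)) (ContinuousMap.snd : C(M₁ × M₂, M₂)) where
  pull₁ := outerSumPull₁ I₁ F₁ E₁ I₂ F₂ E₂
  pull₂ := outerSumPull₂ I₁ F₁ E₁ I₂ F₂ E₂
  baseEquiv := LinearEquiv.refl ℂ _
  fibreEquiv := LinearEquiv.refl ℂ _
  extChartAt_eq w x := by
    rw [extChartAt_prod]
    rfl
  dom_le₁ w x hx := ⟨hx.1.1, hx.2.1⟩
  dom_le₂ w x hx := ⟨hx.1.2, hx.2.2⟩
  trivSymm_eq w x hx v := by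
    have hx₁ : x.1 ∈ (trivializationAt F₁ E₁ w.1).baseSet := hx.2.1
    have hx₂ : x.2 ∈ (trivializationAt F₂ E₂ w.2).baseSet := hx.2.2
    let v₁ : E₁ x.1 := trivSymm F₁ E₁ w.1 x.1 v.1
    let v₂ : E₂ x.2 := trivSymm F₂ E₂ w.2 x.2 v.2
    have h₁ : triv F₁ E₁ w.1 x.1 v₁ = v.1 :=
      LinearMap.congr_fun (triv_comp_trivSymm (F := F₁) (E := E₁) hx.2.1) v.1
    have h₂ : triv F₂ E₂ w.2 x.2 v₂ = v.2 :=
      LinearMap.congr_fun (triv_comp_trivSymm (F := F₂) (E := E₂) hx.2.2) v.2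
    have h : triv (F₁ × F₂) (outerSum I₁ I₂ E₁ E₂) w x (v₁, v₂) = v := by
      rw [triv, Trivialization.coe_linearMapAt_of_mem _ hx₁] at h₁
      rw [triv, Trivialization.coe_linearMapAt_of_mem _ hx₂] at h₂
      rw [triv, Trivialization.coe_linearMapAt_of_mem _ hx.2]
      exact Prod.ext h₁ h₂
    have h' : trivSymm (F₁ × F₂) (outerSum I₁ I₂ E₁ E₂) w x v = (v₁, v₂) := by
      rw [← h]
      exact LinearMap.congr_fun (trivSymm_comp_triv hx.2) _
    rw [h']
    exact Prod.ext (add_zero v₁).symm (zero_add v₂).symm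
  exists_box W m hm := by
    obtain ⟨u, hu, v, hv, h⟩ := mem_nhds_prod_iff.1 (W.isOpen.mem_nhds hm)
    obtain ⟨u', hu', huo, hmu⟩ := mem_nhds_iff.1 hu
    obtain ⟨v', hv', hvo, hmv⟩ := mem_nhds_iff.1 hv
    exact ⟨⟨u', huo⟩, ⟨v', hvo⟩, hmu, hmv, fun x hx => h ⟨hu' hx.1, hv' hx.2⟩⟩

/-- The slices of an outer direct sum in the direction of the first factor. -/
def outerSumSlices₁ : (outerSumProduct I₁ F₁ E₁ I₂ F₂ E₂).Slices where
  slice m := ⟨fun x => (x, m.2), by fun_prop⟩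
  pull m :=
    { lin := fun x => LinearMap.fst ℂ (E₁ x) (E₂ m.2)
      contMDiff := contMDiff_id.prodMk contMDiff_const
      contMDiffOn := fun U e he => ((contMDiffOn_outerSum_iff I₁ F₁ E₁ I₂ F₂ E₂ _ _).1 he).1.comp
        (contMDiff_id.prodMk contMDiff_const).contMDiffOn fun _ hx => hx }
  proj m := LinearMap.fst ℂ (E₁ m.1) (E₂ m.2)
  fst_slice _ _ := rfl
  snd_slice _ _ := rfl
  proj_pull₁ _ _ := rfl
  proj_pull₂ m v := LinearMap.congr_fun (LinearMap.fst_comp_inr ℂ (E₁ m.1) (E₂ m.2)) v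
  sec_pull₁ m V V' U h h' hV f := by
    refine Subtype.ext (funext fun x => ?_)
    change ExteriorAlgebra.map (LinearMap.fst ℂ (E₁ x) (E₂ m.2))
      (ExteriorAlgebra.map (LinearMap.inl ℂ (E₁ x) (E₂ m.2)) (f.1 ⟨x.1, hV x.2⟩)) =
        f.1 ⟨x.1, hV x.2⟩
    rw [← AlgHom.comp_apply, ExteriorAlgebra.map_comp_map, LinearMap.fst_comp_inl,
      ExteriorAlgebra.map_id]
    rfl
  sec_pull₂ m V V' U h h' hm f := by
    refine Subtype.ext (funext fun x => ?_)
    change ExteriorAlgebra.map (LinearMap.fst ℂ (E₁ x) (E₂ m.2))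
      (ExteriorAlgebra.map (LinearMap.inr ℂ (E₁ x) (E₂ m.2)) (f.1 ⟨m.2, hm⟩)) =
        algebraMap ℂ _ (ExteriorAlgebra.algebraMapInv (f.1 ⟨m.2, hm⟩))
    rw [← AlgHom.comp_apply, ExteriorAlgebra.map_comp_map, LinearMap.fst_comp_inr]
    exact map_zero_eq_algebraMap _
  sec_self _ _ _ _ _ _ _ := rfl

/-- The slices of an outer direct sum in the direction of the second factor. -/
def outerSumSlices₂ : (outerSumProduct I₁ F₁ E₁ I₂ F₂ E₂).swap.Slices where
  slice m := ⟨fun x => (m.1, x), by fun_prop⟩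
  pull m :=
    { lin := fun x => LinearMap.snd ℂ (E₁ m.1) (E₂ x)
      contMDiff := contMDiff_const.prodMk contMDiff_id
      contMDiffOn := fun U e he => ((contMDiffOn_outerSum_iff I₁ F₁ E₁ I₂ F₂ E₂ _ _).1 he).2.comp
        (contMDiff_const.prodMk contMDiff_id).contMDiffOn fun _ hx => hx }
  proj m := LinearMap.snd ℂ (E₁ m.1) (E₂ m.2)
  fst_slice _ _ := rfl
  snd_slice _ _ := rfl
  proj_pull₁ _ _ := rfl
  proj_pull₂ m v := LinearMap.congr_fun (LinearMap.snd_comp_inl ℂ (E₁ m.1) (E₂ m.2)) v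
  sec_pull₁ m V V' U h h' hV f := by
    refine Subtype.ext (funext fun x => ?_)
    change ExteriorAlgebra.map (LinearMap.snd ℂ (E₁ m.1) (E₂ x))
      (ExteriorAlgebra.map (LinearMap.inr ℂ (E₁ m.1) (E₂ x)) (f.1 ⟨x.1, hV x.2⟩)) =
        f.1 ⟨x.1, hV x.2⟩
    rw [← AlgHom.comp_apply, ExteriorAlgebra.map_comp_map, LinearMap.snd_comp_inr,
      ExteriorAlgebra.map_id]
    rfl
  sec_pull₂ m V V' U h h' hm f := by
    refine Subtype.ext (funext fun x => ?_)
    change ExteriorAlgebra.map (LinearMap.snd ℂ (E₁ m.1) (E₂ x))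
      (ExteriorAlgebra.map (LinearMap.inl ℂ (E₁ m.1) (E₂ x)) (f.1 ⟨m.1, hm⟩)) =
        algebraMap ℂ _ (ExteriorAlgebra.algebraMapInv (f.1 ⟨m.1, hm⟩))
    rw [← AlgHom.comp_apply, ExteriorAlgebra.map_comp_map, LinearMap.snd_comp_inl]
    exact map_zero_eq_algebraMap _
  sec_self _ _ _ _ _ _ _ := rfl

end OuterSum

end

end SuperGeometry

theorem mainTheorem4
    {A₁ A₂ : Type u} [NormedAddCommGroup A₁] [NormedSpace ℂ A₁] [FiniteDimensional ℂ A₁]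
    [NormedAddCommGroup A₂] [NormedSpace ℂ A₂] [FiniteDimensional ℂ A₂]
    {H₁ H₂ : Type u} [TopologicalSpace H₁] [TopologicalSpace H₂]
    (I₁ : ModelWithCorners ℂ A₁ H₁) (I₂ : ModelWithCorners ℂ A₂ H₂)
    [I₁.Boundaryless] [I₂.Boundaryless]
    {M₁ M₂ : Type u} [TopologicalSpace M₁] [ChartedSpace H₁ M₁] [IsManifold I₁ ω M₁]
    [TopologicalSpace M₂] [ChartedSpace H₂ M₂] [IsManifold I₂ ω M₂]
    (F₁ F₂ : Type u) [NormedAddCommGroup F₁] [NormedSpace ℂ F₁] [FiniteDimensional ℂ F₁]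
    [NormedAddCommGroup F₂] [NormedSpace ℂ F₂] [FiniteDimensional ℂ F₂]
    (E₁ : M₁ → Type u) [∀ x, AddCommGroup (E₁ x)] [∀ x, Module ℂ (E₁ x)]
    [TopologicalSpace (TotalSpace F₁ E₁)] [∀ x, TopologicalSpace (E₁ x)] [FiberBundle F₁ E₁]
    [VectorBundle ℂ F₁ E₁] [ContMDiffVectorBundle ω F₁ E₁ I₁]
    (E₂ : M₂ → Type u) [∀ x, AddCommGroup (E₂ x)] [∀ x, Module ℂ (E₂ x)]
    [TopologicalSpace (TotalSpace F₂ E₂)] [∀ x, TopologicalSpace (E₂ x)] [FiberBundle F₂ E₂]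
    [VectorBundle ℂ F₂ E₂] [ContMDiffVectorBundle ω F₂ E₂ I₂]
    (S₁ : SuperGeometry.Supermanifold I₁ F₁ E₁) (S₂ : SuperGeometry.Supermanifold I₂ F₂ E₂)
    (t₁ t₂ : ℕ) (h₁ : S₁.StrictlyNildominated t₁) (h₂ : S₂.StrictlyNildominated t₂) :
    (∃ S : SuperGeometry.Supermanifold (I₁.prod I₂) (F₁ × F₂)
        (SuperGeometry.outerSum I₁ I₂ E₁ E₂),
      SuperGeometry.HasProjections S.toSuperData S₁.toSuperData S₂.toSuperData) ∧
    ∀ S : SuperGeometry.Supermanifold (I₁.prod I₂) (F₁ × F₂)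
        (SuperGeometry.outerSum I₁ I₂ E₁ E₂),
      SuperGeometry.HasProjections S.toSuperData S₁.toSuperData S₂.toSuperData →
        S.StrictlyNildominated (min t₁ t₂) ∧
        ∀ N : SuperGeometry.Supermanifold (I₁.prod I₂) (F₁ × F₂)
            (SuperGeometry.outerSum I₁ I₂ E₁ E₂),
          SuperGeometry.HasProjections N.toSuperData S₁.toSuperData S₂.toSuperData →
            SuperGeometry.AgreeUpTo (min t₁ t₂) S N := by
  have hconv : ∀ N : SuperGeometry.Supermanifold (I₁.prod I₂) (F₁ × F₂)
      (SuperGeometry.outerSum I₁ I₂ E₁ E₂),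
      SuperGeometry.HasProjections N.toSuperData S₁.toSuperData S₂.toSuperData →
      ∃ (q₁ : SuperGeometry.SuperMorphism N.toSuperPresheaf S₁.toSuperPresheaf
          (ContinuousMap.fst : C(M₁ × M₂, M₁)))
        (q₂ : SuperGeometry.SuperMorphism N.toSuperPresheaf S₂.toSuperPresheaf
          (ContinuousMap.snd : C(M₁ × M₂, M₂))),
        q₁.Compat N.toSuperData S₁.toSuperData
          (SuperGeometry.outerSumProduct I₁ F₁ E₁ I₂ F₂ E₂).pull₁.lin ∧
        q₂.Compat N.toSuperData S₂.toSuperData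
          (SuperGeometry.outerSumProduct I₁ F₁ E₁ I₂ F₂ E₂).pull₂.lin := by
    rintro N ⟨⟨q₁, h₁⟩, q₂, h₂⟩
    exact ⟨q₁, q₂, ⟨fun W f x => (h₁ W f x).1, fun W f x => (h₁ W f x).2⟩,
      ⟨fun W f x => (h₂ W f x).1, fun W f x => (h₂ W f x).2⟩⟩
  refine ⟨?_, fun S hS => ?_⟩
  · obtain ⟨N, q₁, q₂, h₁, h₂⟩ :=
      (SuperGeometry.outerSumProduct I₁ F₁ E₁ I₂ F₂ E₂).exists_supermanifold S₁ S₂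
    exact ⟨N, ⟨q₁, fun W f x => ⟨h₁.body W f x, h₁.lin W f x⟩⟩,
      ⟨q₂, fun W f x => ⟨h₂.body W f x, h₂.lin W f x⟩⟩⟩
  · obtain ⟨p₁, p₂, hp₁, hp₂⟩ := hconv S hS
    refine ⟨?_, fun N hN => ?_⟩
    · exact SuperGeometry.BundleProduct.strictlyNildominated
        (SuperGeometry.outerSumSlices₁ I₁ F₁ E₁ I₂ F₂ E₂)
        (SuperGeometry.outerSumSlices₂ I₁ F₁ E₁ I₂ F₂ E₂) hp₁ hp₂ h₁ h₂
    · obtain ⟨q₁, q₂, hq₁, hq₂⟩ := hconv N hN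
      exact (SuperGeometry.outerSumProduct I₁ F₁ E₁ I₂ F₂ E₂).agreeUpTo hp₁ hp₂ hq₁ hq₂ _
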